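/- **Corollary 4.4.** Let $\aleph_0\le\kappa_i<\lambda_i\le\mu_i^+$ be cardinals for $i=1,2$. For $\aleph_0\le\nu\le\mu^+$ let $S_\nu(\mu)$ be the group of all permutations of $\mu$ whose support has cardinality $<\nu$. Then $$\mathcal M_{\kappa_1\lambda_1\mu_1}\equiv\mathcal M_{\kappa_2\lambda_2\mu_2}\quad\Longleftrightarrow\quad S_{\lambda_1}(\mu_1)/S_{\kappa_1}(\mu_1)\equiv S_{\lambda_2}(\mu_2)/S_{\kappa_2}(\mu_2),$$ where $\equiv$ is first-order elementary equivalence (of many-sorted structures on the left, of groups on the right), and $\mathcal M_{\kappa\lambda\mu}$ is the following many-sorted structure. Permutations act on the right. *Sorts.* For each $n\ge1$: * $IS_n$ is the set of isomorphism types $t=(A_t,\bar g)_{\cong}$ of pairs $(A,\bar g)$, where $\bar g$ is an $n$-tuple of permutations of the set $A\ne\emptyset$ and $\langle\bar g\rangle$ is transitive on $A$; if $\lambda\le\mu$, the type with all $g_i=1$ is left out. (So $1\le|A_t|\le\aleph_0$.) * $F_n$ is the set of functions $h$ from $IS_n$ to the cardinals $<\lambda$ with $\sum_t|A_t|\,h(t)<\lambda$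 and, if $\lambda=\mu^+$, $\sum_t|A_t|\,h(t)=\mu$, modulo the equivalence relation $h\,\mathcal E_n\,h'\iff\sum_t|A_t|\cdot|h(t)-h'(t)|<\kappa$. Here, for cardinals $a\le b$, $|a-b|=|b-a|$ is the least $c$ with $a+c=b$. (The factors $|A_t|$ matter only if $\kappa=\aleph_0$.) There is one further sort, $Card^-=\{0\}\cup\{\nu:\kappa\le\nu<\lambda\}$, a set of cardinals. *Signature.* * The usual order $<$ on $Card^-$. * $Eq^1=\{(A,g_1,g_2)_{\cong}:g_1=g_2\}\subseteq IS_2$ and $Prod^1=\{(A,g_1,g_2,g_3)_{\cong}:g_1g_2=g_3\}\subseteq IS_3$. * $Eq\subseteq F_2$ and $Prod\subseteq F_3$: the classes of those $h$ for which $\sum_t|A_t'|\,h(t)<\kappa$, where $A_t'=\{\alpha\in A_t:\alpha g_1\ne\alpha g_2\}$ for $Eq$, and $A'_t=\{\alpha\in A_t:\alpha g_1g_2\neq\alpha g_3\}$ for $Prod$. * For each $n\ge 1$ the function $App_n:F_n\times IS_n\to Card^-$, with $App_n(h/\mathcal E_n,t)=h(t)$ if $h(t)\ge\kappa$ and $0$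 otherwise. * For all $m,n\ge1$ and every injection $\sigma:\{1,\dots,m\}\to\{1,\dots,n\}$ the relation $Proj^1_\sigma\subseteq IS_n\times IS_m$ and the function $Proj_\sigma:F_n\to F_m$ given as follows. For $t'=(A,\bar g)_{\cong}\in IS_n$ and $t\in IS_m$ let $B^\sigma_{t't}$ be the set of orbits of $\langle g_{\sigma(1)},\dots,g_{\sigma(m)}\rangle$ on $A$ on which $(g_{\sigma(1)},\dots,g_{\sigma(m)})$ has isomorphism type $t$. Then $Proj^1_\sigma(t',t)$ holds iff $B^\sigma_{t't}\neq\emptyset$, and $Proj_\sigma$ maps the class of $h$ to the class of $t\mapsto\sum_{t'\in IS_n}|B^\sigma_{t't}|\,h(t')$. -/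

import Mathlib

open Cardinal

universe u v

/-! ### Many-sorted first-order logic -/

/-- A many-sorted signature: a set of sorts, function symbols with the list of their argument
sorts and their value sort, and relation symbols with the list of their argument sorts. -/
structure MSLang where
  Sort' : Type
  Func : Type
  dom : Func → List Sort'
  cod : Func → Sort'
  Rel : Type
  ar : Rel → List Sort'

namespace MSLang

variable (L : MSLang)

/-- Terms of a given sort whose variables are typed by the context `Γ`. -/
inductive Term (Γ : List L.Sort') : L.Sort' → Type
  | var (i : Fin Γ.length) : Term Γ (Γ.get i)
  | app (f : L.Func) (ts : ∀ i : Fin (L.dom f).length, Term Γ ((L.dom f).get i)) :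
      Term Γ (L.cod f)

/-- First-order formulas with free variables typed by the context `Γ`; every sort has equality,
and `all s φ` quantifies over the sort `s`. The remaining connectives and the existential
quantifier are definable from the ones listed. -/
inductive Formula : List L.Sort' → Type
  | falsum {Γ} : Formula Γ
  | equal {Γ} {s : L.Sort'} (t₁ t₂ : L.Term Γ s) : Formula Γ
  | rel {Γ} (R : L.Rel) (ts : ∀ i : Fin (L.ar R).length, L.Term Γ ((L.ar R).get i)) : Formula Γ
  | imp {Γ} (φ ψ : Formula Γ) : Formula Γ
  | all {Γ} (s : L.Sort') (φ : Formula (s :: Γ)) : Formula Γ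

/-- A structure for a many-sorted signature. -/
structure Str where
  carrier : L.Sort' → Type v
  func (f : L.Func) : (∀ i : Fin (L.dom f).length, carrier ((L.dom f).get i)) → carrier (L.cod f)
  rel (R : L.Rel) : (∀ i : Fin (L.ar R).length, carrier ((L.ar R).get i)) → Prop

variable {L}

/-- Assignments of elements of a structure to the variables of a context. -/
abbrev Str.Env (M : L.Str) (Γ : List L.Sort') : Type _ :=
  ∀ i : Fin Γ.length, M.carrier (Γ.get i)

/-- Extension of an assignment by a value for a new first variable. -/
def Str.Env.cons {M : L.Str} {Γ : List L.Sort'} {s : L.Sort'} (a : M.carrier s) (e : M.Env Γ) :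
    M.Env (s :: Γ) :=
  fun i => Fin.cases (motive := fun i => M.carrier ((s :: Γ).get i)) a e i

/-- The value of a term. -/
def Term.val (M : L.Str) {Γ : List L.Sort'} (e : M.Env Γ) :
    {s : L.Sort'} → L.Term Γ s → M.carrier s
  | _, .var i => e i
  | _, .app f ts => M.func f fun i => (ts i).val M e

/-- Satisfaction of a formula under an assignment. -/
def Formula.Sat (M : L.Str) : {Γ : List L.Sort'} → L.Formula Γ → M.Env Γ → Prop
  | _, .falsum, _ => False
  | _, .equal t₁ t₂, e => t₁.val M e = t₂.val M e
  | _, .rel R ts, e => M.rel R fun i => (ts i).val M e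
  | _, .imp φ ψ, e => φ.Sat M e → ψ.Sat M e
  | _, .all s φ, e => ∀ a : M.carrier s, φ.Sat M (Str.Env.cons a e)

/-- Elementary equivalence of many-sorted structures: the same sentences hold. -/
def Str.ElemEquiv (M N : L.Str) : Prop :=
  ∀ φ : L.Formula [], φ.Sat M (fun i => i.elim0) ↔ φ.Sat N (fun i => i.elim0)

end MSLang

/-! ### The language of groups -/

/-- The symbols for product, inverse and identity. -/
inductive GroupFunc : ℕ → Type
  | mul : GroupFunc 2
  | inv : GroupFunc 1
  | one : GroupFunc 0

/-- The first-order language of groups. -/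
def groupLang : FirstOrder.Language where
  Functions := GroupFunc
  Relations := fun _ => Empty

/-- Every group is a structure for the language of groups. -/
instance groupStr (G : Type*) [Group G] : groupLang.Structure G where
  funMap {_} f x := match f with
    | .mul => x 0 * x 1
    | .inv => (x 0)⁻¹
    | .one => 1
  RelMap {_} r := r.elim

/-! ### The groups `S_lam(μ) / S_κ(μ)` -/

/-- `supportLT X ν` is the group of the permutations of `X` whose support has cardinality less
than the infinite cardinal `ν`. -/
def supportLT (X : Type u) (ν : Cardinal.{u}) (hν : ℵ₀ ≤ ν) : Subgroup (Equiv.Perm X) where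
  carrier := {g | #{x | g x ≠ x} < ν}
  one_mem' := by
    have : {x : X | (1 : Equiv.Perm X) x ≠ x} = ∅ := by ext; simp
    rw [Set.mem_ofPred_eq, this, mk_eq_zero]
    exact aleph0_pos.trans_le hν
  mul_mem' := by
    intro a b ha hb
    refine lt_of_le_of_lt (mk_le_mk_of_subset (t := {x | a x ≠ x} ∪ {x | b x ≠ x}) ?_)
      ((mk_union_le _ _).trans_lt (add_lt_of_lt hν ha hb))
    intro x hx
    by_contra h
    simp only [Set.mem_union, Set.mem_ofPred_eq, not_or, not_not] at h
    exact hx (by rw [Equiv.Perm.mul_apply, h.2, h.1])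
  inv_mem' := by
    intro a ha
    refine lt_of_le_of_lt (mk_le_mk_of_subset (t := {x | a x ≠ x}) ?_) ha
    intro x hx h
    exact hx (by rw [Equiv.Perm.inv_eq_iff_eq]; exact h.symm)

instance supportLT_normal (X : Type u) (ν : Cardinal.{u}) (hν : ℵ₀ ≤ ν) :
    (supportLT X ν hν).Normal where
  conj_mem := by
    intro a ha g
    have ha' : #{x | a x ≠ x} < ν := ha
    change #{x | (g * a * g⁻¹) x ≠ x} < ν
    have h : {x | (g * a * g⁻¹) x ≠ x} = g '' {x | a x ≠ x} := by
      ext x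
      rw [Equiv.image_eq_preimage_symm]
      simp only [Equiv.Perm.mul_apply, Set.mem_ofPred_eq, Set.mem_preimage]
      rw [not_iff_not]
      constructor
      · intro h
        apply g.injective
        rw [Equiv.apply_symm_apply]
        exact h
      · intro h
        have h2 : g (a (g.symm x)) = g (g.symm x) := congrArg g h
        rwa [Equiv.apply_symm_apply] at h2
    rw [h]
    exact mk_image_le.trans_lt ha'

/-- The quotient group `S_lam(μ) / S_κ(μ)`, the cardinal `μ` being realized as a type of that
cardinality. -/
abbrev symQuot (κ lam μ : Cardinal.{u}) (hκ : ℵ₀ ≤ κ) (hlam : κ < lam) : Type u :=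
  supportLT μ.out lam (hκ.trans hlam.le) ⧸
    (supportLT μ.out κ hκ).subgroupOf (supportLT μ.out lam (hκ.trans hlam.le))

/-! ### Isomorphism types of transitive tuples of permutations -/

/-- A pair `(A, g)` of a non-empty set `A` and an `n`-tuple `g` of permutations of `A` generating
a transitive group. Such an `A` is countable, so subsets of `ℕ` represent all isomorphism
types. -/
structure TransTuple (n : ℕ) where
  carrier : Set ℕ
  gen : Fin n → Equiv.Perm carrier
  nonempty : carrier.Nonempty
  trans : ∀ x y : carrier, ∃ w ∈ Subgroup.closure (Set.range gen), w x = y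

/-- Isomorphism of pairs `(A, g)`. -/
instance TransTuple.setoid (n : ℕ) : Setoid (TransTuple n) where
  r a b := ∃ e : a.carrier ≃ b.carrier, ∀ i x, e (a.gen i x) = b.gen i (e x)
  iseqv :=
    { refl := fun _ => ⟨Equiv.refl _, fun _ _ => rfl⟩
      symm := by
        rintro a b ⟨e, he⟩
        refine ⟨e.symm, fun i x => ?_⟩
        rw [Equiv.symm_apply_eq, he, Equiv.apply_symm_apply]
      trans := by
        rintro a b c ⟨e, he⟩ ⟨f, hf⟩
        exact ⟨e.trans f, fun i x => by simp [he, hf]⟩ }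

/-- Isomorphism types of pairs `(A, g)`, `g` of length `n`. -/
def OrbitType (n : ℕ) : Type := Quotient (TransTuple.setoid n)

namespace OrbitType

variable {m n : ℕ}

/-- A chosen representative `(A_t, g_t)` of the isomorphism type `t`. -/
noncomputable def rep (t : OrbitType n) : TransTuple n := Quotient.out t

/-- The underlying set `A_t` of the chosen representative. -/
abbrev pts (t : OrbitType n) : Set ℕ := t.rep.carrier

/-- All members of the tuple are the identity (so `A_t` is a single point). -/
def IsTrivial (t : OrbitType n) : Prop := ∀ i, t.rep.gen i = 1

/-- The cardinality `|A_t|`, which is between `1` and `ℵ₀`. -/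
noncomputable def deg (t : OrbitType n) : Cardinal.{u} := lift.{u} #t.pts

/-- For `t'` the type of `(A, g_1, …, g_n)` and a map `σ` of indices, the set `B_{t't}` of all
orbits of the group generated by the tuple `(g_{σ 1}, …, g_{σ m})` on `A` on which this tuple has
isomorphism type `t`. -/
def orbitsOfType (σ : Fin m → Fin n) (t' : OrbitType n) (t : OrbitType m) : Set (Set t'.pts) :=
  {O | (∃ x, O = MulAction.orbit
          (Subgroup.closure (Set.range fun i => t'.rep.gen (σ i))) x) ∧
        ∃ e : t.pts ≃ O, ∀ i x, (e (t.rep.gen i x) : t'.pts) = t'.rep.gen (σ i) (e x)}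

end OrbitType

namespace OrbitType

variable {m n : ℕ}

/-- The orbit of a point under a subtuple, as a tuple of permutations in its own right. -/
theorem exists_type_of_orbit (σ : Fin m → Fin n) (t' : OrbitType n) (x : t'.pts) :
    ∃ t : OrbitType m,
      MulAction.orbit (Subgroup.closure (Set.range fun i => t'.rep.gen (σ i))) x
        ∈ orbitsOfType σ t' t := by
  set H := Subgroup.closure (Set.range fun i => t'.rep.gen (σ i)) with hH
  set O : Set t'.pts := MulAction.orbit H x with hO
  have inv : ∀ i (y : t'.pts), t'.rep.gen (σ i) y ∈ O ↔ y ∈ O := by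
    intro i y
    have hg : t'.rep.gen (σ i) ∈ H := Subgroup.subset_closure ⟨i, rfl⟩
    have h1 := MulAction.orbit_eq_iff (G := H) (a := (⟨_, hg⟩ : H) • y) (b := x)
    rw [MulAction.orbit_smul, MulAction.orbit_eq_iff] at h1
    exact h1.symm
  let p : Fin m → Equiv.Perm O := fun i => (t'.rep.gen (σ i)).subtypePerm (inv i)
  let f : O ≃ (Subtype.val '' O : Set ℕ) := Equiv.Set.image _ O Subtype.val_injective
  have key : ∀ h ∈ H, ∃ w ∈ Subgroup.closure (Set.range fun i => f.permCongr (p i)),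
      ∀ z : O, ((f.symm (w (f z)) : O) : t'.pts) = h z := by
    intro h hh
    induction hh using Subgroup.closure_induction with
    | mem g hg =>
      obtain ⟨i, rfl⟩ := hg
      refine ⟨_, Subgroup.subset_closure ⟨i, rfl⟩, fun z => ?_⟩
      simp [p, Equiv.permCongr_apply]
    | one => exact ⟨1, one_mem _, fun z => by simp⟩
    | mul a b _ _ ha hb =>
      obtain ⟨w, hw, hw'⟩ := ha
      obtain ⟨v, hv, hv'⟩ := hb
      refine ⟨w * v, mul_mem hw hv, fun z => ?_⟩
      have h1 := hw' (f.symm (v (f z)))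
      rw [Equiv.apply_symm_apply] at h1
      rw [Equiv.Perm.mul_apply, h1, hv', Equiv.Perm.mul_apply]
    | inv a _ ha =>
      obtain ⟨w, hw, hw'⟩ := ha
      refine ⟨w⁻¹, inv_mem hw, fun z => ?_⟩
      have h1 := hw' (f.symm (w⁻¹ (f z)))
      rw [Equiv.apply_symm_apply, ← Equiv.Perm.mul_apply, mul_inv_cancel, Equiv.Perm.one_apply,
        Equiv.symm_apply_apply] at h1
      rw [Equiv.Perm.eq_inv_iff_eq]
      exact h1.symm
  let T : TransTuple m :=
    { carrier := Subtype.val '' O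
      gen := fun i => f.permCongr (p i)
      nonempty := ⟨x, x, MulAction.mem_orbit_self x, rfl⟩
      trans := by
        intro y z
        have hy : MulAction.orbit H ((f.symm y : O) : t'.pts) = O :=
          MulAction.orbit_eq_iff.2 (f.symm y).2
        have hz : ((f.symm z : O) : t'.pts) ∈ MulAction.orbit H ((f.symm y : O) : t'.pts) :=
          by rw [hy]; exact (f.symm z).2
        obtain ⟨⟨h, hh⟩, e⟩ := hz
        obtain ⟨w, hw, hw'⟩ := key h hh
        refine ⟨w, hw, ?_⟩
        have h1 := hw' (f.symm y)
        rw [Equiv.apply_symm_apply] at h1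
        have h2 : f.symm (w y) = f.symm z := Subtype.ext (h1.trans e)
        exact f.symm.injective h2 }
  refine ⟨(Quotient.mk _ T : Quotient (TransTuple.setoid m)), ⟨x, rfl⟩, ?_⟩
  obtain ⟨e, he⟩ : (rep (Quotient.mk _ T : Quotient (TransTuple.setoid m))) ≈ T :=
    Quotient.mk_out T
  refine ⟨e.trans f.symm, fun i y => ?_⟩
  have : f.symm (f.permCongr (p i) (e y)) = p i (f.symm (e y)) := by
    simp [Equiv.permCongr_apply]
  simp only [Equiv.trans_apply]
  rw [he]
  change ((f.symm (f.permCongr (p i) (e y)) : O) : t'.pts) = _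
  rw [this]
  rfl

/-- The set `A_{t'}` is partitioned into the orbits of any subtuple. -/
theorem sum_orbitsOfType (σ : Fin m → Fin n) (t' : OrbitType n) :
    Cardinal.sum (fun t : OrbitType m => #(orbitsOfType σ t' t) * #t.pts) = #t'.pts := by
  have h0 : (fun t : OrbitType m => #(orbitsOfType σ t' t) * #t.pts)
      = fun t => #(orbitsOfType σ t' t × t.pts) := by
    funext t; exact (mk_prod _ _).symm ▸ by simp
  rw [h0, ← mk_sigma]
  let φ : (Σ t : OrbitType m, orbitsOfType σ t' t × t.pts) → t'.pts :=
    fun q => ((q.2.1.2.2.choose q.2.2 : q.2.1.1) : t'.pts)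
  refine mk_congr (Equiv.ofBijective φ ⟨?_, ?_⟩)
  · rintro ⟨t, ⟨O, hO⟩, x⟩ ⟨s, ⟨P, hP⟩, y⟩ h
    have hx : φ ⟨t, ⟨O, hO⟩, x⟩ ∈ O := Subtype.prop _
    have hy : φ ⟨s, ⟨P, hP⟩, y⟩ ∈ P := Subtype.prop _
    have hOP : O = P := by
      obtain ⟨a, ha⟩ := hO.1
      obtain ⟨b, hb⟩ := hP.1
      rw [← h] at hy
      have hx1 := MulAction.orbit_eq_iff.2 (ha.subset hx)
      have hy1 := MulAction.orbit_eq_iff.2 (hb.subset hy)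
      exact ha.trans (hx1.symm.trans (hy1.trans hb.symm))
    subst hOP
    have hts : t = s := by
      have h1 := hO.2.choose_spec
      have h2 := hP.2.choose_spec
      rw [← Quotient.out_eq t, ← Quotient.out_eq s]
      refine Quotient.sound ⟨hO.2.choose.trans hP.2.choose.symm, fun i z => ?_⟩
      refine (Equiv.symm_apply_eq _).2 (Subtype.ext ?_)
      refine (h1 i z).trans ?_
      refine Eq.trans ?_ (h2 i _).symm
      exact congrArg (fun q => t'.rep.gen (σ i) q.1) (hP.2.choose.apply_symm_apply _).symm
    subst hts
    have : x = y := (hO.2.choose).injective (Subtype.ext h)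
    rw [this]
  · intro x
    obtain ⟨t, ht⟩ := exists_type_of_orbit σ t' x
    refine ⟨⟨t, ⟨_, ht⟩, ht.2.choose.symm ⟨x, MulAction.mem_orbit_self x⟩⟩, ?_⟩
    simp [φ]

theorem one_le_deg (t : OrbitType n) : 1 ≤ deg.{u} t := by
  have : Nonempty t.pts := t.rep.nonempty.to_subtype
  rw [deg, Cardinal.one_le_iff_ne_zero, Ne, lift_eq_zero]
  exact mk_ne_zero _

end OrbitType

/-! ### Sums and differences of cardinals -/

section CardinalArithmetic

theorem cardinal_mul_sum {ι : Type} (a : Cardinal.{u}) (f : ι → Cardinal.{u}) :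
    a * Cardinal.sum f = Cardinal.sum fun i => a * f i := by
  induction a using Cardinal.inductionOn with | _ α => ?_
  have h1 : f = fun i => #(f i).out := by funext i; simp
  have h2 : (fun i => #α * f i) = fun i => #((f i).out × α) := by
    funext i; simp [mul_comm]
  rw [h2, ← mk_sigma]
  conv_lhs => rw [h1, ← mk_sigma, mul_comm]
  rw [← mk_congr (Equiv.sigmaProdDistrib (fun i => (f i).out) α)]
  simp

theorem cardinal_sum_comm {ι κ : Type} (f : ι → κ → Cardinal.{u}) :
    (Cardinal.sum fun i => Cardinal.sum (f i)) =
      Cardinal.sum fun j => Cardinal.sum fun i => f i j := by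
  have h1 : ∀ i, Cardinal.sum (f i) = #(Σ j, (f i j).out) := by
    intro i; rw [mk_sigma]; simp
  have h2 : ∀ j, (Cardinal.sum fun i => f i j) = #(Σ i, (f i j).out) := by
    intro j; rw [mk_sigma]; simp
  simp only [h1, h2]
  rw [← mk_sigma, ← mk_sigma]
  exact mk_congr
    { toFun := fun q => ⟨q.2.1, q.1, q.2.2⟩
      invFun := fun q => ⟨q.2.1, q.1, q.2.2⟩
      left_inv := fun _ => rfl
      right_inv := fun _ => rfl }

theorem cardinal_sum_subtype_le {ι : Type} (p : ι → Prop) (f : ι → Cardinal.{u}) :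
    (Cardinal.sum fun i : {i // p i} => f i) ≤ Cardinal.sum f := by
  have h1 : Cardinal.sum f = #(Σ i, (f i).out) := by rw [mk_sigma]; simp
  have h2 : (Cardinal.sum fun i : {i // p i} => f i) = #(Σ i : {i // p i}, (f i).out) := by
    rw [mk_sigma]; simp
  rw [h1, h2]
  refine mk_le_of_injective (f := fun q => ⟨q.1.1, q.2⟩) ?_
  rintro ⟨⟨i, hi⟩, x⟩ ⟨⟨j, hj⟩, y⟩ h
  simp only [Sigma.mk.injEq] at h
  obtain ⟨rfl, h⟩ := h
  simp [eq_of_heq h]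

theorem cardinal_sum_subtype_eq {ι : Type} (p : ι → Prop) (hp : ∀ i, p i) (f : ι → Cardinal.{u}) :
    (Cardinal.sum fun i : {i // p i} => f i) = Cardinal.sum f := by
  have h1 : Cardinal.sum f = #(Σ i, (f i).out) := by rw [mk_sigma]; simp
  have h2 : (Cardinal.sum fun i : {i // p i} => f i) = #(Σ i : {i // p i}, (f i).out) := by
    rw [mk_sigma]; simp
  rw [h1, h2]
  exact mk_congr
    { toFun := fun q => ⟨q.1.1, q.2⟩
      invFun := fun q => ⟨⟨q.1, hp q.1⟩, q.2⟩
      left_inv := fun _ => rfl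
      right_inv := fun _ => rfl }

/-- For `a ≤ b` the difference `b - a` is the least `c` with `a + c = b`; `cardDist a b` is the
difference of the larger and the smaller one. -/
noncomputable def cardDist (a b : Cardinal.{u}) : Cardinal.{u} :=
  open Classical in if a ≤ b then sInf {c | a + c = b} else sInf {c | b + c = a}

theorem add_sInf_sub {a b : Cardinal.{u}} (h : a ≤ b) : a + sInf {c | a + c = b} = b := by
  obtain ⟨c, hc⟩ := exists_add_of_le h
  exact csInf_mem (s := {c | a + c = b}) ⟨c, hc.symm⟩

theorem sInf_sub_le {a b d : Cardinal.{u}} (h : a ≤ b) (hd : b ≤ a + d) :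
    sInf {c | a + c = b} ≤ d := by
  rcases lt_or_ge b ℵ₀ with hb | hb
  · have ha := h.trans_lt hb
    have h1 := add_sInf_sub h
    rw [← h1] at hd
    exact (Cardinal.add_le_add_iff_of_lt_aleph0 (γ := a) ha).1
      (by rwa [add_comm a, add_comm a] at hd)
  · rcases h.eq_or_lt with rfl | hlt
    · exact (csInf_le' (s := {c | a + c = a}) (add_zero a)).trans zero_le
    · refine (csInf_le' (s := {c | a + c = b}) (add_eq_right hb h)).trans ?_
      by_contra hdb
      exact absurd hd (not_le.2 (add_lt_of_lt hb hlt (not_le.1 hdb)))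

theorem cardDist_le_iff {a b d : Cardinal.{u}} : cardDist a b ≤ d ↔ a ≤ b + d ∧ b ≤ a + d := by
  unfold cardDist
  split_ifs with h
  · constructor
    · intro hd
      refine ⟨h.trans le_self_add, ?_⟩
      conv_lhs => rw [← add_sInf_sub h]
      gcongr
    · exact fun hd => sInf_sub_le h hd.2
  · have h' : b ≤ a := (not_le.1 h).le
    constructor
    · intro hd
      refine ⟨?_, h'.trans le_self_add⟩
      conv_lhs => rw [← add_sInf_sub h']
      gcongr
    · exact fun hd => sInf_sub_le h' hd.1

theorem cardDist_self (a : Cardinal.{u}) : cardDist a a = 0 :=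
  le_zero_iff.1 (cardDist_le_iff.2 (by simp))

theorem cardDist_comm (a b : Cardinal.{u}) : cardDist a b = cardDist b a :=
  le_antisymm (cardDist_le_iff.2 (cardDist_le_iff.1 le_rfl).symm)
    (cardDist_le_iff.2 (cardDist_le_iff.1 le_rfl).symm)

theorem cardDist_triangle (a b c : Cardinal.{u}) :
    cardDist a c ≤ cardDist a b + cardDist b c := by
  obtain ⟨h1, h2⟩ := cardDist_le_iff.1 (le_refl (cardDist a b))
  obtain ⟨h3, h4⟩ := cardDist_le_iff.1 (le_refl (cardDist b c))
  refine cardDist_le_iff.2 ⟨h1.trans ?_, h4.trans ?_⟩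
  · calc b + cardDist a b ≤ (c + cardDist b c) + cardDist a b := by gcongr
      _ = c + (cardDist a b + cardDist b c) := by rw [add_assoc, add_comm (cardDist b c)]
  · calc b + cardDist b c ≤ (a + cardDist a b) + cardDist b c := by gcongr
      _ = a + (cardDist a b + cardDist b c) := add_assoc _ _ _

theorem cardDist_sum_mul_le {ι : Type} (w f g : ι → Cardinal.{u}) :
    cardDist (Cardinal.sum fun i => w i * f i) (Cardinal.sum fun i => w i * g i) ≤
      Cardinal.sum fun i => w i * cardDist (f i) (g i) := by
  refine cardDist_le_iff.2 ⟨?_, ?_⟩ <;> rw [← sum_add_distrib'] <;>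
    refine sum_le_sum _ _ fun i => ?_ <;> rw [← mul_add]
  · gcongr
    exact (cardDist_le_iff.1 le_rfl).1
  · gcongr
    exact (cardDist_le_iff.1 le_rfl).2

end CardinalArithmetic

/-! ### The sorts of the structure `M` -/

section Sorts

variable {κ lam μ : Cardinal.{u}} {m n : ℕ}

/-- `IS_n`: all isomorphism types of pairs `(A, g)` with `g` of length `n`, where the trivial type
is left out if `lam ≤ μ`. -/
abbrev IS (lam μ : Cardinal.{u}) (n : ℕ) : Type :=
  {t : OrbitType n // lam ≤ μ → ¬ t.IsTrivial}

/-- The cardinal `|B_{t't}|` as a cardinal of the universe of `lam` and `μ`. -/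
noncomputable def orbitCount (σ : Fin m → Fin n) (t' : OrbitType n) (t : OrbitType m) :
    Cardinal.{u} :=
  lift.{u} #(OrbitType.orbitsOfType σ t' t)

theorem sum_orbitCount_le (σ : Fin m → Fin n) (t' : OrbitType n) :
    (Cardinal.sum fun t : IS lam μ m => t.1.deg * orbitCount σ t' t.1) ≤ t'.deg := by
  refine (cardinal_sum_subtype_le _ fun t : OrbitType m => t.deg * orbitCount σ t' t).trans ?_
  rw [OrbitType.deg, ← OrbitType.sum_orbitsOfType σ t', lift_sum]
  refine sum_le_sum _ _ fun t => ?_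
  rw [lift_mul, mul_comm]
  exact le_rfl

theorem sum_orbitCount_eq (h : ¬ lam ≤ μ) (σ : Fin m → Fin n) (t' : OrbitType n) :
    (Cardinal.sum fun t : IS lam μ m => t.1.deg * orbitCount σ t' t.1) = t'.deg := by
  refine (cardinal_sum_subtype_eq _ (fun _ h' => absurd h' h)
    fun t : OrbitType m => t.deg * orbitCount σ t' t).trans ?_
  rw [OrbitType.deg, ← OrbitType.sum_orbitsOfType σ t', lift_sum]
  congr 1
  funext t
  rw [lift_mul, mul_comm]
  rfl

theorem sum_deg_orbitCount (σ : Fin m → Fin n) (w : IS lam μ n → Cardinal.{u}) :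
    (Cardinal.sum fun t : IS lam μ m =>
        t.1.deg * Cardinal.sum fun t' : IS lam μ n => orbitCount σ t'.1 t.1 * w t') =
      Cardinal.sum fun t' : IS lam μ n =>
        (Cardinal.sum fun t : IS lam μ m => t.1.deg * orbitCount σ t'.1 t.1) * w t' := by
  simp only [cardinal_mul_sum]
  rw [cardinal_sum_comm]
  congr 1
  funext t'
  rw [mul_comm, cardinal_mul_sum]
  congr 1
  funext t
  rw [← mul_assoc, mul_comm]

theorem sum_deg_orbitCount_le (σ : Fin m → Fin n) (w : IS lam μ n → Cardinal.{u}) :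
    (Cardinal.sum fun t : IS lam μ m =>
        t.1.deg * Cardinal.sum fun t' : IS lam μ n => orbitCount σ t'.1 t.1 * w t') ≤
      Cardinal.sum fun t' : IS lam μ n => t'.1.deg * w t' := by
  rw [sum_deg_orbitCount]
  refine sum_le_sum _ _ fun t' => ?_
  exact mul_le_mul_left (sum_orbitCount_le σ t'.1) _

/-- The functions `h : IS_n → Card` (all values below `lam`) with `∑ |A_t| h(t) < lam` and, if
`lam = μ⁺`, `∑ |A_t| h(t) = μ`. As `1 ≤ |A_t| ≤ ℵ₀`, the factors `|A_t|` change nothing unless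
`lam = μ⁺` and `μ = ℵ₀`. -/
structure PreF (lam μ : Cardinal.{u}) (n : ℕ) where
  val : IS lam μ n → Cardinal.{u}
  val_lt : ∀ t, val t < lam
  total_lt : (Cardinal.sum fun t => t.1.deg * val t) < lam
  total_eq : lam = Order.succ μ → (Cardinal.sum fun t => t.1.deg * val t) = μ

/-- The relation `E_n` on functions `IS_n → Card`: `∑ |A_t| |h(t) - h'(t)| < κ`. For `κ > ℵ₀` the
factors `|A_t|` change nothing. -/
def PreF.E (κ : Cardinal.{u}) (h h' : PreF lam μ n) : Prop :=
  (Cardinal.sum fun t => t.1.deg * cardDist (h.val t) (h'.val t)) < κ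

theorem PreF.E_equivalence (hκ : ℵ₀ ≤ κ) : Equivalence (PreF.E κ (lam := lam) (μ := μ) (n := n)) where
  refl h := by
    have h0 : ∀ t, cardDist (h.val t) (h.val t) = 0 := fun t => cardDist_self _
    simp only [PreF.E, h0, mul_zero]
    simpa using aleph0_pos.trans_le hκ
  symm {h h'} H := by
    have h0 : ∀ t, cardDist (h'.val t) (h.val t) = cardDist (h.val t) (h'.val t) :=
      fun t => cardDist_comm _ _
    simpa only [PreF.E, h0] using H
  trans {f g h} H H' := by
    refine lt_of_le_of_lt ?_ (add_lt_of_lt hκ H H')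
    rw [← sum_add_distrib']
    refine sum_le_sum _ _ fun t => ?_
    rw [← mul_add]
    gcongr
    exact cardDist_triangle _ _ _

/-- The sort `F_n`: functions modulo the equivalence relation `E_n`. -/
def FSort (κ lam μ : Cardinal.{u}) (n : ℕ) : Type (u + 1) :=
  Quot (PreF.E κ : PreF lam μ n → PreF lam μ n → Prop)

/-- The sort `Card⁻`: the cardinal `0` and the cardinals `ν` with `κ ≤ ν < lam`. -/
def CardMinus (κ lam : Cardinal.{u}) : Type (u + 1) :=
  {ν : Cardinal.{u} // ν < lam ∧ (ν = 0 ∨ κ ≤ ν)}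

/-- `h ↦ h_σ`, `h_σ(t) = ∑ |B_{t't}| h(t')`: the projection of a function on `IS_n` to one on
`IS_m` along a choice `σ` of coordinates. -/
noncomputable def PreF.proj (σ : Fin m → Fin n) (h : PreF lam μ n) : PreF lam μ m where
  val t := Cardinal.sum fun t' : IS lam μ n => orbitCount σ t'.1 t.1 * h.val t'
  val_lt t := by
    refine lt_of_le_of_lt ?_ ((sum_deg_orbitCount_le σ h.val).trans_lt h.total_lt)
    refine le_trans ?_ (le_sum _ t)
    exact le_mul_of_one_le_left zero_le (OrbitType.one_le_deg _)
  total_lt := (sum_deg_orbitCount_le σ h.val).trans_lt h.total_lt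
  total_eq hl := by
    refine Eq.trans ?_ (h.total_eq hl)
    rw [sum_deg_orbitCount]
    congr 1
    funext t'
    rw [sum_orbitCount_eq]
    rw [hl]
    exact not_le.2 (Order.lt_succ μ)

theorem PreF.proj_E (σ : Fin m → Fin n) (h h' : PreF lam μ n) (H : PreF.E κ h h') :
    PreF.E κ (h.proj σ) (h'.proj σ) := by
  refine lt_of_le_of_lt ?_ ((sum_deg_orbitCount_le σ _).trans_lt H)
  refine sum_le_sum _ _ fun t => ?_
  gcongr
  exact cardDist_sum_mul_le _ _ _

/-- The projection `F_n → F_m` along `σ`. -/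
noncomputable def FSort.proj (σ : Fin m → Fin n) : FSort κ lam μ n → FSort κ lam μ m :=
  Quot.map (PreF.proj σ) (PreF.proj_E σ)

/-- `App_n(x, t)`: the value `h(t)` if it is at least `κ`, and `0` otherwise, for a representative
`h` of the class `x`; for infinite `κ` it does not depend on `h`. -/
noncomputable def FSort.app (x : FSort κ lam μ n) (t : IS lam μ n) : CardMinus κ lam :=
  open Classical in
  if h : κ ≤ (Quot.out x).val t then ⟨(Quot.out x).val t, (Quot.out x).val_lt t, Or.inr h⟩
  else ⟨0, zero_le.trans_lt ((Quot.out x).val_lt t), Or.inl rfl⟩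

/-- The predicate `Eq` on `F_2`: `∑ |{α ∈ A_t : α g₁ ≠ α g₂}| h(t) < κ`. For `κ > ℵ₀` this says
that the sum of all `h(t)` with `g₁ ≠ g₂` is less than `κ`, or equivalently is `0` for a suitable
representative. -/
def FSort.IsEq (x : FSort κ lam μ 2) : Prop :=
  ∃ h : PreF lam μ 2, Quot.mk _ h = x ∧
    (Cardinal.sum fun t : IS lam μ 2 =>
      lift.{u} #{a : t.1.pts | t.1.rep.gen 0 a ≠ t.1.rep.gen 1 a} * h.val t) < κ

/-- The predicate `Prod` on `F_3`: `∑ |{α ∈ A_t : α g₁ g₂ ≠ α g₃}| h(t) < κ`, with permutations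
acting on the right. -/
def FSort.IsProd (x : FSort κ lam μ 3) : Prop :=
  ∃ h : PreF lam μ 3, Quot.mk _ h = x ∧
    (Cardinal.sum fun t : IS lam μ 3 =>
      lift.{u} #{a : t.1.pts | t.1.rep.gen 1 (t.1.rep.gen 0 a) ≠ t.1.rep.gen 2 a} * h.val t) < κ

end Sorts

/-! ### The many-sorted structure `M` -/

/-- The sorts `IS_{n+1}`, `Card⁻` and `F_{n+1}` for `n = 0, 1, 2, …`. -/
inductive MSort : Type
  | is (n : ℕ)
  | card
  | fn (n : ℕ)

/-- The functions `App_{n+1} : F_{n+1} × IS_{n+1} → Card⁻` and the coordinate projections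
`F_{n+1} → F_{m+1}` along injections `σ` of the index sets. -/
inductive MFunc : Type
  | app (n : ℕ)
  | proj (m n : ℕ) (σ : Fin (m + 1) ↪ Fin (n + 1))

/-- The relations `Eq¹ ⊆ IS_2`, `Prod¹ ⊆ IS_3`, the coordinate projection relations
`⊆ IS_{n+1} × IS_{m+1}`, the order of `Card⁻`, `Eq ⊆ F_2` and `Prod ⊆ F_3`. -/
inductive MRel : Type
  | eq1
  | prod1
  | proj1 (m n : ℕ) (σ : Fin (m + 1) ↪ Fin (n + 1))
  | lt
  | eq
  | prod

/-- The signature of the structures `M`. -/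
def MLang : MSLang where
  Sort' := MSort
  Func := MFunc
  dom
    | .app n => [.fn n, .is n]
    | .proj _ n _ => [.fn n]
  cod
    | .app _ => .card
    | .proj m _ _ => .fn m
  Rel := MRel
  ar
    | .eq1 => [.is 1]
    | .prod1 => [.is 2]
    | .proj1 m n _ => [.is n, .is m]
    | .lt => [.card, .card]
    | .eq => [.fn 1]
    | .prod => [.fn 2]

/-- The universe of each sort. -/
def MCarrier (κ lam μ : Cardinal.{u}) : MSort → Type (u + 1)
  | .is n => ULift.{u + 1} (IS lam μ (n + 1))
  | .card => CardMinus κ lam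
  | .fn n => FSort κ lam μ (n + 1)

/-- The many-sorted structure `M_{κ lam μ}`. -/
noncomputable def MStr (κ lam μ : Cardinal.{u}) : MLang.Str where
  carrier := MCarrier κ lam μ
  func
    | .app n => fun x =>
      let h : FSort κ lam μ (n + 1) := x (0 : Fin 2)
      let t : ULift.{u + 1} (IS lam μ (n + 1)) := x (1 : Fin 2)
      h.app t.down
    | .proj m n σ => fun x =>
      let h : FSort κ lam μ (n + 1) := x (0 : Fin 1)
      (h.proj σ : FSort κ lam μ (m + 1))
  rel
    | .eq1 => fun x =>
      let t : ULift.{u + 1} (IS lam μ 2) := x (0 : Fin 1)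
      t.down.1.rep.gen 0 = t.down.1.rep.gen 1
    | .prod1 => fun x =>
      let t : ULift.{u + 1} (IS lam μ 3) := x (0 : Fin 1)
      ∀ a, t.down.1.rep.gen 1 (t.down.1.rep.gen 0 a) = t.down.1.rep.gen 2 a
    | .proj1 m n σ => fun x =>
      let t₁ : ULift.{u + 1} (IS lam μ (n + 1)) := x (0 : Fin 2)
      let t₂ : ULift.{u + 1} (IS lam μ (m + 1)) := x (1 : Fin 2)
      (OrbitType.orbitsOfType σ t₁.down.1 t₂.down.1).Nonempty
    | .lt => fun x =>
      let a : CardMinus κ lam := x (0 : Fin 2)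
      let b : CardMinus κ lam := x (1 : Fin 2)
      a.1 < b.1
    | .eq => fun x =>
      let h : FSort κ lam μ 2 := x (0 : Fin 1)
      h.IsEq
    | .prod => fun x =>
      let h : FSort κ lam μ 3 := x (0 : Fin 1)
      h.IsProd

/-! Each of the two structures is interpreted in the other by formulas that do not depend on the
triple of cardinals (up to one case distinction that a group sentence decides), so sentences
translate into sentences and elementary equivalence passes in both directions.

The group inside `M`. A tuple `f` of elements of `P.S` is described by the function `ty f` that
counts its orbits by isomorphism type. By `tyPre_E_iff` two such functions are E-equivalent exactly
if the tuples are isomorphic after fewer than `κ` relevant points are dropped on either side, and by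
`exists_aut` some automorphism of the quotient group then carries one tuple of cosets to the other.
So the truth of a group formula at a tuple depends only on its class in `F_n`. Every class is
realized by a tuple (`exists_ty_eq`), and lengthening a tuple corresponds to choosing a class in the
next sort with the given projection. Induction on formulas (`MDef.all`, `MDef.of_formula`) gives the
translation `exists_M_sentence`.

`M` inside the group. The first task is to recover the sets of fewer than `lam` points modulo sets
of fewer than `κ` points. Such a set is coded by an element of order three that has it as support.
The first-order condition `Separated` says of an element of order three and an involution that their
supports are almost disjoint (`separated_iff`); from it inclusion, image under a permutation and
comparison of cardinalities become definable (`UDef.sub`, `UDef.image`, `UDef.leC`).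

For uncountable `κ` the orbits are smaller than `κ`, so any small exceptional set can be enlarged to
a small invariant set and thrown away. A type is coded by a tuple together with a non-small almost
invariant set consisting almost entirely of points of that type; `pure_iff` recognizes such pairs
and `OfType.common_iff` compares their types. A class in `F_n` is coded by a tuple, and equality of
classes is simultaneous conjugacy in the quotient (`E_ty_iff`).

For `κ = ℵ₀` an infinite orbit cannot be thrown away, and a single point is invisible. Points are
therefore replaced by ends of infinite cycles of an auxiliary permutation `c`: these are the minimal
non-small almost `c`-invariant sets (`ray_atom`, `Atom.exists_ray`). The ends inside a set `V` form
a set `Pt c V` of fewer than `lam` new points on which permutations act exactly, not just up to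
small sets. Any tuple of permutations of a set of fewer than `lam` elements arises in this way
(`Pt.exists_equiv`), and partial injections, subsets, finiteness and cardinality on the new points
are definable (`Pt.exists_link`, `Pt.exists_meet`, `Pt.finite_iff`, `Pt.cval_eq_iff`). This is
enough to read off types and counting functions.

Minimal sets of this kind exist only for `κ = ℵ₀` (`ctb_iff`), so one sentence of the language of
groups tells which of the two interpretations applies. -/

/-! ### Orbits of tuples of permutations -/

section Tuples

variable {m n : ℕ} {E : Type u} {E' : Type v}

/-- A set invariant under all members of a tuple of permutations (and their inverses). -/
def InvSet (f : Fin n → Equiv.Perm E) (Y : Set E) : Prop := ∀ i x, f i x ∈ Y ↔ x ∈ Y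

/-- The orbit of a point, as the least invariant set that contains it. -/
def orb (f : Fin n → Equiv.Perm E) (x : E) : Set E := {y | ∀ Y, InvSet f Y → x ∈ Y → y ∈ Y}

theorem InvSet.symm_mem {f : Fin n → Equiv.Perm E} {Y : Set E} (h : InvSet f Y) (i : Fin n)
    (x : E) : (f i).symm x ∈ Y ↔ x ∈ Y := by
  rw [← h i, Equiv.apply_symm_apply]

theorem InvSet.compl {f : Fin n → Equiv.Perm E} {Y : Set E} (h : InvSet f Y) : InvSet f Yᶜ :=
  fun i x => not_congr (h i x)

theorem orb_inv (f : Fin n → Equiv.Perm E) (x : E) : InvSet f (orb f x) := fun i y =>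
  ⟨fun h Y hY hx => (hY i y).1 (h Y hY hx), fun h Y hY hx => (hY i y).2 (h Y hY hx)⟩

theorem mem_orb_self (f : Fin n → Equiv.Perm E) (x : E) : x ∈ orb f x := fun _ _ h => h

theorem orb_subset {f : Fin n → Equiv.Perm E} {x : E} {Y : Set E} (hY : InvSet f Y)
    (hx : x ∈ Y) : orb f x ⊆ Y := fun _ hy => hy Y hY hx

/-- The complement of an invariant set is invariant, so if the orbit of `y` missed `x`, its
complement would be an invariant set that contains `x` but not `y`. -/
theorem mem_orb_symm {f : Fin n → Equiv.Perm E} {x y : E} (h : y ∈ orb f x) : x ∈ orb f y := by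
  by_contra hx
  exact h _ (orb_inv f y).compl hx (mem_orb_self f y)

theorem InvSet.closure {f : Fin n → Equiv.Perm E} {Y : Set E} (hY : InvSet f Y)
    {w : Equiv.Perm E} (hw : w ∈ Subgroup.closure (Set.range f)) : ∀ x, w x ∈ Y ↔ x ∈ Y := by
  induction hw using Subgroup.closure_induction with
  | mem g hg => obtain ⟨i, rfl⟩ := hg; exact hY i
  | one => exact fun x => Iff.rfl
  | mul a b _ _ ha hb => exact fun x => (ha _).trans (hb x)
  | inv a _ ha =>
    intro x
    rw [← ha, ← Equiv.Perm.mul_apply, mul_inv_cancel, Equiv.Perm.one_apply]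

theorem mem_orb_iff {f : Fin n → Equiv.Perm E} {x y : E} :
    y ∈ orb f x ↔ ∃ w ∈ Subgroup.closure (Set.range f), w x = y := by
  constructor
  · intro h
    refine h {y | ∃ w ∈ Subgroup.closure (Set.range f), w x = y} ?_ ⟨1, one_mem _, rfl⟩
    intro i z
    have hi : f i ∈ Subgroup.closure (Set.range f) := Subgroup.subset_closure ⟨i, rfl⟩
    constructor
    · rintro ⟨w, hw, e⟩
      exact ⟨(f i)⁻¹ * w, mul_mem (inv_mem hi) hw, by
        rw [Equiv.Perm.mul_apply, e, ← Equiv.Perm.mul_apply, inv_mul_cancel]; rfl⟩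
    · rintro ⟨w, hw, e⟩
      exact ⟨f i * w, mul_mem hi hw, by rw [Equiv.Perm.mul_apply, e]⟩
  · rintro ⟨w, hw, rfl⟩ Y hY hx
    exact (hY.closure hw x).2 hx

/-- The values at `x` of the countably many words in the generators and their inverses form an
invariant set. -/
theorem orb_countable (f : Fin n → Equiv.Perm E) (x : E) : (orb f x).Countable := by
  let ev : List (Fin n × Bool) → E := fun l =>
    l.foldr (fun p y => if p.2 then f p.1 y else (f p.1).symm y) x
  have hev : ∀ p l, ev (p :: l) = if p.2 then f p.1 (ev l) else (f p.1).symm (ev l) :=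
    fun _ _ => rfl
  refine (Set.countable_range ev).mono (orb_subset (Y := Set.range ev) ?_ ⟨[], rfl⟩)
  intro i y
  constructor
  · rintro ⟨l, hl⟩
    exact ⟨(i, false) :: l, by rw [hev, hl]; simp⟩
  · rintro ⟨l, hl⟩
    exact ⟨(i, true) :: l, by rw [hev, hl]; simp⟩

namespace OrbitType

theorem inv_eq_univ (t : OrbitType n) {Y : Set t.pts} (hY : InvSet t.rep.gen Y) {a : t.pts}
    (ha : a ∈ Y) : Y = Set.univ := by
  ext b
  obtain ⟨w, hw, rfl⟩ := t.rep.trans a b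
  simp [hY.closure hw a, ha]

/-- An equivariant embedding of the representative of the type `t`. -/
structure IsChart (f : Fin n → Equiv.Perm E) (t : OrbitType n) (j : t.pts → E) : Prop where
  inj : Function.Injective j
  map : ∀ i a, j (t.rep.gen i a) = f i (j a)

variable {f : Fin n → Equiv.Perm E} {t t' : OrbitType n}

theorem IsChart.range_inv {j : t.pts → E} (h : IsChart f t j) : InvSet f (Set.range j) := by
  intro i x
  constructor
  · rintro ⟨a, ha⟩
    refine ⟨(t.rep.gen i).symm a, (f i).injective ?_⟩
    rw [← h.map, Equiv.apply_symm_apply, ha]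
  · rintro ⟨a, rfl⟩
    exact ⟨_, h.map i a⟩

theorem IsChart.preimage_inv {j : t.pts → E} (h : IsChart f t j) {Y : Set E} (hY : InvSet f Y) :
    InvSet t.rep.gen (j ⁻¹' Y) := by
  intro i a
  rw [Set.mem_preimage, h.map, hY]
  rfl

theorem IsChart.range_subset {j : t.pts → E} (h : IsChart f t j) {Y : Set E} (hY : InvSet f Y)
    {a : t.pts} (ha : j a ∈ Y) : Set.range j ⊆ Y := by
  rintro _ ⟨b, rfl⟩
  have := t.inv_eq_univ (h.preimage_inv hY) ha
  exact this.symm.subset (Set.mem_univ b)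

theorem IsChart.range_eq_orb {j : t.pts → E} (h : IsChart f t j) (a : t.pts) :
    Set.range j = orb f (j a) :=
  (h.range_subset (orb_inv f _) (mem_orb_self f (j a))).antisymm
    (orb_subset h.range_inv ⟨a, rfl⟩)

theorem eq_of_equiv (e : t.pts ≃ t'.pts) (he : ∀ i a, e (t.rep.gen i a) = t'.rep.gen i (e a)) :
    t = t' := by
  rw [← Quotient.out_eq t, ← Quotient.out_eq t']
  exact Quotient.sound ⟨e, he⟩

/-- The range of an equivariant map is invariant, so by transitivity an injective one is already an
isomorphism. -/
theorem eq_of_map {k : t.pts → t'.pts} (hk : Function.Injective k)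
    (hm : ∀ i a, k (t.rep.gen i a) = t'.rep.gen i (k a)) : t = t' := by
  have hc : IsChart t'.rep.gen t k := ⟨hk, hm⟩
  obtain ⟨a⟩ : Nonempty t.pts := t.rep.nonempty.to_subtype
  have hs : Set.range k = Set.univ := t'.inv_eq_univ hc.range_inv ⟨a, rfl⟩
  exact eq_of_equiv (Equiv.ofBijective k ⟨hk, Set.range_eq_univ.1 hs⟩) hm

theorem IsChart.type_eq {j : t.pts → E} {j' : t'.pts → E} (h : IsChart f t j)
    (h' : IsChart f t' j') {a : t.pts} {b : t'.pts} (hab : j a = j' b) : t = t' := by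
  have hsub : ∀ c, ∃ d, j' d = j c := fun c =>
    h.range_subset h'.range_inv (a := a) ⟨b, hab.symm⟩ ⟨c, rfl⟩
  choose k hk using hsub
  refine eq_of_map (k := k) (fun c d hcd => h.inj ?_) fun i c => h'.inj ?_
  · rw [← hk, ← hk, hcd]
  · rw [hk, h.map, h'.map, hk]

theorem exists_of_transitive {A : Type v} [Countable A] [Nonempty A] (g : Fin n → Equiv.Perm A)
    (hg : ∀ x y, y ∈ orb g x) : ∃ t : OrbitType n, ∃ e : t.pts ≃ A,
      ∀ i a, e (t.rep.gen i a) = g i (e a) := by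
  obtain ⟨k, hk⟩ := Countable.exists_injective_nat A
  let ε : A ≃ Set.range k := Equiv.ofInjective k hk
  let T : TransTuple n :=
    { carrier := Set.range k
      gen := fun i => ε.permCongr (g i)
      nonempty := Set.range_nonempty k
      trans := by
        intro x y
        rw [← mem_orb_iff]
        intro Y hY hx
        have hinv : InvSet g (ε ⁻¹' Y) := by
          intro i a
          have := hY i (ε a)
          simpa [Equiv.permCongr_apply] using this
        have := hg (ε.symm x) (ε.symm y) _ hinv (by simpa using hx)
        simpa using this }
  obtain ⟨e, he⟩ : (rep (Quotient.mk _ T : Quotient (TransTuple.setoid n))) ≈ T :=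
    Quotient.mk_out T
  refine ⟨(Quotient.mk _ T : Quotient (TransTuple.setoid n)), e.trans ε.symm, fun i a => ?_⟩
  have h1 := he i a
  simp only [Equiv.trans_apply]
  rw [Equiv.symm_apply_eq]
  refine h1.trans ?_
  simp [T, Equiv.permCongr_apply]

theorem exists_chart (f : Fin n → Equiv.Perm E) (x : E) :
    ∃ t : OrbitType n, ∃ j, IsChart f t j ∧ x ∈ Set.range j := by
  have : Countable (orb f x) := (orb_countable f x).to_subtype
  have : Nonempty (orb f x) := ⟨⟨x, mem_orb_self f x⟩⟩
  let g : Fin n → Equiv.Perm (orb f x) := fun i => (f i).subtypePerm (orb_inv f x i)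
  obtain ⟨t, e, he⟩ := exists_of_transitive g (by
    rintro ⟨y, hy⟩ ⟨z, hz⟩ Y hY hyY
    have hinv : InvSet f (Subtype.val '' Y) := by
      intro i a
      constructor
      · rintro ⟨b, hb, hba⟩
        have ha : a ∈ orb f x := (orb_inv f x i a).1 (hba ▸ b.2)
        refine ⟨⟨a, ha⟩, (hY i _).1 ?_, rfl⟩
        convert hb
        exact Subtype.ext hba.symm
      · rintro ⟨b, hb, rfl⟩
        exact ⟨g i b, (hY i b).2 hb, rfl⟩
    have h1 : z ∈ Subtype.val '' Y :=
      orb_subset hinv ⟨_, hyY, rfl⟩ (orb_subset (orb_inv f y) (mem_orb_symm hy) hz)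
    obtain ⟨b, hb, rfl⟩ := h1
    exact hb)
  refine ⟨t, fun a => (e a : E), ⟨fun a b h => e.injective (Subtype.ext h), fun i a => ?_⟩, ?_⟩
  · rw [he]; rfl
  · exact ⟨e.symm ⟨x, mem_orb_self f x⟩, by simp⟩

end OrbitType

open OrbitType

/-- The set of all orbits of type `t`. -/
def orbs (f : Fin n → Equiv.Perm E) (t : OrbitType n) : Set (Set E) :=
  {O | ∃ j, IsChart f t j ∧ Set.range j = O}

theorem orbitsOfType_eq (σ : Fin m → Fin n) (t' : OrbitType n) (t : OrbitType m) :
    orbitsOfType σ t' t = orbs (fun i => t'.rep.gen (σ i)) t := by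
  have horb : ∀ x : t'.pts, MulAction.orbit (Subgroup.closure
      (Set.range fun i => t'.rep.gen (σ i))) x = orb (fun i => t'.rep.gen (σ i)) x := by
    intro x
    ext y
    rw [mem_orb_iff]
    constructor
    · rintro ⟨⟨w, hw⟩, h⟩; exact ⟨w, hw, h⟩
    · rintro ⟨w, hw, h⟩; exact ⟨⟨w, hw⟩, h⟩
  ext O
  constructor
  · rintro ⟨-, e, he⟩
    refine ⟨fun a => (e a : t'.pts), ⟨fun a b h => e.injective (Subtype.ext h), he⟩, ?_⟩
    ext y
    exact ⟨by rintro ⟨a, rfl⟩; exact (e a).2, fun hy => ⟨e.symm ⟨y, hy⟩, by simp⟩⟩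
  · rintro ⟨j, hj, rfl⟩
    obtain ⟨a⟩ : Nonempty t.pts := t.rep.nonempty.to_subtype
    exact ⟨⟨j a, by rw [horb, hj.range_eq_orb a]⟩, Equiv.ofInjective j hj.inj, hj.map⟩

variable {f : Fin n → Equiv.Perm E} {t : OrbitType n}

/-- A chart of an orbit. -/
noncomputable def orbChart (O : orbs f t) : t.pts → E := O.2.choose

theorem orbChart_spec (O : orbs f t) : IsChart f t (orbChart O) := O.2.choose_spec.1

theorem range_orbChart (O : orbs f t) : Set.range (orbChart O) = O := O.2.choose_spec.2

theorem orbChart_mem (O : orbs f t) (a : t.pts) : orbChart O a ∈ (O : Set E) := by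
  rw [← range_orbChart]; exact ⟨a, rfl⟩

theorem orbs_inv (O : orbs f t) : InvSet f (O : Set E) := by
  rw [← range_orbChart]; exact (orbChart_spec O).range_inv

theorem orbs_eq_orb (O : orbs f t) {x : E} (hx : x ∈ (O : Set E)) : (O : Set E) = orb f x := by
  rw [← range_orbChart] at hx ⊢
  obtain ⟨a, rfl⟩ := hx
  exact (orbChart_spec O).range_eq_orb a

theorem exists_orbChart (f : Fin n → Equiv.Perm E) (x : E) :
    ∃ (t : OrbitType n) (O : orbs f t) (a : t.pts), orbChart O a = x := by
  obtain ⟨t, j, hj, hx⟩ := exists_chart f x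
  refine ⟨t, ⟨_, j, hj, rfl⟩, ?_⟩
  change x ∈ Set.range _
  rwa [range_orbChart]

/-- Together with `exists_orbChart` this gives each point unique coordinates: the type of its orbit,
the orbit, and the position in the chosen chart. All counts of points by orbits rest on these
coordinates. -/
theorem orbChart_inj {t t' : OrbitType n} {O : orbs f t} {O' : orbs f t'} {a : t.pts}
    {a' : t'.pts} (h : orbChart O a = orbChart O' a') :
    (⟨t, O, a⟩ : Σ t, orbs f t × t.pts) = ⟨t', O', a'⟩ := by
  have ht : t = t' := (orbChart_spec O).type_eq (orbChart_spec O') h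
  subst ht
  have hO : O = O' := by
    refine Subtype.ext ?_
    rw [orbs_eq_orb O (orbChart_mem O a), orbs_eq_orb O' (orbChart_mem O' a'), h]
  subst hO
  rw [(orbChart_spec O).inj h]

/-- The number of points in prescribed places of prescribed orbits. -/
theorem mk_orbit_points (f : Fin n → Equiv.Perm E) (p : OrbitType n → Prop)
    (Or : ∀ t, Set (orbs f t)) (q : ∀ t : OrbitType n, Set t.pts) :
    #{x | ∃ t, p t ∧ ∃ O ∈ Or t, ∃ a ∈ q t, orbChart O a = x} =
      Cardinal.sum fun t : {t // p t} => lift.{u} #(q t.1) * #(Or t.1) := by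
  have h1 : (fun t : {t // p t} => lift.{u} #(q t.1) * #(Or t.1)) =
      fun t => #(q t.1 × Or t.1) := by
    funext t; rw [mk_prod]; simp
  rw [h1, ← mk_sigma]
  refine (mk_congr (Equiv.ofBijective (fun z => ⟨orbChart z.2.2.1 z.2.1.1,
    z.1.1, z.1.2, _, z.2.2.2, _, z.2.1.2, rfl⟩) ⟨?_, ?_⟩)).symm
  · rintro ⟨⟨t, ht⟩, ⟨a, ha⟩, ⟨O, hO⟩⟩ ⟨⟨t', ht'⟩, ⟨a', ha'⟩, ⟨O', hO'⟩⟩ h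
    have h2 := orbChart_inj (Subtype.ext_iff.1 h)
    simp only [Sigma.mk.injEq] at h2
    obtain ⟨rfl, h3⟩ := h2
    simp only [heq_eq_eq, Prod.mk.injEq] at h3
    obtain ⟨rfl, rfl⟩ := h3
    rfl
  · rintro ⟨x, t, ht, O, hO, a, ha, rfl⟩
    exact ⟨⟨⟨t, ht⟩, ⟨a, ha⟩, ⟨O, hO⟩⟩, rfl⟩

/-- All points, or all points moved by the tuple if `Z` holds. -/
def core (Z : Prop) (f : Fin n → Equiv.Perm E) : Set E := {x | Z → ∃ i, f i x ≠ x}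

/-- The points fixed by the whole tuple form an invariant set, so an orbit that contains one of them
has the trivial type. Hence, with `lam ≤ μ` for `Z`, passing to `core` is the same as omitting the
trivial type from `IS`. -/
theorem IsChart.mem_core_iff {Z : Prop} {j : t.pts → E} (h : IsChart f t j) (a : t.pts) :
    j a ∈ core Z f ↔ (Z → ¬ t.IsTrivial) := by
  refine imp_congr_right fun _ => ?_
  constructor
  · rintro ⟨i, hi⟩ ht
    rw [← h.map, ht i] at hi
    exact hi rfl
  · intro ht
    by_contra hx
    push Not at hx
    refine ht fun i => ?_
    have hinv : InvSet t.rep.gen {b | ∀ i, t.rep.gen i b = b} := by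
      intro k b
      constructor
      · intro hb
        have h1 : t.rep.gen k b = b := (t.rep.gen k).injective (hb k)
        have hb' : ∀ i, t.rep.gen i (t.rep.gen k b) = t.rep.gen k b := hb
        rw [h1] at hb'
        exact hb'
      · intro hb
        change ∀ i, t.rep.gen i (t.rep.gen k b) = t.rep.gen k b
        rw [hb k]
        exact hb
    have h1 := t.inv_eq_univ hinv (a := a) fun i => h.inj (by rw [h.map, hx])
    ext b
    have h2 : b ∈ {b | ∀ i, t.rep.gen i b = b} := h1 ▸ Set.mem_univ b
    rw [h2 i]
    rfl

theorem core_inv (Z : Prop) (f : Fin n → Equiv.Perm E) : InvSet f (core Z f) := by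
  intro i x
  obtain ⟨t, O, a, rfl⟩ := exists_orbChart f x
  have hO := orbChart_spec O
  rw [← hO.map, IsChart.mem_core_iff hO, IsChart.mem_core_iff hO]

theorem core_of_not {Z : Prop} (hZ : ¬ Z) (f : Fin n → Equiv.Perm E) : core Z f = Set.univ :=
  Set.eq_univ_of_forall fun _ h => absurd h hZ

theorem mk_core (Z : Prop) (f : Fin n → Equiv.Perm E) :
    #(core Z f) = Cardinal.sum fun t : {t : OrbitType n // Z → ¬ t.IsTrivial} =>
      t.1.deg * #(orbs f t.1) := by
  have h := mk_orbit_points f (fun t => Z → ¬ t.IsTrivial) (fun _ => Set.univ)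
    (fun _ => Set.univ)
  simp only [mk_univ] at h
  refine Eq.trans ?_ h
  congr 2
  ext x
  constructor
  · intro hx
    obtain ⟨t, O, a, rfl⟩ := exists_orbChart f x
    exact ⟨t, (IsChart.mem_core_iff (orbChart_spec O) a).1 hx, O, trivial, a, trivial, rfl⟩
  · rintro ⟨t, ht, O, -, a, -, rfl⟩
    exact (IsChart.mem_core_iff (orbChart_spec O) a).2 ht

end Tuples

/-! ### Partial isomorphisms of tuples of permutations -/

section PartialIso

variable {m n : ℕ} {E E' : Type u}

/-- The domain of a relation. -/
def relDom (L : E → E' → Prop) : Set E := {x | ∃ y, L x y}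

/-- The range of a relation. -/
def relRan (L : E → E' → Prop) : Set E' := {y | ∃ x, L x y}

/-- The relation `L` is an isomorphism of an invariant part of `(E, f)` to one of `(E', f')`. -/
structure PIso (f : Fin n → Equiv.Perm E) (f' : Fin n → Equiv.Perm E') (L : E → E' → Prop) :
    Prop where
  func : ∀ {x y y'}, L x y → L x y' → y = y'
  inj : ∀ {x x' y}, L x y → L x' y → x = x'
  map : ∀ i x y, L (f i x) (f' i y) ↔ L x y

variable {f : Fin n → Equiv.Perm E} {f' : Fin n → Equiv.Perm E'} {L : E → E' → Prop}
  {t : OrbitType n}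

open OrbitType

theorem PIso.symm (h : PIso f f' L) : PIso f' f (flip L) :=
  ⟨fun a b => h.inj a b, fun a b => h.func a b, fun i x y => h.map i y x⟩

theorem PIso.dom_inv (h : PIso f f' L) : InvSet f (relDom L) := by
  intro i x
  constructor
  · rintro ⟨y, hy⟩
    refine ⟨(f' i).symm y, (h.map i _ _).1 ?_⟩
    rwa [Equiv.apply_symm_apply]
  · rintro ⟨y, hy⟩
    exact ⟨_, (h.map i _ _).2 hy⟩

theorem PIso.exists_chart (h : PIso f f' L) {j : t.pts → E} (hj : IsChart f t j) {a : t.pts}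
    (ha : j a ∈ relDom L) : ∃ j', IsChart f' t j' ∧ ∀ b, L (j b) (j' b) := by
  have hs : ∀ b, ∃ y, L (j b) y := fun b => hj.range_subset h.dom_inv ha ⟨b, rfl⟩
  choose j' hj' using hs
  refine ⟨j', ⟨fun b c hbc => hj.inj (h.inj (hj' b) (hbc ▸ hj' c)), fun i b => ?_⟩, hj'⟩
  refine h.func (hj' _) ?_
  rw [hj.map, h.map]
  exact hj' b

theorem PIso.mk_orbs_le (h : PIso f f' L) (t : OrbitType n) :
    #{O : orbs f t | ∃ x ∈ (O : Set E), x ∈ relDom L} ≤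
      #{O : orbs f' t | ∃ x ∈ (O : Set E'), x ∈ relRan L} := by
  have key : ∀ O : {O : orbs f t | ∃ x ∈ (O : Set E), x ∈ relDom L},
      ∃ j', IsChart f' t j' ∧ ∀ b, L (orbChart O.1 b) (j' b) := by
    rintro ⟨O, x, hx, hd⟩
    rw [← range_orbChart] at hx
    obtain ⟨a, rfl⟩ := hx
    exact h.exists_chart (orbChart_spec O) hd
  choose j hj hL using key
  obtain ⟨a⟩ : Nonempty t.pts := t.rep.nonempty.to_subtype
  refine mk_le_of_injective (f := fun O => ⟨⟨Set.range (j O), j O, hj O, rfl⟩, j O a, ⟨a, rfl⟩,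
    _, hL O a⟩) fun O O' hO => ?_
  have hO : Set.range (j O) = Set.range (j O') := Subtype.ext_iff.1 (Subtype.ext_iff.1 hO)
  obtain ⟨b, hb⟩ : j O a ∈ Set.range (j O') := hO ▸ ⟨a, rfl⟩
  have h1 := hL O' b
  rw [hb] at h1
  have h2 := h.inj (hL O a) h1
  refine Subtype.ext (Subtype.ext ?_)
  rw [orbs_eq_orb O.1 (orbChart_mem O.1 a), orbs_eq_orb O'.1 (orbChart_mem O'.1 b), h2]

theorem PIso.mk_orbs_eq (h : PIso f f' L) (t : OrbitType n) :
    #{O : orbs f t | ∃ x ∈ (O : Set E), x ∈ relDom L} =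
      #{O : orbs f' t | ∃ x ∈ (O : Set E'), x ∈ relRan L} :=
  (h.mk_orbs_le t).antisymm (h.symm.mk_orbs_le t)

/-- The points outside the domain of a partial isomorphism, counted by orbits. -/
theorem sum_orbs_notMem_le (Z : Prop) (f : Fin n → Equiv.Perm E) (D : Set E) :
    (Cardinal.sum fun t : {t : OrbitType n // Z → ¬ t.IsTrivial} =>
      t.1.deg * #({O : orbs f t.1 | ∃ x ∈ (O : Set E), x ∈ D}ᶜ : Set _)) ≤
      #(core Z f \ D : Set E) := by
  have h := mk_orbit_points f (fun t => Z → ¬ t.IsTrivial)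
    (fun t => {O : orbs f t | ∃ x ∈ (O : Set E), x ∈ D}ᶜ) (fun _ => Set.univ)
  simp only [mk_univ] at h
  refine h.symm.le.trans (mk_le_mk_of_subset ?_)
  rintro x ⟨t, ht, O, hO, a, -, rfl⟩
  refine ⟨(IsChart.mem_core_iff (orbChart_spec O) a).2 ht, fun hx => hO ⟨_, ?_, hx⟩⟩
  exact orbChart_mem O a

/-- The smaller set together with a set of the size of the difference is in bijection with the
larger one; only that second summand stays unmatched. -/
theorem exists_partial_bijection (α β : Type u) : ∃ M : α → β → Prop,
    (∀ {a b b'}, M a b → M a b' → b = b') ∧ (∀ {a a' b}, M a b → M a' b → a = a') ∧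
    #((relDom M)ᶜ : Set α) ≤ cardDist #α #β ∧ #((relRan M)ᶜ : Set β) ≤ cardDist #α #β := by
  have key : ∀ α β : Type u, #α ≤ #β → ∃ M : α → β → Prop,
      (∀ {a b b'}, M a b → M a b' → b = b') ∧ (∀ {a a' b}, M a b → M a' b → a = a') ∧
      #((relDom M)ᶜ : Set α) ≤ cardDist #α #β ∧ #((relRan M)ᶜ : Set β) ≤ cardDist #α #β := by
    intro α β hle
    have hd : #α + cardDist #α #β = #β := by
      rw [cardDist, if_pos hle]; exact add_sInf_sub hle
    obtain ⟨e⟩ : Nonempty (α ⊕ (cardDist #α #β).out ≃ β) := by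
      rw [← Cardinal.eq, mk_sum]; simpa using hd
    refine ⟨fun a b => e (Sum.inl a) = b, fun h h' => h.symm.trans h',
      fun h h' => Sum.inl_injective (e.injective (h.trans h'.symm)), ?_, ?_⟩
    · have : relDom (fun a b => e (Sum.inl a) = b) = Set.univ :=
        Set.eq_univ_of_forall fun a => ⟨_, rfl⟩
      rw [this]; simp
    · have hsub : ((relRan fun a b => e (Sum.inl a) = b)ᶜ : Set β) ⊆
          Set.range fun c => e (Sum.inr c) := by
        intro b hb
        rcases h : e.symm b with a | c
        · exact absurd ⟨a, e.symm_apply_eq.1 h |>.symm⟩ hb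
        · exact ⟨c, e.symm_apply_eq.1 h |>.symm⟩
      refine (mk_le_mk_of_subset hsub).trans (mk_range_le.trans ?_)
      simp
  rcases le_total #α #β with h | h
  · exact key α β h
  · obtain ⟨M, h1, h2, h3, h4⟩ := key β α h
    rw [cardDist_comm] at h3 h4
    exact ⟨flip M, fun a b => h2 a b, fun a b => h1 a b, h4, h3⟩

end PartialIso

/-! ### The function counting the orbits of a tuple by their types -/

section TupleType

variable {κ lam μ : Cardinal.{u}} {m n : ℕ} {E E' : Type u}

open OrbitType

theorem PreF.ext_val {h h' : PreF lam μ n} (H : h.val = h'.val) : h = h' := by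
  cases h; cases h'; cases H; rfl

/-- The tuple has the total size required for `F_n`. -/
structure Fits (lam μ : Cardinal.{u}) (f : Fin n → Equiv.Perm E) : Prop where
  lt : #(core (lam ≤ μ) f) < lam
  eq : lam = Order.succ μ → #(core (lam ≤ μ) f) = μ

/-- The function counting the orbits of a tuple by their types. -/
def tyPre (f : Fin n → Equiv.Perm E) (hf : Fits lam μ f) : PreF lam μ n where
  val t := #(orbs f t.1)
  val_lt t := by
    refine lt_of_le_of_lt ?_ ((mk_core (lam ≤ μ) f).symm.trans_lt hf.lt)
    refine le_trans ?_ (le_sum _ t)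
    exact le_mul_of_one_le_left zero_le (OrbitType.one_le_deg _)
  total_lt := (mk_core (lam ≤ μ) f).symm.trans_lt hf.lt
  total_eq h := (mk_core (lam ≤ μ) f).symm.trans (hf.eq h)

variable {f : Fin n → Equiv.Perm E} {f' : Fin n → Equiv.Perm E'}

/-- The orbits of type `t` met by the domain correspond to those met by the range, so only the
unmatched orbits can contribute to the difference. -/
theorem PIso.cardDist_orbs_le {L : E → E' → Prop} (h : PIso f f' L) (t : OrbitType n) :
    cardDist #(orbs f t) #(orbs f' t) ≤
      #({O : orbs f t | ∃ x ∈ (O : Set E), x ∈ relDom L}ᶜ : Set _) +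
      #({O : orbs f' t | ∃ x ∈ (O : Set E'), x ∈ relRan L}ᶜ : Set _) := by
  rw [cardDist_le_iff, ← mk_sum_compl {O : orbs f t | ∃ x ∈ (O : Set E), x ∈ relDom L},
    ← mk_sum_compl {O : orbs f' t | ∃ x ∈ (O : Set E'), x ∈ relRan L}, h.mk_orbs_eq t]
  constructor
  · rw [add_assoc]
    refine add_le_add le_rfl ?_
    exact le_add_left (le_add_right le_rfl)
  · rw [add_assoc]
    refine add_le_add le_rfl ?_
    exact le_add_left (le_add_left le_rfl)

theorem PIso.orbs_eq {L : E → E' → Prop} (h : PIso f f' L) {Z : Prop} (h1 : core Z f ⊆ relDom L)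
    (h2 : core Z f' ⊆ relRan L) (t : OrbitType n) (ht : Z → ¬ t.IsTrivial) :
    #(orbs f t) = #(orbs f' t) := by
  obtain ⟨a⟩ : Nonempty t.pts := t.rep.nonempty.to_subtype
  have e1 : {O : orbs f t | ∃ x ∈ (O : Set E), x ∈ relDom L} = Set.univ :=
    Set.eq_univ_of_forall fun O => ⟨_, orbChart_mem O a,
      h1 ((IsChart.mem_core_iff (orbChart_spec O) a).2 ht)⟩
  have e2 : {O : orbs f' t | ∃ x ∈ (O : Set E'), x ∈ relRan L} = Set.univ :=
    Set.eq_univ_of_forall fun O => ⟨_, orbChart_mem O a,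
      h2 ((IsChart.mem_core_iff (orbChart_spec O) a).2 ht)⟩
  have := h.mk_orbs_eq t
  rwa [e1, e2, mk_univ, mk_univ] at this

theorem PIso.tyPre_eq {L : E → E' → Prop} (h : PIso f f' L) (hf : Fits lam μ f)
    (hf' : Fits lam μ f') (h1 : core (lam ≤ μ) f ⊆ relDom L) (h2 : core (lam ≤ μ) f' ⊆ relRan L) :
    tyPre f hf = tyPre f' hf' :=
  PreF.ext_val (funext fun t => h.orbs_eq h1 h2 t.1 t.2)

/-- For each type match the orbits of the two tuples as far as their numbers allow; the points left
over number at most the sum that defines `PreF.E`. Conversely, the orbits of the core that a partial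
isomorphism leaves unmatched bound this sum. This turns E-equivalence of functions into a statement
about permutations. -/
theorem tyPre_E_iff (hκ : ℵ₀ ≤ κ) (hf : Fits lam μ f) (hf' : Fits lam μ f') :
    PreF.E κ (tyPre f hf) (tyPre f' hf') ↔ ∃ L, PIso f f' L ∧
      #(core (lam ≤ μ) f \ relDom L : Set E) < κ ∧ #(core (lam ≤ μ) f' \ relRan L : Set E') < κ := by
  constructor
  · intro H
    choose M hM1 hM2 hM3 hM4 using fun t : OrbitType n =>
      exists_partial_bijection (orbs f t) (orbs f' t)
    -- Points are related if they occupy the same position `a` in the charts of two matched orbits.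
    refine ⟨fun x y => ∃ t O O' a, M t O O' ∧ orbChart O a = x ∧ orbChart O' a = y,
      ⟨?_, ?_, ?_⟩, ?_, ?_⟩
    · rintro x y y' ⟨t, O, O', a, h, rfl, rfl⟩ ⟨s, P, P', b, h', hx, rfl⟩
      have := orbChart_inj hx
      simp only [Sigma.mk.injEq] at this
      obtain ⟨rfl, h3⟩ := this
      simp only [heq_eq_eq, Prod.mk.injEq] at h3
      obtain ⟨rfl, rfl⟩ := h3
      rw [hM1 _ h h']
    · rintro x x' y ⟨t, O, O', a, h, rfl, rfl⟩ ⟨s, P, P', b, h', rfl, hx⟩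
      have := orbChart_inj hx
      simp only [Sigma.mk.injEq] at this
      obtain ⟨rfl, h3⟩ := this
      simp only [heq_eq_eq, Prod.mk.injEq] at h3
      obtain ⟨rfl, rfl⟩ := h3
      rw [hM2 _ h h']
    · intro i x y
      constructor
      · rintro ⟨t, O, O', a, h, hx, hy⟩
        refine ⟨t, O, O', (t.rep.gen i).symm a, h, (f i).injective ?_, (f' i).injective ?_⟩
        · rw [← (orbChart_spec O).map, Equiv.apply_symm_apply, hx]
        · rw [← (orbChart_spec O').map, Equiv.apply_symm_apply, hy]
      · rintro ⟨t, O, O', a, h, rfl, rfl⟩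
        exact ⟨t, O, O', t.rep.gen i a, h, (orbChart_spec O).map i a, (orbChart_spec O').map i a⟩
    · refine lt_of_le_of_lt ?_ H
      have h := mk_orbit_points f (fun t => lam ≤ μ → ¬ t.IsTrivial)
        (fun t => (relDom (M t))ᶜ) (fun _ => Set.univ)
      simp only [mk_univ] at h
      refine le_trans (mk_le_mk_of_subset ?_) (h.le.trans (sum_le_sum _ _ fun t =>
        mul_le_mul_right (hM3 t.1) _))
      rintro x ⟨hx, hx'⟩
      obtain ⟨t, O, a, rfl⟩ := exists_orbChart f x
      refine ⟨t, (IsChart.mem_core_iff (orbChart_spec O) a).1 hx, O, ?_, a, trivial, rfl⟩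
      rintro ⟨O', hO'⟩
      exact hx' ⟨_, t, O, O', a, hO', rfl, rfl⟩
    · refine lt_of_le_of_lt ?_ H
      have h := mk_orbit_points f' (fun t => lam ≤ μ → ¬ t.IsTrivial)
        (fun t => (relRan (M t))ᶜ) (fun _ => Set.univ)
      simp only [mk_univ] at h
      refine le_trans (mk_le_mk_of_subset ?_) (h.le.trans (sum_le_sum _ _ fun t =>
        mul_le_mul_right (hM4 t.1) _))
      rintro x ⟨hx, hx'⟩
      obtain ⟨t, O, a, rfl⟩ := exists_orbChart f' x
      refine ⟨t, (IsChart.mem_core_iff (orbChart_spec O) a).1 hx, O, ?_, a, trivial, rfl⟩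
      rintro ⟨O', hO'⟩
      exact hx' ⟨_, t, O', O, a, hO', rfl, rfl⟩
  · rintro ⟨L, hL, h1, h2⟩
    refine lt_of_le_of_lt ?_ (add_lt_of_lt hκ h1 h2)
    refine le_trans ?_ (add_le_add (sum_orbs_notMem_le (lam ≤ μ) f (relDom L))
      (sum_orbs_notMem_le (lam ≤ μ) f' (relRan L)))
    rw [← sum_add_distrib']
    refine sum_le_sum _ _ fun t => ?_
    rw [← mul_add]
    exact mul_le_mul_right (hL.cardDist_orbs_le t.1) _

/-- Each orbit of the subtuple lies inside exactly one orbit of the whole tuple, and the chart of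
the latter pulls it back to an orbit on the representative of its type. -/
theorem orbs_comp_le (σ : Fin m → Fin n) (f : Fin n → Equiv.Perm E) (Z : Prop) (t : OrbitType m)
    (ht : Z → ¬ t.IsTrivial) : #(orbs (fun i => f (σ i)) t) =
      Cardinal.sum fun t' : {t' : OrbitType n // Z → ¬ t'.IsTrivial} =>
        orbitCount σ t'.1 t * #(orbs f t'.1) := by
  have h1 : (fun t' : {t' : OrbitType n // Z → ¬ t'.IsTrivial} =>
      orbitCount.{u} σ t'.1 t * #(orbs f t'.1)) =
      fun t' => #(orbs (fun i => t'.1.rep.gen (σ i)) t × orbs f t'.1) := by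
    funext t'; rw [mk_prod, orbitCount, orbitsOfType_eq]; simp
  rw [h1, ← mk_sigma]
  have hch : ∀ {t' : OrbitType n} (O : orbs f t') {j : t.pts → t'.pts},
      IsChart (fun i => t'.rep.gen (σ i)) t j →
      IsChart (fun i => f (σ i)) t (fun a => orbChart O (j a)) := fun O j hj =>
    ⟨fun a b h => hj.inj ((orbChart_spec O).inj h), fun i a => by
      rw [hj.map, (orbChart_spec O).map]⟩
  obtain ⟨a₀⟩ : Nonempty t.pts := t.rep.nonempty.to_subtype
  refine (mk_congr (Equiv.ofBijective (fun z => ⟨orbChart z.2.2 '' (z.2.1 : Set z.1.1.pts),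
    _, hch z.2.2 (orbChart_spec z.2.1), by
      rw [← range_orbChart z.2.1, ← Set.range_comp]; rfl⟩) ⟨?_, ?_⟩)).symm
  · rintro ⟨⟨t1, ht1⟩, Q1, O1⟩ ⟨⟨t2, ht2⟩, Q2, O2⟩ h
    have h : orbChart O1 '' (Q1 : Set t1.pts) = orbChart O2 '' (Q2 : Set t2.pts) :=
      Subtype.ext_iff.1 h
    obtain ⟨b, hb, hab⟩ : orbChart O1 (orbChart Q1 a₀) ∈ orbChart O2 '' (Q2 : Set t2.pts) :=
      h ▸ ⟨_, orbChart_mem Q1 a₀, rfl⟩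
    have h3 := orbChart_inj hab
    simp only [Sigma.mk.injEq] at h3
    obtain ⟨rfl, h3⟩ := h3
    simp only [heq_eq_eq, Prod.mk.injEq] at h3
    obtain ⟨rfl, -⟩ := h3
    have : Q1 = Q2 := Subtype.ext ((Set.image_injective.2 (orbChart_spec O2).inj) h)
    rw [this]
  · rintro ⟨_, j, hj, rfl⟩
    obtain ⟨t', O, a, ha⟩ := exists_orbChart f (j a₀)
    have hinv : InvSet (fun i => f (σ i)) (O : Set E) := fun i x => orbs_inv O (σ i) x
    have hsub := hj.range_subset hinv (a := a₀) (ha ▸ orbChart_mem O a)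
    have hk : ∀ b, ∃ c, orbChart O c = j b := fun b => by
      have : j b ∈ (O : Set E) := hsub ⟨b, rfl⟩
      rwa [← range_orbChart] at this
    choose k hk using hk
    have hkc : IsChart (fun i => t'.rep.gen (σ i)) t k :=
      ⟨fun b c h => hj.inj (by rw [← hk, ← hk, h]), fun i b =>
        (orbChart_spec O).inj (by rw [hk, hj.map, (orbChart_spec O).map, hk])⟩
    -- A non-trivial orbit of the subtuple cannot lie in a trivial orbit of the tuple, so the
    -- omitted trivial type contributes nothing to the sum.
    have ht' : Z → ¬ t'.IsTrivial := fun hZ htr => ht hZ fun i => by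
      ext b
      have h5 := hkc.map i b
      rw [htr (σ i), Equiv.Perm.one_apply] at h5
      rw [hkc.inj h5]; rfl
    refine ⟨⟨⟨t', ht'⟩, ⟨_, k, hkc, rfl⟩, O⟩, Subtype.ext ?_⟩
    change orbChart O '' Set.range k = Set.range j
    rw [← Set.range_comp]
    congr 1
    funext b
    exact hk b

theorem core_comp_subset (σ : Fin m → Fin n) (f : Fin n → Equiv.Perm E) (Z : Prop) :
    core Z (fun i => f (σ i)) ⊆ core Z f := fun _ hx hZ => (hx hZ).imp' σ fun _ h => h

theorem Fits.comp (hf : Fits lam μ f) (σ : Fin m → Fin n) : Fits lam μ (fun i => f (σ i)) where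
  lt := (mk_le_mk_of_subset (core_comp_subset σ f _)).trans_lt hf.lt
  eq h := by
    have hZ : ¬ lam ≤ μ := by rw [h]; exact not_le.2 (Order.lt_succ μ)
    rw [core_of_not hZ, ← core_of_not hZ f]
    exact hf.eq h

theorem tyPre_proj (hf : Fits lam μ f) (σ : Fin m → Fin n) :
    (tyPre f hf).proj σ = tyPre (fun i => f (σ i)) (hf.comp σ) :=
  PreF.ext_val (funext fun t => (orbs_comp_le σ f (lam ≤ μ) t.1 t.2).symm)

/-- The disjoint union of `h t` copies of each `A_t` has the prescribed numbers of orbits. All types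
in it are admissible, so the core is everything. -/
theorem exists_tuple (h : PreF lam μ n) : ∃ (Y : Type u) (f : Fin n → Equiv.Perm Y)
    (hf : Fits lam μ f), #Y = #(core (lam ≤ μ) f) ∧ core (lam ≤ μ) f = Set.univ ∧
      tyPre f hf = h := by
  let Y : Type u := Σ t : IS lam μ n, (h.val t).out × t.1.pts
  let f : Fin n → Equiv.Perm Y := fun i => Equiv.sigmaCongrRight fun t =>
    Equiv.prodCongr (Equiv.refl _) (t.1.rep.gen i)
  have hch : ∀ (t : IS lam μ n) (x : (h.val t).out), IsChart f t.1 (fun a => (⟨t, x, a⟩ : Y)) := by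
    intro t x
    refine ⟨fun a b hab => ?_, fun i a => rfl⟩
    have hab : (⟨t, x, a⟩ : Y) = ⟨t, x, b⟩ := hab
    simp only [Sigma.mk.injEq, heq_eq_eq, Prod.mk.injEq, true_and] at hab
    exact hab
  have hcore : core (lam ≤ μ) f = Set.univ := by
    refine Set.eq_univ_of_forall ?_
    rintro ⟨t, x, a⟩
    exact (IsChart.mem_core_iff (hch t x) a).2 t.2
  have hval : ∀ t : IS lam μ n, #(orbs f t.1) = h.val t := by
    intro t
    rw [← mk_out (h.val t)]
    obtain ⟨a₀⟩ : Nonempty t.1.pts := t.1.rep.nonempty.to_subtype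
    refine (mk_congr (Equiv.ofBijective (fun x => ⟨_, _, hch t x, rfl⟩) ⟨?_, ?_⟩)).symm
    · intro x y hxy
      have hxy : Set.range (fun a => (⟨t, x, a⟩ : Y)) = Set.range (fun a => (⟨t, y, a⟩ : Y)) :=
        Subtype.ext_iff.1 hxy
      obtain ⟨b, hb⟩ : (⟨t, x, a₀⟩ : Y) ∈ Set.range (fun a => (⟨t, y, a⟩ : Y)) := hxy ▸ ⟨a₀, rfl⟩
      simp only [Sigma.mk.injEq, heq_eq_eq, Prod.mk.injEq, true_and] at hb
      exact hb.1.symm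
    · rintro ⟨_, j, hj, rfl⟩
      rcases hz : j a₀ with ⟨s, x, a⟩
      have hts : t.1 = s.1 := hj.type_eq (hch s x) (a := a₀) (b := a) hz
      have hts : t = s := Subtype.ext hts
      subst hts
      refine ⟨x, Subtype.ext ?_⟩
      change Set.range _ = Set.range j
      rw [(hch t x).range_eq_orb a, hj.range_eq_orb a₀, hz]
  have hY : #(core (lam ≤ μ) f) = Cardinal.sum fun t => t.1.deg * h.val t := by
    rw [mk_core]
    congr 1
    funext t
    rw [hval t]
  have hf : Fits lam μ f := ⟨hY.trans_lt h.total_lt, fun hl => hY.trans (h.total_eq hl)⟩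
  exact ⟨Y, f, hf, by rw [hcore, mk_univ], hcore, PreF.ext_val (funext hval)⟩

theorem FSort.mk_eq_iff (hκ : ℵ₀ ≤ κ) {h h' : PreF lam μ n} :
    (Quot.mk _ h : FSort κ lam μ n) = Quot.mk _ h' ↔ PreF.E κ h h' :=
  (PreF.E_equivalence hκ).quot_mk_eq_iff h h'

/-- As `q t` is a subset of `A_t`, a change of the representative changes the sum by at most the sum
that defines E, which is below `κ`. So the existential quantifier over representatives in
`FSort.IsEq` and `FSort.IsProd` may be tested on any one of them. -/
theorem exists_sum_lt_iff (hκ : ℵ₀ ≤ κ) (h : PreF lam μ n) (q : ∀ t : OrbitType n, Set t.pts) :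
    (∃ h' : PreF lam μ n, (Quot.mk _ h' : FSort κ lam μ n) = Quot.mk _ h ∧
      (Cardinal.sum fun t : IS lam μ n => lift.{u} #(q t.1) * h'.val t) < κ) ↔
      (Cardinal.sum fun t : IS lam μ n => lift.{u} #(q t.1) * h.val t) < κ := by
  constructor
  · rintro ⟨h', hh, hs⟩
    rw [FSort.mk_eq_iff hκ] at hh
    refine lt_of_le_of_lt ?_ (add_lt_of_lt hκ hs hh)
    rw [← sum_add_distrib']
    refine sum_le_sum _ _ fun t => ?_
    have h1 := (cardDist_le_iff.1 (le_refl (cardDist (h'.val t) (h.val t)))).2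
    refine (mul_le_mul_right h1 _).trans ?_
    rw [mul_add]
    refine add_le_add le_rfl (mul_le_mul_left ?_ _)
    exact lift_le.2 (mk_set_le _)
  · exact fun hs => ⟨h, rfl, hs⟩

theorem isEq_tyPre_iff (hκ : ℵ₀ ≤ κ) {f : Fin 2 → Equiv.Perm E} (hf : Fits lam μ f) :
    FSort.IsEq (Quot.mk _ (tyPre f hf) : FSort κ lam μ 2) ↔ #{x | f 0 x ≠ f 1 x} < κ := by
  have h := mk_orbit_points f (fun t => lam ≤ μ → ¬ t.IsTrivial)
    (fun _ => Set.univ) (fun t => {a | t.rep.gen 0 a ≠ t.rep.gen 1 a})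
  simp only [mk_univ] at h
  refine (exists_sum_lt_iff hκ (tyPre f hf) fun t => {a | t.rep.gen 0 a ≠ t.rep.gen 1 a}).trans ?_
  have hset : {x | f 0 x ≠ f 1 x} = {x | ∃ t : OrbitType 2, (lam ≤ μ → ¬ t.IsTrivial) ∧
      ∃ O ∈ (Set.univ : Set (orbs f t)), ∃ a ∈ {a | t.rep.gen 0 a ≠ t.rep.gen 1 a},
        orbChart O a = x} := by
    ext x
    constructor
    · intro hx
      obtain ⟨t, O, a, rfl⟩ := exists_orbChart f x
      have ha : t.rep.gen 0 a ≠ t.rep.gen 1 a := fun h => hx (by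
        rw [← (orbChart_spec O).map, ← (orbChart_spec O).map, h])
      exact ⟨t, fun _ htr => ha (by rw [htr 0, htr 1]), O, trivial, a, ha, rfl⟩
    · rintro ⟨t, -, O, -, a, ha, rfl⟩ h
      rw [← (orbChart_spec O).map, ← (orbChart_spec O).map] at h
      exact ha ((orbChart_spec O).inj h)
  rw [hset, h]
  exact Iff.rfl

theorem isProd_tyPre_iff (hκ : ℵ₀ ≤ κ) {f : Fin 3 → Equiv.Perm E} (hf : Fits lam μ f) :
    FSort.IsProd (Quot.mk _ (tyPre f hf) : FSort κ lam μ 3) ↔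
      #{x | f 1 (f 0 x) ≠ f 2 x} < κ := by
  have h := mk_orbit_points f (fun t => lam ≤ μ → ¬ t.IsTrivial)
    (fun _ => Set.univ) (fun t => {a | t.rep.gen 1 (t.rep.gen 0 a) ≠ t.rep.gen 2 a})
  simp only [mk_univ] at h
  refine (exists_sum_lt_iff hκ (tyPre f hf)
    fun t => {a | t.rep.gen 1 (t.rep.gen 0 a) ≠ t.rep.gen 2 a}).trans ?_
  have hset : {x | f 1 (f 0 x) ≠ f 2 x} = {x | ∃ t : OrbitType 3, (lam ≤ μ → ¬ t.IsTrivial) ∧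
      ∃ O ∈ (Set.univ : Set (orbs f t)), ∃ a ∈ {a | t.rep.gen 1 (t.rep.gen 0 a) ≠ t.rep.gen 2 a},
        orbChart O a = x} := by
    ext x
    constructor
    · intro hx
      obtain ⟨t, O, a, rfl⟩ := exists_orbChart f x
      have ha : t.rep.gen 1 (t.rep.gen 0 a) ≠ t.rep.gen 2 a := fun h => hx (by
        rw [← (orbChart_spec O).map, ← (orbChart_spec O).map, ← (orbChart_spec O).map, h])
      exact ⟨t, fun _ htr => ha (by rw [htr 0, htr 1, htr 2]; rfl), O, trivial, a, ha, rfl⟩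
    · rintro ⟨t, -, O, -, a, ha, rfl⟩ h
      rw [← (orbChart_spec O).map, ← (orbChart_spec O).map, ← (orbChart_spec O).map] at h
      exact ha ((orbChart_spec O).inj h)
  rw [hset, h]
  exact Iff.rfl

/-- A difference below `κ` is absorbed by a value that is at least `κ`. Used in both directions,
this makes `FSort.app` independent of the representative. -/
theorem PreF.E.le_val (hκ : ℵ₀ ≤ κ) {h h' : PreF lam μ n} (H : PreF.E κ h h') {t : IS lam μ n}
    (ht : κ ≤ h.val t) : h.val t ≤ h'.val t := by
  have hd : cardDist (h.val t) (h'.val t) < κ := by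
    refine lt_of_le_of_lt ?_ H
    refine le_trans ?_ (le_sum _ t)
    exact le_mul_of_one_le_left zero_le (OrbitType.one_le_deg _)
  have h1 := (cardDist_le_iff.1 (le_refl (cardDist (h.val t) (h'.val t)))).1
  have h2 : κ ≤ h'.val t := by
    by_contra hlt
    exact absurd (ht.trans h1) (not_le.2 (add_lt_of_lt hκ (not_le.1 hlt) hd))
  rwa [add_eq_left (hκ.trans h2) (hd.le.trans h2)] at h1

theorem FSort.app_mk (hκ : ℵ₀ ≤ κ) (h : PreF lam μ n) (t : IS lam μ n) :
    ((FSort.app (Quot.mk _ h : FSort κ lam μ n) t).1 = h.val t ∧ κ ≤ h.val t) ∨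
      ((FSort.app (Quot.mk _ h : FSort κ lam μ n) t).1 = 0 ∧ h.val t < κ) := by
  have H : PreF.E κ (Quot.out (Quot.mk _ h : FSort κ lam μ n)) h :=
    (FSort.mk_eq_iff hκ).1 (Quot.out_eq _)
  have H' := (PreF.E_equivalence hκ).symm H
  by_cases h1 : κ ≤ (Quot.out (Quot.mk _ h : FSort κ lam μ n)).val t
  · rw [show FSort.app (Quot.mk _ h : FSort κ lam μ n) t = _ from dif_pos h1]
    have h2 := H.le_val hκ h1
    exact Or.inl ⟨h2.antisymm (H'.le_val hκ (h1.trans h2)), h1.trans h2⟩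
  · rw [show FSort.app (Quot.mk _ h : FSort κ lam μ n) t = _ from dif_neg h1]
    refine Or.inr ⟨rfl, ?_⟩
    by_contra h3
    exact h1 ((not_lt.1 h3).trans (H'.le_val hκ (not_lt.1 h3)))

end TupleType

/-! ### The groups attached to a triple of cardinals -/

/-- A triple of cardinals `κ < lam ≤ μ⁺`, `κ` infinite. -/
structure Par where
  κ : Cardinal.{u}
  lam : Cardinal.{u}
  μ : Cardinal.{u}
  hκ : ℵ₀ ≤ κ
  hlam : κ < lam
  hμ : lam ≤ Order.succ μ

namespace Par

variable (P : Par.{u})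

/-- The set permuted. -/
abbrev X : Type u := P.μ.out

/-- The group of the permutations with support less than `lam`. -/
abbrev S : Subgroup (Equiv.Perm P.X) := supportLT P.μ.out P.lam (P.hκ.trans P.hlam.le)

/-- The quotient group. -/
abbrev G : Type u := symQuot P.κ P.lam P.μ P.hκ P.hlam

/-- The quotient map. -/
def q : P.S →* P.G := QuotientGroup.mk' _

theorem q_surjective : Function.Surjective P.q := QuotientGroup.mk'_surjective _

/-- A set is small if it has fewer than `κ` elements. -/
def Sm (A : Set P.X) : Prop := #A < P.κ

/-- Two permutations agree outside a small set. -/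
def Near (f g : Equiv.Perm P.X) : Prop := P.Sm {x | f x ≠ g x}

variable {P}

theorem Sm.mono {A B : Set P.X} (hB : P.Sm B) (h : A ⊆ B) : P.Sm A :=
  (mk_le_mk_of_subset h).trans_lt hB

theorem Sm.union {A B : Set P.X} (hA : P.Sm A) (hB : P.Sm B) : P.Sm (A ∪ B) :=
  (mk_union_le _ _).trans_lt (add_lt_of_lt P.hκ hA hB)

theorem Sm.of_subset_union {A B C : Set P.X} (hB : P.Sm B) (hC : P.Sm C) (h : A ⊆ B ∪ C) :
    P.Sm A := (hB.union hC).mono h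

theorem Sm.image {A : Set P.X} (hA : P.Sm A) (f : P.X → P.X) : P.Sm (f '' A) :=
  mk_image_le.trans_lt hA

theorem Sm.preimage {A : Set P.X} (hA : P.Sm A) (f : Equiv.Perm P.X) : P.Sm (f ⁻¹' A) := by
  rw [← Equiv.image_symm_eq_preimage]; exact hA.image _

theorem Sm.empty : P.Sm ∅ := by
  rw [Sm, mk_eq_zero]; exact aleph0_pos.trans_le P.hκ

theorem Sm.iUnion_fin {n : ℕ} {A : Fin n → Set P.X} (h : ∀ i, P.Sm (A i)) :
    P.Sm (⋃ i, A i) := by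
  induction n with
  | zero => simpa using Sm.empty
  | succ n ih =>
    refine ((ih fun i => h i.succ).union (h 0)).mono ?_
    intro x hx
    obtain ⟨i, hi⟩ := Set.mem_iUnion.1 hx
    rcases Fin.eq_zero_or_eq_succ i with rfl | ⟨j, rfl⟩
    · exact Or.inr hi
    · exact Or.inl (Set.mem_iUnion.2 ⟨j, hi⟩)

theorem q_eq_iff {f g : P.S} : P.q f = P.q g ↔ P.Near f g := by
  refine (QuotientGroup.eq (s := (supportLT P.X P.κ P.hκ).subgroupOf P.S)).trans ?_
  rw [Subgroup.mem_subgroupOf]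
  change #{x | ((f : Equiv.Perm P.X)⁻¹ * g) x ≠ x} < P.κ ↔ #_ < P.κ
  have : {x | ((f : Equiv.Perm P.X)⁻¹ * g) x ≠ x} = {x | (f : Equiv.Perm P.X) x ≠ g.1 x} := by
    ext x
    refine not_congr ?_
    rw [Equiv.Perm.mul_apply, Equiv.Perm.inv_eq_iff_eq, eq_comm]
  rw [this]

theorem mem_S {g : Equiv.Perm P.X} : g ∈ P.S ↔ #{x | g x ≠ x} < P.lam := Iff.rfl

theorem aleph0_lt_lam : ℵ₀ < P.lam := P.hκ.trans_lt P.hlam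

theorem kappa_le_mu : P.κ ≤ P.μ := Order.lt_succ_iff.1 (P.hlam.trans_le P.hμ)

theorem aleph0_le_mu : ℵ₀ ≤ P.μ := P.hκ.trans kappa_le_mu

theorem mk_X : #P.X = P.μ := mk_out _

theorem mk_le_mu {α : Type u} (h : #α < P.lam) : #α ≤ P.μ := Order.lt_succ_iff.1 (h.trans_le P.hμ)

instance : Infinite P.X := by rw [infinite_iff, mk_X]; exact aleph0_le_mu

theorem lam_eq (h : ¬ P.lam ≤ P.μ) : P.lam = Order.succ P.μ :=
  P.hμ.antisymm (Order.succ_le_of_lt (not_le.1 h))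

theorem mk_lt_of_not (h : ¬ P.lam ≤ P.μ) (A : Set P.X) : #A < P.lam := by
  refine lt_of_le_of_lt (mk_set_le A) ?_
  rw [mk_X]; exact not_le.1 h

theorem lt_lam_union {A B : Set P.X} (hA : #A < P.lam) (hB : #B < P.lam) :
    #(A ∪ B : Set P.X) < P.lam :=
  (mk_union_le _ _).trans_lt (add_lt_of_lt aleph0_lt_lam.le hA hB)

/-- A bijection between two subsets of `Y` whose complements in `Y` are equinumerous extends to a
permutation of `Y`; continued by the identity it has support inside `Y`, which puts it into `P.S`.
-/
theorem exists_perm_of_subset {I : Type u} {Y : Set P.X} (hY : #Y < P.lam) {i i' : I → P.X}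
    (hi : Function.Injective i) (hi' : Function.Injective i') (hr : Set.range i ⊆ Y)
    (hr' : Set.range i' ⊆ Y) (hc : #(Y \ Set.range i : Set P.X) = #(Y \ Set.range i' : Set P.X)) :
    ∃ g : P.S, (∀ a, g.1 (i a) = i' a) ∧ ∀ x ∉ Y, g.1 x = x := by
  classical
  let k : I → Y := fun a => ⟨i a, hr ⟨a, rfl⟩⟩
  let k' : I → Y := fun a => ⟨i' a, hr' ⟨a, rfl⟩⟩
  have hk : Function.Injective k := fun a b h => hi (Subtype.ext_iff.1 h)
  have hk' : Function.Injective k' := fun a b h => hi' (Subtype.ext_iff.1 h)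
  let φ : Set.range k ↪ Y :=
    ⟨k' ∘ (Equiv.ofInjective k hk).symm, hk'.comp (Equiv.injective _)⟩
  have hφ : Set.range φ = Set.range k' := by
    change Set.range (k' ∘ (Equiv.ofInjective k hk).symm) = _
    rw [Set.range_comp, Equiv.range_eq_univ, Set.image_univ]
  have hcompl : ∀ j : I → P.X, ∀ hj : Set.range j ⊆ Y,
      #((Set.range fun a => (⟨j a, hj ⟨a, rfl⟩⟩ : Y))ᶜ : Set Y) =
        #(Y \ Set.range j : Set P.X) := by
    intro j hj
    rw [← mk_image_eq (f := (Subtype.val : Y → P.X)) (Subtype.val_injective)]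
    congr 2
    ext x
    simp only [Set.mem_image, Set.mem_compl_iff, Set.mem_range, Set.mem_sdiff]
    constructor
    · rintro ⟨y, hy, rfl⟩
      exact ⟨y.2, fun ⟨a, ha⟩ => hy ⟨a, Subtype.ext ha⟩⟩
    · rintro ⟨hx, hx'⟩
      exact ⟨⟨x, hx⟩, fun ⟨a, ha⟩ => hx' ⟨a, Subtype.ext_iff.1 ha⟩, rfl⟩
  obtain ⟨h, hh⟩ := extend_function φ (Cardinal.eq.1 (by
    rw [hφ, hcompl i hr, hc, ← hcompl i' hr']))
  refine ⟨⟨Equiv.Perm.ofSubtype h, ?_⟩, fun a => ?_,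
    fun x hx => Equiv.Perm.ofSubtype_apply_of_not_mem h hx⟩
  · refine lt_of_le_of_lt (mk_le_mk_of_subset ?_) hY
    intro x hx
    by_contra hxY
    exact hx (Equiv.Perm.ofSubtype_apply_of_not_mem h hxY)
  · change Equiv.Perm.ofSubtype h (i a) = i' a
    rw [Equiv.Perm.ofSubtype_apply_of_mem h (hr ⟨a, rfl⟩)]
    have h1 := hh ⟨k a, a, rfl⟩
    have h2 : (Equiv.ofInjective k hk).symm ⟨k a, a, rfl⟩ = a :=
      Equiv.ofInjective_symm_apply hk a
    change h (k a) = k' ((Equiv.ofInjective k hk).symm ⟨k a, a, rfl⟩) at h1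
    rw [h2] at h1
    exact congrArg Subtype.val h1

theorem mk_compl_eq_of_le {I : Type u} {i : I → P.X} (hi : Function.Injective i)
    (h : #I ≤ #((Set.range i)ᶜ : Set P.X)) : #((Set.range i)ᶜ : Set P.X) = P.μ := by
  have h1 := mk_sum_compl (Set.range i)
  rw [mk_range_eq i hi, mk_X] at h1
  rcases lt_or_ge #((Set.range i)ᶜ : Set P.X) ℵ₀ with h2 | h2
  · exact absurd (aleph0_le_mu.trans h1.symm.le) (not_le.2 (add_lt_aleph0 (h.trans_lt h2) h2))
  · rwa [add_eq_right h2 h] at h1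

/-- Adjoining `θ` further points outside both ranges makes both relative complements have exactly
`θ` elements. -/
theorem exists_subset_compl_eq {I : Type u} (i i' : I → P.X) {θ : Cardinal.{u}}
    (hθ : ℵ₀ ≤ θ) (hI : #I ≤ θ) (hRc : θ ≤ #((Set.range i ∪ Set.range i')ᶜ : Set P.X)) :
    ∃ Y : Set P.X, Set.range i ⊆ Y ∧ Set.range i' ⊆ Y ∧ #Y ≤ θ ∧
      #(Y \ Set.range i : Set P.X) = #(Y \ Set.range i' : Set P.X) := by
  set R := Set.range i ∪ Set.range i' with hR
  obtain ⟨Q, hQ, hQθ⟩ := le_mk_iff_exists_subset.1 hRc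
  have aux : ∀ j j' : I → P.X, Set.range j ∪ Set.range j' = R →
      #((R ∪ Q : Set P.X) \ Set.range j : Set P.X) = θ := by
    intro j j' hj
    refine le_antisymm ?_ ?_
    · refine (mk_le_mk_of_subset (t := Set.range j' ∪ Q) ?_).trans
        ((mk_union_le _ _).trans ?_)
      · rintro x ⟨hx | hx, hx'⟩
        · rw [← hj] at hx
          exact Or.inl (hx.resolve_left hx')
        · exact Or.inr hx
      · rw [hQθ]
        exact (add_le_add (mk_range_le.trans hI) le_rfl).trans (add_eq_self hθ).le
    · rw [← hQθ]
      exact mk_le_mk_of_subset fun x hx => ⟨Or.inr hx, fun h => hQ hx (hj ▸ Or.inl h)⟩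
  refine ⟨R ∪ Q, fun x hx => Or.inl (Or.inl hx), fun x hx => Or.inl (Or.inr hx), ?_,
    (aux i i' rfl).trans (aux i' i (by rw [Set.union_comm])).symm⟩
  refine (mk_union_le _ _).trans ?_
  rw [hQθ]
  refine (add_le_add ((mk_union_le _ _).trans (add_le_add (mk_range_le.trans hI)
    (mk_range_le.trans hI))) le_rfl).trans ?_
  rw [add_eq_self hθ, add_eq_self hθ]

theorem exists_perm_of_injective {I : Type u} (hI : #I < P.lam) {i i' : I → P.X}
    (hi : Function.Injective i) (hi' : Function.Injective i')
    (hc : #I ≤ #((Set.range i)ᶜ : Set P.X)) (hc' : #I ≤ #((Set.range i')ᶜ : Set P.X)) :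
    ∃ g : P.S, ∀ a, g.1 (i a) = i' a := by
  by_cases hl : P.lam ≤ P.μ
  · have hRl : #(Set.range i ∪ Set.range i' : Set P.X) < P.lam :=
      lt_lam_union (mk_range_le.trans_lt hI) (mk_range_le.trans_lt hI)
    have hRc : #((Set.range i ∪ Set.range i')ᶜ : Set P.X) = P.μ := by
      rw [mk_compl_of_infinite _ (by rw [mk_X]; exact hRl.trans_le hl), mk_X]
    have hθl : max ℵ₀ #I < P.lam := max_lt aleph0_lt_lam hI
    obtain ⟨Y, h1, h2, h3, h4⟩ := exists_subset_compl_eq i i' (le_max_left ℵ₀ #I)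
      (le_max_right _ _) ((hθl.le.trans hl).trans hRc.symm.le)
    obtain ⟨g, hg, -⟩ := exists_perm_of_subset (h3.trans_lt hθl) hi hi' h1 h2 h4
    exact ⟨g, hg⟩
  · refine (exists_perm_of_subset (Y := Set.univ) (mk_lt_of_not hl _) hi hi'
      (Set.subset_univ _) (Set.subset_univ _) ?_).imp fun _ h => h.1
    rw [← Set.compl_eq_univ_sdiff, ← Set.compl_eq_univ_sdiff, mk_compl_eq_of_le hi hc,
      mk_compl_eq_of_le hi' hc']

/-- For finite `I` the union of the two ranges can serve as the support: both complements in it have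
the same size, by cancellation of the finite cardinal `#I`. For infinite `I` one pads with `#I`
further points, which keeps the support below `κ`. -/
theorem exists_small_perm {I : Type u} (hI : #I < P.κ) {i i' : I → P.X}
    (hi : Function.Injective i) (hi' : Function.Injective i') :
    ∃ g : P.S, (∀ a, g.1 (i a) = i' a) ∧ P.Sm {x | g.1 x ≠ x} := by
  obtain ⟨Y, h1, h2, h3, h4⟩ : ∃ Y : Set P.X, Set.range i ⊆ Y ∧ Set.range i' ⊆ Y ∧ P.Sm Y ∧
      #(Y \ Set.range i : Set P.X) = #(Y \ Set.range i' : Set P.X) := by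
    have hR : P.Sm (Set.range i ∪ Set.range i') :=
      Sm.union (mk_range_le.trans_lt hI) (mk_range_le.trans_lt hI)
    rcases lt_or_ge #I ℵ₀ with h | h
    · refine ⟨_, Set.subset_union_left, Set.subset_union_right, hR, ?_⟩
      refine (Cardinal.add_right_inj_of_lt_aleph0 h).1 ?_
      have e1 := mk_sdiff_add_mk (Set.subset_union_left (s := Set.range i) (t := Set.range i'))
      have e2 := mk_sdiff_add_mk (Set.subset_union_right (s := Set.range i) (t := Set.range i'))
      rw [mk_range_eq i hi] at e1
      rw [mk_range_eq i' hi'] at e2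
      exact e1.trans e2.symm
    · obtain ⟨Y, h1, h2, h3, h4⟩ := exists_subset_compl_eq i i' h le_rfl (by
        rw [mk_compl_of_infinite _ (by rw [mk_X]; exact hR.trans_le kappa_le_mu), mk_X]
        exact hI.le.trans kappa_le_mu)
      exact ⟨Y, h1, h2, h3.trans_lt hI, h4⟩
  obtain ⟨g, hg, hg'⟩ := exists_perm_of_subset (lt_trans h3 P.hlam) hi hi' h1 h2 h4
  exact ⟨g, hg, h3.mono fun x hx => by_contra fun h => hx (hg' x h)⟩

theorem viaEmbedding_mem {Y : Type u} (hY : #Y < P.lam) (e : Equiv.Perm Y) (ι : Y ↪ P.X) :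
    e.viaEmbedding ι ∈ P.S := by
  refine lt_of_le_of_lt (mk_le_mk_of_subset (t := Set.range ι) ?_) (mk_range_le.trans_lt hY)
  intro x hx
  by_contra h
  exact hx (e.viaEmbedding_apply_of_notMem ι x h)

/-- Fixed-point-free permutations of a finite set give permutations with prescribed infinite
support. -/
theorem exists_perm_support {A : Set P.X} (hA : #A < P.lam) (hA' : ℵ₀ ≤ #A) {k : ℕ} (hk : 0 < k)
    (ρ : Equiv.Perm (Fin k)) (hρ : ∀ i, ρ i ≠ i) : ∃ g : P.S, {x | g.1 x ≠ x} = A ∧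
      ∀ l, (∀ i, ρ^[l] i = i) → ∀ x, g.1^[l] x = x := by
  -- An infinite `A` splits into blocks of `k` points; `ρ` acts on each block.
  obtain ⟨e⟩ : Nonempty (A × Fin k ≃ A) := by
    rw [← Cardinal.eq, mk_prod]
    simp only [lift_uzero, mk_fin, lift_natCast]
    exact mul_eq_left hA' ((natCast_lt_aleph0).le.trans hA') (by exact_mod_cast hk.ne')
  let ι : A × Fin k ↪ P.X := e.toEmbedding.trans (Function.Embedding.subtype _)
  have hr : Set.range ι = A := by
    ext x
    constructor
    · rintro ⟨z, rfl⟩; exact (e z).2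
    · intro hx; exact ⟨e.symm ⟨x, hx⟩, by simp [ι]⟩
  let r : Equiv.Perm (A × Fin k) := Equiv.prodCongr (Equiv.refl _) ρ
  have hg : ∀ z, r.viaEmbedding ι (ι z) = ι (z.1, ρ z.2) := fun z => r.viaEmbedding_apply ι z
  refine ⟨⟨r.viaEmbedding ι, viaEmbedding_mem ((mk_congr e).trans_lt hA) r ι⟩, ?_, ?_⟩
  · ext x
    constructor
    · intro hx
      rw [← hr]
      by_contra h
      exact hx (r.viaEmbedding_apply_of_notMem ι x h)
    · intro hx
      rw [← hr] at hx
      obtain ⟨z, rfl⟩ := hx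
      change r.viaEmbedding ι (ι z) ≠ _
      rw [hg]
      intro h
      exact hρ z.2 (congrArg Prod.snd (ι.injective h))
  · intro l hl x
    change (r.viaEmbedding ι)^[l] x = x
    by_cases hx : x ∈ Set.range ι
    · obtain ⟨z, rfl⟩ := hx
      have : ∀ l, (r.viaEmbedding ι)^[l] (ι z) = ι (z.1, ρ^[l] z.2) := by
        intro l
        induction l with
        | zero => rfl
        | succ l ih => rw [Function.iterate_succ_apply', ih, hg, Function.iterate_succ_apply']
      rw [this, hl]
    · exact Function.iterate_fixed (r.viaEmbedding_apply_of_notMem ι x hx) l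

theorem exists_involution {A : Set P.X} (hA : #A < P.lam) (hA' : ℵ₀ ≤ #A) :
    ∃ g : P.S, {x | g.1 x ≠ x} = A ∧ ∀ x, g.1 (g.1 x) = x := by
  obtain ⟨g, h, h'⟩ := exists_perm_support hA hA' two_pos (finRotate 2) (by decide)
  exact ⟨g, h, h' 2 (by decide)⟩

theorem exists_order_three {A : Set P.X} (hA : #A < P.lam) (hA' : ℵ₀ ≤ #A) :
    ∃ g : P.S, {x | g.1 x ≠ x} = A ∧ ∀ x, g.1 (g.1 (g.1 x)) = x := by
  obtain ⟨g, h, h'⟩ := exists_perm_support hA hA' three_pos (finRotate 3) (by decide)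
  exact ⟨g, h, h' 3 (by decide)⟩

/-! ### Tuples of elements of the group -/

variable {n : ℕ}

theorem core_fin_lt (f : Fin n → P.S) :
    #(core (P.lam ≤ P.μ) fun i => (f i : Equiv.Perm P.X)) < P.lam := by
  by_cases hl : P.lam ≤ P.μ
  · have key : ∀ (n : ℕ) (f : Fin n → P.S), #{x | ∃ i, (f i).1 x ≠ x} < P.lam := by
      intro n
      induction n with
      | zero => intro f; simpa using aleph0_pos.trans aleph0_lt_lam
      | succ n ih =>
        intro f
        refine lt_of_le_of_lt (mk_le_mk_of_subset ?_)
          (lt_lam_union (f 0).2 (ih fun i => f i.succ))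
        rintro x ⟨i, hi⟩
        rcases Fin.eq_zero_or_eq_succ i with rfl | ⟨j, rfl⟩
        · exact Or.inl hi
        · exact Or.inr ⟨j, hi⟩
    refine lt_of_le_of_lt (mk_le_mk_of_subset ?_) (key n f)
    exact fun x hx => hx hl
  · exact mk_lt_of_not hl _

theorem fits (f : Fin n → P.S) : Fits P.lam P.μ fun i => (f i : Equiv.Perm P.X) :=
  ⟨core_fin_lt f, fun h => by
    rw [core_of_not (by rw [h]; exact not_le.2 (Order.lt_succ _)), mk_univ, mk_X]⟩

/-- The function counting the orbits of a tuple of elements of the group by their types. -/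
def ty (f : Fin n → P.S) : PreF P.lam P.μ n := tyPre _ (fits f)

/-- The tuple given by `exists_tuple` is carried into `P.X` along an injection. If `lam ≤ μ`, the
additional points are fixed and do not count. Otherwise its set has exactly `μ` elements, and the
injection can be taken bijective. -/
theorem exists_ty_eq (h : PreF P.lam P.μ n) : ∃ f : Fin n → P.S, ty f = h := by
  obtain ⟨Y, f, hf, hY, hc, rfl⟩ := exists_tuple h
  have hYl : #Y < P.lam := hY.trans_lt hf.lt
  obtain ⟨ι, hι⟩ : ∃ ι : Y ↪ P.X, ¬ P.lam ≤ P.μ → Set.range ι = Set.univ := by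
    by_cases hl : P.lam ≤ P.μ
    · have : #Y ≤ #P.X := by rw [mk_X]; exact mk_le_mu hYl
      exact ⟨this.some, fun h => absurd hl h⟩
    · have : #Y = #P.X := by rw [mk_X, hY, hf.eq (lam_eq hl)]
      obtain ⟨e⟩ := Cardinal.eq.1 this
      exact ⟨e.toEmbedding, fun _ => e.range_eq_univ⟩
  let F : Fin n → P.S := fun i => ⟨(f i).viaEmbedding ι, viaEmbedding_mem hYl _ ι⟩
  have hF : ∀ i y, (F i).1 (ι y) = ι (f i y) := fun i y => (f i).viaEmbedding_apply ι y
  refine ⟨F, (PIso.tyPre_eq (L := fun y x => ι y = x) ⟨?_, ?_, ?_⟩ hf (fits F) ?_ ?_).symm⟩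
  · exact fun h h' => h.symm.trans h'
  · exact fun h h' => ι.injective (h.trans h'.symm)
  · intro i x y
    rw [← hF]
    exact (F i).1.injective.eq_iff
  · exact fun x _ => ⟨_, rfl⟩
  · intro x hx
    by_contra hxr
    have hxr : x ∉ Set.range ι := hxr
    by_cases hl : P.lam ≤ P.μ
    · obtain ⟨i, hi⟩ := hx hl
      exact hi ((f i).viaEmbedding_apply_of_notMem ι x hxr)
    · exact hxr (hι hl ▸ Set.mem_univ x)

end Par

namespace Par

variable {P : Par.{u}} {n : ℕ}

/-! ### Automorphisms induced by bijections between complements of small sets -/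

/-- Transport along an injection with small co-image, as an endomorphism of the quotient. -/
theorem exists_aut_of_injective (ι : P.X ↪ P.X) (hι : P.Sm (Set.range ι)ᶜ) :
    ∃ θ : P.G ≃* P.G, ∀ f g : P.S, P.Sm {x | g.1 (ι x) ≠ ι (f.1 x)} → θ (P.q f) = P.q g := by
  have hmem : ∀ f : P.S, f.1.viaEmbedding ι ∈ P.S := by
    intro f
    refine lt_of_le_of_lt (mk_le_mk_of_subset (t := ι '' {x | f.1 x ≠ x}) ?_)
      (mk_image_le.trans_lt f.2)
    intro x hx
    by_cases hxr : x ∈ Set.range ι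
    · obtain ⟨y, rfl⟩ := hxr
      refine ⟨y, fun h => hx ?_, rfl⟩
      exact (f.1.viaEmbedding_apply ι y).trans (congrArg ι h)
    · exact absurd (f.1.viaEmbedding_apply_of_notMem ι x hxr) hx
  let ψ : P.S →* P.S :=
    ((Equiv.Perm.viaEmbeddingHom ι).comp P.S.subtype).codRestrict P.S hmem
  have hψ : ∀ (f : P.S) x, (ψ f).1 (ι x) = ι (f.1 x) := fun f x => f.1.viaEmbedding_apply ι x
  have hψ' : ∀ (f : P.S) x, x ∉ Set.range ι → (ψ f).1 x = x :=
    fun f x hx => f.1.viaEmbedding_apply_of_notMem ι x hx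
  have hnear : ∀ f g : P.S, P.Near (ψ f) (ψ g) ↔ P.Near f g := by
    intro f g
    have hs : {x | (ψ f).1 x ≠ (ψ g).1 x} = ι '' {x | f.1 x ≠ g.1 x} := by
      ext x
      by_cases hxr : x ∈ Set.range ι
      · obtain ⟨y, rfl⟩ := hxr
        simp only [Set.mem_ofPred_eq, hψ, ι.injective.mem_set_image, ι.injective.ne_iff]
      · simp only [Set.mem_ofPred_eq, hψ' f x hxr, hψ' g x hxr, ne_eq, not_true_eq_false,
          false_iff]
        rintro ⟨y, -, rfl⟩
        exact hxr ⟨y, rfl⟩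
    unfold Near Sm
    rw [hs, mk_image_eq ι.injective]
  let Θ : P.G →* P.G := QuotientGroup.lift _ (P.q.comp ψ) (by
    intro f hf
    have h1 : P.q f = P.q 1 := by
      rw [map_one]
      exact (QuotientGroup.eq_one_iff f).2 hf
    rw [q_eq_iff, ← hnear, map_one, ← q_eq_iff, map_one] at h1
    exact h1)
  have hΘ : ∀ f, Θ (P.q f) = P.q (ψ f) := fun f => rfl
  have hinj : Function.Injective Θ := by
    intro a b hab
    obtain ⟨f, rfl⟩ := P.q_surjective a
    obtain ⟨g, rfl⟩ := P.q_surjective b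
    rw [hΘ, hΘ, q_eq_iff, hnear, ← q_eq_iff] at hab
    exact hab
  have hsurj : Function.Surjective Θ := by
    intro b
    obtain ⟨z, rfl⟩ := P.q_surjective b
    -- For surjectivity, `z` is multiplied by a small permutation that undoes it on the co-image of
    -- `ι`. The product fixes the co-image pointwise, hence preserves the range of `ι` and comes
    -- from a permutation of `P.X`.
    obtain ⟨τ, hτ, hτs⟩ := exists_small_perm (I := ((Set.range ι)ᶜ : Set P.X)) hι
      (i := fun k => z.1 k) (i' := fun k => k)
      (fun a b h => Subtype.ext (z.1.injective h)) Subtype.val_injective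
    set w : P.S := τ * z with hw
    have hwK : ∀ x, x ∉ Set.range ι → w.1 x = x := fun x hx => hτ ⟨x, hx⟩
    have hwr : ∀ x, w.1 x ∈ Set.range ι ↔ x ∈ Set.range ι := by
      intro x
      constructor
      · intro h
        by_contra hx
        rw [hwK x hx] at h
        exact hx h
      · intro hx
        by_contra h
        have := hwK _ h
        rw [w.1.injective this] at h
        exact h hx
    let f : Equiv.Perm P.X :=
      (Equiv.ofInjective ι ι.injective).symm.permCongr (w.1.subtypePerm hwr)
    have hf : ∀ x, ι (f x) = w.1 (ι x) := by
      intro x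
      have h1 : f x = (Equiv.ofInjective ι ι.injective).symm
          (w.1.subtypePerm hwr ⟨ι x, x, rfl⟩) := rfl
      rw [h1, Equiv.apply_ofInjective_symm ι.injective]
      rfl
    have hfS : f ∈ P.S := by
      refine lt_of_le_of_lt ?_ (mem_S.1 w.2)
      rw [← mk_image_eq (s := {x | f x ≠ x}) ι.injective]
      refine mk_le_mk_of_subset ?_
      rintro _ ⟨x, hx, rfl⟩
      change w.1 (ι x) ≠ ι x
      rw [← hf]
      exact fun h => hx (ι.injective h)
    refine ⟨P.q ⟨f, hfS⟩, ?_⟩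
    have e1 : ψ ⟨f, hfS⟩ = w := by
      ext x
      by_cases hx : x ∈ Set.range ι
      · obtain ⟨y, rfl⟩ := hx
        rw [hψ]
        exact hf y
      · rw [hψ' _ _ hx, hwK x hx]
    rw [hΘ, e1, q_eq_iff]
    refine (hτs.preimage z.1).mono ?_
    intro x hx
    exact hx
  refine ⟨MulEquiv.ofBijective Θ ⟨hinj, hsurj⟩, fun f g h => ?_⟩
  change Θ (P.q f) = P.q g
  rw [hΘ, q_eq_iff]
  refine (hι.union (h.image ι)).mono ?_
  intro x hx
  by_cases hxr : x ∈ Set.range ι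
  · obtain ⟨y, rfl⟩ := hxr
    refine Or.inr ⟨y, ?_, rfl⟩
    have hx : (ψ f).1 (ι y) ≠ g.1 (ι y) := hx
    rw [hψ] at hx
    exact hx.symm
  · exact Or.inl hxr

/-- On its domain in the core the partial isomorphism already conjugates; what needs an argument is
that `g` does not carry points fixed by all `f i` to points moved by some `f' i`, outside a small
set. -/
theorem q_conj_eq_of_piso {f f' : Fin n → P.S} {L : P.X → P.X → Prop}
    (hL : PIso (fun i => (f i).1) (fun i => (f' i).1) L)
    (h1 : P.Sm (core (P.lam ≤ P.μ) (fun i => (f i).1) \ relDom L))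
    (h2 : P.Sm (core (P.lam ≤ P.μ) (fun i => (f' i).1) \ relRan L)) (g : P.S)
    (hg : ∀ x ∈ core (P.lam ≤ P.μ) (fun i => (f i).1), x ∈ relDom L → L x (g.1 x)) (i : Fin n) :
    P.Sm {x | g.1 ((f i).1 x) ≠ (f' i).1 (g.1 x)} := by
  refine (h1.union (h2.preimage g.1)).mono ?_
  intro x hx
  by_contra hcon
  simp only [Set.mem_union, Set.mem_sdiff, Set.mem_preimage, not_or, not_and, not_not] at hcon
  obtain ⟨hc1, hc2⟩ := hcon
  have key : x ∈ core (P.lam ≤ P.μ) (fun i => (f i).1) → False := by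
    intro hxc
    have hl := hg x hxc (hc1 hxc)
    have hl' := hg _ ((core_inv _ _ i x).2 hxc) ((hL.dom_inv i x).2 (hc1 hxc))
    exact hx (hL.func hl' ((hL.map i _ _).2 hl))
  by_cases hxc : x ∈ core (P.lam ≤ P.μ) (fun i => (f i).1)
  · exact key hxc
  have hx' : P.lam ≤ P.μ ∧ ∀ i, (f i).1 x = x := by
    simpa [core] using hxc
  obtain ⟨hl, hfix⟩ := hx'
  have hx : g.1 ((f i).1 x) ≠ (f' i).1 (g.1 x) := hx
  rw [hfix i] at hx
  -- If `f' i` moved `g x`, then `g x` would correspond under `L` to a point `x'` of the core of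
  -- `f`. As `g` agrees with `L` there, `x' = x`, yet `x` lies outside the core.
  have hcore : g.1 x ∈ core (P.lam ≤ P.μ) (fun i => (f' i).1) := fun _ => ⟨i, hx.symm⟩
  obtain ⟨x', hx'⟩ := hc2 hcore
  have hx'c : x' ∈ core (P.lam ≤ P.μ) (fun i => (f i).1) := by
    intro _
    refine ⟨i, fun h => hx ?_⟩
    have h3 := (hL.map i _ _).2 hx'
    have h3 : L ((f i).1 x') ((f' i).1 (g.1 x)) := h3
    rw [h] at h3
    exact hL.func hx' h3
  have h4 := hL.func (hg x' hx'c ⟨_, hx'⟩) hx'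
  exact hxc (g.1.injective h4 ▸ hx'c)

/-- The part of `L` over the core has fewer than `lam ≤ μ` elements, so it leaves `μ` points free on
both sides and extends to a permutation in `P.S`. -/
theorem exists_conj_of_le (hl : P.lam ≤ P.μ) {f f' : Fin n → P.S} {L : P.X → P.X → Prop}
    (hL : PIso (fun i => (f i).1) (fun i => (f' i).1) L)
    (h1 : P.Sm (core (P.lam ≤ P.μ) (fun i => (f i).1) \ relDom L))
    (h2 : P.Sm (core (P.lam ≤ P.μ) (fun i => (f' i).1) \ relRan L)) :
    ∃ g : P.S, ∀ i, P.Sm {x | g.1 ((f i).1 x) ≠ (f' i).1 (g.1 x)} := by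
  let I : Set P.X := core (P.lam ≤ P.μ) (fun i => (f i).1) ∩ relDom L
  have hI : #I < P.lam :=
    (mk_le_mk_of_subset Set.inter_subset_left).trans_lt (core_fin_lt f)
  choose p hp using fun x : I => x.2.2
  have hc : ∀ i : I → P.X, #I ≤ #((Set.range i)ᶜ : Set P.X) := by
    intro i
    rw [mk_compl_of_infinite _ (by
      rw [mk_X]; exact (mk_range_le.trans_lt hI).trans_le hl), mk_X]
    exact hI.le.trans hl
  obtain ⟨g, hg⟩ := exists_perm_of_injective hI (i := Subtype.val) (i' := p)
    Subtype.val_injective (fun a b hab => Subtype.ext (hL.inj (hp a) (hab ▸ hp b))) (hc _) (hc _)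
  refine ⟨g, fun i => q_conj_eq_of_piso hL h1 h2 g (fun x hx hd => ?_) i⟩
  rw [hg ⟨x, hx, hd⟩]
  exact hp ⟨x, hx, hd⟩

/-- The complements of domain and range are small but may differ in size, so `L` need not extend to
a permutation. It does extend to an injection with small co-image, and this induces an automorphism
of the quotient. -/
theorem exists_aut_of_not {f f' : Fin n → P.S} {L : P.X → P.X → Prop}
    (hL : PIso (fun i => (f i).1) (fun i => (f' i).1) L)
    (h1 : P.Sm (relDom L)ᶜ) (h2 : P.Sm (relRan L)ᶜ)
    (hle : #((relDom L)ᶜ : Set P.X) ≤ #((relRan L)ᶜ : Set P.X)) :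
    ∃ θ : P.G ≃* P.G, ∀ i, θ (P.q (f i)) = P.q (f' i) := by
  classical
  obtain ⟨k⟩ := hle
  choose p hp using fun x : relDom L => x.2
  let ι : P.X → P.X := fun x => if h : x ∈ relDom L then p ⟨x, h⟩ else k ⟨x, h⟩
  have hιd : ∀ x (h : x ∈ relDom L), L x (ι x) := fun x h => by
    simp only [ι, dif_pos h]; exact hp ⟨x, h⟩
  have hιn : ∀ x (h : x ∉ relDom L), ι x = k ⟨x, h⟩ := fun x h => by
    simp only [ι, dif_neg h]
  have hinj : Function.Injective ι := by
    intro x y hxy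
    by_cases hx : x ∈ relDom L <;> by_cases hy : y ∈ relDom L
    · exact hL.inj (hιd x hx) (hxy ▸ hιd y hy)
    · rw [hιn y hy] at hxy
      exact absurd ⟨x, hxy ▸ hιd x hx⟩ (k ⟨y, hy⟩).2
    · rw [hιn x hx] at hxy
      exact absurd ⟨y, hxy ▸ hιd y hy⟩ (k ⟨x, hx⟩).2
    · rw [hιn x hx, hιn y hy] at hxy
      exact congrArg Subtype.val (k.injective (Subtype.ext hxy))
  obtain ⟨θ, hθ⟩ := exists_aut_of_injective ⟨ι, hinj⟩ (h2.mono (by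
    intro y hy
    rintro ⟨x, hx⟩
    exact hy ⟨x, hL.func (hιd x ⟨y, hx⟩) hx⟩))
  refine ⟨θ, fun i => hθ _ _ (h1.mono ?_)⟩
  intro x hx hd
  exact hx (hL.func ((hL.map i _ _).2 (hιd x hd)) (hιd _ ((hL.dom_inv i x).2 hd)))

/-- This homogeneity is the reason why a class in `F_n` determines all first-order properties of the
tuple in the quotient group. -/
theorem exists_aut {f f' : Fin n → P.S} (H : PreF.E P.κ (ty f) (ty f')) :
    ∃ θ : P.G ≃* P.G, ∀ i, θ (P.q (f i)) = P.q (f' i) := by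
  obtain ⟨L, hL, h1, h2⟩ := (tyPre_E_iff P.hκ _ _).1 H
  by_cases hl : P.lam ≤ P.μ
  · obtain ⟨g, hg⟩ := exists_conj_of_le hl hL h1 h2
    refine ⟨MulAut.conj (P.q g), fun i => ?_⟩
    rw [MulAut.conj_apply, mul_inv_eq_iff_eq_mul, ← map_mul, ← map_mul, q_eq_iff]
    exact hg i
  · have e1 : ∀ D : Set P.X, core (P.lam ≤ P.μ) (fun i => (f i).1) \ D = Dᶜ := fun D => by
      rw [core_of_not hl, ← Set.compl_eq_univ_sdiff]
    have e2 : ∀ D : Set P.X, core (P.lam ≤ P.μ) (fun i => (f' i).1) \ D = Dᶜ := fun D => by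
      rw [core_of_not hl, ← Set.compl_eq_univ_sdiff]
    rw [e1] at h1
    rw [e2] at h2
    rcases le_total #((relDom L)ᶜ : Set P.X) #((relRan L)ᶜ : Set P.X) with hle | hle
    · exact exists_aut_of_not hL h1 h2 hle
    · obtain ⟨θ, hθ⟩ := exists_aut_of_not hL.symm h2 h1 hle
      exact ⟨θ.symm, fun i => by rw [← hθ i, MulEquiv.symm_apply_apply]⟩

end Par

/-! ### Definability of relations of the quotient group in the structure `M` -/

namespace MSLang

variable {L : MSLang}

/-- A term, with a new first variable added to its context. -/
def Term.weaken {Γ : List L.Sort'} (s : L.Sort') : {s' : L.Sort'} → L.Term Γ s' →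
    L.Term (s :: Γ) s'
  | _, .var i => Term.var (L := L) (Γ := s :: Γ) (Fin.succ i)
  | _, .app f ts => .app f fun i => (ts i).weaken s

theorem Term.val_weaken (M : L.Str) {Γ : List L.Sort'} {s : L.Sort'} (a : M.carrier s)
    (e : M.Env Γ) {s' : L.Sort'} (t : L.Term Γ s') :
    (t.weaken s).val M (Str.Env.cons a e) = t.val M e := by
  induction t with
  | var i => rfl
  | app f ts ih =>
    simp only [Term.weaken, Term.val]
    congr 1
    funext i
    exact ih i

end MSLang

namespace Par

/-- The many-sorted structure `M` of a triple of cardinals. -/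
noncomputable abbrev M (P : Par.{u}) : MLang.Str := MStr P.κ P.lam P.μ

/-- The class of a function in the sort `F_n`. -/
abbrev cls (P : Par.{u}) {n : ℕ} (h : PreF P.lam P.μ n) : FSort P.κ P.lam P.μ n := Quot.mk _ h

end Par

/-- A relation of the quotient groups that is invariant under automorphisms and, in terms of the
classes of orbit-counting functions, uniformly definable in the structures `M`. -/
structure MDef (k : ℕ) (R : ∀ P : Par.{u}, (Fin (k + 1) → P.G) → Prop) : Prop where
  aut : ∀ P (θ : P.G ≃* P.G) v, R P (fun i => θ (v i)) ↔ R P v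
  form : ∀ (Γ : List MLang.Sort') (τ : MLang.Term Γ (MSort.fn k)), ∃ φ : MLang.Formula Γ,
    ∀ (P : Par.{u}) (e : P.M.Env Γ) (f : Fin (k + 1) → P.S),
      τ.val P.M e = P.cls (Par.ty f) → (φ.Sat P.M e ↔ R P fun i => P.q (f i))

namespace MDef

variable {k m n : ℕ} {R R' : ∀ P : Par.{u}, (Fin (k + 1) → P.G) → Prop}

theorem congr (hR : MDef k R) (h : ∀ P v, R P v ↔ R' P v) : MDef k R' where
  aut P θ v := by rw [← h, ← h]; exact hR.aut P θ v
  form Γ τ := by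
    obtain ⟨φ, hφ⟩ := hR.form Γ τ
    exact ⟨φ, fun P e f he => (hφ P e f he).trans (h _ _)⟩

theorem falsum : MDef.{u} k fun _ _ => False where
  aut _ _ _ := Iff.rfl
  form _ _ := ⟨.falsum, fun _ _ _ _ => Iff.rfl⟩

theorem imp (hR : MDef k R) (hR' : MDef k R') : MDef k fun P v => R P v → R' P v where
  aut P θ v := imp_congr (hR.aut P θ v) (hR'.aut P θ v)
  form Γ τ := by
    obtain ⟨φ, hφ⟩ := hR.form Γ τ
    obtain ⟨ψ, hψ⟩ := hR'.form Γ τ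
    exact ⟨.imp φ ψ, fun P e f he => imp_congr (hφ P e f he) (hψ P e f he)⟩

theorem not (hR : MDef k R) : MDef k fun P v => ¬ R P v := hR.imp falsum

theorem and (hR : MDef k R) (hR' : MDef k R') : MDef k fun P v => R P v ∧ R' P v :=
  (hR.imp hR'.not).not.congr fun P v => by tauto

theorem reindex {R : ∀ P : Par.{u}, (Fin (m + 1) → P.G) → Prop} (hR : MDef m R)
    (σ : Fin (m + 1) → Fin (n + 1)) (hσ : Function.Injective σ) :
    MDef n fun P v => R P fun i => v (σ i) where
  aut P θ v := hR.aut P θ _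
  form Γ τ := by
    obtain ⟨φ, hφ⟩ := hR.form Γ (.app (L := MLang) (MFunc.proj m n ⟨σ, hσ⟩)
      (fun i => Fin.cases τ (fun i => i.elim0) i))
    refine ⟨φ, fun P e f he => hφ P e (fun i => f (σ i)) ?_⟩
    change FSort.proj σ (τ.val P.M e : FSort P.κ P.lam P.μ (n + 1)) = _
    rw [he]
    change P.cls (PreF.proj σ _) = _
    rw [Par.ty, tyPre_proj]
    rfl

theorem eq : MDef.{u} 1 fun _ v => v 0 = v 1 where
  aut P θ v := θ.injective.eq_iff
  form Γ τ := by
    refine ⟨.rel (L := MLang) MRel.eq (fun i => Fin.cases τ (fun i => i.elim0) i),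
      fun P e f he => ?_⟩
    change FSort.IsEq (τ.val P.M e : FSort P.κ P.lam P.μ 2) ↔ _
    rw [he, Par.q_eq_iff]
    exact isEq_tyPre_iff P.hκ _

/-- `FSort.IsProd` multiplies permutations acting on the right, which reverses the factors in
`Equiv.Perm`. -/
theorem prod : MDef.{u} 2 fun _ v => v 1 * v 0 = v 2 where
  aut P θ v := by rw [← map_mul]; exact θ.injective.eq_iff
  form Γ τ := by
    refine ⟨.rel (L := MLang) MRel.prod (fun i => Fin.cases τ (fun i => i.elim0) i),
      fun P e f he => ?_⟩
    change FSort.IsProd (τ.val P.M e : FSort P.κ P.lam P.μ 3) ↔ _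
    rw [he, ← map_mul, Par.q_eq_iff]
    exact isProd_tyPre_iff P.hκ _

/-- An additional group element is quantified in `M` as a class in the next sort that projects to
the given class. A tuple `g` realizing it has an initial part that is only E-equivalent to `f`;
`Par.exists_aut` moves this part onto `f`, and the invariance of `R` makes the move harmless. -/
theorem all {R : ∀ P : Par.{u}, (Fin (k + 1 + 1) → P.G) → Prop} (hR : MDef (k + 1) R) :
    MDef k fun P v => ∀ w : Fin (k + 1 + 1) → P.G, (∀ i : Fin (k + 1), w i.castSucc = v i) →
      R P w where
  aut P θ v := by
    constructor
    · intro h w hw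
      rw [← hR.aut P θ]
      exact h _ fun i => by rw [hw]
    · intro h w hw
      rw [← hR.aut P θ.symm]
      exact h _ fun i => by rw [hw, θ.symm_apply_apply]
  form Γ τ := by
    obtain ⟨φ, hφ⟩ := hR.form (MSort.fn (k + 1) :: Γ)
      (.var (L := MLang) (Γ := MSort.fn (k + 1) :: Γ) 0)
    refine ⟨.all (MSort.fn (k + 1)) (.imp (.equal
      (.app (L := MLang) (MFunc.proj k (k + 1) ⟨Fin.castSucc, Fin.castSucc_injective _⟩)
        (fun i => Fin.cases (.var (L := MLang) (Γ := MSort.fn (k + 1) :: Γ) 0)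
          (fun i => i.elim0) i)) (τ.weaken (MSort.fn (k + 1)))) φ), fun P e f he => ?_⟩
    have hsat : ∀ h : PreF P.lam P.μ (k + 1 + 1),
        (P.cls (h.proj Fin.castSucc) = P.cls (Par.ty f) →
          φ.Sat P.M (MSLang.Str.Env.cons (s := MSort.fn (k + 1)) (P.cls h) e)) ↔
        (MSLang.Formula.imp (.equal
          (.app (L := MLang) (MFunc.proj k (k + 1) ⟨Fin.castSucc, Fin.castSucc_injective _⟩)
            (fun i => Fin.cases (.var (L := MLang) (Γ := MSort.fn (k + 1) :: Γ) 0)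
              (fun i => i.elim0) i)) (τ.weaken (MSort.fn (k + 1)))) φ).Sat P.M
          (MSLang.Str.Env.cons (s := MSort.fn (k + 1)) (P.cls h) e) := by
      intro h
      have e1 := (MSLang.Term.val_weaken P.M (s := MSort.fn (k + 1)) (P.cls h) e τ).trans he
      exact imp_congr (iff_of_eq (congrArg (fun z : FSort P.κ P.lam P.μ (k + 1) =>
        P.cls (h.proj Fin.castSucc) = z) e1.symm)) Iff.rfl
    constructor
    · intro H w hw
      choose g hg using fun i => P.q_surjective (w i)
      have hg' : (fun i => P.q (g (Fin.castSucc i))) = fun i => P.q (f i) := by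
        funext i; rw [hg, hw]
      set g' : Fin (k + 1 + 1) → P.S := Fin.snoc (α := fun _ => P.S) f (g (Fin.last _)) with hg'
      have hgf : ∀ i : Fin (k + 1), g' i.castSucc = f i := fun i => by rw [hg', Fin.snoc_castSucc]
      have hgw : (fun i => P.q (g' i)) = w := by
        funext i
        refine Fin.lastCases ?_ (fun i => ?_) i
        · rw [hg', Fin.snoc_last, hg]
        · rw [hgf, hw]
      have h1 := (hsat (Par.ty g')).2 (H _) (by
        rw [Par.ty, tyPre_proj]
        have : (fun i => (g' (Fin.castSucc i)).1) = fun i => (f i).1 := by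
          funext i; rw [hgf]
        simp only [this]
        rfl)
      rw [← hgw]
      exact (hφ P _ g' rfl).1 h1
    · intro H x
      obtain ⟨h, rfl⟩ := Quot.exists_rep x
      refine (hsat h).1 fun hh => ?_
      obtain ⟨g, rfl⟩ := Par.exists_ty_eq h
      have hh := (FSort.mk_eq_iff P.hκ).1 hh
      rw [Par.ty, tyPre_proj] at hh
      obtain ⟨θ, hθ⟩ := Par.exists_aut (f := fun i => g (Fin.castSucc i)) (f' := f) hh
      refine (hφ P _ g rfl).2 ?_
      rw [← hR.aut P θ]
      exact H _ hθ

theorem ex {R : ∀ P : Par.{u}, (Fin (k + 1 + 1) → P.G) → Prop} (hR : MDef (k + 1) R) :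
    MDef k fun P v => ∃ w : Fin (k + 1 + 1) → P.G, (∀ i : Fin (k + 1), w i.castSucc = v i) ∧
      R P w :=
  hR.not.all.not.congr fun P v => by push Not; rfl

/-- Projections exist along injective index maps only, whence the requirement of distinct
coordinates here and in `mul_eq`. -/
theorem var_eq (i j : Fin (n + 1)) (h : i ≠ j) : MDef.{u} n fun _ v => v i = v j :=
  eq.reindex ![i, j] (by
    intro a b hab
    fin_cases a <;> fin_cases b <;> simp_all [eq_comm])

theorem mul_eq (i j l : Fin (n + 1)) (hij : i ≠ j) (hil : i ≠ l) (hjl : j ≠ l) :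
    MDef.{u} n fun _ v => v i * v j = v l :=
  prod.reindex ![j, i, l] (by
    intro a b hab
    fin_cases a <;> fin_cases b <;> simp_all [eq_comm])

/-- The identity is the only idempotent of a group. Since the coordinates in a product have to be
distinct, `v * v = v` is expressed with two further copies of `v`. -/
theorem one : MDef.{u} 0 fun _ v => v 0 = 1 := by
  have h := ((var_eq.{u} (n := 2) 0 1 (by decide)).and
    ((var_eq 0 2 (by decide)).and (mul_eq 0 1 2 (by decide) (by decide) (by decide)))).ex.ex
  refine h.congr fun P v => ?_
  constructor
  · rintro ⟨w, hw, z, hz, h1, h2, h3⟩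
    have e : v 0 = z 0 := by rw [← hw 0]; exact (hz 0).symm
    rw [e]
    rw [← h1, ← h2] at h3
    exact mul_eq_left.1 h3
  · intro hv
    refine ⟨fun _ => 1, fun i => ?_, fun _ => 1, fun _ => rfl, rfl, rfl, mul_one 1⟩
    rw [Fin.fin_one_eq_zero i, hv]

theorem is_one (i : Fin (n + 1)) : MDef.{u} n fun _ v => v i = 1 :=
  one.reindex (fun _ => i) fun a b _ => (Fin.fin_one_eq_zero a).trans (Fin.fin_one_eq_zero b).symm

/-- A term is replaced by its graph: coordinates up to `n` hold the variables and the last one the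
value. For a compound term, two auxiliary coordinates hold the values of the subterms, as no symbol
has more than two arguments. -/
theorem of_term {α : Type} (t : groupLang.Term α) : ∀ (n : ℕ) (w : α → Fin (n + 1)),
    MDef.{u} (n + 1) fun _ v => t.realize (fun a => v (w a).castSucc) = v (Fin.last _) := by
  induction t with
  | var a => exact fun n w => var_eq _ _ (Fin.castSucc_lt_last _).ne
  | @func l f ts ih =>
    intro n w
    -- The index map keeps the variables in place and sends the value coordinate to a free
    -- coordinate `j` beyond them.
    have hσ : ∀ j : Fin (n + 1 + 1 + 1 + 1), n < j.val → Function.Injective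
        (fun i : Fin (n + 1 + 1) => if i.val ≤ n then i.castSucc.castSucc else j) := by
      intro j hj a b hab
      ext
      have := congrArg Fin.val hab
      dsimp only at this
      split_ifs at this with h1 h2 h2 <;> simp at this <;> omega
    have hR : ∀ (i : Fin l) (j : Fin (n + 1 + 1 + 1 + 1)), n < j.val →
        MDef.{u} (n + 1 + 1 + 1) fun _ v => (ts i).realize
          (fun a => v (w a).castSucc.castSucc.castSucc) = v j := by
      intro i j hj
      refine ((ih i n w).reindex _ (hσ j hj)).congr fun P v => ?_
      have e1 : ∀ a, ((w a).castSucc : Fin (n + 1 + 1)).val ≤ n := fun a => by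
        have := (w a).2
        simp only [Fin.val_castSucc]
        omega
      have e2 : ¬ (Fin.last (n + 1)).val ≤ n := by simp
      simp only [e1, if_true, e2, if_false]
    have l0 : n < (⟨n + 1, by omega⟩ : Fin (n + 1 + 1 + 1 + 1)).val := by simp
    have l1 : n < (⟨n + 2, by omega⟩ : Fin (n + 1 + 1 + 1 + 1)).val := by simp
    have l2 : n < (⟨n + 3, by omega⟩ : Fin (n + 1 + 1 + 1 + 1)).val := by simp
    have hget : ∀ {P : Par.{u}} {v : Fin (n + 1 + 1) → P.G} {x : Fin (n + 1 + 1 + 1) → P.G}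
        {y : Fin (n + 1 + 1 + 1 + 1) → P.G}, (∀ i : Fin (n + 1 + 1), x i.castSucc = v i) →
        (∀ i : Fin (n + 1 + 1 + 1), y i.castSucc = x i) →
        (fun a => y (w a).castSucc.castSucc.castSucc) = (fun a => v (w a).castSucc) ∧
          y ⟨n + 1, by omega⟩ = v (Fin.last _) := by
      intro P v x y hx hy
      refine ⟨funext fun a => by rw [hy, hx], ?_⟩
      rw [← hx, ← hy]
      rfl
    have hext : ∀ {P : Par.{u}} (v : Fin (n + 1 + 1) → P.G) (a b : P.G),
        ∃ x : Fin (n + 1 + 1 + 1) → P.G, (∀ i : Fin (n + 1 + 1), x i.castSucc = v i) ∧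
        ∃ y : Fin (n + 1 + 1 + 1 + 1) → P.G, (∀ i : Fin (n + 1 + 1 + 1), y i.castSucc = x i) ∧
        y ⟨n + 2, by omega⟩ = a ∧ y ⟨n + 3, by omega⟩ = b := by
      intro P v a b
      let x : Fin (n + 1 + 1 + 1) → P.G := Fin.snoc (α := fun _ => P.G) v a
      let y : Fin (n + 1 + 1 + 1 + 1) → P.G := Fin.snoc (α := fun _ => P.G) x b
      have hx : ∀ i : Fin (n + 1 + 1), x i.castSucc = v i := fun i => Fin.snoc_castSucc ..
      have hy : ∀ i : Fin (n + 1 + 1 + 1), y i.castSucc = x i := fun i => Fin.snoc_castSucc ..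
      refine ⟨x, hx, y, hy, ?_, ?_⟩
      · exact (hy (Fin.last _)).trans (Fin.snoc_last ..)
      · exact Fin.snoc_last (α := fun _ => P.G) b x
    cases f with
    | mul =>
      have h := ((hR 0 _ l1).and ((hR 1 _ l2).and (mul_eq ⟨n + 2, by omega⟩ ⟨n + 3, by omega⟩
        ⟨n + 1, by omega⟩ (by simp) (by simp) (by simp)))).ex.ex
      refine h.congr fun P v => ?_
      change _ ↔ (ts 0).realize _ * (ts 1).realize _ = _
      constructor
      · rintro ⟨x, hx, y, hy, h1, h2, h3⟩
        obtain ⟨e1, e2⟩ := hget hx hy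
        rw [← e1, h1, h2, h3, e2]
      · intro hv
        obtain ⟨x, hx, y, hy, h1, h2⟩ := hext v
          ((ts 0).realize fun a => v (w a).castSucc) ((ts 1).realize fun a => v (w a).castSucc)
        obtain ⟨e1, e2⟩ := hget hx hy
        refine ⟨x, hx, y, hy, ?_, ?_, ?_⟩
        · rw [h1, e1]
        · rw [h2, e1]
        · rw [h1, h2, hv, e2]
    | inv =>
      -- The coordinate `n + 3` holds the identity here: the argument in `n + 2` times the value in
      -- `n + 1` has to be equal to it.
      have h := ((hR 0 _ l1).and ((is_one ⟨n + 3, by omega⟩).and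
        (mul_eq ⟨n + 2, by omega⟩ ⟨n + 1, by omega⟩ ⟨n + 3, by omega⟩
          (by simp) (by simp) (by simp)))).ex.ex
      refine h.congr fun P v => ?_
      change _ ↔ ((ts 0).realize _)⁻¹ = _
      constructor
      · rintro ⟨x, hx, y, hy, h1, h2, h3⟩
        obtain ⟨e1, e2⟩ := hget hx hy
        rw [← e1, h1, ← e2, inv_eq_iff_mul_eq_one, h3, h2]
      · intro hv
        obtain ⟨x, hx, y, hy, h1, h2⟩ := hext v ((ts 0).realize fun a => v (w a).castSucc) 1
        obtain ⟨e1, e2⟩ := hget hx hy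
        refine ⟨x, hx, y, hy, ?_, h2, ?_⟩
        · rw [h1, e1]
        · rw [h1, h2, e2, ← hv, mul_inv_cancel]
    | one =>
      refine (is_one (Fin.last _)).congr fun P v => ?_
      exact eq_comm

/-- The sorts `F_n` begin with `n = 1`. The single free variable at coordinate `0` is a dummy that
keeps tuples non-empty, also for sentences. -/
theorem of_formula {m : ℕ} (φ : groupLang.BoundedFormula (Fin 1) m) : MDef.{u} m fun _ v =>
    φ.Realize (fun _ => v 0) (fun i => v i.succ) := by
  induction φ with
  | falsum => exact falsum
  | @equal m t₁ t₂ =>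
    have hw : ∀ P : Par.{u}, ∀ v : Fin (m + 1) → P.G, ∀ w : Fin (m + 1 + 1) → P.G,
        (∀ i : Fin (m + 1), w i.castSucc = v i) →
        (fun a : Fin 1 ⊕ Fin m => w (Fin.castSucc (Sum.elim (fun _ => 0) Fin.succ a))) =
        Sum.elim (fun _ => v 0) (fun i => v i.succ) := by
      intro P v w hw
      funext a
      rw [hw]
      rcases a with a | a <;> rfl
    have h := ((of_term.{u} t₁ m (Sum.elim (fun _ => 0) Fin.succ)).and
      (of_term t₂ m (Sum.elim (fun _ => 0) Fin.succ))).ex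
    refine h.congr fun P v => ?_
    change _ ↔ t₁.realize _ = t₂.realize _
    constructor
    · rintro ⟨w, hwv, h1, h2⟩
      rw [hw P v w hwv] at h1 h2
      rw [h1, h2]
    · intro hv
      have hwv : ∀ i : Fin (m + 1), (Fin.snoc (α := fun _ => P.G) v
          (t₁.realize (Sum.elim (fun _ => v 0) (fun i => v i.succ))) :
            Fin (m + 1 + 1) → P.G) i.castSucc = v i := fun i => Fin.snoc_castSucc ..
      refine ⟨_, hwv, ?_⟩
      rw [hw P v _ hwv, Fin.snoc_last]
      exact ⟨rfl, hv.symm⟩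
  | rel r _ => exact r.elim
  | imp _ _ h1 h2 => exact h1.imp h2
  | @all m φ ih =>
    refine ih.all.congr fun P v => ?_
    constructor
    · intro H x
      have h := H (Fin.snoc (α := fun _ => P.G) v x) fun i => Fin.snoc_castSucc ..
      convert h using 1
      · funext _
        exact (Fin.snoc_castSucc (α := fun _ => P.G) x v 0).symm
      · funext i
        refine Fin.lastCases ?_ (fun i => ?_) i
        · rw [Fin.snoc_last, Fin.succ_last, Fin.snoc_last]
        · rw [Fin.snoc_castSucc, Fin.succ_castSucc, Fin.snoc_castSucc]
    · intro H w hw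
      have h := H (w (Fin.last _))
      convert h using 1
      · funext _
        exact hw 0
      · funext i
        refine Fin.lastCases ?_ (fun i => ?_) i
        · rw [Fin.snoc_last, Fin.succ_last]
        · rw [Fin.snoc_castSucc, Fin.succ_castSucc, hw]

end MDef

/-- The dummy coordinate is bound by a universal quantifier over the first sort `F`. This is
harmless, as a sentence does not depend on it and the sort is non-empty. -/
theorem exists_M_sentence (φ : groupLang.Sentence) : ∃ ψ : MLang.Formula [], ∀ P : Par.{u},
    ψ.Sat P.M (fun i => i.elim0) ↔ P.G ⊨ φ := by
  have h := MDef.of_formula.{u} (m := 0) (FirstOrder.Language.Formula.relabel (Empty.elim : Empty → Fin 1) φ)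
  obtain ⟨ψ, hψ⟩ := h.form [MSort.fn 0] (.var (L := MLang) (Γ := [MSort.fn 0]) 0)
  refine ⟨.all (MSort.fn 0) ψ, fun P => ?_⟩
  have key : ∀ v : Fin (0 + 1) → P.G, FirstOrder.Language.BoundedFormula.Realize
      (FirstOrder.Language.Formula.relabel (Empty.elim : Empty → Fin 1) φ) (fun _ => v 0)
      (fun i : Fin 0 => v i.succ) ↔ P.G ⊨ φ := by
    intro v
    have h1 := FirstOrder.Language.Formula.realize_relabel (φ := φ)
      (g := (Empty.elim : Empty → Fin 1)) (v := fun _ => v 0)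
    refine Iff.trans (iff_of_eq (congrArg _ (Subsingleton.elim _ _)))
      (h1.trans (iff_of_eq (congrArg (fun z : Empty → P.G =>
        FirstOrder.Language.Formula.Realize φ z) (Subsingleton.elim _ _))))
  constructor
  · intro H
    rw [← key fun _ => 1]
    have H' := H (P.cls (Par.ty fun _ => (1 : P.S)))
    have := (hψ P _ (fun _ => 1) rfl).1 H'
    simpa using this
  · intro H x
    obtain ⟨x, rfl⟩ := Quot.exists_rep x
    obtain ⟨f, rfl⟩ := Par.exists_ty_eq x
    exact (hψ P _ f rfl).2 ((key fun i => P.q (f i)).2 H)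

theorem elementarilyEquivalent_of_elemEquiv {P Q : Par.{u}} (h : P.M.ElemEquiv Q.M) :
    groupLang.ElementarilyEquivalent P.G Q.G := by
  rw [FirstOrder.Language.elementarilyEquivalent_iff]
  intro φ
  obtain ⟨ψ, hψ⟩ := exists_M_sentence.{u} φ
  rw [← hψ, ← hψ]
  exact h ψ

namespace Par

variable {P : Par.{u}} {n : ℕ}

/-! ### Disjointness of supports in the quotient group -/

theorem not_sm_sdiff {A B : Set P.X} (hA : ¬ P.Sm A) (hB : P.Sm B) : ¬ P.Sm (A \ B) :=
  fun h => hA (h.of_subset_union hB fun x hx => by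
    by_cases hxB : x ∈ B
    · exact Or.inr hxB
    · exact Or.inl ⟨hx, hxB⟩)

theorem aleph0_le_of_not_sm {A : Set P.X} (hA : ¬ P.Sm A) : ℵ₀ ≤ #A := P.hκ.trans (not_lt.1 hA)

/-- By Zorn there is a maximal subset `C` of `M` that is disjoint from its image. Maximality puts
every point of `M` into `C`, its image or its preimage, so `M` would be small if `C` were. -/
theorem exists_disjoint_image (f : Equiv.Perm P.X) {M : Set P.X} (hM : ∀ x ∈ M, f x ≠ x)
    (hs : ¬ P.Sm M) : ∃ C ⊆ M, ¬ P.Sm C ∧ ∀ x ∈ C, f x ∉ C := by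
  obtain ⟨C, hC⟩ := zorn_subset {C : Set P.X | C ⊆ M ∧ ∀ x ∈ C, f x ∉ C} (by
    intro c hc hch
    refine ⟨⋃₀ c, ⟨Set.sUnion_subset fun s hs => (hc hs).1, ?_⟩,
      fun s hs => Set.subset_sUnion_of_mem hs⟩
    rintro x ⟨s, hs, hx⟩ ⟨t, ht, hfx⟩
    rcases hch.total hs ht with h | h
    · exact (hc ht).2 x (h hx) hfx
    · exact (hc hs).2 x hx (h hfx))
  refine ⟨C, hC.prop.1, fun hsm => hs ?_, hC.prop.2⟩
  refine (hsm.union ((hsm.image f).union (hsm.preimage f))).mono ?_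
  intro x hx
  by_contra hcon
  simp only [Set.mem_union, Set.mem_preimage, not_or] at hcon
  obtain ⟨h1, h2, h3⟩ := hcon
  have hins : insert x C ∈ {C : Set P.X | C ⊆ M ∧ ∀ x ∈ C, f x ∉ C} := by
    refine ⟨Set.insert_subset hx hC.prop.1, ?_⟩
    rintro y (rfl | hy) (hz | hz)
    · exact hM _ hx hz
    · exact h3 hz
    · exact h2 ⟨y, hy, hz⟩
    · exact hC.prop.2 y hy hz
  exact h1 (hC.le_of_ge hins (Set.subset_insert _ _) (Set.mem_insert _ _))

/-- An element of the group commutes with all members of the centralizer of `b` that commute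
with their conjugates there. -/
def Separated (a b : P.G) : Prop :=
  ∀ u : P.G, u * b = b * u → (∀ x : P.G, x * b = b * x →
    u * (x * u * x⁻¹) = (x * u * x⁻¹) * u) → a * u = u * a

theorem q_mul_eq_iff {f g h k : P.S} :
    P.q f * P.q g = P.q h * P.q k ↔ P.Sm {x | f.1 (g.1 x) ≠ h.1 (k.1 x)} := by
  rw [← map_mul, ← map_mul, q_eq_iff]; rfl

theorem restrict_mem (b : P.S) {W : Set P.X} (hW : ∀ x, b.1 x ∈ W ↔ x ∈ W) :
    ∃ u : P.S, (∀ x ∈ W, u.1 x = b.1 x) ∧ ∀ x ∉ W, u.1 x = x := by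
  classical
  refine ⟨⟨Equiv.Perm.ofSubtype (b.1.subtypePerm hW), ?_⟩, ?_, ?_⟩
  · refine lt_of_le_of_lt (mk_le_mk_of_subset ?_) b.2
    intro x hx h
    by_cases hxW : x ∈ W
    · refine hx ?_
      rw [Equiv.Perm.ofSubtype_apply_of_mem _ hxW]
      exact h
    · exact hx (Equiv.Perm.ofSubtype_apply_of_not_mem _ hxW)
  · intro x hx
    exact Equiv.Perm.ofSubtype_apply_of_mem _ hx
  · intro x hx
    exact Equiv.Perm.ofSubtype_apply_of_not_mem _ hx

/-- Suppose the common support is not small. Then `u = b` is an admissible test, so `a` and `b`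
commute. The test is next applied to the restriction of `b` to a suitable `b`-invariant part `W = C
∪ b C` of the support; it is still admissible but fails to commute with `a`, which moves `C` out of
`W`. -/
theorem Separated.sm_inter {a b : P.S} (h : Separated (P.q a) (P.q b))
    (ha : P.Sm {x | a.1 (a.1 (a.1 x)) ≠ x}) (hb : P.Sm {x | b.1 (b.1 x) ≠ x}) :
    P.Sm {x | a.1 x ≠ x ∧ b.1 x ≠ x} := by
  by_contra hns
  have hab : P.q a * P.q b = P.q b * P.q a := by
    refine h _ rfl fun x hx => ?_
    rw [hx, mul_inv_cancel_right]
  rw [q_mul_eq_iff] at hab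
  have hM := not_sm_sdiff (not_sm_sdiff (not_sm_sdiff hns ha) hb) hab
  set M := (({x | a.1 x ≠ x ∧ b.1 x ≠ x} \ {x | a.1 (a.1 (a.1 x)) ≠ x}) \
    {x | b.1 (b.1 x) ≠ x}) \ {x | a.1 (b.1 x) ≠ b.1 (a.1 x)} with hMdef
  have hMm : ∀ x ∈ M, a.1 x ≠ x ∧ b.1 x ≠ x ∧ b.1 (b.1 x) = x ∧ a.1 x ≠ b.1 x := by
    rintro x ⟨⟨⟨⟨h1, h2⟩, h3⟩, h4⟩, h5⟩
    simp only [Set.mem_ofPred_eq, not_not] at h3 h4 h5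
    -- The orders two and three clash: if `a x = b x`, then `a (a x) = a (b x) = b (a x) = b (b x) =
    -- x`, and the cube of `a` being trivial at `x` forces `a x = x`.
    refine ⟨h1, h2, h4, fun h6 => h1 ?_⟩
    rw [← h6, ] at h5
    rw [h5, h6, h4] at h3
    rw [h6]; exact h6 ▸ h3
  obtain ⟨C', hC'M, hC's, hC'⟩ := exists_disjoint_image a.1 (fun x hx => (hMm x hx).1) hM
  -- On `C'` the permutations `a` and `b` differ, so `b⁻¹ a` moves every point of it. After both
  -- selections `a` sends `C` neither into `C` nor into `b C`.
  obtain ⟨C, hCC', hCs, hC⟩ := exists_disjoint_image (b.1⁻¹ * a.1) (M := C')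
    (fun x hx h => (hMm x (hC'M hx)).2.2.2 (by
      rw [Equiv.Perm.mul_apply, Equiv.Perm.inv_eq_iff_eq] at h; exact h)) hC's
  have hbb : ∀ x ∈ C, b.1 (b.1 x) = x := fun x hx => (hMm x (hC'M (hCC' hx))).2.2.1
  have hW : ∀ x, b.1 x ∈ C ∪ b.1 '' C ↔ x ∈ C ∪ b.1 '' C := by
    intro x
    constructor
    · rintro (hx | ⟨y, hy, hxy⟩)
      · exact Or.inr ⟨_, hx, b.1.injective (hbb _ hx)⟩
      · exact Or.inl (b.1.injective hxy ▸ hy)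
    · rintro (hx | ⟨y, hy, rfl⟩)
      · exact Or.inr ⟨x, hx, rfl⟩
      · exact Or.inl (by rw [hbb y hy]; exact hy)
  set W := C ∪ b.1 '' C with hWdef
  obtain ⟨u, hu, hu'⟩ := restrict_mem b hW
  have hau := h (P.q u) (by
    rw [q_mul_eq_iff]
    convert Sm.empty (P := P)
    ext x
    simp only [Set.mem_ofPred_eq, Set.mem_empty_iff_false, iff_false, not_not]
    by_cases hx : x ∈ W
    · rw [hu _ ((hW x).2 hx), hu x hx]
    · rw [hu' _ (fun h => hx ((hW x).1 h)), hu' x hx]) (by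
    -- An `x` that commutes with `b` up to a small set conjugates `u` to the permutation that equals
    -- `b` on the image of `W` under `x` and is the identity elsewhere, up to a small set. Two such
    -- partial copies of `b` commute.
    intro x hx
    obtain ⟨x, rfl⟩ := P.q_surjective x
    have hx' : P.q x⁻¹ * P.q b = P.q b * P.q x⁻¹ := by
      rw [map_inv, inv_mul_eq_iff_eq_mul, ← mul_assoc, hx, mul_inv_cancel_right]
    rw [q_mul_eq_iff] at hx'
    rw [← map_inv, ← map_mul, ← map_mul, q_mul_eq_iff]
    refine (hx'.union (hx'.preimage b.1)).mono ?_
    intro y hy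
    by_contra hcon
    simp only [Set.mem_union, Set.mem_preimage, Set.mem_ofPred_eq, not_or, not_not] at hcon
    obtain ⟨h1, h2⟩ := hcon
    have hval : ∀ z, (x * u * x⁻¹).1 z = x.1 (u.1 (x⁻¹.1 z)) := fun z => rfl
    have hxx : ∀ z, x.1 (x⁻¹.1 z) = z := fun z => x.1.apply_symm_apply z
    have key : ∀ z, x⁻¹.1 (b.1 z) = b.1 (x⁻¹.1 z) →
        (x⁻¹.1 z ∈ W → (x * u * x⁻¹).1 z = b.1 z) ∧
        (x⁻¹.1 z ∉ W → (x * u * x⁻¹).1 z = z) := by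
      intro z hz
      constructor
      · intro hw
        rw [hval, hu _ hw, ← hz, hxx]
      · intro hw
        rw [hval, hu' _ hw, hxx]
    have hmem : x⁻¹.1 (b.1 y) ∈ W ↔ x⁻¹.1 y ∈ W := by rw [h1, hW]
    refine hy ?_
    by_cases hyW : y ∈ W <;> by_cases hyW' : x⁻¹.1 y ∈ W
    · rw [(key y h1).1 hyW', hu y hyW, hu _ ((hW y).2 hyW), (key _ h2).1 (hmem.2 hyW')]
    · rw [(key y h1).2 hyW', hu y hyW, (key _ h2).2 (fun h => hyW' (hmem.1 h))]
    · rw [(key y h1).1 hyW', hu' y hyW, hu' _ (fun h => hyW ((hW y).1 h)), (key y h1).1 hyW']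
    · rw [(key y h1).2 hyW', hu' y hyW, (key y h1).2 hyW'])
  rw [q_mul_eq_iff] at hau
  refine hCs (hau.mono ?_)
  intro x hx
  have hxW : x ∈ W := Or.inl hx
  have haxW : a.1 x ∉ W := by
    rintro (h1 | ⟨c, hc, h1⟩)
    · exact hC' x (hCC' hx) (hCC' h1)
    · refine hC x hx ?_
      rw [Equiv.Perm.mul_apply, ← h1, ← Equiv.Perm.mul_apply, inv_mul_cancel]
      exact hc
  change a.1 (u.1 x) ≠ u.1 (a.1 x)
  rw [hu x hxW, hu' _ haxW]
  exact fun h => (hMm x (hC'M (hCC' hx))).2.1 (a.1.injective h)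

/-- An admissible `u` almost has its support inside that of `b`; this is what the condition on
conjugates enforces. Hence the supports of `u` and `a` are almost disjoint and the two elements
commute. -/
theorem separated_of_sm_inter {a b : P.S} (h : P.Sm {x | a.1 x ≠ x ∧ b.1 x ≠ x}) :
    Separated (P.q a) (P.q b) := by
  intro u hub hu
  obtain ⟨u, rfl⟩ := P.q_surjective u
  rw [q_mul_eq_iff] at hub
  have hsup : P.Sm ({x | u.1 x ≠ x} \ {x | b.1 x ≠ x}) := by
    by_contra hns
    obtain ⟨C, hCM, hCs, hC⟩ := exists_disjoint_image u.1 (fun x hx => hx.1) hns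
    have hV := not_sm_sdiff hCs hub
    set V := C \ {x | u.1 (b.1 x) ≠ b.1 (u.1 x)} with hVdef
    have hVm : ∀ v ∈ V, b.1 v = v ∧ b.1 (u.1 v) = u.1 v := by
      rintro v ⟨hv, hv'⟩
      have h1 : b.1 v = v := by simpa using (hCM hv).2
      simp only [Set.mem_ofPred_eq, not_not] at hv'
      exact ⟨h1, by rw [← hv', h1]⟩
    have hDl : #(u.1 '' V) < P.lam := by
      refine mk_image_le.trans_lt (lt_of_le_of_lt (mk_le_mk_of_subset ?_) u.2)
      exact fun x hx => (hCM hx.1).1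
    have hDi : ℵ₀ ≤ #(u.1 '' V) := by
      rw [mk_image_eq u.1.injective]; exact aleph0_le_of_not_sm hV
    -- `V` consists of points moved by `u` such that `b` fixes them and their images. An `x`
    -- supported on `u V` commutes with `b`, so `u` would have to commute with its conjugate by `x`.
    -- At a point `v` this gives `x (u v) = x⁻¹ (u v)`, which is impossible as `x` has order three.
    obtain ⟨x, hxs, hx3⟩ := exists_order_three hDl hDi
    have hxm : ∀ y, x.1 y ≠ y ↔ y ∈ u.1 '' V := fun y => by rw [← hxs]; rfl
    have hxn : ∀ y, y ∉ u.1 '' V → x.1 y = y := fun y hy => by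
      by_contra h; exact hy ((hxm y).1 h)
    have hxD : ∀ y, y ∈ u.1 '' V → x.1 y ∈ u.1 '' V := fun y hy => by
      rw [← hxm] at hy ⊢
      exact fun h => hy (x.1.injective h)
    have hbD : ∀ y, y ∈ u.1 '' V → b.1 y = y := by
      rintro _ ⟨v, hv, rfl⟩
      exact (hVm v hv).2
    have h1 := hu (P.q x) (by
      rw [q_mul_eq_iff]
      convert Sm.empty (P := P)
      ext y
      simp only [Set.mem_ofPred_eq, Set.mem_empty_iff_false, iff_false, not_not]
      by_cases hy : y ∈ u.1 '' V
      · rw [hbD y hy, hbD _ (hxD y hy)]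
      · rw [hxn y hy, hxn _ fun h => hy (by
          have h2 := b.1.injective (hbD _ h)
          rw [h2] at h
          exact h)])
    rw [← map_inv, ← map_mul, ← map_mul, q_mul_eq_iff] at h1
    refine hV (h1.mono ?_)
    intro v hv hcon
    have hinv : ∀ y, x⁻¹.1 y = x.1 (x.1 y) := fun y => by
      apply x.1.injective
      rw [hx3]
      exact x.1.apply_symm_apply y
    have hvD : v ∉ u.1 '' V := by
      rintro ⟨w, hw, hwv⟩
      exact hC w hw.1 (hwv ▸ hv.1)
    have hpD : u.1 v ∈ u.1 '' V := ⟨v, hv, rfl⟩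
    have hcon : u.1 (x.1 (u.1 (x⁻¹.1 v))) = x.1 (u.1 (x⁻¹.1 (u.1 v))) := hcon
    have e1 : x⁻¹.1 v = v := by rw [hinv, hxn v hvD, hxn v hvD]
    have hr : x⁻¹.1 (u.1 v) ∈ u.1 '' V := by rw [hinv]; exact hxD _ (hxD _ hpD)
    have hur : u.1 (x⁻¹.1 (u.1 v)) ∉ u.1 '' V := by
      rintro ⟨w, hw, hwv⟩
      obtain ⟨z, hz, hzr⟩ := hr
      rw [← u.1.injective hwv] at hzr
      exact hC z hz.1 (hzr ▸ hw.1)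
    rw [e1, hxn _ hur] at hcon
    have e2 := u.1.injective hcon
    rw [hinv] at e2
    exact (hxm _).2 (hxD _ hpD) e2.symm
  have hE : P.Sm {x | a.1 x ≠ x ∧ u.1 x ≠ x} := (h.union hsup).mono fun x hx => by
    by_cases hbx : b.1 x = x
    · exact Or.inr ⟨hx.2, by simpa using hbx⟩
    · exact Or.inl ⟨hx.1, hbx⟩
  rw [q_mul_eq_iff]
  refine (hE.union ((hE.preimage u.1).union (hE.preimage a.1))).mono ?_
  intro x hx
  by_contra hcon
  simp only [Set.mem_union, Set.mem_preimage, Set.mem_ofPred_eq, not_or, not_and, not_not] at hcon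
  obtain ⟨h1, h2, h3⟩ := hcon
  have hx : a.1 (u.1 x) ≠ u.1 (a.1 x) := hx
  by_cases hax : a.1 x = x
  · rw [hax] at hx
    exact hx (by rw [u.1.injective (h2 hx), hax])
  · rw [h1 hax] at hx
    exact hx (h3 fun h => hax (a.1.injective h)).symm

theorem separated_iff {a b : P.S} (ha : P.Sm {x | a.1 (a.1 (a.1 x)) ≠ x})
    (hb : P.Sm {x | b.1 (b.1 x) ≠ x}) :
    Separated (P.q a) (P.q b) ↔ P.Sm {x | a.1 x ≠ x ∧ b.1 x ≠ x} :=
  ⟨fun h => h.sm_inter ha hb, separated_of_sm_inter⟩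

/-! ### Coding of sets by elements of order three -/

/-- The sets of fewer than `lam` elements. -/
abbrev PS (P : Par.{u}) : Type u := {A : Set P.X // #A < P.lam}

/-- Inclusion up to a small set. -/
def Sub (P : Par.{u}) (A B : Set P.X) : Prop := P.Sm (A \ B)

/-- The element `a` has order three and support `A`, up to small sets. -/
structure Codes (a : P.S) (A : Set P.X) : Prop where
  cube : P.q a * P.q a * P.q a = 1
  sub : P.Sub {x | a.1 x ≠ x} A
  sup : P.Sub A {x | a.1 x ≠ x}

theorem cube_iff {a : P.S} : P.q a * P.q a * P.q a = 1 ↔ P.Sm {x | a.1 (a.1 (a.1 x)) ≠ x} := by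
  rw [← map_one P.q, ← map_mul, ← map_mul, q_eq_iff]; rfl

theorem square_iff {a : P.S} : P.q a * P.q a = 1 ↔ P.Sm {x | a.1 (a.1 x) ≠ x} := by
  rw [← map_one P.q, ← map_mul, q_eq_iff]; rfl

theorem Sub.refl (A : Set P.X) : P.Sub A A := by
  rw [Sub, Set.sdiff_self]; exact Sm.empty

theorem Sub.of_subset {A B : Set P.X} (h : A ⊆ B) : P.Sub A B := by
  rw [Sub, Set.sdiff_eq_empty.2 h]; exact Sm.empty

theorem Sub.trans {A B C : Set P.X} (h : P.Sub A B) (h' : P.Sub B C) : P.Sub A C :=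
  h.of_subset_union h' fun x hx => by
    by_cases hB : x ∈ B
    · exact Or.inr ⟨hB, hx.2⟩
    · exact Or.inl ⟨hx.1, hB⟩

theorem Sub.sm {A B : Set P.X} (h : P.Sub A B) (hB : P.Sm B) : P.Sm A :=
  h.of_subset_union hB fun x hx => by
    by_cases h : x ∈ B
    · exact Or.inr h
    · exact Or.inl ⟨hx, h⟩

theorem Sub.inter {A B C : Set P.X} (h : P.Sub A B) (h' : P.Sub A C) : P.Sub A (B ∩ C) :=
  (Sm.union h h').mono fun x hx => by
    by_cases hB : x ∈ B
    · exact Or.inr ⟨hx.1, fun hC => hx.2 ⟨hB, hC⟩⟩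
    · exact Or.inl ⟨hx.1, hB⟩

theorem Sub.image {A B : Set P.X} (h : P.Sub A B) (f : Equiv.Perm P.X) :
    P.Sub (f '' A) (f '' B) := by
  rw [Sub, ← Set.image_sdiff f.injective]
  exact Sm.image h f

theorem exists_code (A : P.PS) : ∃ a : P.S, Codes a A.1 := by
  by_cases hA : P.Sm A.1
  · refine ⟨1, by simp, ?_, hA.mono Set.sdiff_subset⟩
    have : {x : P.X | (1 : P.S).1 x ≠ x} = ∅ := by ext; simp
    rw [this]
    exact Sub.of_subset (Set.empty_subset _)
  · obtain ⟨g, hg, hg3⟩ := exists_order_three A.2 (aleph0_le_of_not_sm hA)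
    refine ⟨g, ?_, by rw [hg]; exact Sub.refl _, by rw [hg]; exact Sub.refl _⟩
    rw [cube_iff]
    convert Sm.empty (P := P)
    ext x
    simp [hg3 x]

theorem Codes.separated_iff {a b : P.S} {A : Set P.X} (ha : Codes a A)
    (hb : P.q b * P.q b = 1) :
    Separated (P.q a) (P.q b) ↔ P.Sm (A ∩ {x | b.1 x ≠ x}) := by
  rw [Par.separated_iff (cube_iff.1 ha.cube) (square_iff.1 hb)]
  constructor
  · intro h
    refine (h.union ha.sup).mono ?_
    rintro x ⟨hx, hbx⟩
    by_cases hax : a.1 x = x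
    · exact Or.inr ⟨hx, by simpa using hax⟩
    · exact Or.inl ⟨hax, hbx⟩
  · intro h
    refine (h.union ha.sub).mono ?_
    rintro x ⟨hx, hbx⟩
    by_cases hxA : x ∈ A
    · exact Or.inl ⟨hxA, hbx⟩
    · exact Or.inr ⟨hx, hxA⟩

/-- If `A \ B` is not small, it is the support of an involution, which is disjoint from `B` but not
from `A`. Involutions thus serve as tests while sets are coded by elements of order three, the
combination for which `separated_iff` is available. -/
theorem sub_iff_forall {A B : Set P.X} (hA : #A < P.lam) :
    P.Sub A B ↔ ∀ b : P.S, P.q b * P.q b = 1 → P.Sm (B ∩ {x | b.1 x ≠ x}) →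
      P.Sm (A ∩ {x | b.1 x ≠ x}) := by
  constructor
  · intro h b _ hb
    refine (Sm.union h hb).mono ?_
    rintro x ⟨hx, hbx⟩
    by_cases hxB : x ∈ B
    · exact Or.inr ⟨hxB, hbx⟩
    · exact Or.inl ⟨hx, hxB⟩
  · intro h
    by_contra hns
    have hl : #(A \ B : Set P.X) < P.lam := (mk_le_mk_of_subset Set.sdiff_subset).trans_lt hA
    obtain ⟨b, hb, hb2⟩ := exists_involution hl (aleph0_le_of_not_sm hns)
    refine hns ((h b ?_ ?_).mono ?_)
    · rw [square_iff]
      convert Sm.empty (P := P)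
      ext x
      simp [hb2 x]
    · rw [hb]
      convert Sm.empty (P := P)
      ext x
      simp +contextual
    · rw [hb]
      exact fun x hx => ⟨hx.1, hx⟩

theorem Codes.congr {a : P.S} {A B : Set P.X} (h : Codes a A) (h1 : P.Sub A B)
    (h2 : P.Sub B A) : Codes a B := ⟨h.cube, h.sub.trans h1, h2.trans h.sup⟩

theorem Codes.conj {a : P.S} {A : Set P.X} (h : Codes a A) (t : P.S) :
    Codes (t * a * t⁻¹) (t.1 '' A) := by
  have hs : {x | (t * a * t⁻¹).1 x ≠ x} = t.1 '' {x | a.1 x ≠ x} := by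
    ext x
    rw [Equiv.image_eq_preimage_symm]
    refine not_congr ?_
    exact (Equiv.eq_symm_apply t.1).symm
  refine ⟨?_, by rw [hs]; exact h.sub.image _, by rw [hs]; exact h.sup.image _⟩
  have h3 := h.cube
  simp only [map_mul, map_inv]
  calc _ = P.q t * (P.q a * P.q a * P.q a) * (P.q t)⁻¹ := by group
    _ = 1 := by rw [h3]; group

/-- A permutation that moves a non-small part of `A` moves some non-small subset of it off itself.
So agreement on `A` can be expressed by inclusions between sets and images. -/
theorem sm_ne_iff (u : P.S) {A : P.PS} : P.Sm {x ∈ A.1 | u.1 x ≠ x} ↔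
    ∀ C : P.PS, P.Sub C.1 A.1 → P.Sub (u.1 '' C.1) C.1 := by
  constructor
  · intro h C hC
    refine (Sm.image (Sm.union h hC) u.1).mono ?_
    rintro _ ⟨⟨x, hx, rfl⟩, hux⟩
    refine ⟨x, ?_, rfl⟩
    by_cases hA : x ∈ A.1
    · exact Or.inl ⟨hA, fun h => hux (h.symm ▸ hx)⟩
    · exact Or.inr ⟨hx, hA⟩
  · intro h
    by_contra hns
    obtain ⟨C, hC, hCs, hCu⟩ := exists_disjoint_image u.1 (fun x hx => hx.2) hns
    have hCl : #C < P.lam := (mk_le_mk_of_subset fun x hx => (hC hx).1).trans_lt A.2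
    have h1 := h ⟨C, hCl⟩ (Sub.of_subset fun x hx => (hC hx).1)
    refine hCs ?_
    refine (Sm.preimage h1 u.1).mono ?_
    intro x hx
    exact ⟨⟨x, hx, rfl⟩, hCu x hx⟩

end Par

/-! ### Uniform definability in the quotient groups -/

open FirstOrder FirstOrder.Language in
/-- The relation between elements of the groups and sets of fewer than `lam` points is defined, for
all triples in the class `K`, by one formula of the language of groups, where sets are represented
by their codes. -/
def UDef (K : Par.{u} → Prop) {ι J : Type}
    (R : ∀ P : Par.{u}, (ι → P.S) → (J → P.PS) → Prop) : Prop :=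
  ∃ φ : groupLang.Formula (ι ⊕ J), ∀ P, K P → ∀ (v : ι → P.S) (A : J → P.PS) (a : J → P.S),
    (∀ j, Par.Codes (a j) (A j).1) →
      (φ.Realize (Sum.elim (fun i => P.q (v i)) fun j => P.q (a j)) ↔ R P v A)

/-- A uniformly definable element of the groups. -/
def TDef {ι : Type} (t : ∀ P : Par.{u}, (ι → P.S) → P.S) : Prop :=
  ∃ τ : groupLang.Term ι, ∀ (P : Par.{u}) (v : ι → P.S), τ.realize (fun i => P.q (v i)) = P.q (t P v)

namespace TDef

variable {ι : Type} {s t : ∀ P : Par.{u}, (ι → P.S) → P.S}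

theorem var (i : ι) : TDef.{u} fun _ v => v i := ⟨.var i, fun _ _ => rfl⟩

theorem mul (hs : TDef s) (ht : TDef t) : TDef fun P v => s P v * t P v := by
  obtain ⟨σ, hσ⟩ := hs
  obtain ⟨τ, hτ⟩ := ht
  refine ⟨.func (L := groupLang) (l := 2) GroupFunc.mul ![σ, τ], fun P v => ?_⟩
  rw [map_mul, ← hσ, ← hτ]
  rfl

theorem inv (ht : TDef t) : TDef fun P v => (t P v)⁻¹ := by
  obtain ⟨τ, hτ⟩ := ht
  refine ⟨.func (L := groupLang) (l := 1) GroupFunc.inv ![τ], fun P v => ?_⟩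
  rw [map_inv, ← hτ]
  rfl

theorem one : TDef.{u} (ι := ι) fun _ _ => 1 :=
  ⟨.func (L := groupLang) (l := 0) GroupFunc.one Fin.elim0, fun P _ => (map_one P.q).symm⟩

theorem comap {ι' : Type} (ht : TDef t) (s : ι → ι') :
    TDef fun P (v : ι' → P.S) => t P fun i => v (s i) := by
  obtain ⟨τ, hτ⟩ := ht
  exact ⟨τ.relabel s, fun P v => by rw [FirstOrder.Language.Term.realize_relabel, ← hτ]; rfl⟩

end TDef

namespace UDef

open FirstOrder FirstOrder.Language

variable {K : Par.{u} → Prop} {ι J κ : Type}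
  {R R' : ∀ P : Par.{u}, (ι → P.S) → (J → P.PS) → Prop}

theorem congr (hR : UDef K R) (h : ∀ P, K P → ∀ v A, R P v A ↔ R' P v A) : UDef K R' := by
  obtain ⟨φ, hφ⟩ := hR
  exact ⟨φ, fun P hP v A a ha => (hφ P hP v A a ha).trans (h P hP v A)⟩

theorem not (hR : UDef K R) : UDef K fun P v A => ¬ R P v A := by
  obtain ⟨φ, hφ⟩ := hR
  exact ⟨φ.not, fun P hP v A a ha =>
    (BoundedFormula.realize_not).trans (not_congr (hφ P hP v A a ha))⟩

theorem and (hR : UDef K R) (hR' : UDef K R') : UDef K fun P v A => R P v A ∧ R' P v A := by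
  obtain ⟨φ, hφ⟩ := hR
  obtain ⟨ψ, hψ⟩ := hR'
  exact ⟨φ ⊓ ψ, fun P hP v A a ha =>
    (BoundedFormula.realize_inf).trans (and_congr (hφ P hP v A a ha) (hψ P hP v A a ha))⟩

theorem or (hR : UDef K R) (hR' : UDef K R') : UDef K fun P v A => R P v A ∨ R' P v A :=
  (hR.not.and hR'.not).not.congr fun _ _ _ _ => by tauto

theorem imp (hR : UDef K R) (hR' : UDef K R') : UDef K fun P v A => R P v A → R' P v A :=
  (hR.and hR'.not).not.congr fun _ _ _ _ => by tauto

theorem iff (hR : UDef K R) (hR' : UDef K R') : UDef K fun P v A => (R P v A ↔ R' P v A) :=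
  ((hR.imp hR').and (hR'.imp hR)).congr fun _ _ _ _ => by tauto

theorem forall_fin [Finite κ] {R : κ → ∀ P : Par.{u}, (ι → P.S) → (J → P.PS) → Prop}
    (hR : ∀ k, UDef K (R k)) : UDef K fun P v A => ∀ k, R k P v A := by
  choose φ hφ using hR
  exact ⟨Formula.iInf φ, fun P hP v A a ha =>
    (Formula.realize_iInf).trans (forall_congr' fun k => hφ k P hP v A a ha)⟩

theorem eq {s t : ∀ P : Par.{u}, (ι → P.S) → P.S} (hs : TDef s) (ht : TDef t) :
    UDef K fun P v (_ : J → P.PS) => P.q (s P v) = P.q (t P v) := by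
  obtain ⟨σ, hσ⟩ := hs
  obtain ⟨τ, hτ⟩ := ht
  refine ⟨(σ.relabel Sum.inl).equal (τ.relabel Sum.inl), fun P _ v A a _ => ?_⟩
  rw [Formula.realize_equal, Term.realize_relabel, Term.realize_relabel]
  have h : (Sum.elim (fun i => P.q (v i)) fun j => P.q (a j)) ∘ Sum.inl = fun i => P.q (v i) :=
    Sum.elim_comp_inl _ _
  rw [h, hσ, hτ]

theorem ex_perms [Finite κ] {R : ∀ P : Par.{u}, (κ → P.S) → (ι → P.S) → (J → P.PS) → Prop}
    (hR : UDef K fun P (v : κ ⊕ ι → P.S) A => R P (fun k => v (.inl k)) (fun i => v (.inr i)) A) :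
    UDef K fun P v A => ∃ f, R P f v A := by
  obtain ⟨φ, hφ⟩ := hR
  refine ⟨Formula.iExs κ (φ.relabel (Sum.elim (Sum.elim Sum.inr (Sum.inl ∘ Sum.inl))
    (Sum.inl ∘ Sum.inr) : (κ ⊕ ι) ⊕ J → (ι ⊕ J) ⊕ κ)), fun P hP v A a ha => ?_⟩
  rw [Formula.realize_iExs]
  have key : ∀ f : κ → P.S, Formula.Realize (φ.relabel (Sum.elim (Sum.elim Sum.inr
      (Sum.inl ∘ Sum.inl)) (Sum.inl ∘ Sum.inr) : (κ ⊕ ι) ⊕ J → (ι ⊕ J) ⊕ κ))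
      (Sum.elim (Sum.elim (fun i => P.q (v i)) fun j => P.q (a j)) fun k => P.q (f k)) ↔
      R P f v A := by
    intro f
    rw [Formula.realize_relabel]
    refine Iff.trans (iff_of_eq (congrArg (fun z => Formula.Realize φ z) ?_))
      (hφ P hP (Sum.elim f v) A a ha)
    funext x
    rcases x with (x | x) | x <;> rfl
  constructor
  · rintro ⟨g, hg⟩
    choose f hf using fun k => P.q_surjective (g k)
    exact ⟨f, (key f).1 (by simpa only [hf] using hg)⟩
  · rintro ⟨f, hf⟩
    exact ⟨fun k => P.q (f k), (key f).2 hf⟩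

/-- Every set has a code, and every element with trivial cube codes its own support; so quantifying
over sets is quantifying over elements with trivial cube. -/
theorem ex_sets [Finite κ] {R : ∀ P : Par.{u}, (κ → P.PS) → (ι → P.S) → (J → P.PS) → Prop}
    (hR : UDef K fun P v (A : κ ⊕ J → P.PS) => R P (fun k => A (.inl k)) v fun j => A (.inr j)) :
    UDef K fun P v A => ∃ B, R P B v A := by
  obtain ⟨φ, hφ⟩ := hR
  have hcube : UDef K fun P (f : κ ⊕ ι → P.S) (_ : J → P.PS) =>
      ∀ k, P.q (f (.inl k) * f (.inl k) * f (.inl k)) = P.q 1 :=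
    forall_fin fun k => eq (((TDef.var _).mul (TDef.var _)).mul (TDef.var _)) TDef.one
  have hφ' : UDef K fun P (f : κ ⊕ ι → P.S) (A : J → P.PS) =>
      (∀ k, P.q (f (.inl k) * f (.inl k) * f (.inl k)) = P.q 1) ∧
      ∃ B : κ → P.PS, (∀ k, Par.Codes (f (.inl k)) (B k).1) ∧
        R P B (fun i => f (.inr i)) A := by
    obtain ⟨ψ, hψ⟩ := hcube
    refine ⟨ψ ⊓ φ.relabel (Sum.elim (Sum.inl ∘ Sum.inr) (Sum.elim (Sum.inl ∘ Sum.inl) Sum.inr) :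
      ι ⊕ (κ ⊕ J) → (κ ⊕ ι) ⊕ J), fun P hP f A a ha => ?_⟩
    refine (BoundedFormula.realize_inf).trans (and_congr_right_iff.2 fun h => ?_) |>.trans
      (and_congr (hψ P hP f A a ha) Iff.rfl)
    have hc := (hψ P hP f A a ha).1 h
    have key : ∀ B : κ → P.PS, (∀ k, Par.Codes (f (.inl k)) (B k).1) →
        (Formula.Realize (φ.relabel (Sum.elim (Sum.inl ∘ Sum.inr)
          (Sum.elim (Sum.inl ∘ Sum.inl) Sum.inr) : ι ⊕ (κ ⊕ J) → (κ ⊕ ι) ⊕ J))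
          (Sum.elim (fun i => P.q (f i)) fun j => P.q (a j)) ↔
            R P B (fun i => f (.inr i)) A) := by
      intro B hB
      rw [Formula.realize_relabel]
      refine Iff.trans (iff_of_eq (congrArg (fun z => Formula.Realize φ z) ?_))
        (hφ P hP (fun i => f (.inr i)) (Sum.elim B A) (Sum.elim (fun k => f (.inl k)) a) ?_)
      · funext x
        rcases x with x | x | x <;> rfl
      · rintro (k | j)
        · exact hB k
        · exact ha j
    constructor
    · intro hr
      let B : κ → P.PS := fun k => ⟨{x | (f (.inl k)).1 x ≠ x}, (f (.inl k)).2⟩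
      have hB : ∀ k, Par.Codes (f (.inl k)) (B k).1 := fun k =>
        ⟨by rw [← map_mul, ← map_mul, hc k, map_one], Par.Sub.refl _, Par.Sub.refl _⟩
      exact ⟨B, hB, (key B hB).1 hr⟩
    · rintro ⟨B, hB, hr⟩
      exact (key B hB).2 hr
  refine (ex_perms (R := fun P (f : κ → P.S) v A => (∀ k, P.q (f k * f k * f k) = P.q 1) ∧
      ∃ B : κ → P.PS, (∀ k, Par.Codes (f k) (B k).1) ∧ R P B v A) hφ').congr
    fun P hP v A => ?_
  constructor
  · rintro ⟨f, -, B, -, hB⟩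
    exact ⟨B, hB⟩
  · rintro ⟨B, hB⟩
    choose f hf using fun k => Par.exists_code (B k)
    exact ⟨f, fun k => by rw [map_mul, map_mul, (hf k).cube, map_one], B, hf, hB⟩

theorem ex_perm {R : ∀ P : Par.{u}, P.S → (ι → P.S) → (J → P.PS) → Prop}
    (hR : UDef K fun P (v : Unit ⊕ ι → P.S) A => R P (v (.inl ())) (fun i => v (.inr i)) A) :
    UDef K fun P v A => ∃ f, R P f v A :=
  (ex_perms (κ := Unit) (R := fun P f v A => R P (f ()) v A) hR).congr fun _ _ _ _ =>
    ⟨fun ⟨f, hf⟩ => ⟨f (), hf⟩, fun ⟨f, hf⟩ => ⟨fun _ => f, hf⟩⟩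

theorem ex_set {R : ∀ P : Par.{u}, P.PS → (ι → P.S) → (J → P.PS) → Prop}
    (hR : UDef K fun P v (A : Unit ⊕ J → P.PS) => R P (A (.inl ())) v fun j => A (.inr j)) :
    UDef K fun P v A => ∃ B, R P B v A :=
  (ex_sets (κ := Unit) (R := fun P B v A => R P (B ()) v A) hR).congr fun _ _ _ _ =>
    ⟨fun ⟨f, hf⟩ => ⟨f (), hf⟩, fun ⟨f, hf⟩ => ⟨fun _ => f, hf⟩⟩

theorem all_perm {R : ∀ P : Par.{u}, P.S → (ι → P.S) → (J → P.PS) → Prop}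
    (hR : UDef K fun P (v : Unit ⊕ ι → P.S) A => R P (v (.inl ())) (fun i => v (.inr i)) A) :
    UDef K fun P v A => ∀ f, R P f v A :=
  (ex_perm (R := fun P f v A => ¬ R P f v A) hR.not).not.congr fun _ _ _ _ => not_exists_not

theorem all_set {R : ∀ P : Par.{u}, P.PS → (ι → P.S) → (J → P.PS) → Prop}
    (hR : UDef K fun P v (A : Unit ⊕ J → P.PS) => R P (A (.inl ())) v fun j => A (.inr j)) :
    UDef K fun P v A => ∀ B, R P B v A :=
  (ex_set (R := fun P B v A => ¬ R P B v A) hR.not).not.congr fun _ _ _ _ => not_exists_not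

/-- A relation may be defined in terms of arbitrary codes of its sets. -/
theorem of_codes {R' : ∀ P : Par.{u}, (ι ⊕ J → P.S) → (Empty → P.PS) → Prop} (hR : UDef K R')
    (h : ∀ P, K P → ∀ v A a, (∀ j, Par.Codes (a j) (A j).1) →
      (R' P (Sum.elim v a) (fun e => e.elim) ↔ R P v A)) : UDef K R := by
  obtain ⟨φ, hφ⟩ := hR
  refine ⟨φ.relabel (Sum.elim id Empty.elim : (ι ⊕ J) ⊕ Empty → ι ⊕ J), fun P hP v A a ha => ?_⟩
  rw [Formula.realize_relabel, ← h P hP v A a ha, ← hφ P hP (Sum.elim v a) _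
    (fun e => e.elim) fun e => e.elim]
  refine iff_of_eq (congrArg (fun z => Formula.Realize φ z) ?_)
  funext x
  rcases x with (x | x) | x
  · rfl
  · rfl
  · exact x.elim

/-- Change of variables. -/
theorem comap {ι' J' : Type} (hR : UDef K R) (s : ι → ι') (r : J → J') :
    UDef K fun P (v : ι' → P.S) (A : J' → P.PS) =>
      R P (fun i => v (s i)) fun j => A (r j) := by
  obtain ⟨φ, hφ⟩ := hR
  refine ⟨φ.relabel (Sum.map s r), fun P hP v A a ha => ?_⟩
  rw [Formula.realize_relabel]
  refine Iff.trans (iff_of_eq (congrArg (fun z => Formula.Realize φ z) ?_))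
    (hφ P hP (fun i => v (s i)) (fun j => A (r j)) (fun j => a (r j)) fun j => ha (r j))
  funext x
  rcases x with x | x <;> rfl

variable {s t : ∀ P : Par.{u}, (ι → P.S) → P.S}

theorem true : UDef K fun P (_ : ι → P.S) (_ : J → P.PS) => True :=
  (eq TDef.one TDef.one).congr fun _ _ _ _ => by simp

theorem separated (hs : TDef s) (ht : TDef t) :
    UDef K fun P v (_ : J → P.PS) => Par.Separated (P.q (s P v)) (P.q (t P v)) := by
  have lift : ∀ {t : ∀ P : Par.{u}, (ι → P.S) → P.S}, TDef t →
      TDef fun P (v : Unit ⊕ ι → P.S) => t P fun i => v (.inr i) := fun ⟨τ, hτ⟩ =>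
    ⟨τ.relabel Sum.inr, fun P v => by rw [Term.realize_relabel, ← hτ]; rfl⟩
  have lift' : ∀ {t : ∀ P : Par.{u}, (Unit ⊕ ι → P.S) → P.S}, TDef t →
      TDef fun P (v : Unit ⊕ (Unit ⊕ ι) → P.S) => t P fun i => v (.inr i) := fun ⟨τ, hτ⟩ =>
    ⟨τ.relabel Sum.inr, fun P v => by rw [Term.realize_relabel, ← hτ]; rfl⟩
  have h : UDef K fun P v (_ : J → P.PS) => ∀ u : P.S,
      P.q (u * t P v) = P.q (t P v * u) →
      (∀ x : P.S, P.q (x * t P v) = P.q (t P v * x) →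
        P.q (u * (x * u * x⁻¹)) = P.q ((x * u * x⁻¹) * u)) → P.q (s P v * u) = P.q (u * s P v) := by
    refine all_perm ((eq ((TDef.var _).mul (lift ht)) ((lift ht).mul (TDef.var _))).imp
      (((all_perm ((eq ((TDef.var _).mul (lift' (lift ht))) ((lift' (lift ht)).mul (TDef.var _))).imp
        (eq ?_ ?_)))).imp (eq ((lift hs).mul (TDef.var _)) ((TDef.var _).mul (lift hs)))))
    · exact (TDef.var _).mul (((TDef.var _).mul (TDef.var _)).mul (TDef.var _).inv)
    · exact (((TDef.var _).mul (TDef.var _)).mul (TDef.var _).inv).mul (TDef.var _)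
  refine h.congr fun P _ v A => ?_
  simp only [map_mul, map_inv]
  constructor
  · intro H u hu hx
    obtain ⟨u, rfl⟩ := P.q_surjective u
    exact H u hu fun x => hx (P.q x)
  · intro H u hu hx
    refine H _ hu fun x hxt => ?_
    obtain ⟨x, rfl⟩ := P.q_surjective x
    exact hx x hxt

theorem sub (i j : J) : UDef K fun P (_ : ι → P.S) (A : J → P.PS) => P.Sub (A i).1 (A j).1 := by
  have h : UDef K fun P (v : ι ⊕ J → P.S) (_ : Empty → P.PS) => ∀ b : P.S,
      P.q (b * b) = P.q 1 → Par.Separated (P.q (v (.inr j))) (P.q b) →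
        Par.Separated (P.q (v (.inr i))) (P.q b) :=
    all_perm ((eq ((TDef.var _).mul (TDef.var _)) TDef.one).imp
      ((separated (TDef.var _) (TDef.var _)).imp (separated (TDef.var _) (TDef.var _))))
  refine of_codes h fun P _ v A a ha => ?_
  rw [Par.sub_iff_forall (A i).2]
  refine forall_congr' fun b => ?_
  rw [map_mul, map_one]
  refine imp_congr_right fun hb => ?_
  exact imp_congr ((ha j).separated_iff hb) ((ha i).separated_iff hb)

/-- Two elements with trivial cube have the same support up to small sets exactly if they are
separated from the same involutions. -/
theorem codes (ht : TDef t) (i : J) : UDef K fun P v A => Par.Codes (t P v) (A i).1 := by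
  have lift : ∀ {t : ∀ P : Par.{u}, (ι → P.S) → P.S}, TDef t →
      TDef fun P (v : ι ⊕ J → P.S) => t P fun i => v (.inl i) := fun ⟨τ, hτ⟩ =>
    ⟨τ.relabel Sum.inl, fun P v => by rw [Term.realize_relabel, ← hτ]; rfl⟩
  have lift' : ∀ {t : ∀ P : Par.{u}, (ι ⊕ J → P.S) → P.S}, TDef t →
      TDef fun P (v : Unit ⊕ (ι ⊕ J) → P.S) => t P fun i => v (.inr i) := fun ⟨τ, hτ⟩ =>
    ⟨τ.relabel Sum.inr, fun P v => by rw [Term.realize_relabel, ← hτ]; rfl⟩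
  have h : UDef K fun P (v : ι ⊕ J → P.S) (_ : Empty → P.PS) =>
      P.q (t P (fun i => v (.inl i)) * t P (fun i => v (.inl i)) * t P (fun i => v (.inl i))) =
        P.q 1 ∧ ∀ b : P.S, P.q (b * b) = P.q 1 →
      (Par.Separated (P.q (v (.inr i))) (P.q b) ↔
        Par.Separated (P.q (t P (fun i => v (.inl i)))) (P.q b)) :=
    (eq (((lift ht).mul (lift ht)).mul (lift ht)) TDef.one).and
      (all_perm ((eq ((TDef.var _).mul (TDef.var _)) TDef.one).imp
      ((separated (TDef.var _) (TDef.var _)).iff (separated (lift' (lift ht)) (TDef.var _)))))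
  refine of_codes h fun P _ v A a ha => ?_
  simp only [map_mul, map_one, Sum.elim_inl, Sum.elim_inr]
  constructor
  · rintro ⟨h1, h2⟩
    have hc : Par.Codes (t P v) {x | (t P v).1 x ≠ x} := ⟨h1, Par.Sub.refl _, Par.Sub.refl _⟩
    refine hc.congr ?_ ?_
    · refine (Par.sub_iff_forall (t P v).2).2 fun b hb => ?_
      rw [← (ha i).separated_iff hb, ← hc.separated_iff hb]
      exact (h2 b hb).1
    · refine (Par.sub_iff_forall (A i).2).2 fun b hb => ?_
      rw [← (ha i).separated_iff hb, ← hc.separated_iff hb]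
      exact (h2 b hb).2
  · intro hc
    refine ⟨hc.cube, fun b hb => ?_⟩
    rw [(ha i).separated_iff hb, hc.separated_iff hb]

/-- Conjugating a code of `A` by `t` yields a code of the image of `A` under `t`. -/
theorem image (ht : TDef t) (i j : J) :
    UDef K fun P v A => P.Sub ((t P v).1 '' (A i).1) (A j).1 := by
  have lift : ∀ {t : ∀ P : Par.{u}, (ι → P.S) → P.S}, TDef t →
      TDef fun P (v : Unit ⊕ ι → P.S) => t P fun i => v (.inr i) := fun ⟨τ, hτ⟩ =>
    ⟨τ.relabel Sum.inr, fun P v => by rw [Term.realize_relabel, ← hτ]; rfl⟩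
  have h : UDef K fun P v A => ∃ a : P.S, Par.Codes a (A i).1 ∧ ∃ B : P.PS,
      Par.Codes (t P v * a * (t P v)⁻¹) B.1 ∧ P.Sub B.1 (A j).1 :=
    ex_perm ((codes (TDef.var _) _).and (ex_set ((codes
      (((lift ht).mul (TDef.var _)).mul (lift ht).inv) _).and (sub _ _))))
  refine h.congr fun P _ v A => ?_
  constructor
  · rintro ⟨a, ha, B, hB, hs⟩
    exact ((ha.conj (t P v)).sup.trans hB.sub).trans hs
  · intro hs
    obtain ⟨a, ha⟩ := Par.exists_code (A i)
    exact ⟨a, ha, ⟨(t P v).1 '' (A i).1, mk_image_le.trans_lt (A i).2⟩, ha.conj _, hs⟩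

theorem sm_ne (hs : TDef s) (ht : TDef t) (i : J) :
    UDef K fun P v A => P.Sm {x ∈ (A i).1 | (s P v).1 x ≠ (t P v).1 x} := by
  have h : UDef K fun P v A => ∀ C : P.PS, P.Sub C.1 (A i).1 →
      P.Sub (((s P v)⁻¹ * t P v : P.S).1 '' C.1) C.1 :=
    all_set ((sub _ _).imp (image (hs.inv.mul ht) _ _))
  refine h.congr fun P _ v A => ?_
  rw [← Par.sm_ne_iff]
  refine iff_of_eq (congrArg P.Sm ?_)
  ext x
  refine and_congr_right fun _ => not_congr ?_
  exact (Equiv.symm_apply_eq (s P v).1).trans eq_comm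

/-- The small sets are those almost contained in every set; the empty set is the decisive instance.
-/
theorem sm (i : J) : UDef K fun P (_ : ι → P.S) (A : J → P.PS) => P.Sm (A i).1 := by
  have h : UDef K fun P (_ : ι → P.S) (A : J → P.PS) => ∀ C : P.PS, P.Sub (A i).1 C.1 :=
    all_set (sub _ _)
  refine h.congr fun P _ v A => ?_
  constructor
  · intro H
    have := H ⟨∅, by rw [mk_eq_zero]; exact aleph0_pos.trans Par.aleph0_lt_lam⟩
    exact this.sm Par.Sm.empty
  · intro H C
    exact H.mono Set.sdiff_subset

end UDef

/-! ### Interpretations of many-sorted structures in the quotient groups -/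

/-- The elements of the sorts of the structures `M P` are represented by finite tuples of elements
of the groups and of sets of fewer than `lam` points; equality is definable. -/
structure Coding {L : MSLang} (K : Par.{u} → Prop) (M : Par.{u} → L.Str) where
  p : L.Sort' → Type
  r : L.Sort' → Type
  fin_p : ∀ s, Finite (p s)
  fin_r : ∀ s, Finite (r s)
  C : ∀ (P : Par.{u}) (s : L.Sort'), (p s → P.S) → (r s → P.PS) → (M P).carrier s → Prop
  functional : ∀ {P}, K P → ∀ {s v A x y}, C P s v A x → C P s v A y → x = y
  surjective : ∀ {P}, K P → ∀ {s} (x : (M P).carrier s), ∃ v A, C P s v A x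
  equal : ∀ s, UDef K fun P (v : p s ⊕ p s → P.S) (A : r s ⊕ r s → P.PS) =>
    ∃ x, C P s (fun k => v (.inl k)) (fun k => A (.inl k)) x ∧
      C P s (fun k => v (.inr k)) (fun k => A (.inr k)) x

namespace Coding

variable {L : MSLang} {K : Par.{u} → Prop} {M : Par.{u} → L.Str} (c : Coding K M)

attribute [instance] fin_p fin_r

/-- The relation is definable in terms of codes. -/
def Rep {I : Type} (s : I → L.Sort') (R : ∀ P, (∀ i, (M P).carrier (s i)) → Prop) : Prop :=
  ∃ R' : ∀ P : Par.{u}, ((Σ i, c.p (s i)) → P.S) → ((Σ i, c.r (s i)) → P.PS) → Prop, UDef K R' ∧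
    ∀ P, K P → ∀ v A x, (∀ i, c.C P (s i) (fun k => v ⟨i, k⟩) (fun k => A ⟨i, k⟩) (x i)) →
      (R' P v A ↔ R P x)

namespace Rep

variable {c} {I J : Type} {s : I → L.Sort'} {R R' : ∀ P, (∀ i, (M P).carrier (s i)) → Prop}

theorem congr (hR : c.Rep s R) (h : ∀ P x, R P x ↔ R' P x) : c.Rep s R' := by
  obtain ⟨R₀, h₀, h₁⟩ := hR
  exact ⟨R₀, h₀, fun P hP v A x hx => (h₁ P hP v A x hx).trans (h P x)⟩

theorem falsum : c.Rep s fun _ _ => False :=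
  ⟨fun _ _ _ => ¬ True, UDef.true.not, fun _ _ _ _ _ _ => by simp⟩

theorem imp (hR : c.Rep s R) (hR' : c.Rep s R') : c.Rep s fun P x => R P x → R' P x := by
  obtain ⟨R₀, h₀, h₁⟩ := hR
  obtain ⟨R₂, h₂, h₃⟩ := hR'
  exact ⟨_, h₀.imp h₂, fun P hP v A x hx => imp_congr (h₁ P hP v A x hx) (h₃ P hP v A x hx)⟩

theorem not (hR : c.Rep s R) : c.Rep s fun P x => ¬ R P x := hR.imp falsum

theorem and (hR : c.Rep s R) (hR' : c.Rep s R') : c.Rep s fun P x => R P x ∧ R' P x :=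
  (hR.imp hR'.not).not.congr fun P x => by tauto

theorem forall_fin [Finite J] {R : J → ∀ P, (∀ i, (M P).carrier (s i)) → Prop}
    (hR : ∀ j, c.Rep s (R j)) : c.Rep s fun P x => ∀ j, R j P x := by
  choose R₀ h₀ h₁ using hR
  exact ⟨_, UDef.forall_fin h₀, fun P hP v A x hx => forall_congr' fun j => h₁ j P hP v A x hx⟩

theorem comap (hR : c.Rep s R) (s' : J → L.Sort') (f : I → J) (e : ∀ i, s' (f i) = s i) :
    c.Rep s' fun P x => R P fun i => cast (congrArg _ (e i)) (x (f i)) := by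
  obtain rfl : s = fun i => s' (f i) := funext fun i => (e i).symm
  obtain ⟨R₀, h₀, h₁⟩ := hR
  exact ⟨_, h₀.comap (fun k => ⟨f k.1, k.2⟩) (fun k => ⟨f k.1, k.2⟩),
    fun P hP v A x hx => h₁ P hP _ _ _ fun i => hx (f i)⟩

theorem ex [Finite J] {s' : J → L.Sort'}
    {R : ∀ P, (∀ j, (M P).carrier (s' j)) → (∀ i, (M P).carrier (s i)) → Prop}
    (hR : c.Rep (Sum.elim s' s) fun P x => R P (fun j => x (Sum.inl j)) fun i => x (Sum.inr i)) :
    c.Rep s fun P x => ∃ y, R P y x := by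
  obtain ⟨R₀, h₀, h₁⟩ := hR
  refine ⟨fun P v A => ∃ f : (Σ j, c.p (s' j)) → P.S, ∃ B : (Σ j, c.r (s' j)) → P.PS,
    -- Asking for an element coded twice by the same tuple says only that the tuple is a code; in
    -- this form it is an instance of the definable relation `c.equal`.
    (∀ j, ∃ x, c.C P (s' j) (fun k => f ⟨j, k⟩) (fun k => B ⟨j, k⟩) x ∧
      c.C P (s' j) (fun k => f ⟨j, k⟩) (fun k => B ⟨j, k⟩) x) ∧
    R₀ P (fun k => match k with
        | ⟨.inl j, k⟩ => f ⟨j, k⟩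
        | ⟨Sum.inr i, k⟩ => v ⟨i, k⟩) (fun k => match k with
        | ⟨.inl j, k⟩ => B ⟨j, k⟩
        | ⟨Sum.inr i, k⟩ => A ⟨i, k⟩), ?_, fun P hP v A x hx => ?_⟩
  · refine UDef.ex_perms (UDef.ex_sets (UDef.and (UDef.forall_fin fun j =>
      (c.equal (s' j)).comap
        (Sum.elim (fun k => Sum.inl (Sigma.mk j k)) (fun k => Sum.inl (Sigma.mk j k)) :
          _ → (Σ j, c.p (s' j)) ⊕ (Σ i, c.p (s i)))
        (Sum.elim (fun k => Sum.inl (Sigma.mk j k)) (fun k => Sum.inl (Sigma.mk j k)) :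
          _ → (Σ j, c.r (s' j)) ⊕ (Σ i, c.r (s i)))) ?_))
    refine (h₀.comap (fun k => match k with
        | ⟨.inl j, k⟩ => Sum.inl ⟨j, k⟩
        | ⟨Sum.inr i, k⟩ => Sum.inr ⟨i, k⟩) (fun k => match k with
        | ⟨.inl j, k⟩ => Sum.inl ⟨j, k⟩
        | ⟨Sum.inr i, k⟩ => Sum.inr ⟨i, k⟩)).congr fun P hP v A => iff_of_eq ?_
    congr 1
    · funext k
      rcases k with ⟨j | i, k⟩ <;> rfl
    · funext k
      rcases k with ⟨j | i, k⟩ <;> rfl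
  · constructor
    · rintro ⟨f, B, h2, h3⟩
      choose y hy using fun j => h2 j
      refine ⟨y, (h₁ P hP _ _ (fun k => match k with
        | Sum.inl j => y j
        | Sum.inr i => x i) ?_).1 h3⟩
      rintro (j | i)
      · exact (hy j).1
      · exact hx i
    · rintro ⟨y, hy⟩
      choose f B hfB using fun j => c.surjective hP (y j)
      refine ⟨fun k => f k.1 k.2, fun k => B k.1 k.2, fun j => ⟨y j, hfB j, hfB j⟩,
        (h₁ P hP _ _ (fun k => match k with
        | Sum.inl j => y j
        | Sum.inr i => x i) ?_).2 hy⟩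
      rintro (j | i)
      · exact hfB j
      · exact hx i

theorem eq (a : L.Sort') (i j : I) (hi : s i = a) (hj : s j = a) : c.Rep s fun P x =>
    (cast (congrArg _ hi) (x i) : (M P).carrier a) = cast (congrArg _ hj) (x j) := by
  subst hi
  have h : c.Rep (I := Bool) (fun _ => s i) fun P x => x true = x false := by
    refine ⟨_, (c.equal (s i)).comap (Sum.elim (fun k => ⟨true, k⟩) fun k => ⟨false, k⟩)
      (Sum.elim (fun k => ⟨true, k⟩) fun k => ⟨false, k⟩), fun P hP v A x hx => ?_⟩
    constructor
    · rintro ⟨y, h1, h2⟩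
      exact (c.functional hP (hx true) h1).trans (c.functional hP h2 (hx false))
    · intro h
      exact ⟨x true, hx true, h ▸ hx false⟩
  exact h.comap _ (fun b => if b then i else j) (by rintro (_ | _) <;> simp [hj])

end Rep

/-- The symbols of the signature are definable in terms of codes. -/
structure Interprets : Prop where
  func : ∀ f : L.Func, c.Rep (Sum.elim (L.dom f).get fun _ : Unit => L.cod f)
    fun P x => (M P).func f (fun i => x (Sum.inl i)) = x (Sum.inr ())
  rel : ∀ R : L.Rel, c.Rep (L.ar R).get fun P x => (M P).rel R x

namespace Interprets

variable {c} (hc : c.Interprets)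
include hc

theorem term {Γ : List L.Sort'} {a : L.Sort'} (t : L.Term Γ a) :
    c.Rep (Sum.elim Γ.get fun _ : Unit => a)
      fun P x => t.val (M P) (fun i => x (Sum.inl i)) = x (Sum.inr ()) := by
  induction t with
  | var i => exact Rep.eq (Γ.get i) (Sum.inl i) (Sum.inr ()) rfl rfl
  | app f ts ih =>
    refine (Rep.ex (s' := (L.dom f).get) (R := fun P y x =>
      (∀ i, (ts i).val (M P) (fun i => x (Sum.inl i)) = y i) ∧ (M P).func f y = x (Sum.inr ()))
      (Rep.and (Rep.forall_fin fun i => ?_) ?_)).congr fun P x => ?_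
    · exact (ih i).comap _ (Sum.elim (fun k => Sum.inr (Sum.inl k)) fun _ => Sum.inl i)
        (by rintro (k | k) <;> rfl)
    · exact (hc.func f).comap _ (Sum.elim (fun k => Sum.inl k) fun _ => Sum.inr (Sum.inr ()))
        (by rintro (k | k) <;> rfl)
    · constructor
      · rintro ⟨y, h1, h2⟩
        obtain rfl : (fun i => (ts i).val (M P) fun i => x (Sum.inl i)) = y := funext h1
        exact h2
      · exact fun h => ⟨_, fun i => rfl, h⟩

theorem formula {Γ : List L.Sort'} (φ : L.Formula Γ) :
    c.Rep Γ.get fun P x => φ.Sat (M P) x := by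
  induction φ with
  | falsum => exact Rep.falsum
  | @equal Γ a t₁ t₂ =>
    refine (Rep.ex (s' := fun _ : Unit => a) (R := fun P y x =>
      t₁.val (M P) x = y () ∧ t₂.val (M P) x = y ()) (Rep.and ?_ ?_)).congr fun P x => ?_
    · exact (hc.term t₁).comap _ (Sum.elim (fun k => Sum.inr k) fun _ => Sum.inl ())
        (by rintro (k | k) <;> rfl)
    · exact (hc.term t₂).comap _ (Sum.elim (fun k => Sum.inr k) fun _ => Sum.inl ())
        (by rintro (k | k) <;> rfl)
    · exact ⟨fun ⟨y, h1, h2⟩ => h1.trans h2.symm, fun h => ⟨fun _ => _, h, rfl⟩⟩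
  | @rel Γ R ts =>
    refine (Rep.ex (s' := (L.ar R).get) (R := fun P y x =>
      (∀ i, (ts i).val (M P) x = y i) ∧ (M P).rel R y)
      (Rep.and (Rep.forall_fin fun i => ?_) ?_)).congr fun P x => ?_
    · exact (hc.term (ts i)).comap _ (Sum.elim (fun k => Sum.inr k) fun _ => Sum.inl i)
        (by rintro (k | k) <;> rfl)
    · exact (hc.rel R).comap _ (fun k => Sum.inl k) fun _ => rfl
    · constructor
      · rintro ⟨y, h1, h2⟩
        obtain rfl : (fun i => (ts i).val (M P) x) = y := funext h1
        exact h2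
      · exact fun h => ⟨_, fun i => rfl, h⟩
  | imp _ _ h1 h2 => exact h1.imp h2
  | @all Γ a φ ih =>
    refine (Rep.ex (s' := fun _ : Unit => a) (R := fun P y x =>
      ¬ φ.Sat (M P) (MSLang.Str.Env.cons (y ()) x)) (Rep.not ?_)).not.congr fun P x => ?_
    · refine (ih.comap _ (fun i : Fin (Γ.length + 1) => Fin.cases (motive := fun _ => Unit ⊕ Fin Γ.length)
        (Sum.inl ()) (fun k => Sum.inr k) i) fun i => ?_).congr fun P x => iff_of_eq (congrArg _ ?_)
      · refine Fin.cases ?_ (fun k => ?_) i <;> rfl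
      · funext i
        refine Fin.cases ?_ (fun k => ?_) i <;> rfl
    · constructor
      · intro h y
        by_contra hy
        exact h ⟨fun _ => y, hy⟩
      · rintro h ⟨y, hy⟩
        exact hy (h _)

open FirstOrder FirstOrder.Language in
theorem exists_sentence (φ : L.Formula []) : ∃ ψ : groupLang.Sentence, ∀ P, K P →
    (P.G ⊨ ψ ↔ φ.Sat (M P) fun i => i.elim0) := by
  obtain ⟨R, ⟨ψ, hψ⟩, hR⟩ := hc.formula φ
  refine ⟨ψ.relabel (Sum.elim (fun k => k.1.elim0) fun k => k.1.elim0), fun P hP => ?_⟩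
  refine Iff.trans ?_ ((hψ P hP (fun k => k.1.elim0) (fun k => k.1.elim0) (fun k => k.1.elim0)
    fun k => k.1.elim0).trans (hR P hP _ _ _ fun i => i.elim0))
  refine Formula.realize_relabel.trans (iff_of_eq (congrArg (fun z => Formula.Realize ψ z) ?_))
  funext k
  rcases k with k | k <;> exact k.1.elim0

end Interprets

end Coding

/-! ### The points of a given type -/

section TypePoints

variable {n : ℕ} {E : Type u}

open OrbitType

/-- The points whose orbit has type `t`. -/
def tyPts (f : Fin n → Equiv.Perm E) (t : OrbitType n) : Set E :=
  {x | ∃ j, IsChart f t j ∧ x ∈ Set.range j}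

variable {f : Fin n → Equiv.Perm E} {t t' : OrbitType n}

theorem OrbitType.IsChart.range_subset_tyPts {j : t.pts → E} (h : IsChart f t j) :
    Set.range j ⊆ tyPts f t := fun _ hx => ⟨j, h, hx⟩

theorem tyPts_inv : InvSet f (tyPts f t) := by
  intro i x
  constructor
  · rintro ⟨j, hj, hx⟩
    exact ⟨j, hj, (hj.range_inv i x).1 hx⟩
  · rintro ⟨j, hj, hx⟩
    exact ⟨j, hj, (hj.range_inv i x).2 hx⟩

theorem tyPts_unique {x : E} (h : x ∈ tyPts f t) (h' : x ∈ tyPts f t') : t = t' := by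
  obtain ⟨j, hj, a, rfl⟩ := h
  obtain ⟨j', hj', b, hb⟩ := h'
  exact hj.type_eq hj' hb.symm

theorem exists_mem_tyPts (f : Fin n → Equiv.Perm E) (x : E) : ∃ t, x ∈ tyPts f t := by
  obtain ⟨t, j, hj, hx⟩ := exists_chart f x
  exact ⟨t, j, hj, hx⟩

theorem mk_tyPts (f : Fin n → Equiv.Perm E) (t : OrbitType n) :
    #(tyPts f t) = t.deg * #(orbs f t) := by
  have e : (orbs f t × t.pts) ≃ tyPts f t := Equiv.ofBijective
    (fun p => ⟨orbChart p.1 p.2, _, orbChart_spec p.1, p.2, rfl⟩) ⟨by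
      rintro ⟨O, a⟩ ⟨O', a'⟩ h
      have := orbChart_inj (congrArg Subtype.val h)
      simpa using this, by
      rintro ⟨_, j, hj, a, rfl⟩
      have hm : j a ∈ Set.range (orbChart (⟨_, j, hj, rfl⟩ : orbs f t)) := by
        rw [range_orbChart]; exact ⟨a, rfl⟩
      obtain ⟨b, hb⟩ := hm
      exact ⟨⟨_, b⟩, Subtype.ext hb⟩⟩
  have h := e.cardinal_eq
  rw [mk_prod, mul_comm] at h
  rw [deg, ← h]
  simp

theorem mem_tyPts_iff_mem_core {Z : Prop} {x : E} (hx : x ∈ tyPts f t) :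
    x ∈ core Z f ↔ (Z → ¬ t.IsTrivial) := by
  obtain ⟨j, hj, a, rfl⟩ := hx
  exact IsChart.mem_core_iff hj a

theorem exists_inv_superset (f : Fin n → Equiv.Perm E) (B : Set E) :
    ∃ B', B ⊆ B' ∧ InvSet f B' ∧ #B' ≤ #B * ℵ₀ ∧ ∀ Y, InvSet f Y → B ⊆ Y → B' ⊆ Y := by
  refine ⟨⋃ x : B, orb f x, fun x hx => Set.mem_iUnion.2 ⟨⟨x, hx⟩, mem_orb_self f x⟩, ?_, ?_, ?_⟩
  · intro i x
    simp only [Set.mem_iUnion]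
    exact exists_congr fun y => orb_inv f y i x
  · refine (mk_iUnion_le _).trans ?_
    gcongr
    refine ciSup_le' fun x => ?_
    exact mk_le_aleph0_iff.2 (orb_countable f x).to_subtype
  · intro Y hY hB
    exact Set.iUnion_subset fun x => orb_subset hY (hB x.2)

end TypePoints

/-! ### Almost invariant sets and the types of their points -/

namespace Par

variable {P : Par.{u}} {m n : ℕ}

/-- The underlying permutations of a tuple. -/
abbrev val (f : Fin n → P.S) : Fin n → Equiv.Perm P.X := fun i => (f i).1

/-- The set is invariant under the members of the tuple up to small sets. -/
def AInv (f : Fin n → P.S) (A : Set P.X) : Prop :=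
  ∀ i, P.Sub ((f i).1 '' A) A ∧ P.Sub ((f i)⁻¹.1 '' A) A

/-- Orbits are countable. This is the point where uncountability of `κ` is used; for `κ = ℵ₀` a
finite set may have an infinite saturation. -/
theorem Sm.saturate (hκ : ℵ₀ < P.κ) (f : Fin n → P.S) {B : Set P.X} (hB : P.Sm B) :
    ∃ B', B ⊆ B' ∧ InvSet (val f) B' ∧ P.Sm B' := by
  obtain ⟨B', h1, h2, h3, -⟩ := exists_inv_superset (val f) B
  exact ⟨B', h1, h2, h3.trans_lt (mul_lt_of_lt P.hκ hB hκ)⟩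

theorem AInv.of_inv {f : Fin n → P.S} {A : Set P.X} (h : InvSet (val f) A) : AInv f A := by
  refine fun i => ⟨Sub.of_subset ?_, Sub.of_subset ?_⟩
  · rintro _ ⟨x, hx, rfl⟩
    exact (h i x).2 hx
  · rintro _ ⟨x, hx, rfl⟩
    exact (h.symm_mem i x).2 hx

/-- A set that is almost invariant contains an invariant set up to a small set. -/
theorem AInv.exists_inv (hκ : ℵ₀ < P.κ) {f : Fin n → P.S} {A M : Set P.X} (hA : AInv f A)
    (hM : P.Sm M) :
    ∃ A' ⊆ A, InvSet (val f) A' ∧ P.Sm (A \ A') ∧ Disjoint A' M := by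
  -- The points of `A` that a generator or its inverse sends outside `A`; removing the saturation of
  -- these and of `M` leaves an invariant set.
  have hbad : P.Sm ((⋃ i, (f i).1 ⁻¹' ((f i).1 '' A \ A)) ∪
      (⋃ i, (f i)⁻¹.1 ⁻¹' ((f i)⁻¹.1 '' A \ A))) :=
    (Sm.iUnion_fin fun i => Sm.preimage (hA i).1 _).union
      (Sm.iUnion_fin fun i => Sm.preimage (hA i).2 _)
  obtain ⟨B, hB, hBi, hBs⟩ := Sm.saturate hκ f (hbad.union hM)
  refine ⟨A \ B, Set.sdiff_subset, ?_, ?_, ?_⟩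
  · have h1 : ∀ i, ∀ x ∈ A \ B, (f i).1 x ∈ A \ B := by
      rintro i x ⟨hx, hxB⟩
      refine ⟨?_, fun h => hxB ((hBi i x).1 h)⟩
      by_contra h
      exact hxB (hB (Or.inl (Or.inl (Set.mem_iUnion.2 ⟨i, ⟨x, hx, rfl⟩, h⟩))))
    have h2 : ∀ i, ∀ x ∈ A \ B, (f i)⁻¹.1 x ∈ A \ B := by
      rintro i x ⟨hx, hxB⟩
      refine ⟨?_, fun h => hxB ((hBi.symm_mem i x).1 h)⟩
      by_contra h
      exact hxB (hB (Or.inl (Or.inr (Set.mem_iUnion.2 ⟨i, ⟨x, hx, rfl⟩, h⟩))))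
    intro i x
    refine ⟨fun h => ?_, h1 i x⟩
    have := h2 i _ h
    rwa [show (f i)⁻¹.1 (val f i x) = x from (f i).1.symm_apply_apply x] at this
  · exact hBs.mono fun x hx => by
      by_contra h
      exact hx.2 ⟨hx.1, h⟩
  · exact Set.disjoint_left.2 fun x hx hxM => hx.2 (hB (Or.inr hxM))

/-- A non-small almost invariant set consisting, up to a small set, of points of type `t`. -/
structure OfType (f : Fin n → P.S) (A : Set P.X) (t : OrbitType n) : Prop where
  not_sm : ¬ P.Sm A
  ainv : AInv f A
  sub : P.Sub A (tyPts (val f) t)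

open OrbitType

theorem OfType.exists_inv (hκ : ℵ₀ < P.κ) {f : Fin n → P.S} {A M : Set P.X} {t : OrbitType n}
    (h : OfType f A t) (hM : P.Sm M) : ∃ A' ⊆ A, InvSet (val f) A' ∧ P.Sm (A \ A') ∧
      Disjoint A' M ∧ A' ⊆ tyPts (val f) t ∧ ¬ P.Sm A' := by
  obtain ⟨A', h1, h2, h3, h4⟩ := h.ainv.exists_inv hκ (hM.union h.sub)
  rw [Set.disjoint_union_right] at h4
  refine ⟨A', h1, h2, h3, h4.1, fun x hx => ?_, fun hs => h.not_sm ?_⟩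
  · by_contra hxt
    exact Set.disjoint_left.1 h4.2 hx ⟨h1 hx, hxt⟩
  · exact (h3.union hs).mono fun x hx => by
      by_cases hx' : x ∈ A'
      · exact Or.inr hx'
      · exact Or.inl ⟨hx, hx'⟩

theorem OfType.exists_chart (hκ : ℵ₀ < P.κ) {f : Fin n → P.S} {A M : Set P.X} {t : OrbitType n}
    (h : OfType f A t) (hM : P.Sm M) :
    ∃ j, IsChart (val f) t j ∧ Set.range j ⊆ A ∧ Disjoint (Set.range j) M := by
  obtain ⟨A', h1, h2, h3, h4, h5, h6⟩ := h.exists_inv hκ hM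
  obtain ⟨x, hx⟩ : A'.Nonempty := by
    by_contra hne
    rw [Set.not_nonempty_iff_eq_empty.1 hne] at h6
    exact h6 Sm.empty
  obtain ⟨j, hj, a, rfl⟩ := h5 hx
  have hr := hj.range_subset h2 hx
  exact ⟨j, hj, hr.trans h1, h4.mono_left hr⟩

theorem OfType.unique (hκ : ℵ₀ < P.κ) {f : Fin n → P.S} {A : Set P.X} {t t' : OrbitType n}
    (h : OfType f A t) (h' : OfType f A t') : t = t' := by
  obtain ⟨j, hj, hjA, hjM⟩ := h.exists_chart hκ h'.sub
  obtain ⟨a⟩ : Nonempty t.pts := t.rep.nonempty.to_subtype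
  refine tyPts_unique (hj.range_subset_tyPts ⟨a, rfl⟩) ?_
  by_contra hcon
  exact Set.disjoint_left.1 hjM ⟨a, rfl⟩ ⟨hjA ⟨a, rfl⟩, hcon⟩

/-- Outside any given small set `A` contains a complete orbit of type `t`. A property that fails on
a small part of `A` only thus holds on all of `A_t`. -/
theorem OfType.sm_ne_iff (hκ : ℵ₀ < P.κ) {f : Fin n → P.S} {A : Set P.X} {t : OrbitType n}
    (h : OfType f A t) (p : P.X → Prop) (q : t.pts → Prop)
    (hpq : ∀ j, IsChart (val f) t j → ∀ a, p (j a) ↔ q a) :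
    P.Sm {x ∈ A | ¬ p x} ↔ ∀ a, q a := by
  constructor
  · intro hs a
    obtain ⟨j, hj, hjA, hjM⟩ := h.exists_chart hκ hs
    rw [← hpq j hj]
    by_contra hcon
    exact Set.disjoint_left.1 hjM ⟨a, rfl⟩ ⟨hjA ⟨a, rfl⟩, hcon⟩
  · intro hq
    refine Sm.mono h.sub ?_
    rintro x ⟨hx, hxp⟩
    refine ⟨hx, ?_⟩
    rintro ⟨j, hj, a, rfl⟩
    exact hxp ((hpq j hj a).2 (hq a))

/-- Two tuples agree on non-small almost invariant subsets of `A` and `A'`, up to conjugation. -/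
def Common (f : Fin n → P.S) (A : Set P.X) (f' : Fin n → P.S) (A' : Set P.X) : Prop :=
  ∃ W : P.PS, ∃ g : P.S, ¬ P.Sm W.1 ∧ P.Sub W.1 A ∧ AInv f W.1 ∧ P.Sub (g.1 '' W.1) A' ∧
    ∀ i, P.Sm {x ∈ W.1 | (g * f i).1 x ≠ (f' i * g).1 x}

/-- Once the saturation of all exceptional points is removed from `W`, the permutation `g` maps each
remaining orbit of `f` equivariantly onto an orbit of `f'`. -/
theorem Common.exists_charts (hκ : ℵ₀ < P.κ) {f f' : Fin n → P.S} {A A' M M' : Set P.X}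
    (h : Common f A f' A') (hM : P.Sm M) (hM' : P.Sm M') : ∃ t j j', IsChart (val f) t j ∧
      IsChart (val f') t j' ∧ Set.range j ⊆ A \ M ∧ Set.range j' ⊆ A' \ M' := by
  obtain ⟨W, g, h1, h2, h3, h4, h5⟩ := h
  obtain ⟨W', hW1, hW2, hW3, hW4⟩ := h3.exists_inv hκ (((hM.union h2).union
    (Sm.preimage (hM'.union h4) g.1)).union (Sm.iUnion_fin h5))
  obtain ⟨x, hx⟩ : W'.Nonempty := by
    by_contra hne
    rw [Set.not_nonempty_iff_eq_empty.1 hne, Set.sdiff_empty] at hW3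
    exact h1 hW3
  obtain ⟨t, j, hj, hxj⟩ := OrbitType.exists_chart (val f) x
  obtain ⟨a, rfl⟩ := hxj
  have hr := hj.range_subset hW2 hx
  have hd : ∀ y ∈ Set.range j, y ∈ W.1 ∧ (y ∉ M ∧ y ∉ W.1 \ A) ∧
      (g.1 y ∉ M' ∧ g.1 y ∉ g.1 '' W.1 \ A') ∧
      ∀ i, (g * f i).1 y = (f' i * g).1 y := by
    intro y hy
    have h6 := Set.disjoint_left.1 hW4 (hr hy)
    simp only [Set.mem_union, Set.mem_preimage, not_or] at h6
    refine ⟨hW1 (hr hy), h6.1.1, h6.1.2, fun i => ?_⟩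
    by_contra hne
    exact h6.2 (Set.mem_iUnion.2 ⟨i, hW1 (hr hy), hne⟩)
  refine ⟨t, j, g.1 ∘ j, hj, ⟨g.1.injective.comp hj.inj, fun i a => ?_⟩, fun y hy => ?_, ?_⟩
  · rw [Function.comp_apply, hj.map]
    exact (hd _ ⟨a, rfl⟩).2.2.2 i
  · obtain ⟨h6, h7, -⟩ := hd y hy
    exact ⟨by by_contra h8; exact h7.2 ⟨h6, h8⟩, h7.1⟩
  · rintro _ ⟨b, rfl⟩
    obtain ⟨h6, -, h7, -⟩ := hd _ ⟨b, rfl⟩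
    exact ⟨by by_contra h8; exact h7.2 ⟨⟨_, h6, rfl⟩, h8⟩, h7.1⟩

/-- A family of `κ` disjoint orbits of type `t`, with a large complement. -/
structure Family (f : Fin n → P.S) (A : Set P.X) (t : OrbitType n)
    (j : P.κ.out × t.pts → P.X) : Prop where
  inj : Function.Injective j
  chart : ∀ a, IsChart (val f) t fun b => j (a, b)
  sub : ∀ x, j x ∈ A
  compl : P.κ ≤ #((Set.range j)ᶜ : Set P.X)

theorem mk_family (hκ : ℵ₀ < P.κ) (t : OrbitType n) : #(P.κ.out × t.pts) = P.κ := by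
  have h1 : #(P.κ.out × t.pts) = P.κ * t.deg := by
    rw [mk_prod, OrbitType.deg]; simp
  rw [h1]
  refine mul_eq_left P.hκ ?_ (one_pos.trans_le t.one_le_deg).ne'
  refine le_trans ?_ hκ.le
  rw [OrbitType.deg, lift_le_aleph0]
  exact mk_le_aleph0

theorem le_mk_orbs (hκ : ℵ₀ < P.κ) {f : Fin n → P.S} {t : OrbitType n} {Q : Set (orbs (val f) t)}
    (h : P.κ ≤ #(⋃ O ∈ Q, (O : Set P.X) : Set P.X)) : P.κ ≤ #Q := by
  by_contra hQ
  rw [not_le] at hQ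
  refine absurd h (not_le.2 ?_)
  rw [Set.biUnion_eq_iUnion]
  refine (mk_iUnion_le _).trans_lt (mul_lt_of_lt P.hκ hQ ?_)
  refine lt_of_le_of_lt (ciSup_le' fun O => ?_) hκ
  rw [← range_orbChart]
  exact mk_le_aleph0_iff.2 (Set.countable_range _).to_subtype

theorem OfType.exists_family (hκ : ℵ₀ < P.κ) {f : Fin n → P.S} {A : Set P.X} {t : OrbitType n}
    (h : OfType f A t) : ∃ j, Family f A t j := by
  obtain ⟨A', h1, h2, -, -, h5, h6⟩ := h.exists_inv hκ Sm.empty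
  let Q : Set (orbs (val f) t) := {O | (O : Set P.X) ⊆ A'}
  have hQ : P.κ ≤ #Q := by
    refine le_mk_orbs hκ ((not_lt.1 h6).trans (mk_le_mk_of_subset fun x hx => ?_))
    obtain ⟨j, hj, a, rfl⟩ := h5 hx
    exact Set.mem_biUnion (x := (⟨_, j, hj, rfl⟩ : orbs (val f) t))
      (hj.range_subset h2 hx) ⟨a, rfl⟩
  -- Twice `κ` orbits are chosen: one half forms the family, the other half keeps its complement
  -- large enough for `exists_perm_of_injective`.
  have hs : #(P.κ.out ⊕ P.κ.out) ≤ #Q := by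
    rw [mk_sum, lift_id, mk_out, add_eq_self P.hκ]; exact hQ
  obtain ⟨ε⟩ := hs
  have hinj : ∀ {x y : P.κ.out ⊕ P.κ.out} {a b : t.pts},
      orbChart (ε x).1 a = orbChart (ε y).1 b → x = y ∧ a = b := by
    intro x y a b hxy
    have := orbChart_inj hxy
    simp only [Sigma.mk.injEq, heq_eq_eq, Prod.mk.injEq, true_and] at this
    exact ⟨ε.injective (Subtype.ext this.1), this.2⟩
  refine ⟨fun x => orbChart (ε (.inl x.1)).1 x.2, ?_, fun a => orbChart_spec (ε (.inl a)).1, ?_, ?_⟩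
  · rintro ⟨a, b⟩ ⟨c, d⟩ hac
    obtain ⟨h7, h8⟩ := hinj hac
    exact Prod.ext (Sum.inl_injective h7) h8
  · rintro ⟨a, b⟩
    exact h1 ((ε (.inl a)).2 (orbChart_mem _ b))
  · obtain ⟨b⟩ : Nonempty t.pts := t.rep.nonempty.to_subtype
    have hk : #P.κ.out ≤ #((Set.range fun x : P.κ.out × t.pts =>
        orbChart (ε (.inl x.1)).1 x.2)ᶜ : Set P.X) := by
      refine mk_le_of_injective (f := fun a => ⟨orbChart (ε (.inr a)).1 b, ?_⟩) ?_
      · rintro ⟨⟨c, d⟩, hcd⟩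
        exact Sum.inl_ne_inr (hinj hcd).1
      · intro a c hac
        exact Sum.inr_injective (hinj (congrArg Subtype.val hac)).1
    rwa [mk_out] at hk

theorem Family.common (hκ : ℵ₀ < P.κ) {f f' : Fin n → P.S} {A A' : Set P.X} {t : OrbitType n}
    {j j' : P.κ.out × t.pts → P.X} (h : Family f A t j) (h' : Family f' A' t j') :
    Common f A f' A' := by
  have hc := mk_family (P := P) hκ t
  have hl : #(P.κ.out × t.pts) < P.lam := hc.trans_lt P.hlam
  obtain ⟨g, hg⟩ := exists_perm_of_injective hl h.inj h'.inj (hc.trans_le h.compl)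
    (hc.trans_le h'.compl)
  refine ⟨⟨Set.range j, mk_range_le.trans_lt hl⟩, g, ?_, ?_, AInv.of_inv ?_, ?_, fun i => ?_⟩
  · rw [Sm, mk_range_eq _ h.inj, hc]
    exact lt_irrefl _
  · exact Sub.of_subset (Set.range_subset_iff.2 h.sub)
  · intro i x
    constructor
    · rintro ⟨⟨a, b⟩, hab⟩
      refine ⟨⟨a, (t.rep.gen i).symm b⟩, (f i).1.injective ?_⟩
      refine ((h.chart a).map i ((t.rep.gen i).symm b)).symm.trans (Eq.trans ?_ hab)
      exact congrArg (fun z => j (a, z)) (Equiv.apply_symm_apply _ b)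
    · rintro ⟨⟨a, b⟩, rfl⟩
      exact ⟨⟨a, t.rep.gen i b⟩, (h.chart a).map i b⟩
  · refine Sub.of_subset ?_
    rintro _ ⟨_, ⟨x, rfl⟩, rfl⟩
    rw [hg]
    exact h'.sub x
  · convert Sm.empty (P := P)
    rw [Set.eq_empty_iff_forall_notMem]
    rintro _ ⟨⟨⟨a, b⟩, rfl⟩, hx⟩
    refine hx ?_
    change g.1 ((f i).1 (j (a, b))) = (f' i).1 (g.1 (j (a, b)))
    rw [hg, show (f i).1 (j (a, b)) = j (a, t.rep.gen i b) from ((h.chart a).map i b).symm, hg]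
    exact (h'.chart a).map i b

/-- A shared orbit determines the type. Conversely, if the types agree, `κ` orbits on one side can
be moved onto `κ` orbits on the other by a single permutation. This makes equality of types
definable. -/
theorem OfType.common_iff (hκ : ℵ₀ < P.κ) {f f' : Fin n → P.S} {A A' : Set P.X}
    {t t' : OrbitType n} (h : OfType f A t) (h' : OfType f' A' t') :
    Common f A f' A' ↔ t = t' := by
  constructor
  · intro hc
    obtain ⟨s, j, j', hj, hj', hjA, hjA'⟩ := hc.exists_charts hκ h.sub h'.sub
    obtain ⟨a⟩ : Nonempty s.pts := s.rep.nonempty.to_subtype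
    have h1 : j a ∈ tyPts (val f) t := by
      by_contra hcon
      exact (hjA ⟨a, rfl⟩).2 ⟨(hjA ⟨a, rfl⟩).1, hcon⟩
    have h2 : j' a ∈ tyPts (val f') t' := by
      by_contra hcon
      exact (hjA' ⟨a, rfl⟩).2 ⟨(hjA' ⟨a, rfl⟩).1, hcon⟩
    exact (tyPts_unique h1 (hj.range_subset_tyPts ⟨a, rfl⟩)).trans
      (tyPts_unique (hj'.range_subset_tyPts ⟨a, rfl⟩) h2)
  · rintro rfl
    obtain ⟨j, hj⟩ := h.exists_family hκ
    obtain ⟨j', hj'⟩ := h'.exists_family hκ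
    exact hj.common hκ hj'

/-- Now only a subtuple of `f` is compared with `f'`: the common part consists of orbits of the
subtuple inside orbits of type `t`, which is the content of the relation `Proj¹`. -/
theorem OfType.common_comp_iff (hκ : ℵ₀ < P.κ) {f : Fin n → P.S} {f' : Fin m → P.S}
    {A A' : Set P.X} {t : OrbitType n} {t' : OrbitType m} (h : OfType f A t)
    (h' : OfType f' A' t') (σ : Fin m → Fin n) :
    Common (fun i => f (σ i)) A f' A' ↔ (orbitsOfType σ t t').Nonempty := by
  rw [orbitsOfType_eq]
  constructor
  · intro hc
    obtain ⟨s, j, j', hj, hj', hjA, hjA'⟩ := hc.exists_charts hκ h.sub h'.sub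
    obtain ⟨a⟩ : Nonempty s.pts := s.rep.nonempty.to_subtype
    have h1 : j a ∈ tyPts (val f) t := by
      by_contra hcon
      exact (hjA ⟨a, rfl⟩).2 ⟨(hjA ⟨a, rfl⟩).1, hcon⟩
    have h2 : j' a ∈ tyPts (val f') t' := by
      by_contra hcon
      exact (hjA' ⟨a, rfl⟩).2 ⟨(hjA' ⟨a, rfl⟩).1, hcon⟩
    obtain rfl := tyPts_unique (hj'.range_subset_tyPts ⟨a, rfl⟩) h2
    obtain ⟨k, hk, b, hb⟩ := h1
    have hkr : InvSet (fun i => val f (σ i)) (Set.range k) := fun i => hk.range_inv (σ i)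
    have hjr := IsChart.range_subset (f := fun i => val f (σ i)) hj hkr (a := a) ⟨b, hb⟩
    choose l hl using fun c => hjr ⟨c, rfl⟩
    refine ⟨Set.range l, l, ⟨fun c d hcd => hj.inj ?_, fun i c => hk.inj ?_⟩, rfl⟩
    · rw [← hl, ← hl, hcd]
    · rw [hl, hk.map, hl, hj.map]
  · rintro ⟨_, l, hl, -⟩
    obtain ⟨j, hj⟩ := h.exists_family hκ
    obtain ⟨j', hj'⟩ := h'.exists_family hκ
    refine Family.common (t := t') (j := fun x => j (x.1, l x.2)) hκ ⟨?_, fun a => ⟨?_, ?_⟩, ?_, ?_⟩ hj'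
    · rintro ⟨a, b⟩ ⟨c, d⟩ hx
      have := hj.inj hx
      simp only [Prod.mk.injEq] at this
      exact Prod.ext this.1 (hl.inj this.2)
    · intro b c hbc
      have := hj.inj hbc
      simp only [Prod.mk.injEq, true_and] at this
      exact hl.inj this
    · intro i b
      exact (congrArg (fun z => j (a, z)) (hl.map i b)).trans ((hj.chart a).map (σ i) (l b))
    · exact fun x => hj.sub _
    · refine hj.compl.trans (mk_le_mk_of_subset (Set.compl_subset_compl.2 ?_))
      rintro _ ⟨x, rfl⟩
      exact ⟨_, rfl⟩

end Par

/-! ### Sets all of whose large invariant subsets share a type -/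

/-- Colour the cardinals by well-founded recursion so that the successor within `Z` of an element of
`Z` receives the opposite colour. -/
theorem Cardinal.exists_alternating (Z : Set Cardinal.{u}) : ∃ c : Cardinal.{u} → Prop,
    ∀ x ∈ Z, (∃ y ∈ Z, x < y) → ∃ y ∈ Z, x < y ∧ (c y ↔ ¬ c x) := by
  let next : Cardinal.{u} → Cardinal.{u} := fun x => sInf {y ∈ Z | x < y}
  have hnext : ∀ x, (∃ y ∈ Z, x < y) → next x ∈ Z ∧ x < next x := fun x hx => csInf_mem hx
  have hle : ∀ x y, y ∈ Z → x < y → next x ≤ y := fun x y hy hxy => csInf_le' ⟨hy, hxy⟩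
  let c : Cardinal.{u} → Prop := Cardinal.lt_wf.fix (C := fun _ => Prop) fun y ih =>
    ∀ x (h : x < y), x ∈ Z → next x = y → ¬ ih x h
  have hc : ∀ y, c y ↔ ∀ x, x < y → x ∈ Z → next x = y → ¬ c x := fun y => by
    simp only [c]
    rw [WellFounded.fix_eq]
  refine ⟨c, fun x hx hy => ?_⟩
  obtain ⟨h1, h2⟩ := hnext x hy
  refine ⟨next x, h1, h2, fun h => (hc _).1 h x h2 hx rfl, fun h => (hc _).2 ?_⟩
  intro x' h3 h4 h5
  rcases lt_trichotomy x x' with h6 | h6 | h6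
  · exact absurd (hle x x' h4 h6) (not_le.2 h3)
  · exact h6 ▸ h
  · exact absurd (h5 ▸ hle x' x hx h6) (not_le.2 h2)

/-- A partition of a set of at least `κ` elements into classes of fewer than `κ` elements has two
disjoint subfamilies that cover at least `κ` elements each. -/
theorem Cardinal.exists_split {α : Type u} {ι : Type v} (τ : α → ι) {κ : Cardinal.{u}}
    (hκ : ℵ₀ ≤ κ) (hα : κ ≤ #α) (hτ : ∀ i, #(τ ⁻¹' {i}) < κ) :
    ∃ Q : Set ι, κ ≤ #(τ ⁻¹' Q) ∧ κ ≤ #(τ ⁻¹' Qᶜ) := by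
  obtain ⟨D, hD, hDr⟩ : ∃ D : Set α, Set.InjOn τ D ∧ ∀ a, ∃ d ∈ D, τ d = τ a := by
    refine ⟨Set.range fun i : Set.range τ => i.2.choose, ?_, fun a => ?_⟩
    · rintro _ ⟨i, rfl⟩ _ ⟨k, rfl⟩ h
      have : i = k := Subtype.ext (i.2.choose_spec.symm.trans (h.trans k.2.choose_spec))
      rw [this]
    · exact ⟨_, ⟨⟨τ a, a, rfl⟩, rfl⟩, Exists.choose_spec (p := fun y => τ y = τ a) ⟨a, rfl⟩⟩
  -- With at least `κ` classes, represented by the transversal `D`, it suffices to divide the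
  -- classes into two families of at least `κ` classes each.
  by_cases hDκ : κ ≤ #D
  · have hs : #(D ⊕ D) ≤ #D := by
      rw [mk_sum, lift_id, add_eq_self (hκ.trans hDκ)]
    obtain ⟨ε⟩ := hs
    refine ⟨Set.range fun d => τ (ε (.inl d)), ?_, ?_⟩
    · refine hDκ.trans (mk_le_of_injective (f := fun d => ⟨(ε (.inl d)).1, ⟨d, rfl⟩⟩) ?_)
      intro a b hab
      exact Sum.inl_injective (ε.injective (Subtype.ext (congrArg (fun z => z.1) hab)))
    · refine hDκ.trans (mk_le_of_injective (f := fun d => ⟨(ε (.inr d)).1, ?_⟩) ?_)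
      · rintro ⟨e, he⟩
        exact Sum.inl_ne_inr (ε.injective (Subtype.ext (hD (ε _).2 (ε _).2 he)))
      · intro a b hab
        exact Sum.inr_injective (ε.injective (Subtype.ext (congrArg (fun z => z.1) hab)))
  -- With fewer than `κ` classes their sizes must be cofinal below `κ`. The alternating colouring of
  -- the sizes divides the classes so that the sizes in either family are still cofinal.
  · rw [not_le] at hDκ
    let z : α → Cardinal.{u} := fun a => #(τ ⁻¹' {τ a})
    have hz : ∀ θ < κ, ∃ a, θ < z a := by
      intro θ hθ
      by_contra! hcon
      refine absurd hα (not_le.2 ?_)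
      have : (Set.univ : Set α) ⊆ ⋃ d : D, τ ⁻¹' {τ d.1} := fun a _ => by
        obtain ⟨d, hd, hda⟩ := hDr a
        exact Set.mem_iUnion.2 ⟨⟨d, hd⟩, hda.symm⟩
      rw [← mk_univ]
      refine (mk_le_mk_of_subset this).trans_lt ((mk_iUnion_le _).trans_lt
        (mul_lt_of_lt hκ hDκ (lt_of_le_of_lt (ciSup_le' fun d => hcon d.1) hθ)))
    obtain ⟨c, hc⟩ := Cardinal.exists_alternating (Set.range z)
    have hcof : ∀ θ < κ, (∃ a, θ < z a ∧ c (z a)) ∧ ∃ a, θ < z a ∧ ¬ c (z a) := by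
      intro θ hθ
      obtain ⟨a, ha⟩ := hz θ hθ
      obtain ⟨b, hb⟩ := hz (z a) (hτ _)
      obtain ⟨_, ⟨d, rfl⟩, hd, hcd⟩ := hc (z a) ⟨a, rfl⟩ ⟨_, ⟨b, rfl⟩, hb⟩
      by_cases h : c (z a)
      · exact ⟨⟨a, ha, h⟩, d, ha.trans hd, fun h' => hcd.1 h' h⟩
      · exact ⟨⟨d, ha.trans hd, hcd.2 h⟩, a, ha, h⟩
    refine ⟨{i | c #(τ ⁻¹' {i})}, ?_, ?_⟩
    · refine le_of_forall_lt fun θ hθ => ?_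
      obtain ⟨⟨a, ha, hca⟩, -⟩ := hcof θ hθ
      refine ha.trans_le (mk_le_mk_of_subset ?_)
      intro x hx
      have hx : τ x = τ a := hx
      change _ at hca
      simpa [hx] using hca
    · refine le_of_forall_lt fun θ hθ => ?_
      obtain ⟨-, a, ha, hca⟩ := hcof θ hθ
      refine ha.trans_le (mk_le_mk_of_subset ?_)
      intro x hx
      have hx : τ x = τ a := hx
      change _ at hca
      simpa [hx] using hca

namespace Par

variable {P : Par.{u}} {m n : ℕ}

/-- Any two non-small almost invariant subsets of `A` share a type. -/
def Pure (f : Fin n → P.S) (A : P.PS) : Prop :=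
  ¬ P.Sm A.1 ∧ AInv f A.1 ∧ ∀ A₁ A₂ : P.PS, ¬ P.Sm A₁.1 → ¬ P.Sm A₂.1 → P.Sub A₁.1 A.1 →
    P.Sub A₂.1 A.1 → AInv f A₁.1 → AInv f A₂.1 → Common f A₁.1 f A₂.1

/-- Divide the types into `Q` and its complement. The corresponding parts of `A'` have no type in
common, so by purity one of them is small. If each single type occupied a small part only,
`Cardinal.exists_split` would give a `Q` with both parts non-small. So some type occupies a
non-small part, and all others together a small one. -/
theorem pure_iff (hκ : ℵ₀ < P.κ) {f : Fin n → P.S} {A : P.PS} :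
    Pure f A ↔ ∃ t, OfType f A.1 t := by
  constructor
  · rintro ⟨h1, h2, h3⟩
    obtain ⟨A', hA, hAi, hAs, -⟩ := h2.exists_inv hκ Sm.empty
    have hA' : ¬ P.Sm A' := fun h => h1 ((hAs.union h).mono fun x hx => by
      by_cases hx' : x ∈ A'
      · exact Or.inr hx'
      · exact Or.inl ⟨hx, hx'⟩)
    have key : ∀ Q : Set (OrbitType n), P.Sm {x ∈ A' | ∃ t ∈ Q, x ∈ tyPts (val f) t} ∨
        P.Sm {x ∈ A' | ∃ t ∈ Qᶜ, x ∈ tyPts (val f) t} := by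
      intro Q
      by_contra! hcon
      have hinv : ∀ Q : Set (OrbitType n),
          InvSet (val f) {x ∈ A' | ∃ t ∈ Q, x ∈ tyPts (val f) t} := fun Q i x =>
        and_congr (hAi i x) (exists_congr fun t => and_congr_right fun _ => tyPts_inv i x)
      have hsub : ∀ Q : Set (OrbitType n), {x ∈ A' | ∃ t ∈ Q, x ∈ tyPts (val f) t} ⊆ A.1 :=
        fun Q x hx => hA hx.1
      have hl : ∀ Q : Set (OrbitType n),
          #{x ∈ A' | ∃ t ∈ Q, x ∈ tyPts (val f) t} < P.lam := fun Q =>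
        (mk_le_mk_of_subset (hsub Q)).trans_lt A.2
      obtain ⟨t, j, j', hj, hj', hjA, hjA'⟩ := (h3 ⟨_, hl Q⟩ ⟨_, hl Qᶜ⟩ hcon.1 hcon.2
        (Sub.of_subset (hsub _)) (Sub.of_subset (hsub _)) (AInv.of_inv (hinv _))
        (AInv.of_inv (hinv _))).exists_charts hκ Sm.empty Sm.empty
      obtain ⟨a⟩ : Nonempty t.pts := t.rep.nonempty.to_subtype
      obtain ⟨-, t₁, ht₁, hx₁⟩ := (hjA ⟨a, rfl⟩).1
      obtain ⟨-, t₂, ht₂, hx₂⟩ := (hjA' ⟨a, rfl⟩).1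
      obtain rfl := tyPts_unique (hj.range_subset_tyPts ⟨a, rfl⟩) hx₁
      obtain rfl := tyPts_unique (hj'.range_subset_tyPts ⟨a, rfl⟩) hx₂
      exact ht₂ ht₁
    by_cases hex : ∃ t, ¬ P.Sm (A' ∩ tyPts (val f) t)
    · obtain ⟨t, ht⟩ := hex
      refine ⟨t, h1, h2, ?_⟩
      have := (key {t}).resolve_left fun h => ht (h.mono fun x hx => ⟨hx.1, t, rfl, hx.2⟩)
      refine (hAs.union this).mono fun x hx => ?_
      by_cases hx' : x ∈ A'
      · obtain ⟨s, hs⟩ := exists_mem_tyPts (val f) x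
        exact Or.inr ⟨hx', s, fun h => hx.2 (h ▸ hs), hs⟩
      · exact Or.inl ⟨hx.1, hx'⟩
    · push Not at hex
      choose τ hτ using fun x : A' => exists_mem_tyPts (val f) x.1
      obtain ⟨Q, hQ, hQ'⟩ := Cardinal.exists_split τ P.hκ (not_lt.1 hA') fun t => by
        refine lt_of_le_of_lt ?_ (hex t)
        refine mk_le_of_injective (f := fun x => ⟨x.1.1, x.1.2, by
          have := hτ x.1; rwa [show τ x.1 = t from x.2] at this⟩) ?_
        intro x y hxy
        exact Subtype.ext (Subtype.ext (congrArg (fun z => z.1) hxy))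
      have hle : ∀ Q : Set (OrbitType n), #(τ ⁻¹' Q) ≤
          #{x ∈ A' | ∃ t ∈ Q, x ∈ tyPts (val f) t} := fun Q =>
        mk_le_of_injective (f := fun x => ⟨x.1.1, x.1.2, _, x.2, hτ x.1⟩) fun x y hxy =>
          Subtype.ext (Subtype.ext (congrArg (fun z => z.1) hxy))
      rcases key Q with h | h
      · exact absurd (hQ.trans (hle _)) (not_le.2 h)
      · exact absurd (hQ'.trans (hle _)) (not_le.2 h)
  · rintro ⟨t, ht⟩
    refine ⟨ht.not_sm, ht.ainv, fun A₁ A₂ h1 h2 h3 h4 h5 h6 => ?_⟩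
    exact (OfType.common_iff hκ ⟨h1, h5, h3.trans ht.sub⟩ ⟨h2, h6, h4.trans ht.sub⟩).2 rfl

/-! ### Conjugacy up to small sets -/

/-- Domain and range may have complements of different sizes, which prevents an extension to a
permutation. For uncountable `κ` one can give up an invariant part `B` of the domain whose size `θ <
κ` dominates both complements; after this both complements have size `θ`. -/
theorem exists_conj_of_not (hκ : ℵ₀ < P.κ) {f f' : Fin n → P.S} {L : P.X → P.X → Prop}
    (hl : ¬ P.lam ≤ P.μ)
    (hL : PIso (val f) (val f') L) (h1 : P.Sm (relDom L)ᶜ) (h2 : P.Sm (relRan L)ᶜ) :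
    ∃ g : P.S, ∀ i, P.Sm {x | g.1 ((f i).1 x) ≠ (f' i).1 (g.1 x)} := by
  set θ := max (max #((relDom L)ᶜ : Set P.X) #((relRan L)ᶜ : Set P.X)) ℵ₀ with hθ
  have hθκ : θ < P.κ := max_lt (max_lt h1 h2) hκ
  have hD : P.κ ≤ #(relDom L) := by
    by_contra hcon
    have := add_lt_of_lt P.hκ (not_le.1 hcon) h1
    rw [mk_sum_compl, mk_X] at this
    exact absurd kappa_le_mu (not_le.2 this)
  obtain ⟨B₀, hB₀, hB₀θ⟩ := le_mk_iff_exists_subset.1 (hθκ.le.trans hD)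
  obtain ⟨B, hB₀B, hBi, hBl, hBu⟩ := exists_inv_superset (val f) B₀
  have hBD : B ⊆ relDom L := hBu _ hL.dom_inv hB₀
  have hBθ : #B = θ := by
    refine le_antisymm (hBl.trans ?_) (hB₀θ ▸ mk_le_mk_of_subset hB₀B)
    rw [hB₀θ]
    exact (mul_eq_left (le_max_right _ _) (le_max_right _ _) aleph0_pos.ne').le
  choose φ hφ using fun x : relDom L => x.2
  have hφi : Function.Injective φ := fun x y hxy => Subtype.ext
    (hL.inj (hφ x) (hxy ▸ hφ y))
  have hdom : ((relDom L)ᶜ ∪ B : Set P.X) = (Set.range fun x : (relDom L \ B : Set P.X) => x.1)ᶜ := by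
    ext x
    simp only [Set.mem_union, Set.mem_compl_iff, Subtype.range_coe, Set.mem_sdiff]
    tauto
  have hran : ((relRan L)ᶜ ∪ φ '' {x | x.1 ∈ B} : Set P.X) =
      (Set.range fun x : (relDom L \ B : Set P.X) => φ ⟨x.1, x.2.1⟩)ᶜ := by
    ext y
    constructor
    · rintro (hy | ⟨x, hx, rfl⟩) ⟨z, hz⟩
      · exact hy ⟨z.1, hz ▸ hφ ⟨z.1, z.2.1⟩⟩
      · exact z.2.2 (by rw [← hφi hz] at hx; exact hx)
    · intro hy
      by_contra hcon
      simp only [Set.mem_union, Set.mem_compl_iff, not_or, not_not] at hcon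
      obtain ⟨⟨x, hx⟩, hyB⟩ := hcon
      have hxy : φ ⟨x, y, hx⟩ = y := hL.func (hφ _) hx
      exact hy ⟨⟨x, ⟨y, hx⟩, fun hxB => hyB ⟨_, hxB, hxy⟩⟩, hxy⟩
  have hBφ : #(φ '' {x | x.1 ∈ B}) = θ := by
    rw [mk_image_eq hφi, ← hBθ]
    exact mk_congr ⟨fun x => ⟨x.1.1, x.2⟩, fun x => ⟨⟨x.1, hBD x.2⟩, x.2⟩, fun _ => rfl, fun _ => rfl⟩
  have hcard : ∀ U V : Set P.X, #U ≤ θ → #V = θ → #(U ∪ V : Set P.X) = θ := fun U V hU hV =>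
    le_antisymm ((mk_union_le _ _).trans ((add_le_add hU hV.le).trans
      (add_eq_self (le_max_right _ _)).le)) (hV ▸ mk_le_mk_of_subset Set.subset_union_right)
  obtain ⟨g, hg, -⟩ := exists_perm_of_subset (Y := Set.univ) (mk_lt_of_not hl _)
    (i := fun x : (relDom L \ B : Set P.X) => x.1)
    (i' := fun x : (relDom L \ B : Set P.X) => φ ⟨x.1, x.2.1⟩) Subtype.val_injective
    (fun x y hxy => Subtype.ext (congrArg (fun z => z.1) (hφi hxy))) (Set.subset_univ _)
    (Set.subset_univ _) (by
      rw [← Set.compl_eq_univ_sdiff, ← Set.compl_eq_univ_sdiff, ← hdom, ← hran,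
        hcard _ _ ((le_max_left _ _).trans (le_max_left _ _)) hBθ,
        hcard _ _ ((le_max_right _ _).trans (le_max_left _ _)) hBφ])
  have hsm : P.Sm ((relDom L)ᶜ ∪ B) := h1.union (hBθ.trans_lt hθκ)
  refine ⟨g, fun i => hsm.mono fun x hx => ?_⟩
  by_contra hcon
  simp only [Set.mem_union, Set.mem_compl_iff, not_or, not_not] at hcon
  have hfx : (f i).1 x ∈ relDom L := (hL.dom_inv i x).2 hcon.1
  have hfB : (f i).1 x ∉ B := fun h => hcon.2 ((hBi i x).1 h)
  refine hx ?_
  have e1 := hg ⟨x, hcon.1, hcon.2⟩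
  have e2 := hg ⟨(f i).1 x, hfx, hfB⟩
  dsimp only at e1 e2
  rw [e1, e2]
  exact hL.func (hφ _) ((hL.map i _ _).2 (hφ ⟨x, hcon.1⟩))

/-- For uncountable `κ` no outer automorphism is needed: E-equivalent tuples are conjugate in the
quotient. Conversely, a conjugating element becomes a partial isomorphism off the saturation of the
set where it fails to conjugate. -/
theorem E_ty_iff (hκ : ℵ₀ < P.κ) {f f' : Fin n → P.S} : PreF.E P.κ (ty f) (ty f') ↔
    ∃ g : P.S, ∀ i, P.q (g * f i) = P.q (f' i * g) := by
  rw [ty, ty, tyPre_E_iff P.hκ]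
  constructor
  · rintro ⟨L, hL, h1, h2⟩
    simp only [q_eq_iff]
    by_cases hl : P.lam ≤ P.μ
    · exact exists_conj_of_le hl hL h1 h2
    · rw [core_of_not hl, ← Set.compl_eq_univ_sdiff] at h1 h2
      exact exists_conj_of_not hκ hl hL h1 h2
  · rintro ⟨g, hg⟩
    obtain ⟨B, h1, h2, h3⟩ := Sm.saturate hκ f (Sm.iUnion_fin fun i => q_eq_iff.1 (hg i))
    refine ⟨fun x y => x ∉ B ∧ y = g.1 x, ⟨?_, ?_, ?_⟩, h3.mono ?_, (h3.image g.1).mono ?_⟩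
    · rintro x y y' ⟨-, rfl⟩ ⟨-, rfl⟩
      rfl
    · rintro x x' y ⟨-, rfl⟩ ⟨-, h⟩
      exact g.1.injective h
    · intro i x y
      rw [show (f i).1 x ∉ B ↔ x ∉ B from not_congr (h2 i x)]
      refine and_congr_right fun hx => ?_
      have h4 : g.1 ((f i).1 x) = (f' i).1 (g.1 x) := by
        by_contra hne
        exact hx (h1 (Set.mem_iUnion.2 ⟨i, hne⟩))
      rw [h4, (f' i).1.injective.eq_iff]
    · rintro x ⟨-, hx⟩
      by_contra hxB
      exact hx ⟨_, hxB, rfl⟩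
    · rintro y ⟨-, hy⟩
      by_contra hyB
      refine hy ⟨g.1.symm y, fun h => hyB ⟨_, h, ?_⟩, ?_⟩ <;> simp

end Par

namespace Par

variable {P : Par.{u}} {m n : ℕ}

/-! ### Comparison of cardinalities -/

/-- Almost inclusion in a union is recovered from inclusion alone: a part of `A` that has only small
sets in common with `B` and with `C` must be small. -/
theorem sub_union_iff {A B C : P.PS} : P.Sub A.1 (B.1 ∪ C.1) ↔ ∀ D : P.PS, P.Sub D.1 A.1 →
    (∀ F : P.PS, P.Sub F.1 D.1 → P.Sub F.1 B.1 → P.Sm F.1) →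
    (∀ F : P.PS, P.Sub F.1 D.1 → P.Sub F.1 C.1 → P.Sm F.1) → P.Sm D.1 := by
  have hl : ∀ (D : P.PS) (F : Set P.X), #(D.1 ∩ F : Set P.X) < P.lam := fun D F =>
    (mk_le_mk_of_subset Set.inter_subset_left).trans_lt D.2
  constructor
  · intro h D hD hB hC
    have h1 := hB ⟨D.1 ∩ B.1, hl _ _⟩ (Sub.of_subset Set.inter_subset_left)
      (Sub.of_subset Set.inter_subset_right)
    have h2 := hC ⟨D.1 ∩ C.1, hl _ _⟩ (Sub.of_subset Set.inter_subset_left)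
      (Sub.of_subset Set.inter_subset_right)
    refine (Sm.union (hD.trans h) (h1.union h2)).mono fun x hx => ?_
    by_cases hxB : x ∈ B.1
    · exact Or.inr (Or.inl ⟨hx, hxB⟩)
    · by_cases hxC : x ∈ C.1
      · exact Or.inr (Or.inr ⟨hx, hxC⟩)
      · exact Or.inl ⟨hx, fun h => h.elim hxB hxC⟩
  · intro h
    refine h ⟨A.1 \ (B.1 ∪ C.1), hl _ _⟩ (Sub.of_subset Set.sdiff_subset) ?_ ?_
    · intro F h1 h2
      refine (Sm.union h1 h2).mono fun x hx => ?_
      by_cases hxB : x ∈ B.1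
      · exact Or.inl ⟨hx, fun h => h.2 (Or.inl hxB)⟩
      · exact Or.inr ⟨hx, hxB⟩
    · intro F h1 h2
      refine (Sm.union h1 h2).mono fun x hx => ?_
      by_cases hxC : x ∈ C.1
      · exact Or.inl ⟨hx, fun h => h.2 (Or.inr hxC)⟩
      · exact Or.inr ⟨hx, hxC⟩

/-- The set `A` is the union of two sets that can be moved into `B`, up to small sets. -/
def LeC (A B : P.PS) : Prop :=
  ∃ A₁ A₂ : P.PS, ∃ g₁ g₂ : P.S, P.Sub A.1 (A₁.1 ∪ A₂.1) ∧ P.Sub (g₁.1 '' A₁.1) B.1 ∧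
    P.Sub (g₂.1 '' A₂.1) B.1

theorem exists_halves {A : Set P.X} (hA : P.κ ≤ #A) : ∃ A₁ A₂, A₁ ∪ A₂ = A ∧ Disjoint A₁ A₂ ∧
    #A₁ = #A ∧ #A₂ = #A := by
  have hs : #(A ⊕ A) = #A := by
    rw [mk_sum, lift_id, add_eq_self (P.hκ.trans hA)]
  obtain ⟨ε⟩ := Cardinal.eq.1 hs
  have h1 : Function.Injective fun a => (ε (.inl a)).1 := fun a b h =>
    Sum.inl_injective (ε.injective (Subtype.ext h))
  have h2 : Function.Injective fun a => (ε (.inr a)).1 := fun a b h =>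
    Sum.inr_injective (ε.injective (Subtype.ext h))
  refine ⟨Set.range fun a => (ε (.inl a)).1, Set.range fun a => (ε (.inr a)).1, ?_, ?_,
    mk_range_eq _ h1, mk_range_eq _ h2⟩
  · ext x
    constructor
    · rintro (⟨a, rfl⟩ | ⟨a, rfl⟩) <;> exact Subtype.prop _
    · intro hx
      obtain ⟨a | a, ha⟩ := ε.surjective ⟨x, hx⟩
      · exact Or.inl ⟨a, congrArg Subtype.val ha⟩
      · exact Or.inr ⟨a, congrArg Subtype.val ha⟩
  · rw [Set.disjoint_left]
    rintro _ ⟨a, rfl⟩ ⟨b, hb⟩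
    exact Sum.inr_ne_inl (ε.injective (Subtype.ext hb))

/-- A single permutation would not do: if `lam = μ⁺`, the whole space has size `μ` but cannot be
moved into a proper subset of that size with large complement. Each of two halves of `A` leaves the
other half free, so `exists_perm_of_injective` applies to it. -/
theorem leC_iff {A B : P.PS} : LeC A B ↔ (P.κ ≤ #A.1 → #A.1 ≤ #B.1) := by
  constructor
  · rintro ⟨A₁, A₂, g₁, g₂, h, h1, h2⟩ hA
    have key : ∀ (C : Set P.X) (g : P.S), P.Sub (g.1 '' C) B.1 →
        ∃ θ < P.κ, #C ≤ θ + #B.1 := by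
      intro C g hC
      refine ⟨_, hC, ?_⟩
      rw [← mk_image_eq g.1.injective]
      refine (mk_le_mk_of_subset fun x hx => ?_).trans (mk_union_le _ _)
      by_cases hxB : x ∈ B.1
      · exact Or.inr hxB
      · exact Or.inl ⟨hx, hxB⟩
    obtain ⟨θ₁, hθ₁, h1⟩ := key _ _ h1
    obtain ⟨θ₂, hθ₂, h2⟩ := key _ _ h2
    have hle : #A.1 ≤ #(A.1 \ (A₁.1 ∪ A₂.1) : Set P.X) + ((θ₁ + #B.1) + (θ₂ + #B.1)) := by
      refine le_trans (mk_le_mk_of_subset (t := (A.1 \ (A₁.1 ∪ A₂.1)) ∪ (A₁.1 ∪ A₂.1))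
        fun x hx => ?_) ((mk_union_le _ _).trans (add_le_add le_rfl ((mk_union_le _ _).trans
          (add_le_add h1 h2))))
      by_cases hxB : x ∈ A₁.1 ∪ A₂.1
      · exact Or.inr hxB
      · exact Or.inl ⟨hx, hxB⟩
    by_contra hcon
    rw [not_le] at hcon
    have hA0 := P.hκ.trans hA
    exact absurd hle (not_le.2 (add_lt_of_lt hA0 (lt_of_lt_of_le h hA)
      (add_lt_of_lt hA0 (add_lt_of_lt hA0 (hθ₁.trans_le hA) hcon)
        (add_lt_of_lt hA0 (hθ₂.trans_le hA) hcon))))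
  · intro h
    by_cases hA : P.κ ≤ #A.1
    · obtain ⟨A₁, A₂, hA12, hAd, hA1, hA2⟩ := exists_halves hA
      obtain ⟨B₁, B₂, hB12, hBd, hB1, hB2⟩ := exists_halves (hA.trans (h hA))
      have key : ∀ C D : Set P.X, C ⊆ A.1 → Disjoint C D → #C = #A.1 → #D = #A.1 →
          ∃ g : P.S, g.1 '' C ⊆ B.1 := by
        intro C D hC hCD hC1 hD1
        obtain ⟨φ⟩ : #C ≤ #B₁ := by rw [hC1, hB1]; exact h hA
        obtain ⟨g, hg⟩ := exists_perm_of_injective (P := P) (I := C)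
          ((mk_le_mk_of_subset hC).trans_lt A.2) (i := Subtype.val) (i' := fun c => (φ c).1)
          Subtype.val_injective (Subtype.val_injective.comp φ.injective) (by
            rw [Subtype.range_coe, hC1, ← hD1]
            exact mk_le_mk_of_subset hCD.symm.subset_compl_right) (by
            rw [hC1]
            refine ((h hA).trans hB2.ge).trans (mk_le_mk_of_subset ?_)
            rintro x hx ⟨c, rfl⟩
            exact Set.disjoint_left.1 hBd (φ c).2 hx)
        refine ⟨g, ?_⟩
        rintro _ ⟨x, hx, rfl⟩
        rw [hg ⟨x, hx⟩, ← hB12]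
        exact Or.inl (φ _).2
      have s1 : A₁ ⊆ A.1 := hA12 ▸ Set.subset_union_left
      have s2 : A₂ ⊆ A.1 := hA12 ▸ Set.subset_union_right
      obtain ⟨g₁, hg₁⟩ := key A₁ A₂ s1 hAd hA1 hA2
      obtain ⟨g₂, hg₂⟩ := key A₂ A₁ s2 hAd.symm hA2 hA1
      exact ⟨⟨A₁, hA1.trans_lt A.2⟩, ⟨A₂, hA2.trans_lt A.2⟩, g₁, g₂,
        Sub.of_subset hA12.symm.subset, Sub.of_subset hg₁, Sub.of_subset hg₂⟩
    · refine ⟨⟨∅, ?_⟩, ⟨∅, ?_⟩, 1, 1, ?_, ?_, ?_⟩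
      · rw [mk_eq_zero]; exact aleph0_pos.trans aleph0_lt_lam
      · rw [mk_eq_zero]; exact aleph0_pos.trans aleph0_lt_lam
      · exact Sm.mono (not_le.1 hA) Set.sdiff_subset
      · rw [Set.image_empty]; exact Sub.of_subset (Set.empty_subset _)
      · rw [Set.image_empty]; exact Sub.of_subset (Set.empty_subset _)

open Classical in
/-- The cardinality of a set, where `0` stands for the cardinals less than `κ`. -/
noncomputable def cval (P : Par.{u}) (ν : Cardinal.{u}) : Cardinal.{u} := if P.κ ≤ ν then ν else 0

theorem cval_le_iff {ν ν' : Cardinal.{u}} : P.cval ν ≤ P.cval ν' ↔ (P.κ ≤ ν → ν ≤ ν') := by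
  unfold cval
  have hpos := aleph0_pos.trans_le P.hκ
  split_ifs with h1 h2 h2
  · exact ⟨fun h _ => h, fun h => h h1⟩
  · refine ⟨fun h => absurd (h1.trans h) (not_le.2 hpos), fun h => absurd (h1.trans (h h1)) h2⟩
  · exact ⟨fun _ h => absurd h h1, fun _ => zero_le⟩
  · exact ⟨fun _ h => absurd h h1, fun _ => le_rfl⟩

theorem leC_iff_cval {A B : P.PS} : LeC A B ↔ P.cval #A.1 ≤ P.cval #B.1 :=
  leC_iff.trans cval_le_iff.symm

theorem exists_cval_eq (x : CardMinus P.κ P.lam) : ∃ A : P.PS, x.1 = P.cval #A.1 := by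
  obtain ⟨ν, h1, h2⟩ := x
  obtain ⟨A, hA⟩ : ∃ A : Set P.X, #A = ν := by
    have : ν ≤ #P.X := by rw [mk_X]; exact Order.lt_succ_iff.1 (h1.trans_le P.hμ)
    exact le_mk_iff_exists_set.1 this
  refine ⟨⟨A, hA.trans_lt h1⟩, ?_⟩
  change ν = P.cval #A
  rw [hA, cval]
  split_ifs with h
  · rfl
  · exact h2.resolve_right h

theorem app_cls_eq (f : Fin n → P.S) (t : IS P.lam P.μ n) :
    ((P.cls (ty f)).app t).1 = P.cval #(orbs (val f) t.1) := by
  have h := FSort.app_mk P.hκ (ty f) t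
  have e : (ty f).val t = #(orbs (val f) t.1) := rfl
  rw [e] at h
  rw [cval]
  split_ifs with h'
  · exact (h.resolve_right fun h => absurd h' (not_le.2 h.2)).1
  · exact (h.resolve_left fun h => h' h.2).1

/-- There is a largest set of fewer than `lam` points, up to small sets, exactly if the whole space
is one. -/
theorem lam_le_iff : P.lam ≤ P.μ ↔ ¬ ∃ B : P.PS, ∀ A : P.PS, P.Sub A.1 B.1 := by
  constructor
  · rintro h ⟨B, hB⟩
    have hc : P.κ ≤ #((B.1)ᶜ : Set P.X) := by
      by_contra hcon
      have h1 := add_lt_of_lt aleph0_lt_lam.le B.2 ((not_le.1 hcon).trans P.hlam)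
      rw [mk_sum_compl, mk_X] at h1
      exact absurd h (not_le.2 h1)
    obtain ⟨A, hA, hAc⟩ := le_mk_iff_exists_subset.1 hc
    have h2 := hB ⟨A, hAc.trans_lt P.hlam⟩
    refine absurd hAc (ne_of_lt (Sm.mono h2 fun x hx => ⟨hx, hA hx⟩))
  · intro h
    by_contra hl
    exact h ⟨⟨Set.univ, mk_lt_of_not hl _⟩, fun A => Sub.of_subset (Set.subset_univ _)⟩

end Par

/-! ### Definability of cardinality comparison and of purity -/

namespace UDef

open Par

variable {K : Par.{u} → Prop} {ι J : Type} {n : ℕ} {f f' : Fin n → ∀ P : Par.{u}, (ι → P.S) → P.S}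

theorem sub_union (i j k : J) : UDef K fun P (_ : ι → P.S) (A : J → P.PS) =>
    P.Sub (A i).1 ((A j).1 ∪ (A k).1) := by
  have h : UDef K fun P (_ : ι → P.S) (A : J → P.PS) => ∀ D : P.PS, P.Sub D.1 (A i).1 →
      (∀ F : P.PS, P.Sub F.1 D.1 → P.Sub F.1 (A j).1 → P.Sm F.1) →
      (∀ F : P.PS, P.Sub F.1 D.1 → P.Sub F.1 (A k).1 → P.Sm F.1) → P.Sm D.1 :=
    all_set ((sub _ _).imp ((all_set ((sub _ _).imp ((sub _ _).imp (sm _)))).imp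
      ((all_set ((sub _ _).imp ((sub _ _).imp (sm _)))).imp (sm _))))
  exact h.congr fun P _ v A => sub_union_iff.symm

theorem leC (i j : J) : UDef K fun P (_ : ι → P.S) (A : J → P.PS) => LeC (A i) (A j) :=
  ex_set (ex_set (ex_perm (ex_perm ((sub_union _ _ _).and
    ((image (TDef.var _) _ _).and (image (TDef.var _) _ _))))))

theorem lam_le : UDef K fun P (_ : ι → P.S) (_ : J → P.PS) => P.lam ≤ P.μ := by
  have h : UDef K fun P (_ : ι → P.S) (_ : J → P.PS) =>
      ¬ ∃ B : P.PS, ∀ A : P.PS, P.Sub A.1 B.1 := (ex_set (all_set (sub _ _))).not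
  exact h.congr fun P _ v A => lam_le_iff.symm

theorem ainv (hf : ∀ i, TDef (f i)) (j : J) :
    UDef K fun P v A => AInv (fun i => f i P v) (A j).1 :=
  forall_fin fun i => (image (hf i) _ _).and (image (hf i).inv _ _)

theorem common (hf : ∀ i, TDef (f i)) (hf' : ∀ i, TDef (f' i)) (j k : J) :
    UDef K fun P v A => Common (fun i => f i P v) (A j).1 (fun i => f' i P v) (A k).1 :=
  ex_set (ex_perm ((sm _).not.and ((sub _ _).and ((ainv (fun i => (hf i).comap _) _).and
    ((image (TDef.var _) _ _).and (forall_fin fun i =>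
      sm_ne ((TDef.var _).mul ((hf i).comap _)) (((hf' i).comap _).mul (TDef.var _)) _))))))

theorem pure (hf : ∀ i, TDef (f i)) (j : J) :
    UDef K fun P v A => Pure (fun i => f i P v) (A j) :=
  (sm _).not.and ((ainv hf _).and (all_set (all_set ((sm _).not.imp ((sm _).not.imp
    ((sub _ _).imp ((sub _ _).imp ((ainv hf _).imp ((ainv hf _).imp (common hf hf _ _))))))))))

end UDef

/-! ### The interpretation for uncountable `κ` -/

namespace Par

variable {P : Par.{u}} {m n : ℕ}

open OrbitType

theorem OfType.isTrivial_iff (hκ : ℵ₀ < P.κ) {f : Fin n → P.S} {A : Set P.X} {t : OrbitType n}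
    (h : OfType f A t) : (∀ i, P.Sm {x ∈ A | (f i).1 x ≠ x}) ↔ t.IsTrivial := by
  refine forall_congr' fun i => ?_
  rw [h.sm_ne_iff hκ (fun x => (f i).1 x = x) (fun a => t.rep.gen i a = a) ?_]
  · exact (Equiv.ext_iff (f := t.rep.gen i) (g := 1)).symm
  · intro j hj a
    rw [← hj.inj.eq_iff, hj.map]

theorem exists_ofType (hκ : ℵ₀ < P.κ) (t : OrbitType n) : ∃ (f : Fin n → P.S) (A : P.PS),
    OfType f A.1 t := by
  have hc := mk_family (P := P) hκ t
  obtain ⟨ι⟩ : #(P.κ.out × t.pts) ≤ #P.X := by rw [hc, mk_X]; exact kappa_le_mu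
  let f : Fin n → P.S := fun i => ⟨Equiv.Perm.viaEmbedding
    (Equiv.prodCongr (Equiv.refl P.κ.out) (t.rep.gen i)) ι, viaEmbedding_mem (hc.trans_lt P.hlam) _ ι⟩
  have hf : ∀ i a b, (f i).1 (ι (a, b)) = ι (a, t.rep.gen i b) := fun i a b => by
    change Equiv.Perm.viaEmbedding _ ι (ι (a, b)) = _
    rw [Equiv.Perm.viaEmbedding_apply]
    rfl
  have hch : ∀ a, IsChart (val f) t fun b => ι (a, b) := fun a =>
    ⟨fun b b' h => by simpa using ι.injective h, fun i b => (hf i a b).symm⟩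
  refine ⟨f, ⟨Set.range ι, mk_range_le.trans_lt (hc.trans_lt P.hlam)⟩, ?_, AInv.of_inv ?_,
    Sub.of_subset ?_⟩
  · rw [Sm, mk_range_eq _ ι.injective, hc]
    exact lt_irrefl _
  · intro i x
    constructor
    · rintro ⟨⟨a, b⟩, hab⟩
      obtain ⟨c, hc⟩ := ((hch a).range_inv i x).1 ⟨b, hab⟩
      exact ⟨_, hc⟩
    · rintro ⟨⟨a, b⟩, rfl⟩
      exact ⟨_, (hf i a b).symm⟩
  · rintro _ ⟨⟨a, b⟩, rfl⟩
    exact (hch a).range_subset_tyPts ⟨b, rfl⟩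

theorem ofType_is_iff (hκ : ℵ₀ < P.κ) {f f' : Fin n → P.S} {A A' : P.PS} :
    (∃ t : ULift.{u + 1} (IS P.lam P.μ n), OfType f A.1 t.down.1 ∧ OfType f' A'.1 t.down.1) ↔
      Pure f A ∧ Pure f' A' ∧ Common f A.1 f' A'.1 ∧
        (P.lam ≤ P.μ → ¬ ∀ i, P.Sm {x ∈ A.1 | (f i).1 x ≠ (1 : P.S).1 x}) := by
  have e : (∀ i, P.Sm {x ∈ A.1 | (f i).1 x ≠ (1 : P.S).1 x}) ↔
    ∀ i, P.Sm {x ∈ A.1 | (f i).1 x ≠ x} := Iff.rfl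
  rw [e, pure_iff hκ, pure_iff hκ]
  constructor
  · rintro ⟨t, h1, h2⟩
    refine ⟨⟨_, h1⟩, ⟨_, h2⟩, (h1.common_iff hκ h2).2 rfl, ?_⟩
    rw [h1.isTrivial_iff hκ]
    exact t.down.2
  · rintro ⟨⟨t, h1⟩, ⟨t', h2⟩, h3, h4⟩
    obtain rfl := (h1.common_iff hκ h2).1 h3
    rw [h1.isTrivial_iff hκ] at h4
    exact ⟨⟨t, h4⟩, h1, h2⟩

theorem mk_tyPts_lt (f : Fin n → P.S) (t : IS P.lam P.μ n) : #(tyPts (val f) t.1) < P.lam :=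
  (mk_le_mk_of_subset fun _ hx => (mem_tyPts_iff_mem_core hx).2 t.2).trans_lt (core_fin_lt f)

/-- The factor `|A_t|` is at most `ℵ₀ < κ`, so it affects neither values of at least `κ` nor
smallness. Orbits may thus be counted by their points. -/
theorem cval_mk_tyPts (hκ : ℵ₀ < P.κ) (f : Fin n → P.S) (t : OrbitType n) :
    P.cval #(tyPts (val f) t) = P.cval #(orbs (val f) t) := by
  have hd : t.deg ≤ ℵ₀ := by
    rw [OrbitType.deg, lift_le_aleph0]; exact mk_le_aleph0
  rw [mk_tyPts, cval, cval]
  by_cases h : P.κ ≤ #(orbs (val f) t)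
  · have e : t.deg * #(orbs (val f) t) = #(orbs (val f) t) := by
      rw [mul_comm]
      exact mul_eq_left (P.hκ.trans h) (hd.trans (P.hκ.trans h))
        (one_pos.trans_le t.one_le_deg).ne'
    rw [e]
  · rw [if_neg h, if_neg]
    rw [not_le] at h ⊢
    exact mul_lt_of_lt P.hκ (hd.trans_lt hκ) h

/-- The set is the set of all points of type `t`, up to small sets. -/
theorem cval_tyPts_iff (hκ : ℵ₀ < P.κ) {f : Fin n → P.S} {t : IS P.lam P.μ n} {B : P.PS} :
    P.cval #(orbs (val f) t.1) = P.cval #B.1 ↔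
      ∃ W : P.PS, (¬ P.Sm W.1 → OfType f W.1 t.1) ∧ (∀ W' : P.PS, ¬ P.Sm W'.1 → OfType f W'.1 t.1 →
        P.Sub W'.1 W.1) ∧ LeC W B ∧ LeC B W := by
  rw [← cval_mk_tyPts hκ]
  have h0 : OfType f (tyPts (val f) t.1) t.1 ∨ P.Sm (tyPts (val f) t.1) := by
    by_cases h : P.Sm (tyPts (val f) t.1)
    · exact Or.inr h
    · exact Or.inl ⟨h, AInv.of_inv tyPts_inv, Sub.refl _⟩
  constructor
  · intro h
    refine ⟨⟨_, mk_tyPts_lt f t⟩, h0.resolve_right, fun W' _ h => h.sub, ?_, ?_⟩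
    · rw [leC_iff_cval, h]
    · rw [leC_iff_cval, h]
  · rintro ⟨W, h1, h2, h3, h4⟩
    rw [leC_iff_cval] at h3 h4
    rw [← h3.antisymm h4]
    have h5 : P.Sub W.1 (tyPts (val f) t.1) := by
      by_cases hW : P.Sm W.1
      · exact hW.mono Set.sdiff_subset
      · exact (h1 hW).sub
    have h6 : P.Sub (tyPts (val f) t.1) W.1 := by
      by_cases hT : P.Sm (tyPts (val f) t.1)
      · exact hT.mono Set.sdiff_subset
      · exact h2 ⟨_, mk_tyPts_lt f t⟩ hT (h0.resolve_right hT)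
    have key : ∀ A B : P.PS, P.Sub A.1 B.1 → P.cval #A.1 ≤ P.cval #B.1 := fun A B h => by
      refine leC_iff_cval.1 ⟨A, A, 1, 1, Sub.of_subset Set.subset_union_left, ?_, ?_⟩ <;>
        simpa using h
    exact (key ⟨_, mk_tyPts_lt f t⟩ W h6).antisymm (key W ⟨_, mk_tyPts_lt f t⟩ h5)

end Par

open Par

/-- The relation between codes and elements of `M` for uncountable `κ`. -/
def CodesUncountable (P : Par.{u}) : (s : MSort) →
    ((match s with | .is n => Fin (n + 1) | .card => Empty | .fn n => Fin (n + 1)) → P.S) →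
    ((match s with | .is _ => Unit | .card => Unit | .fn _ => Empty) → P.PS) →
    MCarrier P.κ P.lam P.μ s → Prop
  | .is n => fun v A x =>
    let t : ULift.{u + 1} (IS P.lam P.μ (n + 1)) := x
    OfType (P := P) v (A ()).1 t.down.1
  | .card => fun _ A x =>
    let ν : CardMinus P.κ P.lam := x
    ν.1 = P.cval #(A ()).1
  | .fn n => fun v _ x =>
    let h : FSort P.κ P.lam P.μ (n + 1) := x
    h = P.cls (ty (P := P) v)

theorem cls_eq_iff {P : Par.{u}} (hκ : ℵ₀ < P.κ) {n : ℕ} {f f' : Fin n → P.S} :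
    P.cls (ty f) = P.cls (ty f') ↔ ∃ g : P.S, ∀ i, P.q (g * f i) = P.q (f' i * g) :=
  (FSort.mk_eq_iff P.hκ).trans (E_ty_iff hκ)

/-- The coding of `M` in the groups for uncountable `κ`. -/
noncomputable def codingUncountable :
    Coding.{u} (L := MLang) (fun P => ℵ₀ < P.κ) (fun P => P.M) where
  p := fun s : MSort => match s with | .is n => Fin (n + 1) | .card => Empty | .fn n => Fin (n + 1)
  r := fun s : MSort => match s with | .is _ => Unit | .card => Unit | .fn _ => Empty
  fin_p := fun s : MSort => match s with
    | .is n => inferInstanceAs (Finite (Fin (n + 1)))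
    | .card => inferInstanceAs (Finite Empty)
    | .fn n => inferInstanceAs (Finite (Fin (n + 1)))
  fin_r := fun s : MSort => match s with
    | .is n => inferInstanceAs (Finite Unit)
    | .card => inferInstanceAs (Finite Unit)
    | .fn n => inferInstanceAs (Finite Empty)
  C := CodesUncountable
  functional := by
    rintro P hP (n | _ | n) v A x y hx hy
    · exact ULift.down_injective (Subtype.ext (OfType.unique (P := P) hP hx hy))
    · exact Subtype.ext (Eq.trans hx (Eq.symm hy))
    · exact Eq.trans hx (Eq.symm hy)
  surjective := by
    rintro P hP (n | _ | n) x
    · obtain ⟨f, A, h⟩ := exists_ofType (P := P) hP (ULift.down x).1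
      exact ⟨f, fun _ => A, h⟩
    · obtain ⟨A, h⟩ := exists_cval_eq (P := P) x
      exact ⟨fun e => e.elim, fun _ => A, h⟩
    · obtain ⟨h, rfl⟩ := Quot.exists_rep x
      obtain ⟨f, rfl⟩ := exists_ty_eq (P := P) h
      exact ⟨f, fun e => e.elim, rfl⟩
  equal := by
    rintro (n | _ | n)
    · refine UDef.congr (R := fun P (v : Fin (n + 1) ⊕ Fin (n + 1) → P.S) (A : Unit ⊕ Unit → P.PS) =>
        Pure (fun i => v (.inl i)) (A (.inl ())) ∧ Pure (fun i => v (.inr i)) (A (.inr ())) ∧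
        Common (fun i => v (.inl i)) (A (.inl ())).1 (fun i => v (.inr i)) (A (.inr ())).1 ∧
        (P.lam ≤ P.μ → ¬ ∀ i, P.Sm {x ∈ (A (.inl ())).1 | (v (.inl i)).1 x ≠ (1 : P.S).1 x})) ?_ ?_
      · exact (UDef.pure (fun i => TDef.var _) _).and ((UDef.pure (fun i => TDef.var _) _).and
          ((UDef.common (fun i => TDef.var _) (fun i => TDef.var _) _ _).and
            (UDef.lam_le.imp (UDef.forall_fin fun i =>
              UDef.sm_ne (TDef.var _) TDef.one _).not)))
      · intro P hP v A
        exact (ofType_is_iff hP).symm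
    · refine UDef.congr (R := fun P (v : Empty ⊕ Empty → P.S) (A : Unit ⊕ Unit → P.PS) =>
        LeC (A (.inl ())) (A (.inr ())) ∧ LeC (A (.inr ())) (A (.inl ()))) ?_ ?_
      · exact (UDef.leC _ _).and (UDef.leC _ _)
      · intro P hP v A
        rw [leC_iff_cval, leC_iff_cval, ← le_antisymm_iff]
        constructor
        · intro h
          refine ⟨(⟨P.cval #(A (.inl ())).1, ?_, ?_⟩ : CardMinus P.κ P.lam), rfl, h⟩
          · unfold cval
            split_ifs
            · exact (A _).2
            · exact aleph0_pos.trans aleph0_lt_lam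
          · unfold cval
            split_ifs with h'
            · exact Or.inr h'
            · exact Or.inl rfl
        · rintro ⟨x, h1, h2⟩
          exact Eq.trans (Eq.symm h1) h2
    · refine UDef.congr (R := fun P (v : Fin (n + 1) ⊕ Fin (n + 1) → P.S) (A : Empty ⊕ Empty → P.PS) =>
        ∃ g : P.S, ∀ i, P.q (g * v (.inl i)) = P.q (v (.inr i) * g)) ?_ ?_
      · exact UDef.ex_perm (UDef.forall_fin fun i => UDef.eq ((TDef.var _).mul (TDef.var _))
          ((TDef.var _).mul (TDef.var _)))
      · intro P hP v A
        refine (cls_eq_iff (P := P) hP).symm.trans ?_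
        constructor
        · intro h
          exact ⟨_, rfl, h⟩
        · rintro ⟨x, h1, h2⟩
          exact Eq.trans (Eq.symm h1) h2

namespace codingUncountable

/-- `W` stands for the set of all points of type `t`: it is small or of type `t`, it almost contains
every set of type `t`, and its size is compared with that of the set coding the value. Being of type
`t` is expressed by the definable equality of codes in the sort `IS`. -/
theorem rep_app (n : ℕ) : codingUncountable.{u}.Rep (Sum.elim (MLang.dom (.app n)).get
    fun _ : Unit => MLang.cod (.app n))
    fun P x => P.M.func (.app n) (fun i => x (.inl i)) = x (.inr ()) := by
  let ιp := Σ i, codingUncountable.{u}.p (Sum.elim (MLang.dom (.app n)).get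
    (fun _ : Unit => MLang.cod (.app n)) i)
  let ιr := Σ i, codingUncountable.{u}.r (Sum.elim (MLang.dom (.app n)).get
    (fun _ : Unit => MLang.cod (.app n)) i)
  let a : Fin (n + 1) → ιp := fun k => ⟨.inl (0 : Fin 2), k⟩
  let b : Fin (n + 1) → ιp := fun k => ⟨.inl (1 : Fin 2), k⟩
  let T : ιr := ⟨.inl (1 : Fin 2), ()⟩
  let B : ιr := ⟨.inr (), ()⟩
  refine ⟨fun P (v : ιp → P.S) (A : ιr → P.PS) => ∃ W : P.PS,
    (¬ P.Sm W.1 → ∃ t : ULift.{u + 1} (IS P.lam P.μ (n + 1)),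
      OfType (fun i => v (a i)) W.1 t.down.1 ∧ OfType (fun i => v (b i)) (A T).1 t.down.1) ∧
    (∀ W' : P.PS, ¬ P.Sm W'.1 → (∃ t : ULift.{u + 1} (IS P.lam P.μ (n + 1)),
      OfType (fun i => v (a i)) W'.1 t.down.1 ∧ OfType (fun i => v (b i)) (A T).1 t.down.1) →
        P.Sub W'.1 W.1) ∧ LeC W (A B) ∧ LeC (A B) W, ?_, ?_⟩
  · have h := codingUncountable.{u}.equal (.is n)
    exact UDef.ex_set (((UDef.sm _).not.imp (h.comap (Sum.elim a b)
      (Sum.elim (fun _ => Sum.inl ()) fun _ => Sum.inr T))).and ((UDef.all_set ((UDef.sm _).not.imp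
        ((h.comap (Sum.elim a b) (Sum.elim (fun _ => Sum.inl ()) fun _ => Sum.inr (Sum.inr T))).imp
          (UDef.sub _ _)))).and ((UDef.leC _ _).and (UDef.leC _ _))))
  · intro P hP v A x hx
    have h1 : x (.inl (0 : Fin 2)) = P.cls (ty (P := P) fun i => v (a i)) := hx (.inl (0 : Fin 2))
    let t : ULift.{u + 1} (IS P.lam P.μ (n + 1)) := x (.inl (1 : Fin 2))
    let ν : CardMinus P.κ P.lam := x (.inr ())
    have h2 : OfType (P := P) (fun i => v (b i)) (A T).1 t.down.1 := hx (.inl (1 : Fin 2))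
    have h3 : ν.1 = P.cval #(A B).1 := hx (.inr ())
    have hW : ∀ W : P.PS, (∃ t : ULift.{u + 1} (IS P.lam P.μ (n + 1)),
        OfType (fun i => v (a i)) W.1 t.down.1 ∧ OfType (fun i => v (b i)) (A T).1 t.down.1) ↔
        OfType (fun i => v (a i)) W.1 t.down.1 := by
      intro W
      constructor
      · rintro ⟨s, hs, hs'⟩
        rwa [h2.unique hP hs']
      · exact fun h => ⟨t, h, h2⟩
    simp only [hW]
    rw [← cval_tyPts_iff (P := P) hP (t := t.down), ← h3]
    have e : (FSort.app (x (.inl (0 : Fin 2)) : FSort P.κ P.lam P.μ (n + 1)) t.down : CardMinus _ _).1 =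
        P.cval #(orbs (val fun i => v (a i)) t.down.1) := by
      rw [h1]
      exact app_cls_eq _ _
    rw [← e]
    exact Subtype.ext_iff.symm

theorem rep_proj (m n : ℕ) (σ : Fin (m + 1) ↪ Fin (n + 1)) :
    codingUncountable.{u}.Rep (Sum.elim (MLang.dom (.proj m n σ)).get
    fun _ : Unit => MLang.cod (.proj m n σ))
    fun P x => P.M.func (.proj m n σ) (fun i => x (.inl i)) = x (.inr ()) := by
  let ιp := Σ i, codingUncountable.{u}.p (Sum.elim (MLang.dom (.proj m n σ)).get
    (fun _ : Unit => MLang.cod (.proj m n σ)) i)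
  let a : Fin (n + 1) → ιp := fun k => ⟨.inl (0 : Fin 1), k⟩
  let b : Fin (m + 1) → ιp := fun k => ⟨.inr (), k⟩
  refine ⟨fun P (v : ιp → P.S) _ => ∃ g : P.S, ∀ i, P.q (g * v (a (σ i))) = P.q (v (b i) * g),
    ?_, ?_⟩
  · exact UDef.ex_perm (UDef.forall_fin fun i => UDef.eq ((TDef.var _).mul (TDef.var _))
          ((TDef.var _).mul (TDef.var _)))
  · intro P hP v A x hx
    have h1 : x (.inl (0 : Fin 1)) = P.cls (ty (P := P) fun i => v (a i)) := hx (.inl (0 : Fin 1))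
    have h2 : x (.inr ()) = P.cls (ty (P := P) fun i => v (b i)) := hx (.inr ())
    have e : P.cls (ty (P := P) fun i => v (a (σ i))) = (P.cls (ty (P := P) fun i => v (a i))).proj σ :=
      congrArg P.cls (tyPre_proj (fits (P := P) fun i => v (a i)) σ).symm
    refine (cls_eq_iff (P := P) hP).symm.trans ?_
    rw [e, ← h1, ← h2]
    exact Iff.rfl

theorem interprets : codingUncountable.{u}.Interprets where
  func := by
    rintro (n | ⟨m, n, σ⟩)
    · exact rep_app n
    · exact rep_proj m n σ
  rel := by
    rintro (_ | _ | ⟨m, n, σ⟩ | _ | _ | _)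
    · let ιp := Σ i, codingUncountable.{u}.p ((MLang.ar .eq1).get i)
      let ιr := Σ i, codingUncountable.{u}.r ((MLang.ar .eq1).get i)
      let a : Fin 2 → ιp := fun k => ⟨(0 : Fin 1), k⟩
      let T : ιr := ⟨(0 : Fin 1), ()⟩
      refine ⟨fun P (v : ιp → P.S) (A : ιr → P.PS) =>
        P.Sm {x ∈ (A T).1 | (v (a 0)).1 x ≠ (v (a 1)).1 x}, UDef.sm_ne (TDef.var _) (TDef.var _) _, ?_⟩
      intro P hP v A x hx
      let t : ULift.{u + 1} (IS P.lam P.μ 2) := x (0 : Fin 1)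
      have h : OfType (P := P) (fun i => v (a i)) (A T).1 t.down.1 := hx (0 : Fin 1)
      refine (h.sm_ne_iff hP (fun x => (v (a 0)).1 x = (v (a 1)).1 x)
        (fun c => t.down.1.rep.gen 0 c = t.down.1.rep.gen 1 c) ?_).trans
        (Equiv.ext_iff (f := t.down.1.rep.gen 0) (g := t.down.1.rep.gen 1)).symm
      intro j hj c
      rw [← hj.inj.eq_iff, hj.map, hj.map]
    · let ιp := Σ i, codingUncountable.{u}.p ((MLang.ar .prod1).get i)
      let ιr := Σ i, codingUncountable.{u}.r ((MLang.ar .prod1).get i)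
      let a : Fin 3 → ιp := fun k => ⟨(0 : Fin 1), k⟩
      let T : ιr := ⟨(0 : Fin 1), ()⟩
      refine ⟨fun P (v : ιp → P.S) (A : ιr → P.PS) =>
        P.Sm {x ∈ (A T).1 | (v (a 1) * v (a 0)).1 x ≠ (v (a 2)).1 x},
        UDef.sm_ne ((TDef.var _).mul (TDef.var _)) (TDef.var _) _, ?_⟩
      intro P hP v A x hx
      let t : ULift.{u + 1} (IS P.lam P.μ 3) := x (0 : Fin 1)
      have h : OfType (P := P) (fun i => v (a i)) (A T).1 t.down.1 := hx (0 : Fin 1)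
      refine h.sm_ne_iff hP (fun x => (v (a 1)).1 ((v (a 0)).1 x) = (v (a 2)).1 x)
        (fun c => t.down.1.rep.gen 1 (t.down.1.rep.gen 0 c) = t.down.1.rep.gen 2 c) ?_
      intro j hj c
      rw [← hj.inj.eq_iff, hj.map, hj.map, hj.map]
    · let ιp := Σ i, codingUncountable.{u}.p ((MLang.ar (.proj1 m n σ)).get i)
      let ιr := Σ i, codingUncountable.{u}.r ((MLang.ar (.proj1 m n σ)).get i)
      let a : Fin (n + 1) → ιp := fun k => ⟨(0 : Fin 2), k⟩
      let b : Fin (m + 1) → ιp := fun k => ⟨(1 : Fin 2), k⟩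
      let T : ιr := ⟨(0 : Fin 2), ()⟩
      let T' : ιr := ⟨(1 : Fin 2), ()⟩
      refine ⟨fun P (v : ιp → P.S) (A : ιr → P.PS) =>
        Common (fun i => v (a (σ i))) (A T).1 (fun i => v (b i)) (A T').1,
        UDef.common (fun i => TDef.var _) (fun i => TDef.var _) _ _, ?_⟩
      intro P hP v A x hx
      let t : ULift.{u + 1} (IS P.lam P.μ (n + 1)) := x (0 : Fin 2)
      let t' : ULift.{u + 1} (IS P.lam P.μ (m + 1)) := x (1 : Fin 2)
      have h : OfType (P := P) (fun i => v (a i)) (A T).1 t.down.1 := hx (0 : Fin 2)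
      have h' : OfType (P := P) (fun i => v (b i)) (A T').1 t'.down.1 := hx (1 : Fin 2)
      exact h.common_comp_iff hP h' σ
    · let ιr := Σ i, codingUncountable.{u}.r ((MLang.ar .lt).get i)
      let T : ιr := ⟨(0 : Fin 2), ()⟩
      let T' : ιr := ⟨(1 : Fin 2), ()⟩
      refine ⟨fun P v (A : ιr → P.PS) => ¬ LeC (A T') (A T), (UDef.leC _ _).not, ?_⟩
      intro P hP v A x hx
      let ν : CardMinus P.κ P.lam := x (0 : Fin 2)
      let ν' : CardMinus P.κ P.lam := x (1 : Fin 2)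
      have h : ν.1 = P.cval #(A T).1 := hx (0 : Fin 2)
      have h' : ν'.1 = P.cval #(A T').1 := hx (1 : Fin 2)
      refine (not_congr leC_iff_cval).trans (not_le.trans ?_)
      rw [← h, ← h']
      exact Iff.rfl
    · let ιp := Σ i, codingUncountable.{u}.p ((MLang.ar .eq).get i)
      let a : Fin 2 → ιp := fun k => ⟨(0 : Fin 1), k⟩
      refine ⟨fun P (v : ιp → P.S) _ => P.q (v (a 0)) = P.q (v (a 1)),
        UDef.eq (TDef.var _) (TDef.var _), ?_⟩
      intro P hP v A x hx
      have h : x (0 : Fin 1) = P.cls (ty (P := P) fun i => v (a i)) := hx (0 : Fin 1)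
      have e : P.M.rel .eq x ↔ FSort.IsEq (P.cls (ty (P := P) fun i => v (a i))) := by
        rw [← h]; exact Iff.rfl
      exact q_eq_iff.trans ((isEq_tyPre_iff P.hκ _).symm.trans e.symm)
    · let ιp := Σ i, codingUncountable.{u}.p ((MLang.ar .prod).get i)
      let a : Fin 3 → ιp := fun k => ⟨(0 : Fin 1), k⟩
      refine ⟨fun P (v : ιp → P.S) _ => P.q (v (a 1) * v (a 0)) = P.q (v (a 2)),
        UDef.eq ((TDef.var _).mul (TDef.var _)) (TDef.var _), ?_⟩
      intro P hP v A x hx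
      have h : x (0 : Fin 1) = P.cls (ty (P := P) fun i => v (a i)) := hx (0 : Fin 1)
      have e : P.M.rel .prod x ↔ FSort.IsProd (P.cls (ty (P := P) fun i => v (a i))) := by
        rw [← h]; exact Iff.rfl
      exact q_eq_iff.trans ((isProd_tyPre_iff P.hκ _).symm.trans e.symm)

end codingUncountable

/-! ### Points coded by the ends of infinite cycles, for `κ = ℵ₀` -/

namespace Par

variable {P : Par.{u}} {m n : ℕ}

/-- The set is invariant under `c` up to small sets. -/
def AI (c : P.S) (e : Set P.X) : Prop := P.Sub (c.1 '' e) e ∧ P.Sub (c⁻¹.1 '' e) e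

/-- A minimal non-small almost invariant set for `c`, contained in `V` up to a small set. -/
structure Atom (c : P.S) (V e : P.PS) : Prop where
  not_sm : ¬ P.Sm e.1
  ai : AI c e.1
  sub : P.Sub e.1 V.1
  min : ∀ e' : P.PS, ¬ P.Sm e'.1 → AI c e'.1 → P.Sub e'.1 e.1 → P.Sub e.1 e'.1

theorem sm_iff_finite (hκ : P.κ = ℵ₀) {A : Set P.X} : P.Sm A ↔ A.Finite := by
  rw [Sm, hκ, lt_aleph0_iff_set_finite]

theorem AI.inv {c : P.S} {e : Set P.X} (h : AI c e) : AI c⁻¹ e := ⟨h.2, by rw [inv_inv]; exact h.1⟩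

theorem AI.inter {c : P.S} {e e' : Set P.X} (h : AI c e) (h' : AI c e') : AI c (e ∩ e') :=
  ⟨(((Sub.of_subset (Set.image_mono Set.inter_subset_left)).trans h.1).inter
    ((Sub.of_subset (Set.image_mono Set.inter_subset_right)).trans h'.1)),
   (((Sub.of_subset (Set.image_mono Set.inter_subset_left)).trans h.2).inter
    ((Sub.of_subset (Set.image_mono Set.inter_subset_right)).trans h'.2))⟩

/-- The part of the cycle of `x` from the `a`-th iterate on. -/
def ray (c : Equiv.Perm P.X) (x : P.X) (a : ℤ) : Set P.X := (fun k : ℤ => (c ^ k) x) '' Set.Ici a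

theorem zpow_succ_apply (c : Equiv.Perm P.X) (x : P.X) (k : ℤ) :
    (c ^ (k + 1)) x = c ((c ^ k) x) := by
  rw [add_comm, zpow_add, zpow_one, Equiv.Perm.mul_apply]

theorem zpow_pred_apply (c : Equiv.Perm P.X) (x : P.X) (k : ℤ) :
    (c ^ (k - 1)) x = c⁻¹ ((c ^ k) x) := by
  rw [sub_eq_neg_add, zpow_add, zpow_neg_one, Equiv.Perm.mul_apply]

theorem ray_sub (hκ : P.κ = ℵ₀) (c : Equiv.Perm P.X) (x : P.X) (a b : ℤ) :
    P.Sub (ray c x a) (ray c x b) := by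
  rw [Sub, sm_iff_finite hκ]
  refine ((Set.finite_Ico a b).image fun k : ℤ => (c ^ k) x).subset ?_
  rintro _ ⟨⟨k, hk, rfl⟩, h⟩
  refine ⟨k, ⟨hk, ?_⟩, rfl⟩
  by_contra hkb
  exact h ⟨k, not_lt.1 hkb, rfl⟩

/-- Almost invariance allows the cycle to step out of `e` finitely often only. If it is in `e`
arbitrarily far out, it stays there from some exponent on. -/
theorem AI.exists_ray (hκ : P.κ = ℵ₀) {c : P.S} {e : Set P.X} (he : AI c e) {x : P.X}
    (hx : Function.Injective fun k : ℤ => (c.1 ^ k) x) (h : ∀ N : ℤ, ∃ k ≥ N, (c.1 ^ k) x ∈ e) :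
    ∃ a, ray c.1 x a ⊆ e := by
  have hb := (sm_iff_finite hκ).1 he.1
  have hK : {k : ℤ | (c.1 ^ k) x ∈ e ∧ (c.1 ^ (k + 1)) x ∉ e}.Finite := by
    refine Set.Finite.of_injOn (f := fun k : ℤ => (c.1 ^ (k + 1)) x) ?_
      (fun k _ l _ hkl => by simpa using hx hkl) hb
    rintro k ⟨h1, h2⟩
    exact ⟨⟨_, h1, (zpow_succ_apply _ _ _).symm⟩, h2⟩
  obtain ⟨N, hN⟩ := hK.bddAbove
  obtain ⟨a, ha, hae⟩ := h (N + 1)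
  refine ⟨a, ?_⟩
  rintro _ ⟨k, hk, rfl⟩
  replace hk : a ≤ k := hk
  change (c.1 ^ k) x ∈ e
  induction k, hk using Int.leInduction with
  | base => exact hae
  | succ k hk ih =>
    by_contra hcon
    have := hN ⟨ih, hcon⟩
    omega

theorem ray_ai (hκ : P.κ = ℵ₀) (c : P.S) (x : P.X) (a : ℤ) : AI c (ray c.1 x a) := by
  constructor
  · refine Sub.of_subset ?_
    rintro _ ⟨_, ⟨k, hk, rfl⟩, rfl⟩
    exact ⟨k + 1, le_trans (show a ≤ k from hk) (by omega), zpow_succ_apply _ _ _⟩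
  · refine Sub.trans (Sub.of_subset ?_) (ray_sub hκ c.1 x (a - 1) a)
    rintro _ ⟨_, ⟨k, hk, rfl⟩, rfl⟩
    have hk : a ≤ k := hk
    exact ⟨k - 1, by simpa using hk, zpow_pred_apply _ _ _⟩

theorem ray_infinite {c : Equiv.Perm P.X} {x : P.X}
    (hx : Function.Injective fun k : ℤ => (c ^ k) x) (a : ℤ) : (ray c x a).Infinite :=
  (Set.Ici_infinite a).image hx.injOn

theorem mk_ray_lt (c : Equiv.Perm P.X) (x : P.X) (a : ℤ) : #(ray c x a) < P.lam :=
  ((mk_le_aleph0_iff.2 ((Set.to_countable _).image _).to_subtype)).trans_lt aleph0_lt_lam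

/-- A non-small almost invariant set almost contained in the ray has infinitely many points on it,
hence contains a tail; and any two tails of the ray differ by a finite set. -/
theorem ray_atom (hκ : P.κ = ℵ₀) {c : P.S} {x : P.X}
    (hx : Function.Injective fun k : ℤ => (c.1 ^ k) x) {a : ℤ} {V : P.PS}
    (hV : P.Sub (ray c.1 x a) V.1) : Atom c V ⟨ray c.1 x a, mk_ray_lt _ _ _⟩ where
  not_sm := by rw [sm_iff_finite hκ]; exact ray_infinite hx a
  ai := ray_ai hκ c x a
  sub := hV
  min e' h1 h2 h3 := by
    have hinf : (e'.1 ∩ ray c.1 x a).Infinite := by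
      intro hf
      refine h1 ((Sm.union h3 ((sm_iff_finite hκ).2 hf)).mono fun y hy => ?_)
      by_cases hy' : y ∈ ray c.1 x a
      · exact Or.inr ⟨hy, hy'⟩
      · exact Or.inl ⟨hy, hy'⟩
    obtain ⟨b, hb⟩ := h2.exists_ray hκ hx fun N => by
      by_contra! hcon
      refine hinf (((Set.finite_Ico a N).image fun k : ℤ => (c.1 ^ k) x).subset ?_)
      rintro _ ⟨hy, k, hk, rfl⟩
      exact ⟨k, ⟨hk, by by_contra h; exact hcon k (not_lt.1 h) hy⟩, rfl⟩
    exact (ray_sub hκ c.1 x a b).trans (Sub.of_subset hb)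

theorem AI.of_subset_cycles {c : P.S} {e : Set P.X} (he : ∀ x, c.1 x ∈ e ↔ x ∈ e) : AI c e := by
  refine ⟨Sub.of_subset ?_, Sub.of_subset ?_⟩
  · rintro _ ⟨x, hx, rfl⟩
    exact (he x).2 hx
  · rintro _ ⟨x, hx, rfl⟩
    rw [← he]
    have : c.1 (c⁻¹.1 x) = x := c.1.apply_symm_apply x
    rwa [this]

theorem injective_zpow {c : Equiv.Perm P.X} {x : P.X}
    (h : (Set.range fun k : ℤ => (c ^ k) x).Infinite) :
    Function.Injective fun k : ℤ => (c ^ k) x := by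
  by_contra hcon
  refine h ?_
  have : ∃ d : ℤ, d ≠ 0 ∧ (c ^ d) x = x := by
    simp only [Function.Injective, not_forall] at hcon
    obtain ⟨k, l, hkl, hne⟩ := hcon
    refine ⟨-l + k, by omega, ?_⟩
    have hkl : (c ^ k) x = (c ^ l) x := hkl
    rw [zpow_add, Equiv.Perm.mul_apply, hkl, ← Equiv.Perm.mul_apply, ← zpow_add]
    simp
  obtain ⟨d, hd, hdx⟩ := this
  refine ((Set.finite_Ico 0 |d|).image fun k : ℤ => (c ^ k) x).subset ?_
  rintro _ ⟨k, rfl⟩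
  refine ⟨k % d, ⟨Int.emod_nonneg k hd, Int.emod_lt_abs k hd⟩, ?_⟩
  have e : k = k % d + d * (k / d) := (Int.emod_add_mul_ediv k d).symm
  change (c ^ (k % d)) x = (c ^ k) x
  conv_rhs => rw [e, zpow_add, Equiv.Perm.mul_apply, zpow_mul,
    Equiv.Perm.zpow_apply_eq_self_of_apply_eq_self hdx]

/-- If some cycle has infinitely many points in `e`, it stays in `e` in one of its two directions.
If there is no such cycle, then up to a finite set `e` is a union of finite cycles, which can be
divided into two infinite unions of cycles, against minimality. -/
theorem Atom.exists_ray (hκ : P.κ = ℵ₀) {c : P.S} {V e : P.PS} (h : Atom c V e) :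
    ∃ x, (Function.Injective fun k : ℤ => (c.1 ^ k) x) ∧
      ((∃ a, ray c.1 x a ⊆ e.1) ∨ ∃ a, ray c⁻¹.1 x a ⊆ e.1) := by
  have hsub : ∀ {e' : Set P.X}, e' ⊆ e.1 → #e' < P.lam := fun h =>
    (mk_le_mk_of_subset h).trans_lt e.2
  by_cases hinf : ∃ x, (e.1 ∩ Set.range fun k : ℤ => (c.1 ^ k) x).Infinite
  · obtain ⟨x, hx⟩ := hinf
    have hi := injective_zpow (hx.mono Set.inter_subset_right)
    refine ⟨x, hi, ?_⟩
    have hJ : {k : ℤ | (c.1 ^ k) x ∈ e.1}.Infinite := by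
      intro hf
      refine hx ((hf.image fun k : ℤ => (c.1 ^ k) x).subset ?_)
      rintro _ ⟨hy, k, rfl⟩
      exact ⟨k, hy, rfl⟩
    have hz : ∀ k : ℤ, (c⁻¹.1 ^ k) x = (c.1 ^ (-k)) x := fun k => by
      rw [show c⁻¹.1 = c.1⁻¹ from rfl, inv_zpow']
    by_cases hup : ∀ N : ℤ, ∃ k ≥ N, (c.1 ^ k) x ∈ e.1
    · exact Or.inl (h.ai.exists_ray hκ hi hup)
    · refine Or.inr (h.ai.inv.exists_ray hκ (fun k l hkl => ?_) fun N => ?_)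
      · dsimp only at hkl
        rw [hz, hz] at hkl
        exact neg_injective (hi hkl)
      · by_contra! hdown
        push Not at hup
        obtain ⟨M, hM⟩ := hup
        refine hJ ((Set.finite_Icc (-N) M).subset fun k hk => ⟨?_, ?_⟩)
        · by_contra hkN
          refine hdown (-k) (by omega) ?_
          rw [hz, neg_neg]
          exact hk
        · by_contra hkM
          exact hM k (by omega) hk
  · exfalso
    push Not at hinf
    -- `F` contains the finitely many points where `c` or its inverse leaves `e`. Deleting their
    -- cycles costs finitely many points of `e` and leaves an invariant set `e'`.
    let F : Set P.X := c.1 ⁻¹' (c.1 '' e.1 \ e.1) ∪ c⁻¹.1 ⁻¹' (c⁻¹.1 '' e.1 \ e.1)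
    have hF : F.Finite := (sm_iff_finite hκ).1 ((Sm.preimage h.ai.1 c.1).union
      (Sm.preimage h.ai.2 c⁻¹.1))
    have hFm : ∀ x ∈ e.1, x ∉ F → c.1 x ∈ e.1 ∧ c⁻¹.1 x ∈ e.1 := by
      intro x hx hxF
      constructor
      · by_contra hcon
        exact hxF (Or.inl ⟨⟨x, hx, rfl⟩, hcon⟩)
      · by_contra hcon
        exact hxF (Or.inr ⟨⟨x, hx, rfl⟩, hcon⟩)
    let e' : Set P.X := {x ∈ e.1 | ∀ y ∈ F, ¬ c.1.SameCycle x y}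
    have he' : ∀ x, c.1 x ∈ e' ↔ x ∈ e' := by
      intro x
      have hc : ∀ y, c.1.SameCycle (c.1 x) y ↔ c.1.SameCycle x y := fun y =>
        Equiv.Perm.sameCycle_apply_left
      constructor
      · rintro ⟨h1, h2⟩
        have h3 : c.1 x ∉ F := fun h => h2 _ h (Equiv.Perm.SameCycle.refl _ _)
        refine ⟨?_, fun y hy h => h2 y hy ((hc y).2 h)⟩
        have := (hFm _ h1 h3).2
        rwa [show c⁻¹.1 (c.1 x) = x from c.1.symm_apply_apply x] at this
      · rintro ⟨h1, h2⟩
        have h3 : x ∉ F := fun h => h2 _ h (Equiv.Perm.SameCycle.refl _ _)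
        exact ⟨(hFm _ h1 h3).1, fun y hy h => h2 y hy ((hc y).1 h)⟩
    have hdiff : P.Sm (e.1 \ e') := by
      rw [sm_iff_finite hκ]
      refine (hF.biUnion (t := fun y => e.1 ∩ Set.range fun k : ℤ => (c.1 ^ k) y)
        fun y _ => hinf y).subset ?_
      rintro x ⟨hx, hx'⟩
      have : ∃ y ∈ F, c.1.SameCycle x y := by
        by_contra! hcon
        exact hx' ⟨hx, hcon⟩
      obtain ⟨y, hy, hxy⟩ := this
      exact Set.mem_biUnion hy ⟨hx, hxy.symm⟩
    have hns : ¬ P.Sm e' := fun h' => h.not_sm ((hdiff.union h').mono fun x hx => by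
      by_cases hx' : x ∈ e'
      · exact Or.inr hx'
      · exact Or.inl ⟨hx, hx'⟩)
    let τ : e' → Set P.X := fun x => {y | c.1.SameCycle x.1 y}
    have hτ : ∀ x y : e', τ x = τ y ↔ c.1.SameCycle x.1 y.1 := by
      intro x y
      constructor
      · intro h
        have : y.1 ∈ τ y := Equiv.Perm.SameCycle.refl _ _
        rw [← h] at this
        exact this
      · intro h
        ext z
        exact ⟨fun h' => h.symm.trans h', fun h' => h.trans h'⟩
    -- The map `τ` sends a point to its cycle, so the two parts are unions of cycles and therefore
    -- invariant.
    obtain ⟨Q, hQ, hQ'⟩ := Cardinal.exists_split τ (le_refl ℵ₀)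
      (by rw [Sm, hκ, not_lt] at hns; exact hns) fun i => by
        rw [lt_aleph0_iff_set_finite]
        by_cases hi : ∃ x, τ x = i
        · obtain ⟨x, rfl⟩ := hi
          refine Set.Finite.of_injOn (f := Subtype.val) (t := e.1 ∩ Set.range fun k : ℤ => (c.1 ^ k) x.1)
            ?_ Subtype.val_injective.injOn (hinf x.1)
          intro y hy
          exact ⟨y.2.1, (hτ _ _).1 (Eq.symm hy)⟩
        · refine Set.Finite.subset Set.finite_empty fun x hx => hi ⟨x, hx⟩
    have key : ∀ Q : Set (Set P.X), ℵ₀ ≤ #(τ ⁻¹' Q) → P.Sub e.1 (Subtype.val '' (τ ⁻¹' Q)) := by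
      intro Q hQ
      have hsube : Subtype.val '' (τ ⁻¹' Q) ⊆ e.1 := by
        rintro _ ⟨x, _, rfl⟩
        exact x.2.1
      refine h.min ⟨_, hsub hsube⟩ ?_ (AI.of_subset_cycles fun x => ?_) (Sub.of_subset hsube)
      · rw [Sm, hκ, not_lt, mk_image_eq Subtype.val_injective]
        exact hQ
      · have h1 : ∀ (hx : x ∈ e') (hx' : c.1 x ∈ e'), τ ⟨x, hx⟩ = τ ⟨c.1 x, hx'⟩ := fun _ _ =>
          (hτ _ _).2 (Equiv.Perm.sameCycle_apply_right.2 (Equiv.Perm.SameCycle.refl _ _))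
        constructor
        · rintro ⟨⟨_, hy⟩, hyQ, rfl⟩
          exact ⟨⟨x, (he' x).1 hy⟩, by rw [Set.mem_preimage, h1 _ hy]; exact hyQ, rfl⟩
        · rintro ⟨⟨_, hy⟩, hyQ, rfl⟩
          exact ⟨⟨_, (he' _).2 hy⟩, by rw [Set.mem_preimage, ← h1 hy]; exact hyQ, rfl⟩
    refine h.not_sm (Sm.mono (key Q hQ |>.inter (key Qᶜ hQ')) fun x hx => ⟨hx, ?_⟩)
    rintro ⟨⟨a, ha, rfl⟩, b, hb, hab⟩
    exact hb (by rw [Subtype.ext hab]; exact ha)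

end Par

/-! ### Ends of infinite cycles as new points -/

namespace Par

variable {P : Par.{u}} {m n : ℕ}

/-- The point is the chosen base point of an infinite cycle of `c`. -/
def IsBase (c : Equiv.Perm P.X) (x : P.X) : Prop :=
  Quotient.out (Quotient.mk (Equiv.Perm.SameCycle.setoid c) x) = x ∧
    Function.Injective fun k : ℤ => (c ^ k) x

theorem exists_base {c : Equiv.Perm P.X} {x : P.X}
    (hx : Function.Injective fun k : ℤ => (c ^ k) x) : ∃ k : ℤ, IsBase c ((c ^ k) x) := by
  obtain ⟨k, hk⟩ : c.SameCycle x (Quotient.out (Quotient.mk (Equiv.Perm.SameCycle.setoid c) x)) :=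
    (Quotient.mk_out (s := Equiv.Perm.SameCycle.setoid c) x).symm
  refine ⟨k, ?_, fun i j hij => ?_⟩
  · have : Quotient.mk (Equiv.Perm.SameCycle.setoid c) ((c ^ k) x) =
        Quotient.mk (Equiv.Perm.SameCycle.setoid c) x :=
      Quotient.sound (Equiv.Perm.SameCycle.symm ⟨k, rfl⟩)
    rw [this, hk]
  · dsimp only at hij
    rw [← Equiv.Perm.mul_apply, ← Equiv.Perm.mul_apply, ← zpow_add, ← zpow_add] at hij
    simpa using hx hij

/-- The exponents of an end of a cycle. -/
def endIdx (b : Bool) (n : ℕ) : ℤ := if b then n else -(n + 1)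

/-- The exponent `0` is given to the positive end only, so the two ends of a cycle are disjoint. -/
theorem endIdx_inj {b b' : Bool} {n n' : ℕ} (h : endIdx b n = endIdx b' n') : b = b' ∧ n = n' := by
  cases b <;> cases b' <;> simp [endIdx] at h ⊢ <;> omega

/-- The ends, contained in `V` up to small sets, of the infinite cycles of `c`. -/
def Pt (c : P.S) (V : P.PS) : Type u :=
  {p : Bool × P.X // IsBase c.1 p.2 ∧
    P.Sub (Set.range fun n : ℕ => (c.1 ^ endIdx p.1 n) p.2) V.1}

namespace Pt

variable {c : P.S} {V : P.PS}

/-- The elements of an end. -/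
def elt (x : Pt c V × ℕ) : P.X := (c.1 ^ endIdx x.1.1.1 x.2) x.1.1.2

/-- With one base point for each cycle and disjoint sets of exponents, different ends are disjoint
outright and not merely up to finite sets. -/
theorem elt_injective : Function.Injective (elt (c := c) (V := V)) := by
  rintro ⟨⟨⟨b, x⟩, hx, hV⟩, k⟩ ⟨⟨⟨b', x'⟩, hx', hV'⟩, k'⟩ h
  change (c.1 ^ endIdx b k) x = (c.1 ^ endIdx b' k') x' at h
  have hs : c.1.SameCycle x x' := by
    have : c.1.SameCycle ((c.1 ^ endIdx b k) x) x' := by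
      rw [h]; exact Equiv.Perm.sameCycle_zpow_left.2 (.refl _ _)
    exact Equiv.Perm.sameCycle_zpow_left.1 this
  have hxx : x = x' := by
    have e : Quotient.mk (Equiv.Perm.SameCycle.setoid c.1) x =
      Quotient.mk (Equiv.Perm.SameCycle.setoid c.1) x' := Quotient.sound hs
    exact hx.1.symm.trans ((congrArg Quotient.out e).trans hx'.1)
  subst hxx
  obtain ⟨rfl, rfl⟩ := endIdx_inj (hx.2 h)
  rfl

/-- Each end is infinite and almost contained in `V`, so it has a point in `V`. Ends being disjoint,
there are at most `#V` of them. -/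
theorem mk_prod_lt (hκ : P.κ = ℵ₀) : #(Pt c V × ℕ) < P.lam := by
  have h1 : #(Pt c V) < P.lam := by
    have h : ∀ p : Pt c V, ∃ k, elt (p, k) ∈ V.1 := by
      intro p
      by_contra! hcon
      have h2 : Set.range (fun k => elt (p, k)) ⊆ (Set.range fun k => elt (p, k)) \ V.1 := by
        rintro _ ⟨k, rfl⟩
        exact ⟨⟨k, rfl⟩, hcon k⟩
      have h3 : #(Set.range (fun k => elt (p, k))) < P.κ := Sm.mono p.2.2 h2
      have h4 : #(ULift.{u} ℕ) ≤ #(Set.range fun k => elt (p, k)) :=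
        mk_le_of_injective (f := fun k => ⟨elt (p, k.down), k.down, rfl⟩) fun k l hkl =>
          ULift.down_injective
            (congrArg Prod.snd (elt_injective (congrArg (fun z => z.1) hkl)))
      rw [mk_uLift, mk_nat, lift_aleph0] at h4
      exact absurd (h4.trans_lt h3) (not_lt.2 hκ.le)
    choose k hk using h
    refine lt_of_le_of_lt (mk_le_of_injective (f := fun p => (⟨_, hk p⟩ : V.1)) ?_) V.2
    intro p q hpq
    exact congrArg Prod.fst (elt_injective (congrArg (fun z => z.1) hpq))
  rw [mk_prod, lift_uzero, mk_nat, lift_aleph0]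
  exact mul_lt_of_lt aleph0_lt_lam.le h1 aleph0_lt_lam

theorem mk_lt (hκ : P.κ = ℵ₀) : #(Pt c V) < P.lam :=
  (mk_le_of_injective (f := fun p => (p, 0)) fun _ _ h => congrArg Prod.fst h).trans_lt (mk_prod_lt hκ)

/-- The set of the elements of an end. -/
def set (p : Pt c V) : P.PS := ⟨Set.range fun k => elt (p, k),
  lt_of_le_of_lt (le_aleph0_iff_set_countable.2 (Set.countable_range _)) aleph0_lt_lam⟩

theorem sub_iff {p : Pt c V} {A : Set P.X} (hκ : P.κ = ℵ₀) :
    P.Sub p.set.1 A ↔ {k | elt (p, k) ∉ A}.Finite := by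
  rw [Sub, sm_iff_finite hκ]
  constructor
  · intro h
    refine Set.Finite.of_injOn (f := fun k => elt (p, k)) (t := p.set.1 \ A)
      (fun k hk => ⟨⟨k, rfl⟩, hk⟩)
      (fun k _ l _ hkl => congrArg Prod.snd (elt_injective hkl)) h
  · intro h
    refine (h.image fun k => elt (p, k)).subset ?_
    rintro _ ⟨⟨k, rfl⟩, hk⟩
    exact ⟨k, hk, rfl⟩

theorem set_eq_ray (p : Pt c V) : p.set.1 =
    if p.1.1 then ray c.1 p.1.2 0 else ray c⁻¹.1 p.1.2 1 := by
  obtain ⟨⟨b, x⟩, h⟩ := p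
  change (Set.range fun k : ℕ => (c.1 ^ endIdx b k) x) = _
  cases b
  · simp only [endIdx, Bool.false_eq_true, if_false]
    ext y
    constructor
    · rintro ⟨k, rfl⟩
      refine ⟨k + 1, by simp, ?_⟩
      change (c.1⁻¹ ^ ((k : ℤ) + 1)) x = _
      rw [inv_zpow']
    · rintro ⟨k, hk, rfl⟩
      have hk : 1 ≤ k := hk
      refine ⟨(k - 1).toNat, ?_⟩
      change _ = (c.1⁻¹ ^ k) x
      have e : -(((k - 1).toNat : ℤ) + 1) = -k := by omega
      dsimp only
      rw [inv_zpow', e]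
  · simp only [endIdx, if_true]
    ext y
    constructor
    · rintro ⟨k, rfl⟩
      exact ⟨k, by simp, rfl⟩
    · rintro ⟨k, hk, rfl⟩
      have hk : 0 ≤ k := hk
      exact ⟨k.toNat, by dsimp only; rw [Int.toNat_of_nonneg hk]⟩

theorem atom (hκ : P.κ = ℵ₀) (p : Pt c V) : Atom c V p.set := by
  have hV : P.Sub p.set.1 V.1 := p.2.2
  have hi := p.2.1.2
  have hs := set_eq_ray p
  by_cases hb : p.1.1
  · rw [if_pos hb] at hs
    have h := ray_atom hκ hi (a := 0) (V := V) (hs ▸ hV)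
    convert h using 1
    exact Subtype.ext hs
  · rw [if_neg hb] at hs
    have h := ray_atom hκ (c := c⁻¹) (x := p.1.2) (fun k l hkl => ?_) (a := 1) (V := V) (hs ▸ hV)
    · have h' : Atom c V ⟨ray c⁻¹.1 p.1.2 1, mk_ray_lt _ _ _⟩ :=
        ⟨h.not_sm, by have := h.ai.inv; rwa [inv_inv] at this, h.sub, fun e' h1 h2 h3 => h.min e' h1 h2.inv h3⟩
      convert h' using 1
      exact Subtype.ext hs
    · dsimp only at hkl
      change (c.1⁻¹ ^ k) _ = (c.1⁻¹ ^ l) _ at hkl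
      rw [inv_zpow', inv_zpow'] at hkl
      exact neg_injective (hi hkl)

theorem _root_.Par.Atom.exists_pt (hκ : P.κ = ℵ₀) {e : P.PS} (he : Atom c V e) :
    ∃ p : Pt c V, P.Sub p.set.1 e.1 := by
  obtain ⟨x, hx, h⟩ := he.exists_ray hκ
  obtain ⟨k, hk⟩ := exists_base hx
  have key : ∀ (b : Bool) (s : P.S) (a : ℤ), s = (if b then c else c⁻¹) → ray s.1 x a ⊆ e.1 →
      ∃ p : Pt c V, P.Sub p.set.1 e.1 := by
    intro b s a hs hray
    have h1 : P.Sub (Set.range fun n : ℕ => (c.1 ^ endIdx b n) ((c.1 ^ k) x)) e.1 := by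
      have hsub : P.Sub (ray s.1 x (a - |a| - |k| - 1)) e.1 :=
        (ray_sub hκ _ _ _ a).trans (Sub.of_subset hray)
      refine Sub.trans ?_ hsub
      cases b
      · simp only [Bool.false_eq_true, if_false] at hs
        subst hs
        refine (Sub.of_subset ?_).trans (ray_sub hκ c⁻¹.1 x (1 - k) _)
        rintro _ ⟨l, rfl⟩
        refine ⟨l + 1 - k, show 1 - k ≤ l + 1 - k by omega, ?_⟩
        change (c.1⁻¹ ^ ((l : ℤ) + 1 - k)) x = _
        dsimp only [endIdx]
        rw [inv_zpow', ← Equiv.Perm.mul_apply, ← zpow_add]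
        congr 2
        simp only [Bool.false_eq_true, if_false]
        ring
      · simp only [if_true] at hs
        subst hs
        refine (Sub.of_subset ?_).trans (ray_sub hκ s.1 x k _)
        rintro _ ⟨l, rfl⟩
        refine ⟨l + k, show k ≤ l + k by omega, ?_⟩
        dsimp only [endIdx]
        rw [← Equiv.Perm.mul_apply, ← zpow_add]
        simp
    exact ⟨⟨(b, (c.1 ^ k) x), hk, h1.trans he.sub⟩, h1⟩
  rcases h with ⟨a, ha⟩ | ⟨a, ha⟩
  · exact key true c a rfl ha
  · exact key false c⁻¹ a rfl ha

end Pt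

/-- Equality up to small sets. -/
def Eqv (A B : P.PS) : Prop := P.Sub A.1 B.1 ∧ P.Sub B.1 A.1

theorem Eqv.symm {A B : P.PS} (h : Eqv A B) : Eqv B A := ⟨h.2, h.1⟩

theorem Eqv.trans {A B C : P.PS} (h : Eqv A B) (h' : Eqv B C) : Eqv A C :=
  ⟨h.1.trans h'.1, h'.2.trans h.2⟩

theorem Eqv.refl (A : P.PS) : Eqv A A := ⟨Sub.refl _, Sub.refl _⟩

theorem Atom.eqv_of_sub {c : P.S} {V e e' : P.PS} (h : Atom c V e) (h' : Atom c V e')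
    (hs : P.Sub e.1 e'.1) : Eqv e e' := ⟨hs, h'.min e h.not_sm h.ai hs⟩

namespace Pt

variable {c : P.S} {V : P.PS}

theorem eq_of_not_sm {p q : Pt c V} (h : ¬ P.Sm (p.set.1 ∩ q.set.1)) : p = q := by
  by_contra hpq
  refine h ?_
  convert Sm.empty (P := P)
  rw [Set.eq_empty_iff_forall_notMem]
  rintro _ ⟨⟨k, rfl⟩, l, hl⟩
  exact hpq (congrArg Prod.fst (elt_injective hl)).symm

theorem eq_of_sub {p q : Pt c V} (hκ : P.κ = ℵ₀) (h : P.Sub p.set.1 q.set.1) : p = q :=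
  eq_of_not_sm fun h' => (p.atom hκ).not_sm ((Sm.union h h').mono fun x hx => by
    by_cases hq : x ∈ q.set.1
    · exact Or.inr ⟨hx, hq⟩
    · exact Or.inl ⟨hx, hq⟩)

theorem exists_eqv (hκ : P.κ = ℵ₀) {e : P.PS} (he : Atom c V e) : ∃ p : Pt c V, Eqv p.set e := by
  obtain ⟨p, hp⟩ := he.exists_pt hκ
  exact ⟨p, (p.atom hκ).eqv_of_sub he hp⟩

/-- Every atom agrees with exactly one end up to a finite set. Quantification over ends is thus
quantification over atoms, as long as the property respects `Eqv`; every definition in terms of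
points has to be checked for this. -/
theorem forall_iff (hκ : P.κ = ℵ₀) {φ : P.PS → Prop} (hφ : ∀ e e', Eqv e e' → φ e → φ e') :
    (∀ e, Atom c V e → φ e) ↔ ∀ p : Pt c V, φ p.set := by
  constructor
  · exact fun h p => h _ (p.atom hκ)
  · intro h e he
    obtain ⟨p, hp⟩ := exists_eqv hκ he
    exact hφ _ _ hp (h p)

theorem exists_iff (hκ : P.κ = ℵ₀) {φ : P.PS → Prop} (hφ : ∀ e e', Eqv e e' → φ e → φ e') :
    (∃ e, Atom c V e ∧ φ e) ↔ ∃ p : Pt c V, φ p.set := by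
  constructor
  · rintro ⟨e, he, h⟩
    obtain ⟨p, hp⟩ := exists_eqv hκ he
    exact ⟨p, hφ _ _ hp.symm h⟩
  · rintro ⟨p, hp⟩
    exact ⟨_, p.atom hκ, hp⟩

end Pt

end Par

/-! ### Permutations, partial injections and subsets of the new points -/

namespace Par

variable {P : Par.{u}} {m n : ℕ}

theorem nonempty_of_not_sm {A : Set P.X} (h : ¬ P.Sm A) : A.Nonempty :=
  Set.nonempty_iff_ne_empty.2 fun h' => h (h' ▸ Sm.empty)

/-- The permutation maps the one set onto the other up to small sets. -/
def Im (f : P.S) (e e' : P.PS) : Prop := P.Sub (f.1 '' e.1) e'.1 ∧ P.Sub (f⁻¹.1 '' e'.1) e.1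

theorem image_inv_image (f : P.S) (A : Set P.X) : f.1 '' (f⁻¹.1 '' A) = A := by
  change (f.1 : P.X → P.X) '' ((f.1⁻¹ : Equiv.Perm P.X) '' A) = A
  rw [← Set.image_comp, ← Equiv.Perm.coe_mul, mul_inv_cancel]
  exact Set.image_id _

theorem image_image_inv (f : P.S) (A : Set P.X) : f⁻¹.1 '' (f.1 '' A) = A := by
  have h := image_inv_image f⁻¹ A
  rwa [inv_inv] at h

theorem Im.inv {f : P.S} {e e' : P.PS} (h : Im f e e') : Im f⁻¹ e' e :=
  ⟨h.2, by rw [inv_inv]; exact h.1⟩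

theorem Im.eqv {f : P.S} {e e' e₁ : P.PS} (h : Im f e e') (h' : Im f e e₁) : Eqv e' e₁ := by
  have key : ∀ {e' e₁ : P.PS}, Im f e e' → Im f e e₁ → P.Sub e'.1 e₁.1 := fun {e' e₁} h h' => by
    have h1 := h.2.image f.1
    rw [image_inv_image] at h1
    exact h1.trans h'.1
  exact ⟨key h h', key h' h⟩

theorem Im.congr {f : P.S} {e e' e₁ e₁' : P.PS} (h : Im f e e') (h1 : Eqv e e₁) (h2 : Eqv e' e₁') :
    Im f e₁ e₁' :=
  ⟨(h1.2.image _).trans (h.1.trans h2.1), (h2.2.image _).trans (h.2.trans h1.1)⟩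

/-- The set `e` has a non-small part in `W` that `g` maps into `e'`, up to small sets. -/
def Link (g : P.S) (W e e' : P.PS) : Prop := ∃ F : P.PS, ¬ P.Sm F.1 ∧ P.Sub F.1 e.1 ∧
  P.Sub F.1 W.1 ∧ P.Sub (g.1 '' F.1) e'.1

theorem Link.congr {g : P.S} {W e e' e₁ e₁' : P.PS} (h : Link g W e e') (h1 : Eqv e e₁)
    (h2 : Eqv e' e₁') : Link g W e₁ e₁' := by
  obtain ⟨F, hF, h3, h4, h5⟩ := h
  exact ⟨F, hF, h3.trans h1.1, h4, h5.trans h2.1⟩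

/-- The sets have a non-small intersection. -/
def Meet (U e : P.PS) : Prop := ∃ F : P.PS, ¬ P.Sm F.1 ∧ P.Sub F.1 U.1 ∧ P.Sub F.1 e.1

theorem Meet.congr {U e e' : P.PS} (h : Meet U e) (h1 : Eqv e e') : Meet U e' := by
  obtain ⟨F, hF, h3, h4⟩ := h
  exact ⟨F, hF, h3, h4.trans h1.1⟩

theorem meet_iff {U e : P.PS} : Meet U e ↔ ¬ P.Sm (U.1 ∩ e.1) := by
  constructor
  · rintro ⟨F, hF, h1, h2⟩ h
    exact hF ((h1.inter h2).sm h)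
  · intro h
    exact ⟨⟨U.1 ∩ e.1, (mk_le_mk_of_subset Set.inter_subset_left).trans_lt U.2⟩, h,
      Sub.of_subset Set.inter_subset_left, Sub.of_subset Set.inter_subset_right⟩

namespace Pt

variable {c c' : P.S} {V V' : P.PS}

theorem not_sm (hκ : P.κ = ℵ₀) (p : Pt c V) : ¬ P.Sm p.set.1 := (p.atom hκ).not_sm

theorem eq_of_eqv (hκ : P.κ = ℵ₀) {p q : Pt c V} (h : Eqv p.set q.set) : p = q := eq_of_sub hκ h.1

open Classical in
/-- The permutation of the points induced by a permutation, if there is one. -/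
noncomputable def act (c : P.S) (V : P.PS) (f : P.S) : Equiv.Perm (Pt c V) :=
  if h : (∀ p : Pt c V, ∃! q : Pt c V, Im f p.set q.set) ∧
      ∀ q : Pt c V, ∃! p : Pt c V, Im f p.set q.set then
    { toFun := fun p => (h.1 p).choose
      invFun := fun q => (h.2 q).choose
      left_inv := fun p => ((h.2 _).choose_spec.2 p (h.1 p).choose_spec.1).symm
      right_inv := fun q => ((h.1 _).choose_spec.2 q (h.2 q).choose_spec.1).symm }
  -- A junk value: the facts about `act` assume `Valid`.
  else 1

/-- The permutation induces a permutation of the points. -/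
def Valid (c : P.S) (V : P.PS) (f : P.S) : Prop :=
  (∀ p : Pt c V, ∃ q : Pt c V, Im f p.set q.set) ∧ ∀ q : Pt c V, ∃ p : Pt c V, Im f p.set q.set

theorem act_eq_iff (hκ : P.κ = ℵ₀) {f : P.S} (hf : Valid c V f) {p q : Pt c V} :
    act c V f p = q ↔ Im f p.set q.set := by
  have h : (∀ p : Pt c V, ∃! q : Pt c V, Im f p.set q.set) ∧
      ∀ q : Pt c V, ∃! p : Pt c V, Im f p.set q.set := by
    refine ⟨fun p => ?_, fun q => ?_⟩
    · obtain ⟨q, hq⟩ := hf.1 p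
      exact ⟨q, hq, fun q' hq' => eq_of_eqv hκ (hq'.eqv hq)⟩
    · obtain ⟨p, hp⟩ := hf.2 q
      exact ⟨p, hp, fun p' hp' => eq_of_eqv hκ (hp'.inv.eqv hp.inv)⟩
  have e : act c V f p = (h.1 p).choose := by
    rw [act, dif_pos h]
    rfl
  rw [e]
  constructor
  · rintro rfl
    exact (h.1 p).choose_spec.1
  · exact fun hq => ((h.1 p).choose_spec.2 q hq).symm

/-- A partial injection between two sets of ends is realized by one permutation that carries the
even-numbered elements of each end to those of its partner. So partial injections are coded by a
permutation and a set. -/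
theorem exists_link (hκ : P.κ = ℵ₀) {L : Pt c V → Pt c' V' → Prop}
    (hf : ∀ {x y y'}, L x y → L x y' → y = y') (hi : ∀ {x x' y}, L x y → L x' y → x = x') :
    ∃ (g : P.S) (W : P.PS), ∀ p p', Link g W p.set p'.set ↔ L p p' := by
  let D := {d : Pt c V × Pt c' V' // L d.1 d.2}
  have hD : ∀ d d' : D, d.1.1 = d'.1.1 → d = d' := fun d d' h => by
    refine Subtype.ext (Prod.ext h (hf d.2 ?_))
    rw [h]; exact d'.2
  have hD' : ∀ d d' : D, d.1.2 = d'.1.2 → d = d' := fun d d' h => by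
    refine Subtype.ext (Prod.ext (hi d.2 ?_) h)
    rw [h]; exact d'.2
  -- Only even indices are used; the odd ones, in `o` and `o'`, show that the complements are large
  -- enough for `exists_perm_of_injective`.
  let i : D × ℕ → P.X := fun x => elt (x.1.1.1, 2 * x.2)
  let o : D × ℕ → P.X := fun x => elt (x.1.1.1, 2 * x.2 + 1)
  let i' : D × ℕ → P.X := fun x => elt (x.1.1.2, 2 * x.2)
  let o' : D × ℕ → P.X := fun x => elt (x.1.1.2, 2 * x.2 + 1)
  have hinj : Function.Injective i := by
    rintro ⟨d, k⟩ ⟨d', k'⟩ h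
    have h := elt_injective h
    simp only [Prod.mk.injEq] at h
    obtain rfl := hD _ _ h.1
    obtain rfl : k = k' := by omega
    rfl
  have hinj' : Function.Injective i' := by
    rintro ⟨d, k⟩ ⟨d', k'⟩ h
    have h := elt_injective h
    simp only [Prod.mk.injEq] at h
    obtain rfl := hD' _ _ h.1
    obtain rfl : k = k' := by omega
    rfl
  have hI : #(D × ℕ) < P.lam := by
    refine lt_of_le_of_lt (mk_le_of_injective (f := fun x : D × ℕ => (x.1.1.1, x.2)) ?_)
      (mk_prod_lt (c := c) (V := V) hκ)
    rintro ⟨d, k⟩ ⟨d', k'⟩ h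
    simp only [Prod.mk.injEq] at h
    obtain rfl := hD _ _ h.1
    obtain rfl := h.2
    rfl
  have hc : #(D × ℕ) ≤ #((Set.range i)ᶜ : Set P.X) := by
    refine mk_le_of_injective (f := fun x => ⟨o x, ?_⟩) ?_
    · rintro ⟨⟨d, k⟩, h⟩
      have h := elt_injective h
      simp only [Prod.mk.injEq] at h
      omega
    · rintro ⟨d, k⟩ ⟨d', k'⟩ h
      have h := elt_injective (congrArg Subtype.val h)
      simp only [Prod.mk.injEq] at h
      obtain rfl := hD _ _ h.1
      obtain rfl : k = k' := by omega
      rfl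
  have hc' : #(D × ℕ) ≤ #((Set.range i')ᶜ : Set P.X) := by
    refine mk_le_of_injective (f := fun x => ⟨o' x, ?_⟩) ?_
    · rintro ⟨⟨d, k⟩, h⟩
      have h := elt_injective h
      simp only [Prod.mk.injEq] at h
      omega
    · rintro ⟨d, k⟩ ⟨d', k'⟩ h
      have h := elt_injective (congrArg Subtype.val h)
      simp only [Prod.mk.injEq] at h
      obtain rfl := hD' _ _ h.1
      obtain rfl : k = k' := by omega
      rfl
  obtain ⟨g, hg⟩ := exists_perm_of_injective hI hinj hinj' hc hc'
  refine ⟨g, ⟨Set.range i, mk_range_le.trans_lt hI⟩, fun p p' => ⟨?_, fun h => ?_⟩⟩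
  · rintro ⟨F, hF, h1, h2, h3⟩
    have h4 : ¬ P.Sm (F.1 ∩ p.set.1 ∩ Set.range i ∩ g.1 ⁻¹' p'.set.1) := by
      intro hs
      have h5 : P.Sm {x ∈ F.1 | g.1 x ∉ p'.set.1} :=
        (h3.preimage g.1).mono fun x hx => ⟨⟨x, hx.1, rfl⟩, hx.2⟩
      refine hF (((Sm.union h1 (Sm.union h2 (Sm.union h5 hs)))).mono fun x hx => ?_)
      by_cases hx1 : x ∈ p.set.1
      · by_cases hx2 : x ∈ Set.range i
        · by_cases hx3 : g.1 x ∈ p'.set.1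
          · exact Or.inr (Or.inr (Or.inr ⟨⟨⟨hx, hx1⟩, hx2⟩, hx3⟩))
          · exact Or.inr (Or.inr (Or.inl ⟨hx, hx3⟩))
        · exact Or.inr (Or.inl ⟨hx, hx2⟩)
      · exact Or.inl ⟨hx, hx1⟩
    obtain ⟨x, ⟨⟨-, k, hk⟩, ⟨d, l⟩, rfl⟩, l', hl'⟩ := nonempty_of_not_sm h4
    have e1 := elt_injective hk
    rw [hg] at hl'
    have e2 := elt_injective hl'
    simp only [Prod.mk.injEq] at e1 e2
    rw [e1.1, e2.1]
    exact d.2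
  · let d : D := ⟨(p, p'), h⟩
    have hinf : (Set.range fun k => i (d, k)).Infinite :=
      Set.infinite_range_of_injective fun k k' hk => congrArg Prod.snd (hinj hk)
    refine ⟨⟨Set.range fun k => i (d, k), (mk_le_mk_of_subset
      (t := Set.range i) (Set.range_subset_iff.2 fun k => ⟨_, rfl⟩)).trans_lt (mk_range_le.trans_lt hI)⟩,
      by rwa [sm_iff_finite hκ], Sub.of_subset ?_, Sub.of_subset ?_, Sub.of_subset ?_⟩
    · rintro _ ⟨k, rfl⟩
      exact ⟨_, rfl⟩
    · rintro _ ⟨k, rfl⟩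
      exact ⟨_, rfl⟩
    · rintro _ ⟨_, ⟨k, rfl⟩, rfl⟩
      change g.1 (i (d, k)) ∈ _
      rw [hg]
      exact ⟨_, rfl⟩

/-- The union of a set of points. -/
def un (hκ : P.κ = ℵ₀) (D : Set (Pt c V)) : P.PS := ⟨elt '' {x | x.1 ∈ D},
  (mk_le_mk_of_subset (Set.image_subset_range _ _)).trans_lt
    (mk_range_le.trans_lt (mk_prod_lt hκ))⟩

theorem set_subset_un (hκ : P.κ = ℵ₀) {D : Set (Pt c V)} {p : Pt c V} (hp : p ∈ D) :
    p.set.1 ⊆ (un hκ D).1 := by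
  rintro _ ⟨k, rfl⟩
  exact ⟨(p, k), hp, rfl⟩

theorem meet_un_iff (hκ : P.κ = ℵ₀) {D : Set (Pt c V)} {p : Pt c V} :
    Meet (un hκ D) p.set ↔ p ∈ D := by
  rw [meet_iff]
  constructor
  · intro h
    obtain ⟨_, ⟨⟨q, k⟩, hq, rfl⟩, l, hl⟩ := nonempty_of_not_sm h
    have e := elt_injective hl
    simp only [Prod.mk.injEq] at e
    exact e.1 ▸ hq
  · intro h hs
    exact p.not_sm hκ (hs.mono fun x hx => ⟨set_subset_un hκ h hx, hx⟩)

theorem exists_meet (hκ : P.κ = ℵ₀) (D : Set (Pt c V)) : ∃ U : P.PS, ∀ p : Pt c V,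
    Meet U p.set ↔ p ∈ D := ⟨un hκ D, fun _ => meet_un_iff hκ⟩

theorem exists_elt_mem (hκ : P.κ = ℵ₀) {p : Pt c V} {U : Set P.X} (h : P.Sub p.set.1 U) (N : ℕ) :
    ∃ k ≥ N, elt (p, k) ∈ U := by
  by_contra! hcon
  exact (Set.Ici_infinite N) (((sub_iff hκ).1 h).subset hcon)

/-- For finite `D` the union of its ends is a witness, because a non-small subset must have
infinitely many elements in one of them. For infinite `D`, one element of `U` from each end in `D`
gives an infinite set that has at most one element in each of these ends. -/
theorem finite_iff (hκ : P.κ = ℵ₀) {D : Set (Pt c V)} : D.Finite ↔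
    ∃ U : P.PS, (∀ p ∈ D, P.Sub p.set.1 U.1) ∧ ∀ B : P.PS, ¬ P.Sm B.1 → P.Sub B.1 U.1 →
      ∃ p ∈ D, Meet B p.set := by
  constructor
  · intro h
    refine ⟨un hκ D, fun p hp => Sub.of_subset (set_subset_un hκ hp), fun B hB hBU => ?_⟩
    by_contra! hcon
    refine hB ?_
    have h1 : P.Sm (⋃ p ∈ D, B.1 ∩ p.set.1) := by
      rw [sm_iff_finite hκ]
      refine h.biUnion fun p hp => ?_
      have := hcon p hp
      rw [meet_iff, not_not, sm_iff_finite hκ] at this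
      exact this
    refine (h1.union hBU).mono fun x hx => ?_
    by_cases hxU : x ∈ (un hκ D).1
    · obtain ⟨⟨p, k⟩, hp, rfl⟩ := hxU
      exact Or.inl (Set.mem_biUnion hp ⟨hx, k, rfl⟩)
    · exact Or.inr ⟨hx, hxU⟩
  · rintro ⟨U, hU, hB⟩
    by_contra hD
    have hD : D.Infinite := hD
    choose! k _ hk using fun p hp => exists_elt_mem hκ (hU p hp) 0
    have hinj : Function.Injective fun p : Pt c V => elt (p, k p) :=
      fun p q h => congrArg Prod.fst (elt_injective h)
    have hsub : (fun p : Pt c V => elt (p, k p)) '' D ⊆ U.1 := by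
      rintro _ ⟨p, hp, rfl⟩
      exact hk p hp
    obtain ⟨p, hp, hm⟩ := hB ⟨_, (mk_le_mk_of_subset hsub).trans_lt U.2⟩
      (by rw [sm_iff_finite hκ]; exact hD.image hinj.injOn) (Sub.of_subset hsub)
    rw [meet_iff] at hm
    refine hm ?_
    rw [sm_iff_finite hκ]
    refine (Set.finite_singleton (elt (p, k p))).subset ?_
    rintro _ ⟨⟨q, hq, rfl⟩, l, hl⟩
    have e := congrArg Prod.fst (elt_injective hl)
    simp only at e
    subst e
    exact rfl

theorem cval_mono {ν ν' : Cardinal.{u}} (h : ν ≤ ν') : P.cval ν ≤ P.cval ν' :=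
  cval_le_iff.2 fun _ => h

/-- For infinite `D` the cardinality of `D` is the least size of a set that almost contains all its
ends: such a set has an element in each of the disjoint ends, and the union of the ends is no larger
than `D`. -/
theorem cval_eq_iff (hκ : P.κ = ℵ₀) {D : Set (Pt c V)} {B : P.PS} : P.cval #D = P.cval #B.1 ↔
    (D.Finite ∧ P.Sm B.1) ∨ (¬ D.Finite ∧
      (∀ U : P.PS, (∀ p ∈ D, P.Sub p.set.1 U.1) → LeC B U) ∧
      ∃ U : P.PS, (∀ p ∈ D, P.Sub p.set.1 U.1) ∧ LeC U B) := by
  have hle : ∀ U : P.PS, (∀ p ∈ D, P.Sub p.set.1 U.1) → #D ≤ #U.1 := by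
    intro U hU
    choose! k _ hk using fun p hp => exists_elt_mem hκ (hU p hp) 0
    refine mk_le_of_injective (f := fun p : D => (⟨_, hk p.1 p.2⟩ : U.1)) fun p q h => ?_
    exact Subtype.ext (congrArg Prod.fst (elt_injective (congrArg Subtype.val h)))
  by_cases hD : D.Finite
  · have h0 : P.cval #D = 0 := by
      rw [cval, if_neg]
      rw [hκ, not_le, lt_aleph0_iff_set_finite]
      exact hD
    rw [h0]
    simp only [hD, true_and, not_true_eq_false, false_and, or_false]
    rw [cval]
    split_ifs with h
    · have h1 : ¬ P.Sm B.1 := not_lt.2 h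
      simp only [h1, iff_false]
      exact (aleph0_pos.trans_le (P.hκ.trans h)).ne
    · simp only [true_iff]
      exact not_le.1 h
  · simp only [hD, false_and, not_false_eq_true, true_and, false_or]
    have hinf : ℵ₀ ≤ #D := by
      rw [← not_lt, lt_aleph0_iff_set_finite]; exact hD
    have hun : #(un hκ D).1 = #D := by
      refine le_antisymm ?_ (hle _ fun p hp => Sub.of_subset (set_subset_un hκ hp))
      refine mk_image_le.trans ?_
      refine (mk_le_of_injective (β := D × ULift.{u} ℕ)
        (f := fun x : {x : Pt c V × ℕ | x.1 ∈ D} => (⟨x.1.1, x.2⟩, ⟨x.1.2⟩)) ?_).trans ?_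
      · rintro ⟨⟨p, k⟩, hp⟩ ⟨⟨p', k'⟩, hp'⟩ h
        simp only [Prod.mk.injEq, Subtype.mk.injEq, ULift.up.injEq] at h
        obtain ⟨rfl, rfl⟩ := h
        rfl
      · rw [mk_prod, lift_id, lift_id, mk_uLift, mk_nat, lift_aleph0,
          mul_eq_left hinf hinf aleph0_pos.ne']
    constructor
    · intro h
      refine ⟨fun U hU => ?_, un hκ D, fun p hp => Sub.of_subset (set_subset_un hκ hp), ?_⟩
      · rw [leC_iff_cval, ← h]
        exact cval_mono (hle U hU)
      · rw [leC_iff_cval, hun, h]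
    · rintro ⟨h1, U, hU, h2⟩
      have h3 := h1 _ fun p hp => Sub.of_subset (set_subset_un hκ hp)
      rw [leC_iff_cval, hun] at h3
      rw [leC_iff_cval] at h2
      exact ((cval_mono (hle U hU)).trans h2).antisymm h3

end Pt

end Par

namespace Par

/-- The case `κ = ℵ₀`. -/
def Ctb (P : Par.{u}) : Prop := P.κ = ℵ₀

end Par

/-! ### Definability of quantification over the new points -/

namespace UDef

open Par

variable {K : Par.{u} → Prop} {ι J : Type} {n : ℕ}
  {c c' g f₀ : ∀ P : Par.{u}, (ι → P.S) → P.S}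
  {f f' : Fin n → ∀ P : Par.{u}, (ι → P.S) → P.S}

theorem ai (hc : TDef c) (j : J) : UDef K fun P v A => AI (c P v) (A j).1 :=
  (image hc _ _).and (image hc.inv _ _)

theorem atom (hc : TDef c) (V e : J) : UDef K fun P v A => Atom (c P v) (A V) (A e) := by
  refine congr (R := fun P v A => ¬ P.Sm (A e).1 ∧ AI (c P v) (A e).1 ∧ P.Sub (A e).1 (A V).1 ∧
    ∀ e' : P.PS, ¬ P.Sm e'.1 → AI (c P v) e'.1 → P.Sub e'.1 (A e).1 → P.Sub (A e).1 e'.1) ?_ ?_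
  · exact (sm _).not.and ((ai hc _).and ((sub _ _).and (all_set ((sm _).not.imp ((ai hc _).imp
      ((sub _ _).imp (sub _ _)))))))
  · intro P _ v A
    exact ⟨fun h => ⟨h.1, h.2.1, h.2.2.1, h.2.2.2⟩, fun h => ⟨h.1, h.2, h.3, h.4⟩⟩

theorem im (hg : TDef g) (i j : J) : UDef K fun P v A => Im (g P v) (A i) (A j) :=
  (image hg _ _).and (image hg.inv _ _)

theorem link (hg : TDef g) (W i j : J) : UDef K fun P v A => Link (g P v) (A W) (A i) (A j) :=
  ex_set ((sm _).not.and ((sub _ _).and ((sub _ _).and (image hg _ _))))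

theorem meet (i j : J) : UDef K fun P (_ : ι → P.S) A => Meet (A i) (A j) :=
  ex_set ((sm _).not.and ((sub _ _).and (sub _ _)))

section

variable {φ : ∀ P : Par.{u}, P.PS → (ι → P.S) → (J → P.PS) → Prop}

theorem all_pt (hc : TDef c) (j : J) (hφ : ∀ P v A e e', Eqv e e' → φ P e v A → φ P e' v A)
    (h : UDef Ctb fun P v (A : Unit ⊕ J → P.PS) => φ P (A (.inl ())) v fun j => A (.inr j)) :
    UDef Ctb fun P v A => ∀ p : Pt (c P v) (A j), φ P p.set v A := by
  refine congr (R := fun P v A => ∀ e, Atom (c P v) (A j) e → φ P e v A) ?_ ?_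
  · exact all_set ((atom hc _ _).imp h)
  · intro P hP v A
    exact Pt.forall_iff hP (hφ P v A)

theorem ex_pt (hc : TDef c) (j : J) (hφ : ∀ P v A e e', Eqv e e' → φ P e v A → φ P e' v A)
    (h : UDef Ctb fun P v (A : Unit ⊕ J → P.PS) => φ P (A (.inl ())) v fun j => A (.inr j)) :
    UDef Ctb fun P v A => ∃ p : Pt (c P v) (A j), φ P p.set v A := by
  refine congr (R := fun P v A => ∃ e, Atom (c P v) (A j) e ∧ φ P e v A) ?_ ?_
  · exact ex_set ((atom hc _ _).and h)
  · intro P hP v A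
    exact Pt.exists_iff hP (hφ P v A)

theorem weaken_pt {J' : Type} (h : UDef K fun P v (A : Unit ⊕ J → P.PS) =>
    φ P (A (.inl ())) v fun j => A (.inr j)) (r : J → J') :
    UDef K fun P v (A : Unit ⊕ J' → P.PS) => φ P (A (.inl ())) v fun j => A (.inr (r j)) :=
  h.comap (J' := Unit ⊕ J') id (Sum.elim (fun _ => .inl ()) fun j => .inr (r j))

theorem finite_pt (hc : TDef c) (j : J) (hφ : ∀ P v A e e', Eqv e e' → φ P e v A → φ P e' v A)
    (h : UDef Ctb fun P v (A : Unit ⊕ J → P.PS) => φ P (A (.inl ())) v fun j => A (.inr j)) :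
    UDef Ctb fun P v A => {p : Pt (c P v) (A j) | φ P p.set v A}.Finite := by
  refine congr (R := fun P v A => ∃ U : P.PS, (∀ p : Pt (c P v) (A j), φ P p.set v A →
    P.Sub p.set.1 U.1) ∧ ∀ B : P.PS, ¬ P.Sm B.1 → P.Sub B.1 U.1 →
      ∃ p : Pt (c P v) (A j), φ P p.set v A ∧ Meet B p.set) ?_ ?_
  · refine ex_set ((all_pt (J := Unit ⊕ J) hc (.inr j) (φ := fun P e v A => φ P e v (fun j => A (.inr j)) →
      P.Sub e.1 (A (.inl ())).1) ?_ ?_).and (all_set ((sm _).not.imp ((sub _ _).imp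
        (ex_pt (J := Unit ⊕ Unit ⊕ J) hc (.inr (.inr j)) (φ := fun P e v A =>
          φ P e v (fun j => A (.inr (.inr j))) ∧
          Meet (A (.inl ())) e) ?_ ?_)))))
    · exact fun P v A e e' he H h' => he.2.trans (H (hφ _ _ _ _ _ he.symm h'))
    · exact (weaken_pt (J' := Unit ⊕ J) h .inr).imp (sub _ _)
    · exact fun P v A e e' he H => ⟨hφ _ _ _ _ _ he H.1, H.2.congr he⟩
    · exact (weaken_pt (J' := Unit ⊕ Unit ⊕ J) h fun j => .inr (.inr j)).and (meet _ _)
  · intro P hP v A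
    exact (Pt.finite_iff hP).symm

theorem cval_pt (hc : TDef c) (j B : J) (hφ : ∀ P v A e e', Eqv e e' → φ P e v A → φ P e' v A)
    (h : UDef Ctb fun P v (A : Unit ⊕ J → P.PS) => φ P (A (.inl ())) v fun j => A (.inr j)) :
    UDef Ctb fun P v A => P.cval #{p : Pt (c P v) (A j) | φ P p.set v A} = P.cval #(A B).1 := by
  have hU : UDef Ctb fun P v (A : Unit ⊕ J → P.PS) => ∀ p : Pt (c P v) (A (.inr j)),
      φ P p.set v (fun j => A (.inr j)) → P.Sub p.set.1 (A (.inl ())).1 := by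
    refine all_pt (J := Unit ⊕ J) hc (.inr j) (φ := fun P e v A => φ P e v (fun j => A (.inr j)) →
      P.Sub e.1 (A (.inl ())).1) ?_ ?_
    · exact fun P v A e e' he H h' => he.2.trans (H (hφ _ _ _ _ _ he.symm h'))
    · exact (weaken_pt (J' := Unit ⊕ J) h .inr).imp (sub _ _)
  refine congr (R := fun P v A => ({p : Pt (c P v) (A j) | φ P p.set v A}.Finite ∧ P.Sm (A B).1) ∨
    (¬ {p : Pt (c P v) (A j) | φ P p.set v A}.Finite ∧
      (∀ U : P.PS, (∀ p : Pt (c P v) (A j), φ P p.set v A → P.Sub p.set.1 U.1) → LeC (A B) U) ∧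
      ∃ U : P.PS, (∀ p : Pt (c P v) (A j), φ P p.set v A → P.Sub p.set.1 U.1) ∧ LeC U (A B))) ?_ ?_
  · exact ((finite_pt hc j hφ h).and (sm _)).or ((finite_pt hc j hφ h).not.and
      ((all_set (hU.imp (leC _ _))).and (ex_set (hU.and (leC _ _)))))
  · intro P hP v A
    exact (Pt.cval_eq_iff hP).symm

end

end UDef

/-! ### The induced action and partial isomorphisms of such actions -/

namespace Par

variable {P : Par.{u}} {m n : ℕ} {c c' : P.S} {V V' : P.PS} {f f₁ f₂ : P.S}

theorem Im.mul {e e' e₁ : P.PS} {f g : P.S} (h : Im f e e') (h' : Im g e' e₁) :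
    Im (g * f) e e₁ := by
  constructor
  · have := (h.1.image g.1).trans h'.1
    rwa [← Set.image_comp] at this
  · have := (h'.2.image f⁻¹.1).trans h.2
    rw [← Set.image_comp] at this
    rw [mul_inv_rev]
    exact this

namespace Pt

theorem im_act (hκ : P.κ = ℵ₀) (hf : Valid c V f) (p : Pt c V) : Im f p.set (act c V f p).set :=
  (act_eq_iff hκ hf).1 rfl

theorem act_eq_self_iff (hκ : P.κ = ℵ₀) (hf : Valid c V f) {p : Pt c V} :
    act c V f p = p ↔ Im f p.set p.set := act_eq_iff hκ hf

theorem act_eq_act_iff (hκ : P.κ = ℵ₀) (h₁ : Valid c V f₁) (h₂ : Valid c V f₂) {p : Pt c V} :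
    act c V f₁ p = act c V f₂ p ↔ Im (f₂⁻¹ * f₁) p.set p.set := by
  constructor
  · intro h
    exact (im_act hκ h₁ p).mul (h ▸ (im_act hκ h₂ p).inv)
  · intro h
    refine (act_eq_iff hκ h₁).2 ?_
    have := h.mul (im_act hκ h₂ p)
    rwa [mul_inv_cancel_left] at this

/-- A relation between several induced permutations becomes the statement that one element of the
group fixes an end up to a finite set, so that `Eq` and `Prod` need `Im` only. -/
theorem act_act_eq_act_iff (hκ : P.κ = ℵ₀) (h : Valid c V f) (h₁ : Valid c V f₁)
    (h₂ : Valid c V f₂) {p : Pt c V} :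
    act c V f₁ (act c V f p) = act c V f₂ p ↔ Im (f₂⁻¹ * (f₁ * f)) p.set p.set := by
  have hi := (im_act hκ h p).mul (im_act hκ h₁ _)
  constructor
  · intro e
    exact hi.mul (e ▸ (im_act hκ h₂ p).inv)
  · intro e
    have := e.mul (im_act hκ h₂ p)
    rw [mul_inv_cancel_left] at this
    exact eq_of_eqv hκ (hi.eqv this)

/-- The conditions for the relation given by `g` and `W` to be an isomorphism between invariant
subsets. -/
def PLink (c : P.S) (V : P.PS) (f : Fin n → P.S) (c' : P.S) (V' : P.PS) (f' : Fin n → P.S)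
    (g : P.S) (W : P.PS) : Prop :=
  (∀ p : Pt c V, ∀ q q' : Pt c' V', Link g W p.set q.set → Link g W p.set q'.set →
    P.Sub q.set.1 q'.set.1) ∧
  (∀ p p' : Pt c V, ∀ q : Pt c' V', Link g W p.set q.set → Link g W p'.set q.set →
    P.Sub p.set.1 p'.set.1) ∧
  ∀ i, ∀ p p' : Pt c V, ∀ q q' : Pt c' V', Im (f i) p.set p'.set → Im (f' i) q.set q'.set →
    (Link g W p'.set q'.set ↔ Link g W p.set q.set)

theorem pLink_iff (hκ : P.κ = ℵ₀) {f f' : Fin n → P.S} (hf : ∀ i, Valid c V (f i))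
    (hf' : ∀ i, Valid c' V' (f' i)) {g : P.S} {W : P.PS} :
    PLink c V f c' V' f' g W ↔ PIso (fun i => act c V (f i)) (fun i => act c' V' (f' i))
      fun p q => Link g W p.set q.set := by
  constructor
  · rintro ⟨h1, h2, h3⟩
    exact ⟨fun h h' => eq_of_sub hκ (h1 _ _ _ h h'), fun h h' => eq_of_sub hκ (h2 _ _ _ h h'),
      fun i p q => h3 i _ _ _ _ (im_act hκ (hf i) p) (im_act hκ (hf' i) q)⟩
  · intro h
    refine ⟨fun p q q' h1 h2 => ?_, fun p p' q h1 h2 => ?_, fun i p p' q q' h1 h2 => ?_⟩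
    · rw [h.func h1 h2]; exact Sub.refl _
    · rw [h.inj h1 h2]; exact Sub.refl _
    · rw [← act_eq_iff hκ (hf i)] at h1
      rw [← act_eq_iff hκ (hf' i)] at h2
      subst h1 h2
      exact h.map i p q

/-- By `exists_link`, second-order quantification over partial isomorphisms of the points is
quantification over a permutation and a set. -/
theorem exists_piso_iff (hκ : P.κ = ℵ₀) {f f' : Fin n → P.S} (hf : ∀ i, Valid c V (f i))
    (hf' : ∀ i, Valid c' V' (f' i)) {φ : (Pt c V → Pt c' V' → Prop) → Prop} :
    (∃ (g : P.S) (W : P.PS), PLink c V f c' V' f' g W ∧ φ fun p q => Link g W p.set q.set) ↔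
      ∃ L, PIso (fun i => act c V (f i)) (fun i => act c' V' (f' i)) L ∧ φ L := by
  constructor
  · rintro ⟨g, W, h, h'⟩
    exact ⟨_, (pLink_iff hκ hf hf').1 h, h'⟩
  · rintro ⟨L, h, h'⟩
    obtain ⟨g, W, hg⟩ := exists_link hκ (L := L) h.func h.inj
    have e : (fun p q => Link g W p.set q.set) = L := by
      funext p q
      exact propext (hg p q)
    exact ⟨g, W, (pLink_iff hκ hf hf').2 (e.symm ▸ h), e.symm ▸ h'⟩

end Pt

end Par

/-! ### Definability of partial isomorphisms -/

namespace UDef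

open Par Pt

variable {K : Par.{u} → Prop} {ι J : Type} {n : ℕ}
  {c c' g f₀ : ∀ P : Par.{u}, (ι → P.S) → P.S}
  {f f' : Fin n → ∀ P : Par.{u}, (ι → P.S) → P.S}

theorem valid (hc : TDef c) (j : J) (hf : TDef f₀) :
    UDef Ctb fun P v A => Valid (c P v) (A j) (f₀ P v) := by
  refine and ?_ ?_
  · refine all_pt hc j (φ := fun P e v A => ∃ q : Pt (c P v) (A j), Im (f₀ P v) e q.set) ?_ ?_
    · rintro P v A e e' he ⟨q, hq⟩
      exact ⟨q, hq.congr he (Eqv.refl _)⟩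
    · exact ex_pt (J := Unit ⊕ J) hc (.inr j) (φ := fun P e v A => Im (f₀ P v) (A (.inl ())) e)
        (fun P v A e e' he h => h.congr (Eqv.refl _) he) (im hf _ _)
  · refine all_pt hc j (φ := fun P e v A => ∃ q : Pt (c P v) (A j), Im (f₀ P v) q.set e) ?_ ?_
    · rintro P v A e e' he ⟨q, hq⟩
      exact ⟨q, hq.congr (Eqv.refl _) he⟩
    · exact ex_pt (J := Unit ⊕ J) hc (.inr j) (φ := fun P e v A => Im (f₀ P v) e (A (.inl ())))
        (fun P v A e e' he h => h.congr he (Eqv.refl _)) (im hf _ _)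

theorem pLink (hc : TDef c) (j : J) (hf : ∀ i, TDef (f i)) (hc' : TDef c') (j' : J)
    (hf' : ∀ i, TDef (f' i)) (hg : TDef g) (W : J) : UDef Ctb fun P v A =>
      PLink (c P v) (A j) (fun i => f i P v) (c' P v) (A j') (fun i => f' i P v) (g P v) (A W) := by
  refine and ?_ (and ?_ (forall_fin fun i => ?_))
  · refine all_pt hc j (φ := fun P e v A => ∀ q q' : Pt (c' P v) (A j'), Link (g P v) (A W) e q.set →
      Link (g P v) (A W) e q'.set → P.Sub q.set.1 q'.set.1) ?_ ?_
    · exact fun P v A e e' he H q q' h1 h2 => H q q' (h1.congr he.symm (Eqv.refl _))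
        (h2.congr he.symm (Eqv.refl _))
    refine all_pt (J := Unit ⊕ J) hc' (.inr j') (φ := fun P q v A => ∀ q' : Pt (c' P v) (A (.inr j')),
      Link (g P v) (A (.inr W)) (A (.inl ())) q → Link (g P v) (A (.inr W)) (A (.inl ())) q'.set →
        P.Sub q.1 q'.set.1) ?_ ?_
    · exact fun P v A e e' he H q' h1 h2 => he.2.trans (H q' (h1.congr (Eqv.refl _) he.symm) h2)
    exact all_pt (J := Unit ⊕ Unit ⊕ J) hc' (.inr (.inr j')) (φ := fun P q' v A =>
      Link (g P v) (A (.inr (.inr W))) (A (.inr (.inl ()))) (A (.inl ())) →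
      Link (g P v) (A (.inr (.inr W))) (A (.inr (.inl ()))) q' → P.Sub (A (.inl ())).1 q'.1)
      (fun P v A e e' he H h1 h2 => (H h1 (h2.congr (Eqv.refl _) he.symm)).trans he.1)
      ((link hg _ _ _).imp ((link hg _ _ _).imp (sub _ _)))
  · refine all_pt hc j (φ := fun P e v A => ∀ p' : Pt (c P v) (A j), ∀ q : Pt (c' P v) (A j'),
      Link (g P v) (A W) e q.set → Link (g P v) (A W) p'.set q.set → P.Sub e.1 p'.set.1) ?_ ?_
    · exact fun P v A e e' he H q q' h1 h2 => he.2.trans (H q q' (h1.congr he.symm (Eqv.refl _)) h2)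
    refine all_pt (J := Unit ⊕ J) hc (.inr j) (φ := fun P p' v A => ∀ q : Pt (c' P v) (A (.inr j')),
      Link (g P v) (A (.inr W)) (A (.inl ())) q.set → Link (g P v) (A (.inr W)) p' q.set →
        P.Sub (A (.inl ())).1 p'.1) ?_ ?_
    · exact fun P v A e e' he H q' h1 h2 => (H q' h1 (h2.congr he.symm (Eqv.refl _))).trans he.1
    exact all_pt (J := Unit ⊕ Unit ⊕ J) hc' (.inr (.inr j')) (φ := fun P q v A =>
      Link (g P v) (A (.inr (.inr W))) (A (.inr (.inl ()))) q →
      Link (g P v) (A (.inr (.inr W))) (A (.inl ())) q →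
        P.Sub (A (.inr (.inl ()))).1 (A (.inl ())).1)
      (fun P v A e e' he H h1 h2 => H (h1.congr (Eqv.refl _) he.symm) (h2.congr (Eqv.refl _) he.symm))
      ((link hg _ _ _).imp ((link hg _ _ _).imp (sub _ _)))
  · refine all_pt hc j (φ := fun P p v A => ∀ p' : Pt (c P v) (A j), ∀ q q' : Pt (c' P v) (A j'),
      Im (f i P v) p p'.set → Im (f' i P v) q.set q'.set →
        (Link (g P v) (A W) p'.set q'.set ↔ Link (g P v) (A W) p q.set)) ?_ ?_
    · exact fun P v A e e' he H p' q q' h1 h2 => (H p' q q' (h1.congr he.symm (Eqv.refl _)) h2).trans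
        ⟨fun h => h.congr he (Eqv.refl _), fun h => h.congr he.symm (Eqv.refl _)⟩
    refine all_pt (J := Unit ⊕ J) hc (.inr j) (φ := fun P p' v A => ∀ q q' : Pt (c' P v) (A (.inr j')),
      Im (f i P v) (A (.inl ())) p' → Im (f' i P v) q.set q'.set →
        (Link (g P v) (A (.inr W)) p' q'.set ↔ Link (g P v) (A (.inr W)) (A (.inl ())) q.set)) ?_ ?_
    · exact fun P v A e e' he H q q' h1 h2 => Iff.trans
        ⟨fun h => h.congr he.symm (Eqv.refl _), fun h => h.congr he (Eqv.refl _)⟩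
        (H q q' (h1.congr (Eqv.refl _) he.symm) h2)
    refine all_pt (J := Unit ⊕ Unit ⊕ J) hc' (.inr (.inr j')) (φ := fun P q v A =>
      ∀ q' : Pt (c' P v) (A (.inr (.inr j'))),
      Im (f i P v) (A (.inr (.inl ()))) (A (.inl ())) → Im (f' i P v) q q'.set →
        (Link (g P v) (A (.inr (.inr W))) (A (.inl ())) q'.set ↔
          Link (g P v) (A (.inr (.inr W))) (A (.inr (.inl ()))) q)) ?_ ?_
    · exact fun P v A e e' he H q' h1 h2 => (H q' h1 (h2.congr he.symm (Eqv.refl _))).trans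
        ⟨fun h => h.congr (Eqv.refl _) he, fun h => h.congr (Eqv.refl _) he.symm⟩
    exact all_pt (J := Unit ⊕ Unit ⊕ Unit ⊕ J) hc' (.inr (.inr (.inr j'))) (φ := fun P q' v A =>
      Im (f i P v) (A (.inr (.inr (.inl ())))) (A (.inr (.inl ()))) → Im (f' i P v) (A (.inl ())) q' →
        (Link (g P v) (A (.inr (.inr (.inr W)))) (A (.inr (.inl ()))) q' ↔
          Link (g P v) (A (.inr (.inr (.inr W)))) (A (.inr (.inr (.inl ())))) (A (.inl ()))))
      (fun P v A e e' he H h1 h2 => Iff.trans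
        ⟨fun h => h.congr (Eqv.refl _) he.symm, fun h => h.congr (Eqv.refl _) he⟩
        (H h1 (h2.congr (Eqv.refl _) he.symm)))
      ((im (hf i) _ _).imp ((im (hf' i) _ _).imp ((link hg _ _ _).iff (link hg _ _ _))))

end UDef

/-! ### Realizing arbitrary tuples on the new points -/

namespace Par

variable {P : Par.{u}} {n : ℕ}

namespace Pt

/-- Every tuple of permutations of a set of fewer than `lam` points is induced by permutations. -/
theorem exists_equiv (hκ : P.κ = ℵ₀) {Y : Type u} (hY : #Y < P.lam) (f : Fin n → Equiv.Perm Y) :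
    ∃ (c : P.S) (V : P.PS) (g : Fin n → P.S) (e : Y ≃ Pt c V), (∀ i, Valid c V (g i)) ∧
      ∀ i y, e (f i y) = act c V (g i) (e y) := by
  have hYZ : #(Y × ℤ) < P.lam := by
    rw [mk_prod, lift_uzero, mk_int, lift_aleph0]
    exact mul_lt_of_lt aleph0_lt_lam.le hY aleph0_lt_lam
  obtain ⟨ι⟩ : #(Y × ℤ) ≤ #P.X := by rw [mk_X]; exact mk_le_mu hYZ
  -- Each element of `Y` is given a copy of `ℤ`, which `c` translates by one; a permutation of `Y`
  -- acts on the first coordinate of `Y × ℤ`.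
  let c : P.S := ⟨Equiv.Perm.viaEmbedding
    (Equiv.prodCongr (Equiv.refl Y) (Equiv.addRight (1 : ℤ))) ι, viaEmbedding_mem hYZ _ ι⟩
  have hc : ∀ y k, c.1 (ι (y, k)) = ι (y, k + 1) := fun y k =>
    Equiv.Perm.viaEmbedding_apply _ ι _
  have hcz : ∀ y k (l : ℤ), (c.1 ^ l) (ι (y, k)) = ι (y, k + l) := by
    intro y k l
    induction l using Int.induction_on with
    | zero => simp
    | succ l ih => rw [zpow_succ_apply, ih, hc, add_assoc]
    | pred l ih =>
      rw [zpow_pred_apply, ih]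
      have := hc y (k + -(l : ℤ) - 1)
      rw [sub_add_cancel] at this
      rw [← this]
      refine (Equiv.symm_apply_apply c.1 _).trans ?_
      congr 2
      ring
  have hcn : ∀ x, x ∉ Set.range ι → c.1 x = x := fun x hx =>
    Equiv.Perm.viaEmbedding_apply_of_notMem _ ι _ hx
  -- The non-negative half selects the positive end of each cycle, so that there is exactly one new
  -- point for each element of `Y`.
  let V : P.PS := ⟨ι '' {x | 0 ≤ x.2}, (mk_le_mk_of_subset (Set.image_subset_range _ _)).trans_lt
    (mk_range_le.trans_lt hYZ)⟩
  have hinj : ∀ y k, Function.Injective fun l : ℤ => (c.1 ^ l) (ι (y, k)) := by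
    intro y k l l' h
    dsimp only at h
    rw [hcz, hcz] at h
    have := congrArg Prod.snd (ι.injective h)
    simpa using this
  let a : Y → P.PS := fun y => ⟨ray c.1 (ι (y, 0)) 0, mk_ray_lt _ _ _⟩
  have hmem : ∀ {y x}, x ∈ (a y).1 ↔ ∃ k : ℤ, 0 ≤ k ∧ ι (y, k) = x := by
    intro y x
    constructor
    · rintro ⟨k, hk, rfl⟩
      refine ⟨k, hk, ?_⟩
      dsimp only
      rw [hcz, zero_add]
    · rintro ⟨k, hk, rfl⟩
      refine ⟨k, hk, ?_⟩
      dsimp only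
      rw [hcz, zero_add]
  have haV : ∀ y, P.Sub (a y).1 V.1 := fun y => Sub.of_subset fun x hx => by
    obtain ⟨k, hk, rfl⟩ := hmem.1 hx
    exact ⟨_, hk, rfl⟩
  have ha : ∀ y, Atom c V (a y) := fun y => ray_atom hκ (hinj y 0) (haV y)
  choose e he using fun y => exists_eqv hκ (ha y)
  have hei : Function.Injective e := by
    intro y y' h
    have h1 : Eqv (a y) (a y') := (he y).symm.trans (h ▸ he y')
    have h2 : P.Sub (a y).1 ((a y).1 ∩ (a y').1) := (Sub.refl _).inter h1.1
    obtain ⟨x, hx, hx'⟩ := nonempty_of_not_sm fun hs => (ha y).not_sm (h2.sm hs)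
    obtain ⟨k, -, rfl⟩ := hmem.1 hx
    obtain ⟨k', -, hk'⟩ := hmem.1 hx'
    exact (congrArg Prod.fst (ι.injective hk')).symm
  have hes : Function.Surjective e := by
    intro p
    obtain ⟨x, hx, h⟩ := (p.atom hκ).exists_ray hκ
    obtain ⟨⟨y, k⟩, rfl⟩ : x ∈ Set.range ι := by
      by_contra hcon
      have h1 : (c.1 ^ (1 : ℤ)) x = (c.1 ^ (0 : ℤ)) x := by simpa using hcn x hcon
      exact one_ne_zero (hx h1)
    refine ⟨y, eq_of_eqv hκ ((he y).trans ?_)⟩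
    refine (ha y).eqv_of_sub (p.atom hκ) ?_
    rcases h with ⟨b, hb⟩ | ⟨b, hb⟩
    · refine Sub.trans ?_ (Sub.of_subset hb)
      refine (ray_sub hκ _ _ 0 (k + b)).trans (Sub.of_subset ?_)
      rintro _ ⟨l, hl, rfl⟩
      have hl : k + b ≤ l := hl
      refine ⟨l - k, show b ≤ l - k by omega, ?_⟩
      dsimp only
      rw [hcz, hcz]
      congr 2
      ring
    -- A negative end has all but finitely many of its elements at negative coordinates, outside
    -- `V`.
    · exfalso
      have h1 : P.Sub (ray c⁻¹.1 (ι (y, k)) b) V.1 := (Sub.of_subset hb).trans (p.atom hκ).sub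
      have h2 : P.Sm (ray c⁻¹.1 (ι (y, k)) (max b (k + 1))) := by
        refine Sm.mono h1 ?_
        rintro _ ⟨l, hl, rfl⟩
        have hl : max b (k + 1) ≤ l := hl
        refine ⟨⟨l, (le_max_left _ _).trans hl, rfl⟩, ?_⟩
        rintro ⟨⟨y', k'⟩, hk', h'⟩
        change ι (y', k') = (c.1⁻¹ ^ l) (ι (y, k)) at h'
        rw [inv_zpow', hcz] at h'
        have h3 := congrArg Prod.snd (ι.injective h')
        have hk' : 0 ≤ k' := hk'
        have h4 := (le_max_right b (k + 1)).trans hl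
        simp only at h3
        omega
      rw [sm_iff_finite hκ] at h2
      refine ray_infinite (c := c⁻¹.1) ?_ _ h2
      intro l l' h'
      change (c.1⁻¹ ^ l) _ = (c.1⁻¹ ^ l') _ at h'
      rw [inv_zpow', inv_zpow'] at h'
      exact neg_injective (hinj y k h')
  let g : Fin n → P.S := fun i => ⟨Equiv.Perm.viaEmbedding
    (Equiv.prodCongr (f i) (Equiv.refl ℤ)) ι, viaEmbedding_mem hYZ _ ι⟩
  have hg : ∀ i y k, (g i).1 (ι (y, k)) = ι (f i y, k) := fun i y k =>
    Equiv.Perm.viaEmbedding_apply _ ι _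
  have him : ∀ i y, Im (g i) (a y) (a (f i y)) := by
    intro i y
    have h1 : (g i).1 '' (a y).1 = (a (f i y)).1 := by
      ext x
      constructor
      · rintro ⟨_, hx, rfl⟩
        obtain ⟨k, hk, rfl⟩ := hmem.1 hx
        exact hmem.2 ⟨k, hk, (hg i y k).symm⟩
      · intro hx
        obtain ⟨k, hk, rfl⟩ := hmem.1 hx
        exact ⟨_, hmem.2 ⟨k, hk, rfl⟩, hg i y k⟩
    refine ⟨h1 ▸ Sub.refl _, ?_⟩
    rw [← h1, image_image_inv]
    exact Sub.refl _
  have him' : ∀ i y, Im (g i) (e y).set (e (f i y)).set := fun i y =>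
    (him i y).congr (he _).symm (he _).symm
  have hv : ∀ i, Valid c V (g i) := by
    intro i
    constructor
    · intro p
      obtain ⟨y, rfl⟩ := hes p
      exact ⟨_, him' i y⟩
    · intro p
      obtain ⟨y, rfl⟩ := hes p
      refine ⟨e ((f i).symm y), ?_⟩
      have := him' i ((f i).symm y)
      rwa [Equiv.apply_symm_apply] at this
  exact ⟨c, V, g, Equiv.ofBijective e ⟨hei, hes⟩, hv, fun i y =>
    ((act_eq_iff hκ (hv i)).2 (him' i y)).symm⟩

end Pt

end Par

/-! ### Transversals of orbits, and isomorphisms between single orbits -/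

section

open OrbitType

variable {n : ℕ} {E E' : Type u} {f : Fin n → Equiv.Perm E} {f' : Fin n → Equiv.Perm E'}
  {t : OrbitType n}

theorem OrbitType.nonempty_pts (t : OrbitType n) : Nonempty t.pts := t.rep.nonempty.to_subtype

theorem OrbitType.IsChart.mem_orb {j : t.pts → E} (h : IsChart f t j) (hj : Function.Surjective j)
    (x y : E) :
    y ∈ orb f x := by
  obtain ⟨a, rfl⟩ := hj x
  rw [← h.range_eq_orb a]
  exact hj y

theorem mem_orbs_iff {x : E} : orb f x ∈ orbs f t ↔ ∃ j, IsChart f t j ∧ x ∈ Set.range j := by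
  constructor
  · rintro ⟨j, hj, h⟩
    exact ⟨j, hj, h ▸ mem_orb_self f x⟩
  · rintro ⟨j, hj, a, rfl⟩
    exact ⟨j, hj, hj.range_eq_orb a⟩

theorem orb_eq_of_mem {x y : E} (h : y ∈ orb f x) : orb f y = orb f x :=
  (orb_subset (orb_inv f x) h).antisymm (orb_subset (orb_inv f y) (mem_orb_symm h))

/-- A transversal of the orbits of a type has as many elements as there are such orbits. -/
theorem mk_transversal {D : Set E} (h1 : ∀ x ∈ D, orb f x ∈ orbs f t)
    (h2 : ∀ x, orb f x ∈ orbs f t → ∃ y ∈ D, y ∈ orb f x)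
    (h3 : ∀ x ∈ D, ∀ y ∈ D, y ∈ orb f x → x = y) : #D = #(orbs f t) := by
  refine mk_congr (Equiv.ofBijective (fun x : D => (⟨_, h1 x.1 x.2⟩ : orbs f t)) ⟨?_, ?_⟩)
  · rintro ⟨x, hx⟩ ⟨y, hy⟩ h
    refine Subtype.ext (h3 x hx y hy ?_)
    rw [show orb f x = orb f y from congrArg Subtype.val h]
    exact mem_orb_self f y
  · intro O
    obtain ⟨x, hx⟩ : ∃ x, x ∈ (O : Set E) := by
      obtain ⟨a⟩ := t.nonempty_pts
      exact ⟨_, orbChart_mem O a⟩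
    have e := orbs_eq_orb O hx
    obtain ⟨y, hy, hyx⟩ := h2 x (e ▸ O.2)
    exact ⟨⟨y, hy⟩, Subtype.ext ((orb_eq_of_mem hyx).trans e.symm)⟩

theorem exists_transversal (f : Fin n → Equiv.Perm E) (t : OrbitType n) : ∃ D : Set E,
    (∀ x ∈ D, orb f x ∈ orbs f t) ∧ (∀ x, orb f x ∈ orbs f t → ∃ y ∈ D, y ∈ orb f x) ∧
      ∀ x ∈ D, ∀ y ∈ D, y ∈ orb f x → x = y := by
  classical
  let s : Setoid E := ⟨fun x y => y ∈ orb f x, mem_orb_self f, mem_orb_symm,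
    fun h h' => orb_eq_of_mem h ▸ h'⟩
  have hs : ∀ x, (Quotient.mk s x).out ∈ orb f x := fun x => mem_orb_symm (Quotient.mk_out (s := s) x)
  refine ⟨{x | orb f x ∈ orbs f t ∧ (Quotient.mk s x).out = x}, fun x hx => hx.1, fun x hx => ?_, ?_⟩
  · refine ⟨_, ⟨?_, ?_⟩, hs x⟩
    · rw [orb_eq_of_mem (hs x)]; exact hx
    · rw [Quotient.out_eq]
  · rintro x ⟨-, hx⟩ y ⟨-, hy⟩ h
    have : Quotient.mk s x = Quotient.mk s y := Quotient.sound h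
    rw [← hx, ← hy, this]

theorem exists_piso_of_chart {j : t.pts → E} (h : IsChart f t j) (hj : Function.Surjective j)
    {j' : t.pts → E'} (h' : IsChart f' t j') : ∃ L, PIso f f' L ∧ (∀ x, ∃ y, L x y) ∧
      ∀ b, L (j b) (j' b) := by
  refine ⟨fun x y => ∃ b, j b = x ∧ j' b = y, ⟨?_, ?_, ?_⟩, fun x => ?_, fun b => ⟨b, rfl, rfl⟩⟩
  · rintro x y y' ⟨b, rfl, rfl⟩ ⟨b', h1, rfl⟩
    rw [h.inj h1]
  · rintro x x' y ⟨b, rfl, rfl⟩ ⟨b', rfl, h1⟩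
    rw [h'.inj h1]
  · intro i x y
    constructor
    · rintro ⟨b, h1, h2⟩
      obtain ⟨a, rfl⟩ := hj x
      rw [← h.map] at h1
      obtain rfl := h.inj h1
      rw [h'.map] at h2
      exact ⟨a, rfl, (f' i).injective h2⟩
    · rintro ⟨b, rfl, rfl⟩
      exact ⟨_, h.map i b, h'.map i b⟩
  · obtain ⟨b, rfl⟩ := hj x
    exact ⟨_, b, rfl, rfl⟩

end

/-! ### Types and counting functions read off from the new points -/

namespace Par

variable {P : Par.{u}} {m n : ℕ} {c c' : P.S} {V V' : P.PS}

open OrbitType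

namespace Pt

/-- There are `μ` points unless `lam ≤ μ`. -/
def Full (c : P.S) (V : P.PS) : Prop := ¬ P.lam ≤ P.μ → #(Pt c V) = P.μ

/-- There are always fewer than `lam` points, so the only requirement left is that there be `μ` of
them in the case `lam = μ⁺`. -/
theorem fits_iff (hκ : P.κ = ℵ₀) {f : Fin n → Equiv.Perm (Pt c V)} :
    Fits P.lam P.μ f ↔ Full c V := by
  constructor
  · intro h hl
    have := h.eq (lam_eq hl)
    rwa [core_of_not hl, mk_univ] at this
  · intro h
    refine ⟨(mk_set_le _).trans_lt (mk_lt hκ), fun hl => ?_⟩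
    have hl : ¬ P.lam ≤ P.μ := by rw [hl]; exact not_le.2 (Order.lt_succ _)
    rw [core_of_not hl, mk_univ, h hl]

/-- If `lam = μ⁺`, the largest coded sets have size `μ`, so comparison with such a set expresses
that there are `μ` points. -/
theorem full_iff : Full c V ↔ (¬ P.lam ≤ P.μ → ∃ B : P.PS, (∀ B' : P.PS, LeC B' B) ∧
    P.cval #{_p : Pt c V | True} = P.cval #B.1) := by
  refine imp_congr_right fun hl => ?_
  have e : #{p : Pt c V | True} = #(Pt c V) := mk_univ
  have hU : P.cval #(⟨Set.univ, mk_lt_of_not hl _⟩ : P.PS).1 = P.μ := by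
    rw [mk_univ, mk_X, cval, if_pos kappa_le_mu]
  rw [e]
  constructor
  · intro h
    refine ⟨⟨Set.univ, mk_lt_of_not hl _⟩, fun B' => ?_, ?_⟩
    · rw [leC_iff_cval]
      exact cval_mono (mk_le_mk_of_subset (Set.subset_univ _))
    · rw [hU, h, cval, if_pos kappa_le_mu]
  · rintro ⟨B, h1, h2⟩
    have h3 := leC_iff_cval.1 (h1 ⟨Set.univ, mk_lt_of_not hl _⟩)
    rw [hU] at h3
    have h4 : P.cval #B.1 ≤ P.μ := by
      rw [← hU]
      exact cval_mono (mk_le_mk_of_subset (Set.subset_univ _))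
    rw [← h2] at h3 h4
    have h5 := h4.antisymm h3
    rw [cval] at h5
    split_ifs at h5 with h
    · exact h5
    · exact absurd h5 (aleph0_pos.trans_le aleph0_le_mu).ne

/-- The two tuples have the same orbits up to finitely many points. -/
def FnEq (c : P.S) (V : P.PS) (f : Fin n → P.S) (c' : P.S) (V' : P.PS) (f' : Fin n → P.S) : Prop :=
  ∃ (g : P.S) (W : P.PS), PLink c V f c' V' f' g W ∧
    {p : Pt c V | (P.lam ≤ P.μ → ¬ ∀ i, Im (f i) p.set p.set) ∧
      ¬ ∃ q : Pt c' V', Link g W p.set q.set}.Finite ∧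
    {q : Pt c' V' | (P.lam ≤ P.μ → ¬ ∀ i, Im (f' i) q.set q.set) ∧
      ¬ ∃ p : Pt c V, Link g W p.set q.set}.Finite

theorem mem_core_iff (hκ : P.κ = ℵ₀) {f : Fin n → P.S} (hf : ∀ i, Valid c V (f i)) {p : Pt c V} :
    p ∈ core (P.lam ≤ P.μ) (fun i => act c V (f i)) ↔
      (P.lam ≤ P.μ → ¬ ∀ i, Im (f i) p.set p.set) := by
  refine imp_congr_right fun _ => ?_
  rw [not_forall]
  exact exists_congr fun i => not_congr (act_eq_self_iff hκ (hf i))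

/-- This is `tyPre_E_iff` on the new points. For `κ = ℵ₀` being small means being finite, and
finiteness of a set of points is definable, so E-equivalence is tested exactly, without recourse to
conjugacy. -/
theorem cls_eq_iff (hκ : P.κ = ℵ₀) {f f' : Fin n → P.S} (hv : ∀ i, Valid c V (f i))
    (hv' : ∀ i, Valid c' V' (f' i)) (hf : Fits P.lam P.μ fun i => act c V (f i))
    (hf' : Fits P.lam P.μ fun i => act c' V' (f' i)) :
    P.cls (tyPre _ hf) = P.cls (tyPre _ hf') ↔ FnEq c V f c' V' f' := by
  refine (FSort.mk_eq_iff P.hκ).trans ((tyPre_E_iff P.hκ hf hf').trans ?_)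
  refine ((exists_piso_iff hκ hv hv' (φ := fun L =>
    {p : Pt c V | (P.lam ≤ P.μ → ¬ ∀ i, Im (f i) p.set p.set) ∧ ¬ ∃ q, L p q}.Finite ∧
    {q : Pt c' V' | (P.lam ≤ P.μ → ¬ ∀ i, Im (f' i) q.set q.set) ∧
      ¬ ∃ p, L p q}.Finite)).trans (exists_congr fun L => and_congr_right fun _ => ?_)).symm
  rw [hκ, lt_aleph0_iff_set_finite, lt_aleph0_iff_set_finite]
  refine and_congr (iff_of_eq (congrArg _ ?_)) (iff_of_eq (congrArg _ ?_))
  · ext p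
    exact and_congr (mem_core_iff hκ hv).symm Iff.rfl
  · ext p
    exact and_congr (mem_core_iff hκ hv').symm Iff.rfl

/-- The points form a single orbit of type `t`. -/
def HasType (c : P.S) (V : P.PS) (f : Fin n → P.S) (t : OrbitType n) : Prop :=
  (∀ i, Valid c V (f i)) ∧ ∃ j, IsChart (fun i => act c V (f i)) t j ∧ Function.Surjective j

/-- An isomorphic copy of the first tuple in the second one. -/
def Emb (c : P.S) (V : P.PS) (f : Fin n → P.S) (c' : P.S) (V' : P.PS) (f' : Fin n → P.S) : Prop :=
  ∃ (g : P.S) (W : P.PS), PLink c V f c' V' f' g W ∧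
    ∀ p : Pt c V, ∃ q : Pt c' V', Link g W p.set q.set

/-- An isomorphic copy of the first tuple that contains a given point. -/
def EmbAt (c : P.S) (V : P.PS) (f : Fin n → P.S) (c' : P.S) (V' : P.PS) (f' : Fin n → P.S)
    (e : P.PS) : Prop :=
  ∃ (g : P.S) (W : P.PS), PLink c V f c' V' f' g W ∧
    (∀ p : Pt c V, ∃ q : Pt c' V', Link g W p.set q.set) ∧ ∃ p : Pt c V, Link g W p.set e

theorem HasType.emb_iff (hκ : P.κ = ℵ₀) {f : Fin n → P.S} {t : OrbitType n} (h : HasType c V f t)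
    {f' : Fin n → P.S} (hf' : ∀ i, Valid c' V' (f' i)) :
    Emb c V f c' V' f' ↔ ∃ j, IsChart (fun i => act c' V' (f' i)) t j := by
  obtain ⟨hv, j, hj, hs⟩ := h
  refine (exists_piso_iff hκ hv hf' (φ := fun L => ∀ p, ∃ q, L p q)).trans ⟨?_, ?_⟩
  · rintro ⟨L, hL, h⟩
    obtain ⟨a⟩ := t.nonempty_pts
    obtain ⟨j', hj', -⟩ := hL.exists_chart hj (a := a) (h _)
    exact ⟨j', hj'⟩
  · rintro ⟨j', hj'⟩
    obtain ⟨L, h1, h2, -⟩ := exists_piso_of_chart hj hs hj'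
    exact ⟨L, h1, h2⟩

theorem HasType.embAt_iff (hκ : P.κ = ℵ₀) {f : Fin n → P.S} {t : OrbitType n} (h : HasType c V f t)
    {f' : Fin n → P.S} (hf' : ∀ i, Valid c' V' (f' i)) {q : Pt c' V'} :
    EmbAt c V f c' V' f' q.set ↔
      orb (fun i => act c' V' (f' i)) q ∈ orbs (fun i => act c' V' (f' i)) t := by
  obtain ⟨hv, j, hj, hs⟩ := h
  rw [mem_orbs_iff]
  refine (exists_piso_iff hκ hv hf' (φ := fun L => (∀ p, ∃ q, L p q) ∧ ∃ p, L p q)).trans ⟨?_, ?_⟩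
  · rintro ⟨L, hL, h, p, hp⟩
    obtain ⟨a, rfl⟩ := hs p
    obtain ⟨j', hj', h'⟩ := hL.exists_chart hj (a := a) (h _)
    exact ⟨j', hj', a, hL.func (h' a) hp⟩
  · rintro ⟨j', hj', a, rfl⟩
    obtain ⟨L, h1, h2, h3⟩ := exists_piso_of_chart hj hs hj'
    exact ⟨L, h1, h2, _, h3 a⟩

theorem HasType.unique_iff (hκ : P.κ = ℵ₀) {f f' : Fin n → P.S} {t t' : OrbitType n}
    (h : HasType c V f t) (h' : HasType c' V' f' t') : Emb c V f c' V' f' ↔ t = t' := by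
  rw [h.emb_iff hκ h'.1]
  obtain ⟨hv', j', hj', hs'⟩ := h'
  constructor
  · rintro ⟨j, hj⟩
    obtain ⟨a⟩ := t.nonempty_pts
    obtain ⟨b, hb⟩ := hs' (j a)
    exact hj.type_eq hj' hb.symm
  · rintro rfl
    exact ⟨j', hj'⟩

theorem HasType.unique {f : Fin n → P.S} {t t' : OrbitType n}
    (h : HasType c V f t) (h' : HasType c V f t') : t = t' := by
  obtain ⟨-, j, hj, -⟩ := h
  obtain ⟨-, j', hj', hs'⟩ := h'
  obtain ⟨a⟩ := t.nonempty_pts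
  obtain ⟨b, hb⟩ := hs' (j a)
  exact hj.type_eq hj' hb.symm

/-- The set of the points meeting `U` is invariant. -/
def UInv (c : P.S) (V : P.PS) (f : Fin n → P.S) (U : P.PS) : Prop :=
  ∀ i, ∀ p q : Pt c V, Im (f i) p.set q.set → (Meet U p.set ↔ Meet U q.set)

/-- The points lie in the same orbit. -/
def SameOrb (c : P.S) (V : P.PS) (f : Fin n → P.S) (e e' : P.PS) : Prop :=
  ∀ U : P.PS, UInv c V f U → Meet U e → Meet U e'

/-- Subsets of the points are coded by `Meet`, so the orbit as the least invariant set is within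
reach of the quantifier over sets. -/
theorem sameOrb_iff (hκ : P.κ = ℵ₀) {f : Fin n → P.S} (hf : ∀ i, Valid c V (f i)) {p q : Pt c V} :
    SameOrb c V f p.set q.set ↔ q ∈ orb (fun i => act c V (f i)) p := by
  have hU : ∀ U : P.PS, UInv c V f U ↔ InvSet (fun i => act c V (f i)) {p | Meet U p.set} := by
    intro U
    refine forall_congr' fun i => ⟨fun h p => (h p _ (im_act hκ (hf i) p)).symm, fun h p q hpq => ?_⟩
    rw [← act_eq_iff hκ (hf i)] at hpq
    subst hpq
    exact (h p).symm
  constructor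
  · intro h Y hY hp
    obtain ⟨U, hU'⟩ := exists_meet hκ Y
    have e : {p | Meet U p.set} = Y := Set.ext hU'
    exact (hU' q).1 (h U ((hU U).2 (e.symm ▸ hY)) ((hU' p).2 hp))
  · intro h U hU' hp
    exact h _ ((hU U).1 hU') hp

/-- The points form a single orbit, of an admissible type. -/
def IsCode (c : P.S) (V : P.PS) (f : Fin n → P.S) : Prop := (∀ i, Valid c V (f i)) ∧
  -- The inclusion is always true; the clause says that there is a point, in a shape to which
  -- `UDef.ex_pt` applies.
  (∃ p : Pt c V, P.Sub p.set.1 p.set.1) ∧ (∀ p q : Pt c V, SameOrb c V f p.set q.set) ∧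
    (P.lam ≤ P.μ → ¬ ∀ i, ∀ p : Pt c V, Im (f i) p.set p.set)

theorem HasType.isTrivial_iff (hκ : P.κ = ℵ₀) {f : Fin n → P.S} {t : OrbitType n}
    (h : HasType c V f t) : t.IsTrivial ↔ ∀ i, ∀ p : Pt c V, Im (f i) p.set p.set := by
  obtain ⟨hv, j, hj, hs⟩ := h
  refine forall_congr' fun i => (Equiv.ext_iff (f := t.rep.gen i) (g := 1)).trans ?_
  rw [hs.forall]
  refine forall_congr' fun a => ?_
  rw [← act_eq_self_iff hκ (hv i), ← hj.map, hj.inj.eq_iff]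
  exact Iff.rfl

/-- A transitive action of finitely many permutations is on a countable set, hence is described by a
type; the last clause excludes the trivial type when it is not admitted. -/
theorem isCode_iff (hκ : P.κ = ℵ₀) {f : Fin n → P.S} :
    IsCode c V f ↔ ∃ t : ULift.{u + 1} (IS P.lam P.μ n), HasType c V f t.down.1 := by
  constructor
  · rintro ⟨hv, ⟨p, -⟩, ht, hl⟩
    have htr : ∀ p q : Pt c V, q ∈ orb (fun i => act c V (f i)) p := fun p q =>
      (sameOrb_iff hκ hv).1 (ht p q)
    have hc : Countable (Pt c V) := Set.countable_univ_iff.1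
      ((orb_countable (fun i => act c V (f i)) p).mono fun q _ => htr p q)
    have hn : Nonempty (Pt c V) := ⟨p⟩
    obtain ⟨t, e, he⟩ := exists_of_transitive (fun i => act c V (f i)) htr
    have h : HasType c V f t := ⟨hv, e, ⟨e.injective, he⟩, e.surjective⟩
    exact ⟨⟨t, fun hl' htt => hl hl' ((h.isTrivial_iff hκ).1 htt)⟩, h⟩
  · rintro ⟨t, h⟩
    have h' := h
    obtain ⟨hv, j, hj, hs⟩ := h'
    obtain ⟨a⟩ := t.down.1.nonempty_pts
    refine ⟨hv, ⟨j a, Sub.refl _⟩, fun p q => ?_, fun hl h3 => t.down.2 hl ((h.isTrivial_iff hκ).2 h3)⟩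
    exact (sameOrb_iff hκ hv).2 (hj.mem_orb hs p q)

/-- The orbits of type `t` are counted by a transversal, coded as a set `U` of points with one point
in each such orbit. -/
theorem HasType.cval_orbs_iff (hκ : P.κ = ℵ₀) {f : Fin n → P.S} {t : OrbitType n}
    (h : HasType c V f t) {f' : Fin n → P.S} (hf' : ∀ i, Valid c' V' (f' i)) {B : P.PS} :
    P.cval #(orbs (fun i => act c' V' (f' i)) t) = P.cval #B.1 ↔ ∃ U : P.PS,
      (∀ p : Pt c' V', Meet U p.set → EmbAt c V f c' V' f' p.set) ∧
      (∀ p : Pt c' V', EmbAt c V f c' V' f' p.set →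
        ∃ q : Pt c' V', Meet U q.set ∧ SameOrb c' V' f' p.set q.set) ∧
      (∀ p q : Pt c' V', Meet U p.set → Meet U q.set → SameOrb c' V' f' p.set q.set →
        P.Sub p.set.1 q.set.1) ∧ P.cval #{p : Pt c' V' | Meet U p.set} = P.cval #B.1 := by
  simp only [h.embAt_iff hκ hf', sameOrb_iff hκ hf']
  constructor
  · intro hB
    obtain ⟨D, h1, h2, h3⟩ := exists_transversal (fun i => act c' V' (f' i)) t
    obtain ⟨U, hU⟩ := exists_meet hκ D
    refine ⟨U, ?_⟩
    simp only [hU]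
    refine ⟨h1, h2, fun p q hp hq hpq => ?_, ?_⟩
    · rw [h3 p hp q hq hpq]; exact Sub.refl _
    · rw [Set.ofPred_mem_eq, mk_transversal h1 h2 h3, hB]
  · rintro ⟨U, h1, h2, h3, h4⟩
    rw [← h4, ← mk_transversal (D := {p : Pt c' V' | Meet U p.set}) h1 h2 fun p hp q hq hpq =>
      eq_of_sub hκ (h3 p q hp hq hpq)]

theorem app_cls_eq {f : Fin n → P.S} (hf : Fits P.lam P.μ fun i => act c V (f i))
    (t : IS P.lam P.μ n) :
    ((P.cls (tyPre _ hf)).app t).1 = P.cval #(orbs (fun i => act c V (f i)) t.1) := by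
  rw [cval]
  rcases FSort.app_mk P.hκ (tyPre _ hf) t with ⟨h1, h2⟩ | ⟨h1, h2⟩
  · exact h1.trans (if_pos h2).symm
  · exact h1.trans (if_neg (not_le.2 h2)).symm

end Pt

end Par

theorem TDef.up {ι : Type} {t : ∀ P : Par.{u}, (ι → P.S) → P.S} (ht : TDef t) :
    TDef fun P (v : Unit ⊕ ι → P.S) => t P fun i => v (.inr i) := ht.comap (ι' := Unit ⊕ ι) .inr

/-! ### Definability of types, orbits and numbers of orbits -/

namespace UDef

open Par Pt

variable {K : Par.{u} → Prop} {ι J : Type} {n : ℕ}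
  {c c' g f₀ : ∀ P : Par.{u}, (ι → P.S) → P.S}
  {f f' : Fin n → ∀ P : Par.{u}, (ι → P.S) → P.S}

theorem all_im (hc : TDef c) (j : J) (hg : TDef g) :
    UDef Ctb fun P v A => ∀ p : Pt (c P v) (A j), Im (g P v) p.set p.set :=
  all_pt (J := J) hc j (φ := fun P p v _ => Im (g P v) p p)
    (fun _ _ _ _ _ he h => h.congr he he) (im hg _ _)

theorem finite_not_im (hc : TDef c) (j : J) (hg : TDef g) :
    UDef Ctb fun P v A => {p : Pt (c P v) (A j) | ¬ Im (g P v) p.set p.set}.Finite :=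
  finite_pt (J := J) hc j (φ := fun P p v _ => ¬ Im (g P v) p p)
    (fun _ _ _ _ _ he h h' => h (h'.congr he.symm he.symm)) (im hg _ _).not

theorem defect (hc : TDef c) (j : J) (hf : ∀ i, TDef (f i)) (hc' : TDef c') (j' : J)
    (hg : TDef g) (W : J) : UDef Ctb fun P v A =>
      {p : Pt (c P v) (A j) | (P.lam ≤ P.μ → ¬ ∀ i, Im (f i P v) p.set p.set) ∧
        ¬ ∃ q : Pt (c' P v) (A j'), Link (g P v) (A W) p.set q.set}.Finite := by
  refine finite_pt (J := J) hc j (φ := fun P e v A => (P.lam ≤ P.μ → ¬ ∀ i, Im (f i P v) e e) ∧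
        ¬ ∃ q : Pt (c' P v) (A j'), Link (g P v) (A W) e q.set) ?_ ?_
  · rintro P v A e e' he ⟨h1, h2⟩
    exact ⟨fun hl H => h1 hl fun i => (H i).congr he.symm he.symm,
      fun ⟨q, hq⟩ => h2 ⟨q, hq.congr he.symm (Eqv.refl _)⟩⟩
  · refine (lam_le.imp (forall_fin fun i => im (hf i) _ _).not).and (UDef.not ?_)
    exact ex_pt (J := Unit ⊕ J) hc' (.inr j') (φ := fun P q v A =>
      Link (g P v) (A (.inr W)) (A (.inl ())) q) (fun P v A e e' he h => h.congr (Eqv.refl _) he)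
      (link hg _ _ _)

theorem defect' (hc : TDef c) (j : J) (hf' : ∀ i, TDef (f' i)) (hc' : TDef c') (j' : J)
    (hg : TDef g) (W : J) : UDef Ctb fun P v A =>
      {q : Pt (c' P v) (A j') | (P.lam ≤ P.μ → ¬ ∀ i, Im (f' i P v) q.set q.set) ∧
        ¬ ∃ p : Pt (c P v) (A j), Link (g P v) (A W) p.set q.set}.Finite := by
  refine finite_pt (J := J) hc' j' (φ := fun P e v A => (P.lam ≤ P.μ → ¬ ∀ i, Im (f' i P v) e e) ∧
        ¬ ∃ p : Pt (c P v) (A j), Link (g P v) (A W) p.set e) ?_ ?_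
  · rintro P v A e e' he ⟨h1, h2⟩
    exact ⟨fun hl H => h1 hl fun i => (H i).congr he.symm he.symm,
      fun ⟨q, hq⟩ => h2 ⟨q, hq.congr (Eqv.refl _) he.symm⟩⟩
  · refine (lam_le.imp (forall_fin fun i => im (hf' i) _ _).not).and (UDef.not ?_)
    exact ex_pt (J := Unit ⊕ J) hc (.inr j) (φ := fun P p v A =>
      Link (g P v) (A (.inr W)) p (A (.inl ()))) (fun P v A e e' he h => h.congr he (Eqv.refl _))
      (link hg _ _ _)

theorem full (hc : TDef c) (j : J) : UDef Ctb fun P v A => Full (c P v) (A j) := by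
  refine congr (R := fun P v A => ¬ P.lam ≤ P.μ → ∃ B : P.PS, (∀ B' : P.PS, LeC B' B) ∧
    P.cval #{p : Pt (c P v) (A j) | True} = P.cval #B.1) ?_ fun P _ v A => full_iff.symm
  refine lam_le.not.imp (ex_set ((all_set (leC _ _)).and ?_))
  exact cval_pt (J := Unit ⊕ J) hc (.inr j) (.inl ()) (φ := fun P e v A => True)
    (fun P v A e e' _ _ => trivial) UDef.true

theorem fnEq (hc : TDef c) (j : J) (hf : ∀ i, TDef (f i)) (hc' : TDef c') (j' : J)
    (hf' : ∀ i, TDef (f' i)) : UDef Ctb fun P v A =>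
      FnEq (c P v) (A j) (fun i => f i P v) (c' P v) (A j') fun i => f' i P v :=
  ex_perm (ex_set ((pLink (ι := Unit ⊕ ι) (J := Unit ⊕ J) hc.up (.inr j) (fun i => (hf i).up) hc'.up
    (.inr j') (fun i => (hf' i).up) (TDef.var (Sum.inl ())) (.inl ())).and
    ((defect (ι := Unit ⊕ ι) (J := Unit ⊕ J) hc.up (.inr j) (fun i => (hf i).up) hc'.up (.inr j')
      (TDef.var (Sum.inl ())) (.inl ())).and
    (defect' (ι := Unit ⊕ ι) (J := Unit ⊕ J) hc.up (.inr j) (fun i => (hf' i).up) hc'.up (.inr j')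
      (TDef.var (Sum.inl ())) (.inl ())))))

theorem total (hc : TDef c) (j : J) (hc' : TDef c') (j' : J) (hg : TDef g) (W : J) :
    UDef Ctb fun P v A => ∀ p : Pt (c P v) (A j), ∃ q : Pt (c' P v) (A j'),
      Link (g P v) (A W) p.set q.set := by
  refine all_pt (J := J) hc j (φ := fun P p v A => ∃ q : Pt (c' P v) (A j'),
    Link (g P v) (A W) p q.set) ?_ ?_
  · rintro P v A e e' he ⟨q, hq⟩
    exact ⟨q, hq.congr he (Eqv.refl _)⟩
  · exact ex_pt (J := Unit ⊕ J) hc' (.inr j') (φ := fun P q v A =>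
      Link (g P v) (A (.inr W)) (A (.inl ())) q) (fun P v A e e' he h => h.congr (Eqv.refl _) he)
      (link hg _ _ _)

theorem emb (hc : TDef c) (j : J) (hf : ∀ i, TDef (f i)) (hc' : TDef c') (j' : J)
    (hf' : ∀ i, TDef (f' i)) : UDef Ctb fun P v A =>
      Emb (c P v) (A j) (fun i => f i P v) (c' P v) (A j') fun i => f' i P v :=
  ex_perm (ex_set ((pLink (ι := Unit ⊕ ι) (J := Unit ⊕ J) hc.up (.inr j) (fun i => (hf i).up) hc'.up
    (.inr j') (fun i => (hf' i).up) (TDef.var (Sum.inl ())) (.inl ())).and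
    (total (ι := Unit ⊕ ι) (J := Unit ⊕ J) hc.up (.inr j) hc'.up (.inr j')
      (TDef.var (Sum.inl ())) (.inl ()))))

theorem embAt (hc : TDef c) (j : J) (hf : ∀ i, TDef (f i)) (hc' : TDef c') (j' : J)
    (hf' : ∀ i, TDef (f' i)) (e : J) : UDef Ctb fun P v A =>
      EmbAt (c P v) (A j) (fun i => f i P v) (c' P v) (A j') (fun i => f' i P v) (A e) :=
  ex_perm (ex_set ((pLink (ι := Unit ⊕ ι) (J := Unit ⊕ J) hc.up (.inr j) (fun i => (hf i).up) hc'.up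
    (.inr j') (fun i => (hf' i).up) (TDef.var (Sum.inl ())) (.inl ())).and
    ((total (ι := Unit ⊕ ι) (J := Unit ⊕ J) hc.up (.inr j) hc'.up (.inr j')
      (TDef.var (Sum.inl ())) (.inl ())).and
    (ex_pt (ι := Unit ⊕ ι) (J := Unit ⊕ J) hc.up (.inr j) (φ := fun _ p v A =>
      Link (v (.inl ())) (A (.inl ())) p (A (.inr e)))
      (fun _ _ _ _ _ he h => h.congr he (Eqv.refl _)) (link (TDef.var (Sum.inl ())) _ _ _)))))

theorem uInv (hc : TDef c) (j : J) (hf : ∀ i, TDef (f i)) (U : J) :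
    UDef Ctb fun P v A => UInv (c P v) (A j) (fun i => f i P v) (A U) := by
  refine forall_fin fun i => ?_
  refine all_pt (J := J) hc j (φ := fun P p v A => ∀ q : Pt (c P v) (A j),
    Im (f i P v) p q.set → (Meet (A U) p ↔ Meet (A U) q.set)) ?_ ?_
  · exact fun P v A e e' he H q hq => Iff.trans ⟨fun h => h.congr he.symm, fun h => h.congr he⟩
      (H q (hq.congr he.symm (Eqv.refl _)))
  · exact all_pt (J := Unit ⊕ J) hc (.inr j) (φ := fun P q v A =>
      Im (f i P v) (A (.inl ())) q → (Meet (A (.inr U)) (A (.inl ())) ↔ Meet (A (.inr U)) q))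
      (fun P v A e e' he H hq => Iff.trans (H (hq.congr (Eqv.refl _) he.symm))
        ⟨fun h => h.congr he, fun h => h.congr he.symm⟩)
      ((im (hf i) _ _).imp ((meet _ _).iff (meet _ _)))

theorem sameOrb (hc : TDef c) (j : J) (hf : ∀ i, TDef (f i)) (e e' : J) :
    UDef Ctb fun P v A => SameOrb (c P v) (A j) (fun i => f i P v) (A e) (A e') :=
  all_set ((uInv (J := Unit ⊕ J) hc (.inr j) hf (.inl ())).imp ((meet _ _).imp (meet _ _)))

theorem sameOrb_congr {P : Par.{u}} {c : P.S} {V : P.PS} {f : Fin n → P.S} {e e' e₁ e₁' : P.PS}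
    (h : SameOrb c V f e e') (h1 : Eqv e e₁) (h2 : Eqv e' e₁') : SameOrb c V f e₁ e₁' :=
  fun U hU H => (h U hU (H.congr h1.symm)).congr h2

theorem isCode (hc : TDef c) (j : J) (hf : ∀ i, TDef (f i)) :
    UDef Ctb fun P v A => IsCode (c P v) (A j) (fun i => f i P v) := by
  refine (forall_fin fun i => valid hc j (hf i)).and (and ?_ (and ?_
    (lam_le.imp (UDef.not (forall_fin fun i => ?_)))))
  · exact ex_pt (J := J) hc j (φ := fun P p v A => P.Sub p.1 p.1)
      (fun P v A e e' _ _ => Sub.refl _) (sub _ _)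
  · refine all_pt (J := J) hc j (φ := fun P p v A => ∀ q : Pt (c P v) (A j),
      SameOrb (c P v) (A j) (fun i => f i P v) p q.set) ?_ ?_
    · exact fun P v A e e' he H q => sameOrb_congr (H q) he (Eqv.refl _)
    · exact all_pt (J := Unit ⊕ J) hc (.inr j) (φ := fun P q v A =>
        SameOrb (c P v) (A (.inr j)) (fun i => f i P v) (A (.inl ())) q)
        (fun P v A e e' he H => sameOrb_congr H (Eqv.refl _) he) (sameOrb hc _ hf _ _)
  · exact all_im hc j (hf i)

theorem embAt_congr {P : Par.{u}} {c c' : P.S} {V V' : P.PS} {f f' : Fin n → P.S} {e e' : P.PS}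
    (h : EmbAt c V f c' V' f' e) (he : Eqv e e') : EmbAt c V f c' V' f' e' := by
  obtain ⟨g, W, h1, h2, p, hp⟩ := h
  exact ⟨g, W, h1, h2, p, hp.congr (Eqv.refl _) he⟩

theorem cval_orbs (hc : TDef c) (j : J) (hf : ∀ i, TDef (f i)) (hc' : TDef c') (j' : J)
    (hf' : ∀ i, TDef (f' i)) (B : J) : UDef Ctb fun P v A => ∃ U : P.PS,
      (∀ p : Pt (c' P v) (A j'), Meet U p.set →
        EmbAt (c P v) (A j) (fun i => f i P v) (c' P v) (A j') (fun i => f' i P v) p.set) ∧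
      (∀ p : Pt (c' P v) (A j'),
        EmbAt (c P v) (A j) (fun i => f i P v) (c' P v) (A j') (fun i => f' i P v) p.set →
        ∃ q : Pt (c' P v) (A j'), Meet U q.set ∧
          SameOrb (c' P v) (A j') (fun i => f' i P v) p.set q.set) ∧
      (∀ p q : Pt (c' P v) (A j'), Meet U p.set → Meet U q.set →
        SameOrb (c' P v) (A j') (fun i => f' i P v) p.set q.set → P.Sub p.set.1 q.set.1) ∧
      P.cval #{p : Pt (c' P v) (A j') | Meet U p.set} = P.cval #(A B).1 := by
  refine ex_set (and ?_ (and ?_ (and ?_ ?_)))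
  · exact all_pt (J := Unit ⊕ J) hc' (.inr j') (φ := fun P p v A => Meet (A (.inl ())) p →
      EmbAt (c P v) (A (.inr j)) (fun i => f i P v) (c' P v) (A (.inr j')) (fun i => f' i P v) p)
      (fun P v A e e' he H h => embAt_congr (H (h.congr he.symm)) he)
      ((meet _ _).imp (embAt hc _ hf hc' _ hf' _))
  · refine all_pt (J := Unit ⊕ J) hc' (.inr j') (φ := fun P p v A =>
      EmbAt (c P v) (A (.inr j)) (fun i => f i P v) (c' P v) (A (.inr j')) (fun i => f' i P v) p →
      ∃ q : Pt (c' P v) (A (.inr j')), Meet (A (.inl ())) q.set ∧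
        SameOrb (c' P v) (A (.inr j')) (fun i => f' i P v) p q.set) ?_ ?_
    · intro P v A e e' he H h
      obtain ⟨q, h1, h2⟩ := H (embAt_congr h he.symm)
      exact ⟨q, h1, sameOrb_congr h2 he (Eqv.refl _)⟩
    · exact (embAt hc _ hf hc' _ hf' _).imp (ex_pt (J := Unit ⊕ Unit ⊕ J) hc' (.inr (.inr j'))
        (φ := fun P q v A => Meet (A (.inr (.inl ()))) q ∧
          SameOrb (c' P v) (A (.inr (.inr j'))) (fun i => f' i P v) (A (.inl ())) q)
        (fun P v A e e' he H => ⟨H.1.congr he, sameOrb_congr H.2 (Eqv.refl _) he⟩)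
        ((meet _ _).and (sameOrb hc' _ hf' _ _)))
  · refine all_pt (J := Unit ⊕ J) hc' (.inr j') (φ := fun P p v A =>
      ∀ q : Pt (c' P v) (A (.inr j')), Meet (A (.inl ())) p → Meet (A (.inl ())) q.set →
        SameOrb (c' P v) (A (.inr j')) (fun i => f' i P v) p q.set → P.Sub p.1 q.set.1) ?_ ?_
    · exact fun P v A e e' he H q h1 h2 h3 => he.2.trans
        (H q (h1.congr he.symm) h2 (sameOrb_congr h3 he.symm (Eqv.refl _)))
    · exact all_pt (J := Unit ⊕ Unit ⊕ J) hc' (.inr (.inr j')) (φ := fun P q v A =>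
        Meet (A (.inr (.inl ()))) (A (.inl ())) → Meet (A (.inr (.inl ()))) q →
        SameOrb (c' P v) (A (.inr (.inr j'))) (fun i => f' i P v) (A (.inl ())) q →
          P.Sub (A (.inl ())).1 q.1)
        (fun P v A e e' he H h1 h2 h3 => (H h1 (h2.congr he.symm)
          (sameOrb_congr h3 (Eqv.refl _) he.symm)).trans he.1)
        ((meet _ _).imp ((meet _ _).imp ((sameOrb hc' _ hf' _ _).imp (sub _ _))))
  · exact cval_pt (J := Unit ⊕ J) hc' (.inr j') (.inr B) (φ := fun P p v A => Meet (A (.inl ())) p)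
      (fun P v A e e' he h => h.congr he) (meet _ _)

end UDef

/-! ### The interpretation for `κ = ℵ₀` -/

namespace Par

open OrbitType

variable {P : Par.{u}} {m n : ℕ} {c c' : P.S} {V V' : P.PS}

namespace Pt

theorem HasType.emb_comp_iff (hκ : P.κ = ℵ₀) {f : Fin n → P.S} {f' : Fin m → P.S} {t' : OrbitType n}
    {t : OrbitType m} (h : HasType c V f t') (h' : HasType c' V' f' t) (σ : Fin m → Fin n) :
    Emb c' V' f' c V (fun i => f (σ i)) ↔ (orbitsOfType σ t' t).Nonempty := by
  rw [h'.emb_iff hκ fun i => h.1 (σ i), orbitsOfType_eq]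
  obtain ⟨hv, j, hj, hs⟩ := h
  constructor
  · rintro ⟨k, hk⟩
    choose r hr using fun b => hs (k b)
    refine ⟨_, r, ⟨fun b b' hb => hk.inj ?_, fun i b => hj.inj ?_⟩, rfl⟩
    · rw [← hr b, ← hr b', hb]
    · rw [hr, hj.map, hr, hk.map]
  · rintro ⟨_, k, hk, rfl⟩
    exact ⟨fun b => j (k b), fun b b' h => hk.inj (hj.inj h), fun i b => by rw [hk.map, hj.map]⟩

/-- The class of the function counting the orbits of the tuple induced on the points. -/
def CodesFn (c : P.S) (V : P.PS) (f : Fin n → P.S) (x : FSort P.κ P.lam P.μ n) : Prop :=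
  (∀ i, Valid c V (f i)) ∧ ∃ hf : Fits P.lam P.μ fun i => act c V (f i), x = P.cls (tyPre _ hf)

theorem CodesFn.unique {f : Fin n → P.S} {x y : FSort P.κ P.lam P.μ n} (hx : CodesFn c V f x)
    (hy : CodesFn c V f y) : x = y := by
  obtain ⟨-, hf, rfl⟩ := hx
  obtain ⟨-, -, rfl⟩ := hy
  rfl

theorem CodesFn.eq_iff (hκ : P.κ = ℵ₀) {f f' : Fin n → P.S} {x y : FSort P.κ P.lam P.μ n}
    (hx : CodesFn c V f x) (hy : CodesFn c' V' f' y) : x = y ↔ FnEq c V f c' V' f' := by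
  obtain ⟨hv, hf, rfl⟩ := hx
  obtain ⟨hv', hf', rfl⟩ := hy
  exact cls_eq_iff hκ hv hv' hf hf'

theorem CodesFn.proj {f : Fin n → P.S} {x : FSort P.κ P.lam P.μ n} (hx : CodesFn c V f x)
    (σ : Fin m → Fin n) : CodesFn c V (fun i => f (σ i)) (x.proj σ) := by
  obtain ⟨hv, hf, rfl⟩ := hx
  exact ⟨fun i => hv (σ i), hf.comp σ, congrArg P.cls (tyPre_proj hf σ)⟩

theorem exists_codesFn_iff (hκ : P.κ = ℵ₀) {f : Fin n → P.S} :
    (∃ x, CodesFn c V f x) ↔ (∀ i, Valid c V (f i)) ∧ Full c V := by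
  constructor
  · rintro ⟨x, hv, hf, -⟩
    exact ⟨hv, (fits_iff hκ).1 hf⟩
  · rintro ⟨hv, hf⟩
    exact ⟨_, hv, (fits_iff hκ).2 hf, rfl⟩

/-- The abstract tuple belonging to a representative of the class acts on fewer than `lam` elements,
so `exists_equiv` reproduces it on the ends of suitable cycles. -/
theorem exists_codesFn (hκ : P.κ = ℵ₀) (x : FSort P.κ P.lam P.μ n) :
    ∃ (c : P.S) (V : P.PS) (f : Fin n → P.S), CodesFn c V f x := by
  obtain ⟨h, rfl⟩ := Quot.exists_rep x
  obtain ⟨Y, f, hf, hY, hcore, rfl⟩ := exists_tuple h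
  obtain ⟨c, V, g, e, hv, he⟩ := exists_equiv hκ (hY.trans_lt hf.lt) f
  have hg : Fits P.lam P.μ fun i => act c V (g i) := by
    refine (fits_iff hκ).2 fun hl => ?_
    rw [← mk_congr e, hY, hf.eq (lam_eq hl)]
  refine ⟨c, V, g, hv, hg, congrArg P.cls (PIso.tyPre_eq (L := fun y p => e y = p)
    ⟨fun h h' => h.symm.trans h', fun h h' => e.injective (h.trans h'.symm), fun i y p => ?_⟩
    hf hg (fun y _ => ⟨_, rfl⟩) fun p _ => ⟨_, e.apply_symm_apply p⟩)⟩
  rw [he, Equiv.apply_eq_iff_eq]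

theorem exists_hasType (hκ : P.κ = ℵ₀) (t : OrbitType n) :
    ∃ (c : P.S) (V : P.PS) (f : Fin n → P.S), HasType c V f t := by
  have hY : #(ULift.{u} t.pts) < P.lam := lt_of_le_of_lt mk_le_aleph0 aleph0_lt_lam
  obtain ⟨c, V, g, e, hv, he⟩ := exists_equiv hκ hY fun i =>
    Equiv.ulift.trans ((t.rep.gen i).trans Equiv.ulift.symm)
  exact ⟨c, V, g, hv, fun a => e ⟨a⟩, ⟨fun a b h => ULift.up_injective (e.injective h),
    fun i a => he i ⟨a⟩⟩, fun p => ⟨(e.symm p).down, e.apply_symm_apply p⟩⟩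

theorem CodesFn.isEq_iff (hκ : P.κ = ℵ₀) {f : Fin 2 → P.S} {x : FSort P.κ P.lam P.μ 2}
    (hx : CodesFn c V f x) :
    {p : Pt c V | ¬ Im ((f 1)⁻¹ * f 0) p.set p.set}.Finite ↔ x.IsEq := by
  obtain ⟨hv, hf, rfl⟩ := hx
  refine Iff.trans ?_ (isEq_tyPre_iff P.hκ hf).symm
  rw [hκ, lt_aleph0_iff_set_finite]
  refine iff_of_eq (congrArg _ ?_)
  ext p
  exact not_congr (act_eq_act_iff hκ (hv 0) (hv 1)).symm

theorem CodesFn.isProd_iff (hκ : P.κ = ℵ₀) {f : Fin 3 → P.S} {x : FSort P.κ P.lam P.μ 3}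
    (hx : CodesFn c V f x) :
    {p : Pt c V | ¬ Im ((f 2)⁻¹ * (f 1 * f 0)) p.set p.set}.Finite ↔ x.IsProd := by
  obtain ⟨hv, hf, rfl⟩ := hx
  refine Iff.trans ?_ (isProd_tyPre_iff P.hκ hf).symm
  rw [hκ, lt_aleph0_iff_set_finite]
  refine iff_of_eq (congrArg _ ?_)
  ext p
  exact not_congr (act_act_eq_act_iff hκ (hv 0) (hv 1) (hv 2)).symm

theorem HasType.gen_eq_iff (hκ : P.κ = ℵ₀) {f : Fin 2 → P.S} {t : OrbitType 2}
    (h : HasType c V f t) : (∀ p : Pt c V, Im ((f 1)⁻¹ * f 0) p.set p.set) ↔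
      t.rep.gen 0 = t.rep.gen 1 := by
  obtain ⟨hv, j, hj, hs⟩ := h
  rw [hs.forall]
  refine Iff.trans (forall_congr' fun a => ?_)
    (Equiv.ext_iff (f := t.rep.gen 0) (g := t.rep.gen 1)).symm
  rw [← act_eq_act_iff hκ (hv 0) (hv 1), ← hj.map 0, ← hj.map 1, hj.inj.eq_iff]

theorem HasType.gen_gen_eq_iff (hκ : P.κ = ℵ₀) {f : Fin 3 → P.S} {t : OrbitType 3}
    (h : HasType c V f t) : (∀ p : Pt c V, Im ((f 2)⁻¹ * (f 1 * f 0)) p.set p.set) ↔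
      ∀ a, t.rep.gen 1 (t.rep.gen 0 a) = t.rep.gen 2 a := by
  obtain ⟨hv, j, hj, hs⟩ := h
  rw [hs.forall]
  refine forall_congr' fun a => ?_
  rw [← act_act_eq_act_iff hκ (hv 0) (hv 1) (hv 2), ← hj.map 0, ← hj.map 1, ← hj.map 2,
    hj.inj.eq_iff]

end Pt

end Par

open Par Pt

/-- The relation between codes and elements of `M` for `κ = ℵ₀`. -/
def CodesCountable (P : Par.{u}) : (s : MSort) →
    ((match s with
      | .is n => Unit ⊕ Fin (n + 1) | .card => Empty | .fn n => Unit ⊕ Fin (n + 1)) → P.S) →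
    (Unit → P.PS) → MCarrier P.κ P.lam P.μ s → Prop
  | .is n => fun v A x =>
    let t : ULift.{u + 1} (IS P.lam P.μ (n + 1)) := x
    HasType (v (.inl ())) (A ()) (fun i => v (.inr i)) t.down.1
  | .card => fun _ A x =>
    let ν : CardMinus P.κ P.lam := x
    ν.1 = P.cval #(A ()).1
  | .fn n => fun v A x =>
    let h : FSort P.κ P.lam P.μ (n + 1) := x
    CodesFn (v (.inl ())) (A ()) (fun i => v (.inr i)) h

theorem exists_cardMinus_iff {P : Par.{u}} {A B : P.PS} :
    (∃ x : CardMinus P.κ P.lam, x.1 = P.cval #A.1 ∧ x.1 = P.cval #B.1) ↔ LeC A B ∧ LeC B A := by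
  rw [leC_iff_cval, leC_iff_cval, ← le_antisymm_iff]
  constructor
  · rintro ⟨x, h1, h2⟩
    exact h1.symm.trans h2
  · intro h
    refine ⟨⟨P.cval #A.1, ?_, ?_⟩, rfl, h⟩
    · unfold cval
      split_ifs
      · exact A.2
      · exact aleph0_pos.trans aleph0_lt_lam
    · unfold cval
      split_ifs with h'
      · exact Or.inr h'
      · exact Or.inl rfl

/-- The coding of `M` in the groups for `κ = ℵ₀`. -/
noncomputable def codingCountable : Coding.{u} (L := MLang) Ctb (fun P => P.M) where
  p := fun s : MSort => match s with
    | .is n => Unit ⊕ Fin (n + 1) | .card => Empty | .fn n => Unit ⊕ Fin (n + 1)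
  r := fun _ => Unit
  fin_p := fun s : MSort => match s with
    | .is n => inferInstanceAs (Finite (Unit ⊕ Fin (n + 1)))
    | .card => inferInstanceAs (Finite Empty)
    | .fn n => inferInstanceAs (Finite (Unit ⊕ Fin (n + 1)))
  fin_r := fun _ => inferInstance
  C := CodesCountable
  functional := by
    rintro P hP (n | _ | n) v A x y hx hy
    · exact ULift.down_injective (Subtype.ext (HasType.unique (P := P) hx hy))
    · exact Subtype.ext (Eq.trans hx (Eq.symm hy))
    · exact CodesFn.unique (P := P) hx hy
  surjective := by
    rintro P hP (n | _ | n) x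
    · obtain ⟨c, V, f, h⟩ := exists_hasType (P := P) hP (ULift.down x).1
      exact ⟨Sum.elim (fun _ => c) f, fun _ => V, h⟩
    · obtain ⟨A, h⟩ := exists_cval_eq (P := P) x
      exact ⟨fun e => e.elim, fun _ => A, h⟩
    · obtain ⟨c, V, f, h⟩ := exists_codesFn (P := P) hP x
      exact ⟨Sum.elim (fun _ => c) f, fun _ => V, h⟩
  equal := by
    rintro (n | _ | n)
    · let a : Unit ⊕ Fin (n + 1) → (Unit ⊕ Fin (n + 1)) ⊕ (Unit ⊕ Fin (n + 1)) := .inl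
      let b : Unit ⊕ Fin (n + 1) → (Unit ⊕ Fin (n + 1)) ⊕ (Unit ⊕ Fin (n + 1)) := .inr
      refine UDef.congr (R := fun P v (A : Unit ⊕ Unit → P.PS) =>
        IsCode (v (a (.inl ()))) (A (.inl ())) (fun i => v (a (.inr i))) ∧
        IsCode (v (b (.inl ()))) (A (.inr ())) (fun i => v (b (.inr i))) ∧
        Emb (v (a (.inl ()))) (A (.inl ())) (fun i => v (a (.inr i)))
          (v (b (.inl ()))) (A (.inr ())) (fun i => v (b (.inr i)))) ?_ ?_
      · exact (UDef.isCode (TDef.var _) _ fun i => TDef.var _).and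
          ((UDef.isCode (TDef.var _) _ fun i => TDef.var _).and
          (UDef.emb (TDef.var _) _ (fun i => TDef.var _) (TDef.var _) _ fun i => TDef.var _))
      · intro P hP v A
        constructor
        · rintro ⟨h1, h2, h3⟩
          obtain ⟨t, ht⟩ := (isCode_iff hP).1 h1
          obtain ⟨t', ht'⟩ := (isCode_iff hP).1 h2
          have e := (ht.unique_iff hP ht').1 h3
          exact ⟨t, ht, (congrArg (HasType (v (b (.inl ()))) (A (.inr ()))
            fun i => v (b (.inr i))) e).mpr ht'⟩
        · rintro ⟨t, h1, h2⟩
          exact ⟨(isCode_iff hP).2 ⟨t, h1⟩, (isCode_iff hP).2 ⟨t, h2⟩,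
            (HasType.unique_iff (P := P) hP h1 h2).2 rfl⟩
    · exact UDef.congr (R := fun P (v : Empty ⊕ Empty → P.S) (A : Unit ⊕ Unit → P.PS) =>
        LeC (A (.inl ())) (A (.inr ())) ∧ LeC (A (.inr ())) (A (.inl ())))
        ((UDef.leC _ _).and (UDef.leC _ _)) fun P hP v A => exists_cardMinus_iff.symm
    · let a : Unit ⊕ Fin (n + 1) → (Unit ⊕ Fin (n + 1)) ⊕ (Unit ⊕ Fin (n + 1)) := .inl
      let b : Unit ⊕ Fin (n + 1) → (Unit ⊕ Fin (n + 1)) ⊕ (Unit ⊕ Fin (n + 1)) := .inr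
      refine UDef.congr (R := fun P v (A : Unit ⊕ Unit → P.PS) =>
        ((∀ i, Valid (v (a (.inl ()))) (A (.inl ())) (v (a (.inr i)))) ∧
          Full (v (a (.inl ()))) (A (.inl ()))) ∧
        ((∀ i, Valid (v (b (.inl ()))) (A (.inr ())) (v (b (.inr i)))) ∧
          Full (v (b (.inl ()))) (A (.inr ()))) ∧
        FnEq (v (a (.inl ()))) (A (.inl ())) (fun i => v (a (.inr i)))
          (v (b (.inl ()))) (A (.inr ())) (fun i => v (b (.inr i)))) ?_ ?_
      · exact ((UDef.forall_fin fun i => UDef.valid (TDef.var _) _ (TDef.var _)).and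
          (UDef.full (TDef.var _) _)).and
          (((UDef.forall_fin fun i => UDef.valid (TDef.var _) _ (TDef.var _)).and
          (UDef.full (TDef.var _) _)).and
          (UDef.fnEq (TDef.var _) _ (fun i => TDef.var _) (TDef.var _) _ fun i => TDef.var _))
      · intro P hP v A
        constructor
        · rintro ⟨h1, h2, h3⟩
          obtain ⟨x, hx⟩ := (exists_codesFn_iff hP).2 h1
          obtain ⟨y, hy⟩ := (exists_codesFn_iff hP).2 h2
          obtain rfl := (hx.eq_iff hP hy).2 h3
          exact ⟨x, hx, hy⟩
        · rintro ⟨x, h1, h2⟩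
          exact ⟨(exists_codesFn_iff hP).1 ⟨_, h1⟩, (exists_codesFn_iff hP).1 ⟨_, h2⟩,
            (CodesFn.eq_iff (P := P) hP h1 h2).1 rfl⟩

namespace codingCountable

theorem rep_app (n : ℕ) : codingCountable.{u}.Rep (Sum.elim (MLang.dom (.app n)).get
    fun _ : Unit => MLang.cod (.app n))
    fun P x => P.M.func (.app n) (fun i => x (.inl i)) = x (.inr ()) := by
  let ιp := Σ i, codingCountable.{u}.p (Sum.elim (MLang.dom (.app n)).get
    (fun _ : Unit => MLang.cod (.app n)) i)
  let ιr := Σ i, codingCountable.{u}.r (Sum.elim (MLang.dom (.app n)).get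
    (fun _ : Unit => MLang.cod (.app n)) i)
  let a : Unit ⊕ Fin (n + 1) → ιp := fun k => ⟨.inl (0 : Fin 2), k⟩
  let b : Unit ⊕ Fin (n + 1) → ιp := fun k => ⟨.inl (1 : Fin 2), k⟩
  let A₀ : ιr := ⟨.inl (0 : Fin 2), ()⟩
  let A₁ : ιr := ⟨.inl (1 : Fin 2), ()⟩
  let B : ιr := ⟨.inr (), ()⟩
  refine ⟨_, UDef.cval_orbs (ι := ιp) (J := ιr) (TDef.var (b (.inl ()))) A₁
    (fun i => TDef.var (b (.inr i))) (TDef.var (a (.inl ()))) A₀ (fun i => TDef.var (a (.inr i))) B, ?_⟩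
  intro P hP v A x hx
  have h1 : CodesFn (P := P) (v (a (.inl ()))) (A A₀) (fun i => v (a (.inr i)))
    (x (.inl (0 : Fin 2))) := hx (.inl (0 : Fin 2))
  let t : ULift.{u + 1} (IS P.lam P.μ (n + 1)) := x (.inl (1 : Fin 2))
  let ν : CardMinus P.κ P.lam := x (.inr ())
  have h2 : HasType (P := P) (v (b (.inl ()))) (A A₁) (fun i => v (b (.inr i))) t.down.1 :=
    hx (.inl (1 : Fin 2))
  have h3 : ν.1 = P.cval #(A B).1 := hx (.inr ())
  refine (h2.cval_orbs_iff hP h1.1).symm.trans ?_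
  obtain ⟨hv, hf, h1⟩ := h1
  have e : (FSort.app (x (.inl (0 : Fin 2)) : FSort P.κ P.lam P.μ (n + 1)) t.down : CardMinus _ _).1 =
      P.cval #(orbs (fun i => act (v (a (.inl ()))) (A A₀) (v (a (.inr i)))) t.down.1) := by
    rw [h1]
    exact Pt.app_cls_eq hf _
  rw [← e, ← h3]
  exact Subtype.ext_iff.symm

theorem rep_proj (m n : ℕ) (σ : Fin (m + 1) ↪ Fin (n + 1)) :
    codingCountable.{u}.Rep (Sum.elim (MLang.dom (.proj m n σ)).get
    fun _ : Unit => MLang.cod (.proj m n σ))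
    fun P x => P.M.func (.proj m n σ) (fun i => x (.inl i)) = x (.inr ()) := by
  let ιp := Σ i, codingCountable.{u}.p (Sum.elim (MLang.dom (.proj m n σ)).get
    (fun _ : Unit => MLang.cod (.proj m n σ)) i)
  let ιr := Σ i, codingCountable.{u}.r (Sum.elim (MLang.dom (.proj m n σ)).get
    (fun _ : Unit => MLang.cod (.proj m n σ)) i)
  let a : Unit ⊕ Fin (n + 1) → ιp := fun k => ⟨.inl (0 : Fin 1), k⟩
  let b : Unit ⊕ Fin (m + 1) → ιp := fun k => ⟨.inr (), k⟩
  let A₀ : ιr := ⟨.inl (0 : Fin 1), ()⟩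
  let A₁ : ιr := ⟨.inr (), ()⟩
  refine ⟨_, UDef.fnEq (ι := ιp) (J := ιr) (TDef.var (a (.inl ()))) A₀
    (fun i => TDef.var (a (.inr (σ i)))) (TDef.var (b (.inl ()))) A₁
    (fun i => TDef.var (b (.inr i))), ?_⟩
  intro P hP v A x hx
  have h1 : CodesFn (P := P) (v (a (.inl ()))) (A A₀) (fun i => v (a (.inr i)))
    (x (.inl (0 : Fin 1))) := hx (.inl (0 : Fin 1))
  have h2 : CodesFn (P := P) (v (b (.inl ()))) (A A₁) (fun i => v (b (.inr i)))
    (x (.inr ())) := hx (.inr ())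
  exact ((h1.proj σ).eq_iff hP h2).symm

theorem rep_eq1 : codingCountable.{u}.Rep (MLang.ar .eq1).get
    fun P x => P.M.rel .eq1 x := by
  let ιp := Σ i, codingCountable.{u}.p ((MLang.ar .eq1).get i)
  let ιr := Σ i, codingCountable.{u}.r ((MLang.ar .eq1).get i)
  let a : Unit ⊕ Fin 2 → ιp := fun k => ⟨(0 : Fin 1), k⟩
  let A₀ : ιr := ⟨(0 : Fin 1), ()⟩
  refine ⟨_, UDef.all_im (ι := ιp) (J := ιr) (TDef.var (a (.inl ()))) A₀
    ((TDef.var (a (.inr 1))).inv.mul (TDef.var (a (.inr 0)))), ?_⟩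
  intro P hP v A x hx
  let t : ULift.{u + 1} (IS P.lam P.μ 2) := x (0 : Fin 1)
  have h : HasType (P := P) (v (a (.inl ()))) (A A₀) (fun i => v (a (.inr i))) t.down.1 :=
    hx (0 : Fin 1)
  exact h.gen_eq_iff hP

theorem rep_prod1 : codingCountable.{u}.Rep (MLang.ar .prod1).get
    fun P x => P.M.rel .prod1 x := by
  let ιp := Σ i, codingCountable.{u}.p ((MLang.ar .prod1).get i)
  let ιr := Σ i, codingCountable.{u}.r ((MLang.ar .prod1).get i)
  let a : Unit ⊕ Fin 3 → ιp := fun k => ⟨(0 : Fin 1), k⟩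
  let A₀ : ιr := ⟨(0 : Fin 1), ()⟩
  refine ⟨_, UDef.all_im (ι := ιp) (J := ιr) (TDef.var (a (.inl ()))) A₀
    ((TDef.var (a (.inr 2))).inv.mul
      ((TDef.var (a (.inr 1))).mul (TDef.var (a (.inr 0))))), ?_⟩
  intro P hP v A x hx
  let t : ULift.{u + 1} (IS P.lam P.μ 3) := x (0 : Fin 1)
  have h : HasType (P := P) (v (a (.inl ()))) (A A₀) (fun i => v (a (.inr i))) t.down.1 :=
    hx (0 : Fin 1)
  exact h.gen_gen_eq_iff hP

theorem rep_proj1 (m n : ℕ) (σ : Fin (m + 1) ↪ Fin (n + 1)) :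
    codingCountable.{u}.Rep (MLang.ar (.proj1 m n σ)).get
    fun P x => P.M.rel (.proj1 m n σ) x := by
  let ιp := Σ i, codingCountable.{u}.p ((MLang.ar (.proj1 m n σ)).get i)
  let ιr := Σ i, codingCountable.{u}.r ((MLang.ar (.proj1 m n σ)).get i)
  let a : Unit ⊕ Fin (n + 1) → ιp := fun k => ⟨(0 : Fin 2), k⟩
  let b : Unit ⊕ Fin (m + 1) → ιp := fun k => ⟨(1 : Fin 2), k⟩
  let A₀ : ιr := ⟨(0 : Fin 2), ()⟩
  let A₁ : ιr := ⟨(1 : Fin 2), ()⟩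
  refine ⟨_, UDef.emb (ι := ιp) (J := ιr) (TDef.var (b (.inl ()))) A₁
    (fun i => TDef.var (b (.inr i))) (TDef.var (a (.inl ()))) A₀
    (fun i => TDef.var (a (.inr (σ i)))), ?_⟩
  intro P hP v A x hx
  let t : ULift.{u + 1} (IS P.lam P.μ (n + 1)) := x (0 : Fin 2)
  let t' : ULift.{u + 1} (IS P.lam P.μ (m + 1)) := x (1 : Fin 2)
  have h : HasType (P := P) (v (a (.inl ()))) (A A₀) (fun i => v (a (.inr i))) t.down.1 :=
    hx (0 : Fin 2)
  have h' : HasType (P := P) (v (b (.inl ()))) (A A₁) (fun i => v (b (.inr i))) t'.down.1 :=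
    hx (1 : Fin 2)
  exact h.emb_comp_iff hP h' σ

theorem rep_lt : codingCountable.{u}.Rep (MLang.ar .lt).get
    fun P x => P.M.rel .lt x := by
  let ιr := Σ i, codingCountable.{u}.r ((MLang.ar .lt).get i)
  let T : ιr := ⟨(0 : Fin 2), ()⟩
  let T' : ιr := ⟨(1 : Fin 2), ()⟩
  refine ⟨fun P v (A : ιr → P.PS) => ¬ LeC (A T') (A T), (UDef.leC _ _).not, ?_⟩
  intro P hP v A x hx
  let ν : CardMinus P.κ P.lam := x (0 : Fin 2)
  let ν' : CardMinus P.κ P.lam := x (1 : Fin 2)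
  have h : ν.1 = P.cval #(A T).1 := hx (0 : Fin 2)
  have h' : ν'.1 = P.cval #(A T').1 := hx (1 : Fin 2)
  refine (not_congr leC_iff_cval).trans (not_le.trans ?_)
  rw [← h, ← h']
  exact Iff.rfl

theorem rep_eq : codingCountable.{u}.Rep (MLang.ar .eq).get
    fun P x => P.M.rel .eq x := by
  let ιp := Σ i, codingCountable.{u}.p ((MLang.ar .eq).get i)
  let ιr := Σ i, codingCountable.{u}.r ((MLang.ar .eq).get i)
  let a : Unit ⊕ Fin 2 → ιp := fun k => ⟨(0 : Fin 1), k⟩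
  let A₀ : ιr := ⟨(0 : Fin 1), ()⟩
  refine ⟨_, UDef.finite_not_im (ι := ιp) (J := ιr) (TDef.var (a (.inl ()))) A₀
    ((TDef.var (a (.inr 1))).inv.mul (TDef.var (a (.inr 0)))), ?_⟩
  intro P hP v A x hx
  let y : FSort P.κ P.lam P.μ 2 := x (0 : Fin 1)
  have h : CodesFn (P := P) (v (a (.inl ()))) (A A₀) (fun i => v (a (.inr i))) y :=
    hx (0 : Fin 1)
  exact h.isEq_iff hP

theorem rep_prod : codingCountable.{u}.Rep (MLang.ar .prod).get
    fun P x => P.M.rel .prod x := by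
  let ιp := Σ i, codingCountable.{u}.p ((MLang.ar .prod).get i)
  let ιr := Σ i, codingCountable.{u}.r ((MLang.ar .prod).get i)
  let a : Unit ⊕ Fin 3 → ιp := fun k => ⟨(0 : Fin 1), k⟩
  let A₀ : ιr := ⟨(0 : Fin 1), ()⟩
  refine ⟨_, UDef.finite_not_im (ι := ιp) (J := ιr) (TDef.var (a (.inl ()))) A₀
    ((TDef.var (a (.inr 2))).inv.mul
      ((TDef.var (a (.inr 1))).mul (TDef.var (a (.inr 0))))), ?_⟩
  intro P hP v A x hx
  let y : FSort P.κ P.lam P.μ 3 := x (0 : Fin 1)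
  have h : CodesFn (P := P) (v (a (.inl ()))) (A A₀) (fun i => v (a (.inr i))) y :=
    hx (0 : Fin 1)
  exact h.isProd_iff hP

theorem interprets : codingCountable.{u}.Interprets where
  func := by
    rintro (n | ⟨m, n, σ⟩)
    · exact rep_app n
    · exact rep_proj m n σ
  rel := by
    rintro (_ | _ | ⟨m, n, σ⟩ | _ | _ | _)
    · exact rep_eq1
    · exact rep_prod1
    · exact rep_proj1 m n σ
    · exact rep_lt
    · exact rep_eq
    · exact rep_prod

end codingCountable

/-! ### Distinguishing `κ = ℵ₀` by a sentence -/

namespace Par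

variable {P : Par.{u}}

/-- Cycles are countable, so for uncountable `κ` a non-small set can be divided along cycles into
two non-small parts. Both are almost invariant if the set is, and minimality fails. -/
theorem Atom.kappa_eq {c : P.S} {V e : P.PS} (h : Atom c V e) : P.κ = ℵ₀ := by
  by_contra hne
  have hκ : ℵ₀ < P.κ := lt_of_le_of_ne P.hκ (Ne.symm hne)
  let τ : e.1 → Quotient (Equiv.Perm.SameCycle.setoid c.1) := fun x => Quotient.mk _ x.1
  have hτ : ∀ i, #(τ ⁻¹' {i}) < P.κ := by
    intro i
    refine lt_of_le_of_lt ?_ hκ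
    obtain ⟨x, rfl⟩ := Quotient.exists_rep i
    have hc : (Set.range fun k : ℤ => (c.1 ^ k) x).Countable := Set.countable_range _
    rw [← mk_image_eq (f := ((↑) : e.1 → P.X)) Subtype.val_injective]
    refine le_aleph0_iff_set_countable.2 (hc.mono ?_)
    rintro _ ⟨y, hy, rfl⟩
    obtain ⟨k, hk⟩ : c.1.SameCycle x y.1 := Equiv.Perm.SameCycle.symm (Quotient.exact hy)
    exact ⟨k, hk⟩
  obtain ⟨Q, h1, h2⟩ := Cardinal.exists_split τ P.hκ (not_lt.1 h.not_sm) hτ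
  let p : Set P.X := {x | Quotient.mk (Equiv.Perm.SameCycle.setoid c.1) x ∈ Q}
  have hp : ∀ x, c.1 x ∈ p ↔ x ∈ p := fun x => by
    have : Quotient.mk (Equiv.Perm.SameCycle.setoid c.1) (c.1 x) =
        Quotient.mk (Equiv.Perm.SameCycle.setoid c.1) x :=
      Quotient.sound (Equiv.Perm.sameCycle_apply_left.2 (.refl _ _))
    change _ ∈ Q ↔ _ ∈ Q
    rw [this]
  have e1 : ((↑) : e.1 → P.X) '' (τ ⁻¹' Q) = e.1 ∩ p := by
    ext x
    exact ⟨fun ⟨y, hy, hyx⟩ => hyx ▸ ⟨y.2, hy⟩, fun hx => ⟨⟨x, hx.1⟩, hx.2, rfl⟩⟩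
  have e2 : ((↑) : e.1 → P.X) '' (τ ⁻¹' Qᶜ) = e.1 \ p := by
    ext x
    exact ⟨fun ⟨y, hy, hyx⟩ => hyx ▸ ⟨y.2, hy⟩, fun hx => ⟨⟨x, hx.1⟩, hx.2, rfl⟩⟩
  rw [← mk_image_eq Subtype.val_injective, e1] at h1
  rw [← mk_image_eq Subtype.val_injective, e2] at h2
  have h3 := h.min ⟨e.1 ∩ p, (mk_le_mk_of_subset Set.inter_subset_left).trans_lt e.2⟩ (not_lt.2 h1)
    (h.ai.inter (AI.of_subset_cycles hp)) (Sub.of_subset Set.inter_subset_left)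
  refine absurd (Sm.mono h3 (A := e.1 \ p) ?_) (not_lt.2 h2)
  exact fun x hx => ⟨hx.1, fun hx' => hx.2 hx'.2⟩

theorem ctb_iff : Ctb P ↔ ∃ (c : P.S) (V e : P.PS), Atom c V e := by
  constructor
  · intro h
    obtain ⟨c, V, -, e, -⟩ := Pt.exists_equiv (P := P) h (Y := PUnit) (n := 0)
      ((mk_le_aleph0).trans_lt aleph0_lt_lam) fun i => i.elim0
    exact ⟨c, V, _, (e ⟨⟩).atom h⟩
  · rintro ⟨c, V, e, h⟩
    exact h.kappa_eq

end Par

open Par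

open FirstOrder FirstOrder.Language in
theorem UDef.exists_sentence {K : Par.{u} → Prop}
    {R : ∀ P : Par.{u}, (Empty → P.S) → (Empty → P.PS) → Prop} (hR : UDef K R) :
    ∃ ψ : groupLang.Sentence, ∀ P, K P → (P.G ⊨ ψ ↔ R P (fun e => e.elim) fun e => e.elim) := by
  obtain ⟨ψ, hψ⟩ := hR
  refine ⟨ψ.relabel (Sum.elim (fun k => k.elim) fun k => k.elim), fun P hP => ?_⟩
  refine Iff.trans ?_ (hψ P hP (fun k => k.elim) (fun k => k.elim) (fun k => k.elim)
    fun k => k.elim)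
  refine Formula.realize_relabel.trans (iff_of_eq (congrArg (fun z => Formula.Realize ψ z) ?_))
  funext k
  rcases k with k | k <;> exact k.elim

open FirstOrder FirstOrder.Language in
theorem exists_ctb_sentence : ∃ ψ : groupLang.Sentence, ∀ P : Par.{u}, P.G ⊨ ψ ↔ Ctb P := by
  have h : UDef.{u} (ι := Empty) (J := Empty) (fun _ => True) fun P _ _ =>
      ∃ (c : P.S) (V e : P.PS), Atom c V e :=
    UDef.ex_perm (UDef.ex_set (UDef.ex_set (UDef.atom (ι := Unit ⊕ Empty)
      (J := Unit ⊕ Unit ⊕ Empty) (TDef.var (.inl ())) (.inr (.inl ())) (.inl ()))))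
  obtain ⟨ψ, hψ⟩ := h.exists_sentence
  exact ⟨ψ, fun P => (hψ P trivial).trans ctb_iff.symm⟩

/-- Equivalent groups agree on whether `κ = ℵ₀`, so one and the same interpretation serves for both
triples. -/
theorem elemEquiv_of_elementarilyEquivalent {P Q : Par.{u}}
    (h : groupLang.ElementarilyEquivalent P.G Q.G) : P.M.ElemEquiv Q.M := by
  rw [FirstOrder.Language.elementarilyEquivalent_iff] at h
  obtain ⟨χ, hχ⟩ := exists_ctb_sentence.{u}
  have hPQ : Ctb P ↔ Ctb Q := by rw [← hχ, ← hχ]; exact h χ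
  intro φ
  by_cases hP : Ctb P
  · obtain ⟨ψ, hψ⟩ := codingCountable.interprets.exists_sentence φ
    rw [← hψ P hP, ← hψ Q (hPQ.1 hP)]
    exact h ψ
  · have key : ∀ {P : Par.{u}}, ¬ Ctb P → ℵ₀ < P.κ := fun {P} h =>
      lt_of_le_of_ne P.hκ fun h' => h h'.symm
    obtain ⟨ψ, hψ⟩ := codingUncountable.interprets.exists_sentence φ
    rw [← hψ P (key hP), ← hψ Q (key (hPQ.not.1 hP))]
    exact h ψ

theorem corollary4p4 (κ₁ lam₁ μ₁ κ₂ lam₂ μ₂ : Cardinal.{u})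
    (hκ₁ : ℵ₀ ≤ κ₁) (hlam₁ : κ₁ < lam₁) (_hμ₁ : lam₁ ≤ Order.succ μ₁)
    (hκ₂ : ℵ₀ ≤ κ₂) (hlam₂ : κ₂ < lam₂) (_hμ₂ : lam₂ ≤ Order.succ μ₂) :
    (MStr κ₁ lam₁ μ₁).ElemEquiv (MStr κ₂ lam₂ μ₂) ↔
      groupLang.ElementarilyEquivalent
        (symQuot κ₁ lam₁ μ₁ hκ₁ hlam₁) (symQuot κ₂ lam₂ μ₂ hκ₂ hlam₂) := by
  let P : Par.{u} := ⟨κ₁, lam₁, μ₁, hκ₁, hlam₁, _hμ₁⟩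
  let Q : Par.{u} := ⟨κ₂, lam₂, μ₂, hκ₂, hlam₂, _hμ₂⟩
  exact ⟨elementarilyEquivalent_of_elemEquiv (P := P) (Q := Q),
    elemEquiv_of_elementarilyEquivalent (P := P) (Q := Q)⟩
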